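/- **Setting.** Sensors $k=1,\dots,K$ produce observations $\xi^k_1,\xi^k_2,\dots$; $\mathcal F^k_t=\sigma(\xi^k_1,\dots,\xi^k_t)$ and $\mathcal F_t=\bigvee_k\mathcal F^k_t$. $P_\infty$ and $P_0$ are locally equivalent laws (no change; change at time $0$), the sensors are independent under each of them, $u^k_t=\log\frac{dP_0}{dP_\infty}\big|_{\mathcal F^k_t}$, $u_t=\sum_k u^k_t$, and $P_\tau$ ($\tau\in\mathbb N$) has $\frac{dP_\tau}{dP_\infty}\big|_{\mathcal F_t}=e^{u_t-u_\tau}$ for $t\ge\tau$. Each $u^k$ is a random walk (under $P_0$ and under $P_\infty$ the increments $u^k_{t+1}-u^k_t$ are independent of $\mathcal F^k_t$ and identically distributed), and $u^k_1$ has a positive density on $\mathbb R$. For a stopping time $T$ put $$\mathcal J[T]=\sup_{\tau\ge0}\operatorname{ess\,sup}E_\tau\big[(u_T-u_\tau)\mathbf 1_{\{T>\tau\}}\,\big|\,\mathcal F_\tau\big].$$ The centralized CUSUM is $\mathcal S=\inf\{t: u_t-\inf_{0\le s<t}u_s\ge\nu\}$. **D-CUSUM.** For thresholds $\bar\Delta^k,\underline\Delta^k>0$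 let $\tau^k_0=0$, $\tau^k_n=\inf\{t>\tau^k_{n-1}:u^k_t-u^k_{\tau^k_{n-1}}\notin(-\underline\Delta^k,\bar\Delta^k)\}$, $\ell^k_n=u^k_{\tau^k_n}-u^k_{\tau^k_{n-1}}$. At time $\tau^k_n$ sensor $k$ sends $z^k_n=j$ if $\bar\epsilon^k_{j-1}\le\ell^k_n-\bar\Delta^k<\bar\epsilon^k_j$ and $z^k_n=-j$ if $-\underline\epsilon^k_j<\ell^k_n+\underline\Delta^k\le-\underline\epsilon^k_{j-1}$ $(1\le j\le d)$, where $\bar\epsilon^k_0=\underline\epsilon^k_0=0$, $\bar\epsilon^k_d=\underline\epsilon^k_d=\infty$, and for $1\le j\le d-1$ the thresholds $\bar\epsilon^k_j,\underline\epsilon^k_j>0$ satisfy $$P_0(\ell^k_1-\bar\Delta^k\ge\bar\epsilon^k_j\mid\ell^k_1\ge\bar\Delta^k)=1-\tfrac jd=P_\infty(\ell^k_1+\underline\Delta^k\le-\underline\epsilon^k_j\mid\ell^k_1\le-\underline\Delta^k).$$ With $\Lambda^k(i)=\log\frac{P_0(z^k_1=i)}{P_\infty(z^k_1=i)}$ let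 $\tilde u_t=\sum_k\sum_{n\ge1:\,\tau^k_n\le t}\Lambda^k(z^k_n)$ and $\tilde{\mathcal S}=\inf\{t\ge0:\tilde u_t-\inf_{0\le s\le t}\tilde u_s\ge\tilde\nu\}$. The thresholds $\nu,\tilde\nu$ are such that $E_\infty[-u_{\mathcal S}]=\gamma=E_\infty[-u_{\tilde{\mathcal S}}]$. Let $\epsilon^k=\max_{1\le j\le d-1}\max\{\bar\epsilon^k_j-\bar\epsilon^k_{j-1},\underline\epsilon^k_j-\underline\epsilon^k_{j-1}\}$ ($0$ if $d=1$) and $$\theta=\max_k\Big(\epsilon^k+E_0\big[(u^k_1)^2\mathbf 1_{\{u^k_1\ge\bar\epsilon^k_{d-1}\}}\big]+E_\infty\big[(u^k_1)^2\mathbf 1_{\{-u^k_1\ge\underline\epsilon^k_{d-1}\}}\big]\Big).$$ **Theorem 2.** Fix $m,B,\Delta_0>0$, $0<a\le b$ and $N\in\mathbb N$, and consider all such networks ($K\ge1$) and schemes ($d\ge1$), with $\gamma>1$, $E_i[(u^k_1)^2]\le B$ for $i=0,\infty$, $E_0[u^k_1]\ge m$, $E_\infty[-u^k_1]\ge m$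 and $a\Delta\le\bar\Delta^k,\underline\Delta^k\le b\Delta$ for all $k$, where $\Delta\ge\Delta_0$. In (i) and (iii) assume in addition that $d\le N$ or $\log K\le N\Delta$. Then $\mathcal J[\mathcal S]$ and $\mathcal J[\tilde{\mathcal S}]$ are finite, and: (i) there are constants $c,C>0$, depending only on $m,B,a,b,\Delta_0,N$, with $$\mathcal J[\tilde{\mathcal S}]-\mathcal J[\mathcal S]\le\frac{\theta}{c\,\Delta}\log\gamma+K\,C\,\Delta ;$$ (ii) (second-order optimality) for fixed $K$, $\Delta$ and $R$, $|\mathcal J[\tilde{\mathcal S}]-\mathcal J[\mathcal S]|$ is bounded over all configurations with $\theta\log\gamma\le R$ (with $d$ and $\gamma$ arbitrary); (iii) (first-order optimality) for every $\varepsilon>0$ there is $\eta>0$ such that $\big|\mathcal J[\tilde{\mathcal S}]/\mathcal J[\mathcal S]-1\big|\le\varepsilon$ whenever $K\Delta\le\eta\log\gamma$ and either $\Delta\ge1/\eta$ or $\theta\le\eta\Delta$. In particular $\mathcal J[\tilde{\mathcal S}]/\mathcal J[\mathcal S]\to1$ when $\Delta\to\infty$ and $K\Delta=o(\log\gamma)$.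 -/

import Mathlib

open MeasureTheory ProbabilityTheory
open scoped ENNReal

universe u v

/-- Discrete-time observations of `K` sensors, with the family of laws `P τ`, one for each
change-point `τ ∈ {0, 1, …, ∞}`. The variable `ξ k s` is the observation of sensor `k` at time
`s + 1`; there is no observation at time `0`. -/
structure ChangeModel (K : ℕ) (Ω : Type u) [mΩ : MeasurableSpace Ω] where
  Obs : Fin K → Type v
  [mObs : ∀ k, MeasurableSpace (Obs k)]
  ξ : ∀ k, ℕ → Ω → Obs k
  measurable_ξ : ∀ k s, Measurable (ξ k s)
  P : ℕ∞ → Measure Ω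
  isProb : ∀ τ, IsProbabilityMeasure (P τ)

/-- A communication scheme for `K` sensors: the alphabet size parameter `d` (messages are
`±1, …, ±d`), the exit thresholds `-lo k < 0 < hi k` and the quantization thresholds of the
overshoots `epsUp k j`, `epsDn k j`, used for `0 ≤ j ≤ d - 1` (the `d`-th ones are `+∞`). -/
structure CommScheme (K : ℕ) where
  d : ℕ
  hi : Fin K → ℝ
  lo : Fin K → ℝ
  epsUp : Fin K → ℕ → ℝ
  epsDn : Fin K → ℕ → ℝ

noncomputable section

namespace ChangeModel

variable {K : ℕ} {Ω : Type u} [mΩ : MeasurableSpace Ω] (M : ChangeModel.{u, v} K Ω)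

/-- The local σ-algebra of sensor `k` at time `t`, generated by its first `t` observations. -/
@[reducible] def localSigma (k : Fin K) (t : ℕ) : MeasurableSpace Ω :=
  ⨆ s : Fin t, (M.mObs k).comap (M.ξ k s)

/-- The global σ-algebra at time `t`. -/
@[reducible] def sigma (t : ℕ) : MeasurableSpace Ω := ⨆ k, M.localSigma k t

theorem localSigma_le (k : Fin K) (t : ℕ) : M.localSigma k t ≤ mΩ :=
  iSup_le fun s => (M.measurable_ξ k s).comap_le

/-- The local log-likelihood ratio `u_t^k` of `P_0` against `P_∞` on the local σ-algebra. -/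
def uLoc (k : Fin K) (t : ℕ) (ω : Ω) : ℝ :=
  llr ((M.P 0).trim (M.localSigma_le k t)) ((M.P ⊤).trim (M.localSigma_le k t)) ω

/-- The global log-likelihood ratio `u_t = u_t^1 + ⋯ + u_t^K`. -/
def u (t : ℕ) (ω : Ω) : ℝ := ∑ k, M.uLoc k t ω

/-- The standing assumptions of the discrete-time problem. -/
structure IsRandomWalkModel : Prop where
  /-- `P_0` and `P_∞` are locally equivalent -/
  equiv : ∀ t A, MeasurableSet[M.sigma t] A → (M.P 0 A = 0 ↔ M.P ⊤ A = 0)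
  /-- the sensors are independent, before and after the change -/
  indep_pre : iIndep (fun k => ⨆ t, M.localSigma k t) (M.P ⊤)
  indep_post : iIndep (fun k => ⨆ t, M.localSigma k t) (M.P 0)
  /-- change at time `τ`: for `t ≥ τ` the density of `P_τ` with respect to `P_∞` on the
  observations up to time `t` is `exp (u_t - u_τ)`; for `t = τ` this says that `P_τ` and `P_∞`
  coincide up to time `τ` -/
  density : ∀ τ t : ℕ, τ ≤ t → ∀ A, MeasurableSet[M.sigma t] A →
    M.P τ A = ∫⁻ ω in A, ENNReal.ofReal (Real.exp (M.u t ω - M.u τ ω)) ∂(M.P ⊤)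
  /-- each `u^k` is a random walk (in its local filtration), before and after the change -/
  indep_incr_pre : ∀ k t, Indep
    (MeasurableSpace.comap (fun ω => M.uLoc k (t + 1) ω - M.uLoc k t ω) inferInstance)
    (M.localSigma k t) (M.P ⊤)
  ident_incr_pre : ∀ k t, IdentDistrib (fun ω => M.uLoc k (t + 1) ω - M.uLoc k t ω)
    (M.uLoc k 1) (M.P ⊤) (M.P ⊤)
  indep_incr_post : ∀ k t, Indep
    (MeasurableSpace.comap (fun ω => M.uLoc k (t + 1) ω - M.uLoc k t ω) inferInstance)
    (M.localSigma k t) (M.P 0)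
  ident_incr_post : ∀ k t, IdentDistrib (fun ω => M.uLoc k (t + 1) ω - M.uLoc k t ω)
    (M.uLoc k 1) (M.P 0) (M.P 0)
  /-- `u_1^k` is absolutely continuous with a positive density on the real line -/
  posDensity : ∀ k, ∃ f : ℝ → ℝ≥0∞, Measurable f ∧ (∀ x, 0 < f x) ∧
    (M.P ⊤).map (M.uLoc k 1) = volume.withDensity f

/-- The second moments of `u_1^k` are finite, and bounded by `B`, under both laws; the
Kullback–Leibler numbers `E_0[u_1^k]` and `E_∞[-u_1^k]` are at least `m`. -/
structure MomentBounds (m B : ℝ) : Prop where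
  memLp_post : ∀ k, MemLp (M.uLoc k 1) 2 (M.P 0)
  memLp_pre : ∀ k, MemLp (M.uLoc k 1) 2 (M.P ⊤)
  second_post : ∀ k, ∫ ω, (M.uLoc k 1 ω) ^ 2 ∂(M.P 0) ≤ B
  second_pre : ∀ k, ∫ ω, (M.uLoc k 1 ω) ^ 2 ∂(M.P ⊤) ≤ B
  kl_post : ∀ k, m ≤ ∫ ω, M.uLoc k 1 ω ∂(M.P 0)
  kl_pre : ∀ k, m ≤ ∫ ω, -M.uLoc k 1 ω ∂(M.P ⊤)

/-! ### Performance of a detection rule -/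

open Classical in
/-- The false-alarm period `E_∞[-u_T]` in Kullback–Leibler units (`+∞` if `T` is infinite with
positive probability or the expectation is not finite). -/
def falseAlarmPeriod (T : Ω → ℕ∞) : EReal :=
  if (∀ᵐ ω ∂(M.P ⊤), T ω ≠ ⊤) ∧ Integrable (fun ω => -M.u (T ω).toNat ω) (M.P ⊤) then
    ((∫ ω, -M.u (T ω).toNat ω ∂(M.P ⊤) : ℝ) : EReal)
  else ⊤

/-- `(u_T - u_τ) 1{T > τ}` -/
def delay (T : Ω → ℕ∞) (τ : ℕ) : Ω → ℝ :=
  {ω | (τ : ℕ∞) < T ω}.indicator fun ω => M.u (T ω).toNat ω - M.u τ ω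

open Classical in
/-- The worst-case delay
`J[T] = sup_τ ess sup E_τ[(u_T - u_τ) 1{T > τ} | F_τ]` in Kullback–Leibler units. -/
def worstDelay (T : Ω → ℕ∞) : EReal :=
  ⨆ τ : ℕ,
    if (∀ᵐ ω ∂(M.P τ), T ω ≠ ⊤) ∧ Integrable (M.delay T τ) (M.P τ) then
      essSup (fun ω => (((M.P τ)[M.delay T τ | M.sigma τ] ω : ℝ) : EReal)) (M.P τ)
    else ⊤

/-- The first time at which the statistic `y` reaches the level `x` (`⊤` if there is none). -/
def hitTime (y : ℕ → Ω → ℝ) (x : ℝ) (ω : Ω) : ℕ∞ :=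
  sInf {s : ℕ∞ | ∃ t : ℕ, s = t ∧ x ≤ y t ω}

/-! ### The centralized CUSUM -/

/-- `y_t = u_t - inf_{0 ≤ s < t} u_s` -/
def yStat (t : ℕ) (ω : Ω) : ℝ := M.u t ω - ⨅ s : Fin t, M.u s ω

/-- The centralized CUSUM test with threshold `ν`. -/
def cusum (ν : ℝ) : Ω → ℕ∞ := hitTime M.yStat ν

/-! ### The decentralized CUSUM -/

variable (S : CommScheme K)

open Classical in
/-- The communication times `τ_n^k` of sensor `k` (`⊤` if there are fewer than `n`
communications). -/
def commTime (k : Fin K) : ℕ → Ω → ℕ∞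
  | 0, _ => 0
  | n + 1, ω => sInf {s : ℕ∞ | ∃ t : ℕ, s = t ∧ commTime k n ω < t ∧
      M.uLoc k t ω - M.uLoc k (commTime k n ω).toNat ω ∉ Set.Ioo (-S.lo k) (S.hi k)}

/-- `m_t^k = max {n : τ_n^k ≤ t}`, the number of messages of sensor `k` up to time `t`. -/
def numMsg (k : Fin K) (t : ℕ) (ω : Ω) : ℕ := sSup {n : ℕ | M.commTime S k n ω ≤ t}

/-- `ℓ_n^k`, the log-likelihood ratio accumulated between communications `n - 1` and `n`,
for `n ≥ 1`. -/
def ell (k : Fin K) (n : ℕ) (ω : Ω) : ℝ :=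
  M.uLoc k (M.commTime S k n ω).toNat ω - M.uLoc k (M.commTime S k (n - 1) ω).toNat ω

/-- `ℓ_n^k - hi k` lies in `[epsUp k (j-1), epsUp k j)`, where `epsUp k d` stands for `+∞`. -/
def MsgUp (k : Fin K) (n j : ℕ) (ω : Ω) : Prop :=
  S.epsUp k (j - 1) ≤ M.ell S k n ω - S.hi k ∧
    (j = S.d ∨ M.ell S k n ω - S.hi k < S.epsUp k j)

/-- `ℓ_n^k + lo k` lies in `(-epsDn k j, -epsDn k (j-1)]`, where `epsDn k d` stands for `+∞`. -/
def MsgDn (k : Fin K) (n j : ℕ) (ω : Ω) : Prop :=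
  M.ell S k n ω + S.lo k ≤ -S.epsDn k (j - 1) ∧
    (j = S.d ∨ -S.epsDn k j < M.ell S k n ω + S.lo k)

open Classical in
/-- The message `z_n^k ∈ {±1, …, ±d}` of sensor `k` at its `n`-th communication, `n ≥ 1`. -/
def msg (k : Fin K) (n : ℕ) (ω : Ω) : ℤ :=
  ∑ j ∈ Finset.Icc 1 S.d,
    ((if M.MsgUp S k n j ω then (j : ℤ) else 0) - (if M.MsgDn S k n j ω then (j : ℤ) else 0))

/-- The log-likelihood ratio of a message: `log (P_0(z_1^k = i) / P_∞(z_1^k = i))`. -/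
def msgLLR (k : Fin K) (i : ℤ) : ℝ :=
  Real.log ((M.P 0).real {ω | M.msg S k 1 ω = i} / (M.P ⊤).real {ω | M.msg S k 1 ω = i})

/-- The fusion center's approximation of `u_t^k`: the sum of the log-likelihood ratios of the
messages received from sensor `k` up to time `t`. -/
def uTildeLoc (k : Fin K) (t : ℕ) (ω : Ω) : ℝ :=
  ∑ n ∈ Finset.Icc 1 (M.numMsg S k t ω), M.msgLLR S k (M.msg S k n ω)

/-- The fusion statistic `ũ_t`. -/
def uTilde (t : ℕ) (ω : Ω) : ℝ := ∑ k, M.uTildeLoc S k t ω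

/-- `ỹ_t = ũ_t - inf_{0 ≤ s ≤ t} ũ_s` -/
def yTilde (t : ℕ) (ω : Ω) : ℝ := M.uTilde S t ω - ⨅ s : Fin (t + 1), M.uTilde S s ω

/-- D-CUSUM with threshold `ν`. -/
def dcusum (ν : ℝ) : Ω → ℕ∞ := hitTime (M.yTilde S) ν

/-- The requirements on the communication scheme: positive exit thresholds, and quantization
thresholds for which the `d` possible overshoot cells on each side are equally likely, on the
upper side under `P_0` and on the lower side under `P_∞`. -/
structure IsAdmissible : Prop where
  d_pos : 1 ≤ S.d
  hi_pos : ∀ k, 0 < S.hi k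
  lo_pos : ∀ k, 0 < S.lo k
  epsUp_zero : ∀ k, S.epsUp k 0 = 0
  epsDn_zero : ∀ k, S.epsDn k 0 = 0
  epsUp_pos : ∀ k j, 1 ≤ j → j < S.d → 0 < S.epsUp k j
  epsDn_pos : ∀ k j, 1 ≤ j → j < S.d → 0 < S.epsDn k j
  level_up : ∀ k j, 1 ≤ j → j < S.d →
    (cond (M.P 0) {ω | S.hi k ≤ M.ell S k 1 ω}).real
      {ω | S.epsUp k j ≤ M.ell S k 1 ω - S.hi k} = 1 - (j : ℝ) / S.d
  level_dn : ∀ k j, 1 ≤ j → j < S.d →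
    (cond (M.P ⊤) {ω | M.ell S k 1 ω ≤ -S.lo k}).real
      {ω | M.ell S k 1 ω + S.lo k ≤ -S.epsDn k j} = 1 - (j : ℝ) / S.d

/-- `ε^k`, the largest distance between consecutive finite quantization thresholds of sensor
`k` (`0` if `d = 1`). -/
def epsGap (k : Fin K) : ℝ :=
  ⨆ j : Fin (S.d - 1),
    max (S.epsUp k (j + 1) - S.epsUp k j) (S.epsDn k (j + 1) - S.epsDn k j)

/-- `θ^k = ε^k + E_0[(u_1^k)² 1{u_1^k ≥ epsUp k (d-1)}] + E_∞[(u_1^k)² 1{-u_1^k ≥ epsDn k (d-1)}]`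
-/
def thetaLoc (k : Fin K) : ℝ :=
  epsGap S k
    + ∫ ω in {ω | S.epsUp k (S.d - 1) ≤ M.uLoc k 1 ω}, (M.uLoc k 1 ω) ^ 2 ∂(M.P 0)
    + ∫ ω in {ω | S.epsDn k (S.d - 1) ≤ -M.uLoc k 1 ω}, (M.uLoc k 1 ω) ^ 2 ∂(M.P ⊤)

/-- `θ = max_k θ^k` -/
def theta : ℝ := ⨆ k, M.thetaLoc S k

/-- All the requirements on a configuration: a random-walk model with at least one sensor that
obeys the moment bounds `m`, `B`, an admissible scheme whose exit thresholds all lie between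
`a Δ` and `b Δ`, and thresholds `ν`, `ν'` of the centralized and of the decentralized CUSUM for
which both tests have the false-alarm period `γ > 1`. -/
structure IsConfig (m B a b Δ γ ν ν' : ℝ) : Prop where
  one_le_K : 1 ≤ K
  walk : M.IsRandomWalkModel
  bounds : M.MomentBounds m B
  scheme : M.IsAdmissible S
  hi_mem : ∀ k, S.hi k ∈ Set.Icc (a * Δ) (b * Δ)
  lo_mem : ∀ k, S.lo k ∈ Set.Icc (a * Δ) (b * Δ)
  one_lt_gamma : 1 < γ
  falseAlarm_cusum : M.falseAlarmPeriod (M.cusum ν) = (γ : EReal)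
  falseAlarm_dcusum : M.falseAlarmPeriod (M.dcusum S ν') = (γ : EReal)

end ChangeModel

end

/-!
All worst-case delays are compared with `log γ` (`ChangeModel.exists_delays`). Since `u` is a random
walk, Wald's identity turns the delay and the false-alarm period into multiples of expected
stopping times (`exists_worstDelay`, `falseAlarm_wald`).

* No stopping time with false-alarm period `γ` has a delay below `log γ - O(K)`: weighted with the
  likelihood ratios after every possible change time, that is with `expCusum`, the false alarms of
  `T` give an entropy bound (`IIDSteps.log_period_le`).
* CUSUM attains this: its false-alarm period is at least `exp ν` (`IIDSteps.exp_le_period`), and its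
  delay exceeds the threshold only by an overshoot with bounded mean (`IIDSteps.delay_le`).
* For D-CUSUM, replacing the increment of `u^k` between two messages by the log-likelihood ratio
  `Λ` of the message costs `O(min θ 1)` in mean under either law, since cells are narrow or at the
  far end (`Quantizer`). Messages of information of order `Δ` arrive at intervals of order `Δ`, so
  after the change the statistic climbs at the full rate of `u` up to a factor `1 + O(θ / Δ)`, with
  `O(KΔ)` for the start (`exists_network_delay`). The mean loss is not controlled for the message
  that straddles the change. It is bounded through `d ≤ N`, as `Λ ≥ -O(Δ)` then; or these messages
  are disregarded, until every sensor has sent one, after a time of order `Δ + log K`.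
* Before the change, `exp Λ` has mean one at a message, but is uncontrolled at the message in
  progress at a fixed time. With the loss cut off and the exponent lowered from `1` to `1 - η`,
  `η = O(θ / Δ)`, its means stay at most one, and are `exp (O(Δ))` at the message in progress.
  Thus the statistic rises by `x` after a given time with probability at most
  `exp (O(KΔ) - (1 - η) x)`, which bounds the threshold by `(1 + O(θ / Δ)) log γ + O(KΔ)`
  (`exists_fusion_threshold`).
-/

noncomputable section

open ENNReal (ofReal ofReal_mul ofReal_le_ofReal ofReal_add ofReal_one ofReal_le_ofReal_iff
 ofReal_natCast toReal_nonneg ofReal_toReal ofReal_ne_top ofReal_zero tsum_le_tsum tsum_add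
 sum_le_tsum tsum_le_of_sum_range_le ofReal_lt_top ofReal_le_one ofReal_of_nonpos)
open Real (exp log exp_pos exp_add sqrt exp_le_exp exp_zero log_pos log_exp log_nonneg exp_log
 exp_le_one_iff log_le_log log_inv log_mul exp_lt_exp)
open Set (Ioo indicator_of_mem indicator_of_notMem univ Iic Ici mem_ofPred_eq mem_univ)
open Finset (range sum_le_sum mul_sum Icc sum_congr sum_const sum_range_succ card_univ mem_Icc
 mem_range sum_add_distrib sum_sub_distrib Ico prod_congr sum_const_zero mem_Ico
 sum_Ico_succ_top card_range)
open MeasureTheory.Measure (pi map_apply isProbabilityMeasure_map restrict_eq_zero restrict_apply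
 restrict_univ restrict_restrict)
open Function (iterate_succ_apply')

variable {x z w lo hi : ℝ} {t : ℕ} {f g : ℝ → ℝ≥0∞}

/-- The interval in which the local statistic of a sensor stays between two messages. -/
local notation "𝕀" => Ioo (-lo) hi

/-! ### Random walks on the line up to the exit from a set -/

/-- `ENNReal.ofReal_mul`, with the sign condition left to `positivity`. -/
theorem ofReal_mul₀ {p q : ℝ} (hp : 0 ≤ p := by positivity) :
    ofReal (p * q) = ofReal p * ofReal q :=
  ofReal_mul hp

/-- `ENNReal.ofReal_add`, with the sign conditions left to `positivity`. -/
theorem ofReal_add₀ {p q : ℝ} (hp : 0 ≤ p := by positivity) (hq : 0 ≤ q := by positivity) :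
    ofReal (p + q) = ofReal p + ofReal q :=
  ofReal_add hp hq

section ExitOperators

variable (Q : Measure ℝ) (I : Set ℝ)

/-- The sub-Markov operator of the random walk with step law `Q`, killed when it leaves `I`. -/
def stay (f : ℝ → ℝ≥0∞) (x : ℝ) : ℝ≥0∞ := ∫⁻ y, I.indicator f (x + y) ∂Q

/-- The expectation of the reward `F` collected at the landing point if the next step leaves `I`. -/
def leave (F : ℝ → ℝ≥0∞) (x : ℝ) : ℝ≥0∞ := ∫⁻ y, Iᶜ.indicator F (x + y) ∂Q

/-- The potential of the killed walk: the expected total running cost `c` up to the exit from `I`,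
starting from `x` (the position at time `0` counts, the exit position does not). -/
def pot (c : ℝ → ℝ≥0∞) (x : ℝ) : ℝ≥0∞ := ∑' n, ((stay Q I)^[n] c) x

/-- The expectation of `F` at the exit position of the walk started at `x`. -/
def exitMean (F : ℝ → ℝ≥0∞) : ℝ → ℝ≥0∞ := pot Q I (leave Q I F)

/-- The expected number of steps until the exit from `I`. -/
def meanTime : ℝ → ℝ≥0∞ := pot Q I 1

/-- The law at time `n` of the walk started at `0`, restricted to its survival in `I`. -/
def aliveLaw : ℕ → Measure ℝ
  | 0 => Measure.dirac 0
  | n + 1 => (Measure.conv (aliveLaw n) Q).restrict I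

/-- The law of the exit position of the walk started at `0`. -/
def exitLaw : Measure ℝ := Measure.sum fun n => (Measure.conv (aliveLaw Q I n) Q).restrict Iᶜ

/-- The transition operator of the walk that is put back to `0` whenever it leaves `I`. -/
def refresh (f : ℝ → ℝ≥0∞) (x : ℝ) : ℝ≥0∞ := stay Q I f x + leave Q I 1 x * f 0

variable {Q I} [SFinite Q] (hI : MeasurableSet I)
include hI

theorem measurable_indicator_add (hf : Measurable f) (x : ℝ) :
    Measurable fun y => I.indicator f (x + y) :=
  (hf.indicator hI).comp (measurable_const_add x)

theorem measurable_stay (hf : Measurable f) : Measurable (stay Q I f) := by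
  unfold stay
  exact Measurable.lintegral_prod_right' (f := fun p : ℝ × ℝ => I.indicator f (p.1 + p.2))
    ((hf.indicator hI).comp (measurable_fst.add measurable_snd))

theorem measurable_leave (hf : Measurable f) :
    Measurable (leave Q I f) := measurable_stay hI.compl hf

theorem measurable_stay_iterate (hf : Measurable f) (n : ℕ) : Measurable ((stay Q I)^[n] f) := by
  induction n with
  | zero => exact hf
  | succ n ih => rw [iterate_succ_apply']; exact measurable_stay hI ih

theorem measurable_pot {c : ℝ → ℝ≥0∞} (hc : Measurable c) : Measurable (pot Q I c) :=
  Measurable.tsum fun n => measurable_stay_iterate hI hc n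

theorem measurable_exitMean {F : ℝ → ℝ≥0∞} (hF : Measurable F) :
    Measurable (exitMean Q I F) := measurable_pot hI (measurable_leave hI hF)

theorem measurable_meanTime : Measurable (meanTime Q I) := measurable_pot hI measurable_one

theorem measurable_refresh (hf : Measurable f) : Measurable (refresh Q I f) :=
  (measurable_stay hI hf).add ((measurable_leave hI measurable_one).mul_const _)

omit hI in
theorem stay_mono (h : ∀ x ∈ I, f x ≤ g x) (x : ℝ) : stay Q I f x ≤ stay Q I g x := by
  refine lintegral_mono fun y => ?_
  by_cases hy : x + y ∈ I
  · simpa [hy] using h _ hy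
  · simp [hy]

theorem stay_add (hf : Measurable f) (x : ℝ) :
    stay Q I (f + g) x = stay Q I f x + stay Q I g x := by
  unfold stay
  rw [← lintegral_add_left (measurable_indicator_add hI hf x)]
  exact lintegral_congr fun y => by rw [Set.indicator_add']; rfl

theorem stay_const_mul (hf : Measurable f) (a : ℝ≥0∞)
    (x : ℝ) : stay Q I (fun z => a * f z) x = a * stay Q I f x := by
  unfold stay
  rw [← lintegral_const_mul _ (measurable_indicator_add hI hf x)]
  refine lintegral_congr fun y => ?_
  by_cases hy : x + y ∈ I <;> simp [hy]

omit hI in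
theorem stay_iterate_mono (h : ∀ x, f x ≤ g x) (n : ℕ) (x : ℝ) :
    (stay Q I)^[n] f x ≤ (stay Q I)^[n] g x := by
  induction n generalizing x with
  | zero => exact h x
  | succ n ih =>
    rw [iterate_succ_apply', iterate_succ_apply']
    exact stay_mono (fun z _ => ih z) x

theorem stay_iterate_add (hf : Measurable f) (n : ℕ) :
    (stay Q I)^[n] (f + g) = (stay Q I)^[n] f + (stay Q I)^[n] g := by
  induction n with
  | zero => rfl
  | succ n ih =>
    rw [iterate_succ_apply', iterate_succ_apply', iterate_succ_apply', ih]
    exact funext fun x => stay_add hI (measurable_stay_iterate hI hf n) x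

theorem stay_iterate_const_mul (hf : Measurable f) (a : ℝ≥0∞) (n : ℕ) (x : ℝ) :
    (stay Q I)^[n] (fun z => a * f z) x = a * (stay Q I)^[n] f x := by
  induction n generalizing x with
  | zero => rfl
  | succ n ih =>
    rw [iterate_succ_apply', iterate_succ_apply', funext ih,
      stay_const_mul hI (measurable_stay_iterate hI hf n)]

theorem pot_add (hf : Measurable f) (x : ℝ) : pot Q I (f + g) x = pot Q I f x + pot Q I g x := by
  unfold pot
  rw [← tsum_add]
  exact tsum_congr fun n => by rw [stay_iterate_add hI hf]; rfl

theorem pot_const_mul (hf : Measurable f) (a : ℝ≥0∞)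
    (x : ℝ) : pot Q I (fun z => a * f z) x = a * pot Q I f x := by
  unfold pot
  rw [← ENNReal.tsum_mul_left]
  exact tsum_congr fun n => stay_iterate_const_mul hI hf a n x

omit hI in
theorem pot_mono (h : ∀ x, f x ≤ g x) (x : ℝ) : pot Q I f x ≤ pot Q I g x :=
  tsum_le_tsum fun n => stay_iterate_mono h n x

theorem leave_add (hf : Measurable f) (x : ℝ) :
    leave Q I (f + g) x = leave Q I f x + leave Q I g x := stay_add hI.compl hf x

omit hI in
theorem leave_mono (h : ∀ x ∉ I, f x ≤ g x) (x : ℝ) : leave Q I f x ≤ leave Q I g x := stay_mono h x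

theorem leave_const_mul (hf : Measurable f) (a : ℝ≥0∞)
    (x : ℝ) : leave Q I (fun z => a * f z) x = a * leave Q I f x :=
  stay_const_mul hI.compl hf a x

theorem exitMean_add (hf : Measurable f) (x : ℝ) :
    exitMean Q I (f + g) x = exitMean Q I f x + exitMean Q I g x := by
  unfold exitMean
  rw [← pot_add hI (measurable_leave hI hf)]
  congr 1
  exact funext fun z => leave_add hI hf z

omit hI in
theorem exitMean_mono (h : ∀ x ∉ I, f x ≤ g x) (x : ℝ) :
    exitMean Q I f x ≤ exitMean Q I g x := pot_mono (fun z => leave_mono h z) x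

theorem exitMean_const_mul (hf : Measurable f) (a : ℝ≥0∞)
    (x : ℝ) : exitMean Q I (fun z => a * f z) x = a * exitMean Q I f x := by
  unfold exitMean
  rw [← pot_const_mul hI (measurable_leave hI hf)]
  congr 1
  exact funext fun z => leave_const_mul hI hf a z

/-- Decomposition of the potential at the first step. -/
theorem pot_eq {c : ℝ → ℝ≥0∞} (hc : Measurable c) (x : ℝ) :
    pot Q I c x = c x + stay Q I (pot Q I c) x := by
  have h1 : stay Q I (pot Q I c) x = ∑' n, ((stay Q I)^[n + 1] c) x := by
    simp_rw [iterate_succ_apply']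
    rw [stay, show (∑' n, stay Q I ((stay Q I)^[n] c) x)
        = ∫⁻ y, ∑' n, I.indicator ((stay Q I)^[n] c) (x + y) ∂Q from
      (lintegral_tsum fun n => (measurable_indicator_add hI
        (measurable_stay_iterate hI hc n) x).aemeasurable).symm]
    refine lintegral_congr fun y => ?_
    by_cases hy : x + y ∈ I <;> simp [hy, pot]
  rw [h1, pot, tsum_eq_zero_add' ENNReal.summable]
  rfl

theorem exitMean_eq {F : ℝ → ℝ≥0∞} (hF : Measurable F) (x : ℝ) :
    exitMean Q I F x = leave Q I F x + stay Q I (exitMean Q I F) x :=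
  pot_eq hI (measurable_leave hI hF) x

/-- A function that decreases in the mean by at least the running cost dominates the potential. -/
theorem pot_le_of_supersolution {c V : ℝ → ℝ≥0∞} (hc : Measurable c)
    (h : ∀ x ∈ I, c x + stay Q I V x ≤ V x) (hx : x ∈ I) : pot Q I c x ≤ V x := by
  have key : ∀ n : ℕ, ∀ x ∈ I, ∑ i ∈ range n, (stay Q I)^[i] c x + (stay Q I)^[n] V x ≤ V x := by
    intro n
    induction n with
    | zero => intro x _; simp
    | succ n ih =>
      intro x hx
      refine le_trans ?_ (h x hx)
      rw [Finset.sum_range_succ', Function.iterate_zero_apply, add_comm _ (c x), add_assoc]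
      gcongr
      have hmeas (n : ℕ) : Measurable (∑ i ∈ range n, (stay Q I)^[i] c) := by
        rw [Finset.sum_fn]
        exact Finset.measurable_sum _ fun i _ => measurable_stay_iterate hI hc i
      have hsum : stay Q I (∑ i ∈ range n, (stay Q I)^[i] c) x
          = ∑ i ∈ range n, (stay Q I)^[i + 1] c x := by
        clear ih
        induction n with
        | zero => simp [stay]
        | succ n ih =>
          rw [sum_range_succ, stay_add hI (hmeas n), ih, sum_range_succ, iterate_succ_apply' _ n]
      rw [← hsum, iterate_succ_apply', ← stay_add hI (hmeas n)]
      refine stay_mono (fun z hz => ?_) x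
      simpa using ih z hz
  unfold pot
  refine tsum_le_of_sum_range_le fun n => le_trans le_self_add (key n x hx)

theorem leave_add_stay {W : ℝ → ℝ≥0∞} (hW : Measurable W) (x : ℝ) :
    leave Q I W x + stay Q I W x = ∫⁻ y, W (x + y) ∂Q := by
  unfold leave stay
  rw [← lintegral_add_left (measurable_indicator_add hI.compl hW x)]
  refine lintegral_congr fun y => ?_
  by_cases hy : x + y ∈ I <;> simp [hy]

/-- A function that is superharmonic on `I` and dominates `F` off `I` dominates the mean of `F` at
the exit position. -/
theorem exitMean_le_of_superharmonic {F W : ℝ → ℝ≥0∞} (hF : Measurable F)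
    (hW : Measurable W) (hFW : ∀ x ∉ I, F x ≤ W x) (h : ∀ x ∈ I, ∫⁻ y, W (x + y) ∂Q ≤ W x)
    (hx : x ∈ I) : exitMean Q I F x ≤ W x := by
  refine pot_le_of_supersolution hI (measurable_leave hI hF) (fun z hz => ?_) hx
  refine le_trans ?_ (h z hz)
  rw [← leave_add_stay hI hW]
  gcongr
  exact leave_mono hFW z

/-- If the walk leaves `I` in finite mean time, its exit position has total mass `1`. -/
theorem exitMean_one [IsProbabilityMeasure Q] (h : meanTime Q I x ≠ ∞) : exitMean Q I 1 x = 1 := by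
  have key : ∀ n : ℕ, ∀ x,
      ∑ i ∈ range n, (stay Q I)^[i] (leave Q I 1) x + (stay Q I)^[n] 1 x = 1 := by
    intro n
    induction n with
    | zero => intro x; simp
    | succ n ih =>
      intro x
      have h2 : (stay Q I)^[n] (leave Q I 1 + stay Q I 1) x = (stay Q I)^[n] 1 x := by
        have : leave Q I 1 + stay Q I 1 = 1 := funext fun z => by
          change leave Q I 1 z + stay Q I 1 z = 1
          rw [leave_add_stay hI measurable_one]; simp
        rw [this]
      rw [sum_range_succ, Function.iterate_succ_apply, add_assoc]
      rw [stay_iterate_add hI (measurable_leave hI measurable_one)] at h2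
      rw [show (stay Q I)^[n] (leave Q I 1) x + (stay Q I)^[n] (stay Q I 1) x
        = (stay Q I)^[n] 1 x from h2, ih]
  have h1 : Filter.Tendsto (fun n => ∑ i ∈ range n, (stay Q I)^[i] (leave Q I 1) x)
      Filter.atTop (nhds (exitMean Q I 1 x)) := ENNReal.tendsto_nat_tsum _
  have h2 := h1.add (ENNReal.tendsto_atTop_zero_of_tsum_ne_top h)
  simp only [key, add_zero] at h2
  exact (tendsto_nhds_unique h2 tendsto_const_nhds)

theorem stay_iterate_exitMean_le {F : ℝ → ℝ≥0∞} (hF : Measurable F)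
    (n : ℕ) (x : ℝ) : (stay Q I)^[n] (exitMean Q I F) x ≤ exitMean Q I F x := by
  induction n with
  | zero => exact le_rfl
  | succ n ih =>
    refine le_trans ?_ ih
    rw [Function.iterate_succ_apply]
    refine stay_iterate_mono (fun z => ?_) n x
    rw [exitMean_eq hI hF z]
    exact le_add_self

theorem lintegral_aliveLaw (n : ℕ) (hf : Measurable f) :
    ∫⁻ x, f x ∂(aliveLaw Q I n) = (stay Q I)^[n] f 0 := by
  induction n generalizing f with
  | zero => simp [aliveLaw]
  | succ n ih =>
    rw [aliveLaw, Function.iterate_succ_apply, ← ih (measurable_stay hI hf),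
      ← lintegral_indicator hI, Measure.lintegral_conv (hf.indicator hI)]
    rfl

theorem lintegral_exitLaw {F : ℝ → ℝ≥0∞} (hF : Measurable F) :
    ∫⁻ x, F x ∂(exitLaw Q I) = exitMean Q I F 0 := by
  rw [exitLaw, lintegral_sum_measure, exitMean, pot]
  refine tsum_congr fun n => ?_
  rw [← lintegral_aliveLaw hI n (measurable_leave hI hF), ← lintegral_indicator hI.compl,
    Measure.lintegral_conv (hF.indicator hI.compl)]
  rfl

omit hI in
theorem refresh_mono (h : ∀ x, f x ≤ g x) (x : ℝ) : refresh Q I f x ≤ refresh Q I g x := by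
  unfold refresh
  gcongr
  · exact stay_mono (fun z _ => h z) x
  · exact h 0

/-- The walk with restarts, at time `s`, is in its `j`-th step after the last restart for some
`j ≤ s`; dropping the probability of a restart at time `s - j` gives this bound. -/
theorem refresh_iterate_le [IsProbabilityMeasure Q] (hf : Measurable f) (s : ℕ) (x : ℝ) :
    (refresh Q I)^[s] f x ≤ (stay Q I)^[s] f x + ∑ j ∈ range s, (stay Q I)^[j] f 0 := by
  induction s generalizing x with
  | zero => simp
  | succ s ih =>
    set S := ∑ j ∈ range s, (stay Q I)^[j] f 0 with hS
    rw [iterate_succ_apply']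
    refine (refresh_mono ih x).trans ?_
    have h1 : leave Q I 1 x + stay Q I 1 x = 1 := by rw [leave_add_stay hI measurable_one]; simp
    have h2 : stay Q I (fun x => (stay Q I)^[s] f x + S) x
        = (stay Q I)^[s + 1] f x + S * stay Q I 1 x := by
      rw [iterate_succ_apply', ← stay_const_mul hI measurable_one,
        ← stay_add hI (measurable_stay_iterate hI hf s)]
      congr 1
      funext z
      simp
    have h3 := h1 ▸ le_self_add
    rw [refresh, h2, sum_range_succ, mul_add, ← hS]
    calc (stay Q I)^[s + 1] f x + S * stay Q I 1 x
          + (leave Q I 1 x * (stay Q I)^[s] f 0 + leave Q I 1 x * S)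
        = (stay Q I)^[s + 1] f x + (S * (leave Q I 1 x + stay Q I 1 x)
          + leave Q I 1 x * (stay Q I)^[s] f 0) := by ring
      _ ≤ (stay Q I)^[s + 1] f x + (S * 1 + 1 * (stay Q I)^[s] f 0) := by rw [h1]; gcongr
      _ = _ := by ring

end ExitOperators

section ChangeOfMeasure

variable {Q Q₀ : Measure ℝ} {I : Set ℝ} [SFinite Q] [SFinite Q₀] (hI : MeasurableSet I)
include hI

theorem stay_tilt (hQ : Q₀ = Q.withDensity fun y => ofReal (exp y)) (hf : Measurable f) (x : ℝ) :
    ofReal (exp x) * stay Q₀ I f x = stay Q I (fun z => ofReal (exp z) * f z) x := by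
  unfold stay
  have hm : Measurable fun y => I.indicator f (x + y) :=
    (hf.indicator hI).comp (measurable_const_add x)
  have he : Measurable fun y : ℝ => ofReal (exp y) := by fun_prop
  rw [hQ, lintegral_withDensity_eq_lintegral_mul _ he hm, ← lintegral_const_mul _ (he.mul hm)]
  refine lintegral_congr fun y => ?_
  by_cases hy : x + y ∈ I
  · simp only [Pi.mul_apply, hy, indicator_of_mem]
    rw [exp_add, ofReal_mul (exp_pos x).le, mul_assoc]
  · simp [hy]

theorem stay_iterate_tilt (hQ : Q₀ = Q.withDensity fun y => ofReal (exp y))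
    (hf : Measurable f) (n : ℕ) (x : ℝ) :
    ofReal (exp x) * (stay Q₀ I)^[n] f x = (stay Q I)^[n] (fun z => ofReal (exp z) * f z) x := by
  induction n generalizing x with
  | zero => rfl
  | succ n ih =>
    rw [iterate_succ_apply', iterate_succ_apply',
      stay_tilt hI hQ (measurable_stay_iterate hI hf n), funext ih]

/-- Wald's likelihood ratio identity for the exit position. -/
theorem exitMean_tilt (hQ : Q₀ = Q.withDensity fun y => ofReal (exp y)) {F : ℝ → ℝ≥0∞}
    (hF : Measurable F) (x : ℝ) :
    ofReal (exp x) * exitMean Q₀ I F x = exitMean Q I (fun z => ofReal (exp z) * F z) x := by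
  unfold exitMean pot
  rw [← ENNReal.tsum_mul_left]
  refine tsum_congr fun n => ?_
  rw [stay_iterate_tilt hI hQ (measurable_leave hI hF),
    show (fun z => ofReal (exp z) * leave Q₀ I F z) = leave Q I (fun z => ofReal (exp z) * F z) from
    funext fun z => stay_tilt hI.compl hQ hF z]

theorem exitLaw_tilt (hQ : Q₀ = Q.withDensity fun y => ofReal (exp y)) :
    exitLaw Q₀ I = (exitLaw Q I).withDensity fun y => ofReal (exp y) := by
  have he : Measurable fun y : ℝ => ofReal (exp y) := by fun_prop
  refine Measure.ext fun s hs => ?_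
  have hs1 : Measurable (s.indicator (1 : ℝ → ℝ≥0∞)) := measurable_one.indicator hs
  rw [← lintegral_indicator_one hs, lintegral_exitLaw hI hs1]
  have := exitMean_tilt hI hQ hs1 0
  rw [exp_zero, ofReal_one, one_mul] at this
  have h2 := lintegral_exitLaw (Q := Q) hI (he.mul hs1)
  simp only [Pi.mul_apply] at h2
  rw [this, withDensity_apply _ hs, ← lintegral_indicator hs]
  refine Eq.trans ?_ (h2.symm.trans ?_)
  · rfl
  refine lintegral_congr fun y => ?_
  by_cases hy : y ∈ s <;> simp [hy]

end ChangeOfMeasure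

/-! ### Lyapunov functions for the overshoot of a random walk -/

/-- The concave function of `w` that is linear on `w ≤ 0` and has slope `(z - w)⁺` at `w ≥ 0`. -/
def concaveKernel (z w : ℝ) : ℝ :=
  if 0 ≤ w then (max z 0 ^ 2 - max (z - w) 0 ^ 2) / 2 else max z 0 * w

theorem concaveKernel_tangent (z : ℝ) (hw : 0 ≤ w) (y : ℝ) :
    concaveKernel z (w - y) ≤ concaveKernel z w - y * max (z - w) 0 := by
  unfold concaveKernel
  rw [if_pos hw]
  split_ifs with h
  · rcases max_cases (z - w) 0 with ⟨h1, h1'⟩ | ⟨h1, h1'⟩ <;>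
      rcases max_cases (z - (w - y)) 0 with ⟨h2, h2'⟩ | ⟨h2, h2'⟩ <;>
      rcases max_cases z 0 with ⟨h3, h3'⟩ | ⟨h3, h3'⟩ <;> rw [h1, h2, h3] <;>
      nlinarith [sq_nonneg y, sq_nonneg (z - w)]
  · push Not at h
    rcases max_cases (z - w) 0 with ⟨h1, h1'⟩ | ⟨h1, h1'⟩ <;>
      rcases max_cases z 0 with ⟨h3, h3'⟩ | ⟨h3, h3'⟩ <;> rw [h1, h3] <;> nlinarith

theorem concaveKernel_le (z w : ℝ) : concaveKernel z w ≤ max z 0 ^ 2 / 2 := by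
  unfold concaveKernel
  split_ifs with h
  · nlinarith [sq_nonneg (max (z - w) 0)]
  · nlinarith [le_max_right z 0, sq_nonneg (max z 0)]

theorem concaveKernel_nonneg (z : ℝ) (hw : 0 ≤ w) : 0 ≤ concaveKernel z w := by
  unfold concaveKernel
  rw [if_pos hw]
  have : max (z - w) 0 ≤ max z 0 := max_le_max (by linarith) le_rfl
  nlinarith [le_max_right (z - w) 0]

theorem concaveKernel_of_neg (z : ℝ) (hw : w < 0) : concaveKernel z w = max z 0 * w :=
  if_neg (not_le.mpr hw)

theorem concaveKernel_sub_le (z : ℝ) {a b : ℝ} (h : a ≤ b) :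
    concaveKernel z b - concaveKernel z a ≤ max z 0 * (b - a) := by
  unfold concaveKernel
  split_ifs with h1 h2 h2
  · rcases max_cases (z - a) 0 with ⟨h1, h1'⟩ | ⟨h1, h1'⟩ <;>
      rcases max_cases (z - b) 0 with ⟨h2, h2'⟩ | ⟨h2, h2'⟩ <;>
      rcases max_cases z 0 with ⟨h3, h3'⟩ | ⟨h3, h3'⟩ <;> rw [h1, h2, h3] <;> nlinarith
  · rcases max_cases (z - b) 0 with ⟨h2, h2'⟩ | ⟨h2, h2'⟩ <;>
      rcases max_cases z 0 with ⟨h3, h3'⟩ | ⟨h3, h3'⟩ <;> rw [h2, h3] <;> nlinarith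
  · exact absurd (h2.trans h) h1
  · rw [mul_sub]

theorem abs_concaveKernel_le (z w : ℝ) : |concaveKernel z w| ≤ z ^ 2 + w ^ 2 := by
  have hz : max z 0 ^ 2 ≤ z ^ 2 := by
    rcases max_cases z 0 with ⟨h, _⟩ | ⟨h, _⟩ <;> rw [h] <;> nlinarith
  rw [abs_le]
  constructor
  · rcases le_or_gt 0 w with h | h
    · nlinarith [concaveKernel_nonneg z h, sq_nonneg z, sq_nonneg w]
    · rw [concaveKernel_of_neg z h]
      nlinarith [sq_nonneg (max z 0 + w), sq_nonneg (max z 0)]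
  · nlinarith [concaveKernel_le z w, sq_nonneg z, sq_nonneg w]

theorem measurable_concaveKernel : Measurable fun p : ℝ × ℝ => concaveKernel p.1 p.2 := by
  unfold concaveKernel
  refine Measurable.ite (measurableSet_le measurable_const measurable_snd) ?_ ?_ <;> fun_prop

section Lyapunov

variable (Q : Measure ℝ)

/-- The mean of the excess of a step over `w + c`. -/
def excess (c w : ℝ) : ℝ := ∫ y, max (y - w - c) 0 ∂Q

/-- A concave function of the distance `w` to an upper barrier, whose mean decreases by
`excess Q c w` in every step. -/
def corrector (c w : ℝ) : ℝ := (∫ y, concaveKernel (y - c) w ∂Q) / ∫ y, y ∂Q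

/-- The ratio of the second moment to twice the first. -/
def spread : ℝ := (∫ y, y ^ 2 ∂Q) / (2 * ∫ y, y ∂Q)

/-- A function of the distance `w` to an upper barrier whose mean decreases by the mean step in
every step from `w ≥ 0`; it differs from `w` by a bounded amount on `w ≥ 0`. -/
def driftFn (w : ℝ) : ℝ := w + spread Q + 2 * max (-w - spread Q) 0 + 2 * corrector Q (spread Q) w

/-- A function of the distance to an upper barrier that is superharmonic and bounded on `w ≥ 0` and
dominates the overshoot `-w` for `w < 0`. -/
def overFn (w : ℝ) : ℝ := driftFn Q w - w + spread Q

/-- The analogue of `overFn` for the part of the overshoot in excess of `ε`. -/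
def overFnAbove (ε w : ℝ) : ℝ :=
  max (-w - ε) 0 + corrector Q ε w + excess Q ε 0 / (∫ y, y ∂Q) * overFn Q w

/-- Finite second moment and positive mean. -/
structure PosDrift : Prop where
  prob : IsProbabilityMeasure Q
  int1 : Integrable (fun y => y) Q
  int2 : Integrable (fun y => y ^ 2) Q
  mean_pos : 0 < ∫ y, y ∂Q

variable {Q} (h : PosDrift Q)
include h

theorem PosDrift.integrable_sub_sq (c : ℝ) : Integrable (fun y => (y - c) ^ 2) Q := by
  have := h.prob
  have : (fun y : ℝ => (y - c) ^ 2) = fun y => y ^ 2 - 2 * c * y + c ^ 2 := by funext y; ring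
  rw [this]
  exact (h.int2.sub (h.int1.const_mul _)).add (integrable_const _)

theorem PosDrift.integrable_excess (c w : ℝ) : Integrable (fun y => max (y - w - c) 0) Q := by
  have := h.prob
  exact ((h.int1.sub (integrable_const w)).sub (integrable_const c)).pos_part

theorem PosDrift.integrable_kernel (c w : ℝ) : Integrable (fun y => concaveKernel (y - c) w) Q := by
  have := h.prob
  refine ((h.integrable_sub_sq c).add (integrable_const (w ^ 2))).mono' ?_
    (.of_forall fun y => abs_concaveKernel_le _ _)
  exact (measurable_concaveKernel.comp
    ((measurable_id.sub_const c).prodMk measurable_const)).aestronglyMeasurable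

theorem PosDrift.second_nonneg : 0 ≤ ∫ y, y ^ 2 ∂Q := integral_nonneg fun y => sq_nonneg y

theorem PosDrift.spread_pos : 0 < spread Q := by
  have := h.prob
  refine div_pos ?_ (by linarith [h.mean_pos])
  have h1 : (0 : ℝ) ≤ ∫ y, (y - ∫ z, z ∂Q) ^ 2 ∂Q := integral_nonneg fun y => sq_nonneg _
  have h2 : ∫ y, (y - ∫ z, z ∂Q) ^ 2 ∂Q = ∫ y, y ^ 2 ∂Q - (∫ z, z ∂Q) ^ 2 := by
    set μ := ∫ z, z ∂Q with hμ
    have : (fun y : ℝ => (y - μ) ^ 2) = fun y => (y ^ 2 - 2 * μ * y) + μ ^ 2 := by funext y; ring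
    have hi : Integrable (fun y => y ^ 2 - 2 * μ * y) Q := h.int2.sub (h.int1.const_mul _)
    rw [this, integral_add hi (integrable_const _),
      integral_sub h.int2 (h.int1.const_mul _), integral_const_mul, ← hμ]
    simp; ring
  nlinarith [h.mean_pos]

theorem PosDrift.excess_nonneg (c w : ℝ) : 0 ≤ excess Q c w :=
  integral_nonneg fun _ => le_max_right _ _

theorem PosDrift.excess_spread_le : excess Q (spread Q) 0 ≤ (∫ y, y ∂Q) / 2 := by
  have hC := h.spread_pos
  have h1 : excess Q (spread Q) 0 ≤ ∫ y, y ^ 2 / (4 * spread Q) ∂Q := by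
    refine integral_mono (h.integrable_excess _ _) (h.int2.div_const _) fun y => ?_
    dsimp only
    rw [le_div_iff₀ (by linarith)]
    rcases max_cases (y - 0 - spread Q) 0 with ⟨h1, _⟩ | ⟨h1, _⟩ <;> rw [h1] <;>
      nlinarith [sq_nonneg (y - 2 * spread Q), sq_nonneg y]
  rw [integral_div] at h1
  refine h1.trans (le_of_eq ?_)
  have h2 : 0 < ∫ y, y ^ 2 ∂Q := by
    by_contra h3
    have : spread Q ≤ 0 := div_nonpos_of_nonpos_of_nonneg (not_lt.mp h3) (by linarith [h.mean_pos])
    linarith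
  unfold spread
  field_simp
  ring

theorem PosDrift.corrector_le (c w : ℝ) :
    corrector Q c w ≤ (∫ y, max (y - c) 0 ^ 2 ∂Q) / (2 * ∫ y, y ∂Q) := by
  unfold corrector
  have hi : Integrable (fun y => max (y - c) 0 ^ 2) Q := by
    refine (h.integrable_sub_sq c).mono' (by fun_prop) (.of_forall fun y => ?_)
    rw [Real.norm_of_nonneg (sq_nonneg _)]
    rcases max_cases (y - c) 0 with ⟨h1, _⟩ | ⟨h1, _⟩ <;> rw [h1] <;> nlinarith [sq_nonneg (y - c)]
  rw [← div_div]
  refine div_le_div_of_nonneg_right ?_ h.mean_pos.le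
  rw [← integral_div]
  exact integral_mono (h.integrable_kernel c w) (hi.div_const 2) fun y => concaveKernel_le _ _

theorem PosDrift.corrector_nonneg (c : ℝ) (hw : 0 ≤ w) : 0 ≤ corrector Q c w :=
  div_nonneg (integral_nonneg fun _ => concaveKernel_nonneg _ hw) h.mean_pos.le

theorem PosDrift.corrector_of_neg (c : ℝ) (hw : w < 0) :
    corrector Q c w = excess Q c 0 / (∫ y, y ∂Q) * w := by
  unfold corrector excess
  simp_rw [concaveKernel_of_neg _ hw, integral_mul_const, sub_zero]
  ring

theorem PosDrift.corrector_sub_le (c : ℝ) {a b : ℝ} (hab : a ≤ b) :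
    corrector Q c b - corrector Q c a ≤ excess Q c 0 / (∫ y, y ∂Q) * (b - a) := by
  unfold corrector excess
  rw [← sub_div, ← integral_sub (h.integrable_kernel _ _) (h.integrable_kernel _ _),
    div_mul_eq_mul_div]
  refine div_le_div_of_nonneg_right ?_ h.mean_pos.le
  rw [← integral_mul_const]
  refine integral_mono ((h.integrable_kernel _ _).sub (h.integrable_kernel _ _))
    ((h.integrable_excess c 0).mul_const _) fun y => ?_
  simpa using concaveKernel_sub_le (y - c) hab

theorem PosDrift.corrector_tangent (c : ℝ) (hw : 0 ≤ w) (y : ℝ) :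
    corrector Q c (w - y) ≤ corrector Q c w - y * (excess Q c w / ∫ y, y ∂Q) := by
  unfold corrector excess
  rw [← mul_div_assoc, ← sub_div]
  refine div_le_div_of_nonneg_right ?_ h.mean_pos.le
  rw [← integral_const_mul, ← integral_sub (h.integrable_kernel _ _)
    ((h.integrable_excess c w).const_mul y)]
  refine integral_mono (h.integrable_kernel _ _)
    ((h.integrable_kernel _ _).sub ((h.integrable_excess c w).const_mul y)) fun z => ?_
  have := concaveKernel_tangent (z - c) hw y
  rwa [show z - c - w = z - w - c by ring] at this

theorem PosDrift.measurable_corrector (c : ℝ) : Measurable (corrector Q c) := by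
  have := h.prob
  unfold corrector
  refine Measurable.div_const ?_ _
  have : Measurable fun p : ℝ × ℝ => concaveKernel (p.2 - c) p.1 :=
    measurable_concaveKernel.comp ((measurable_snd.sub_const c).prodMk measurable_fst)
  exact (this.stronglyMeasurable.integral_prod_right (ν := Q)).measurable

theorem PosDrift.integrable_corrector (c w : ℝ) :
    Integrable (fun y => corrector Q c (w - y)) Q := by
  have := h.prob
  obtain ⟨A, hA⟩ : ∃ A, ∀ w, corrector Q c w ≤ A := ⟨_, h.corrector_le c⟩
  have hlow (v : ℝ) : -(excess Q c 0 / (∫ y, y ∂Q) * |v|) ≤ corrector Q c v := by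
    have h0 := div_nonneg (h.excess_nonneg c 0) h.mean_pos.le
    rcases le_or_gt 0 v with hv | hv
    · have := h.corrector_nonneg c hv
      nlinarith [abs_nonneg v]
    · rw [h.corrector_of_neg c hv, abs_of_neg hv]; linarith
  refine ((((integrable_const |w|).add h.int1.abs).const_mul
    (excess Q c 0 / (∫ y, y ∂Q))).add (integrable_const |A|)).mono'
    ((h.measurable_corrector c).comp (measurable_const.sub measurable_id)).aestronglyMeasurable
    (.of_forall fun y => ?_)
  simp only [Pi.add_apply]
  have h0 := div_nonneg (h.excess_nonneg c 0) h.mean_pos.le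
  have h1 : |w - y| ≤ |w| + |y| := abs_sub _ _
  have h2 := mul_le_mul_of_nonneg_left h1 h0
  rw [Real.norm_eq_abs, abs_le]
  constructor
  · linarith [hlow (w - y), abs_nonneg A]
  · have := mul_nonneg h0 (add_nonneg (abs_nonneg w) (abs_nonneg y))
    linarith [hA (w - y), le_abs_self A]

theorem PosDrift.integral_corrector_le (c : ℝ) (hw : 0 ≤ w) :
    ∫ y, corrector Q c (w - y) ∂Q ≤ corrector Q c w - excess Q c w := by
  have := h.prob
  calc ∫ y, corrector Q c (w - y) ∂Q ≤ ∫ y, (corrector Q c w - y * (excess Q c w / ∫ y, y ∂Q)) ∂Q :=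
        integral_mono (h.integrable_corrector c w)
          ((integrable_const _).sub (h.int1.mul_const _)) fun y => h.corrector_tangent c hw y
    _ = corrector Q c w - excess Q c w := by
        rw [integral_sub (integrable_const _) (h.int1.mul_const _), integral_mul_const]
        have := h.mean_pos.ne'
        simp only [integral_const, probReal_univ, smul_eq_mul, one_mul]
        field_simp

theorem PosDrift.slope_le : excess Q (spread Q) 0 / (∫ y, y ∂Q) ≤ 1 / 2 := by
  rw [div_le_iff₀ h.mean_pos]; linarith [h.excess_spread_le]

theorem PosDrift.measurable_driftFn : Measurable (driftFn Q) := by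
  have := h.measurable_corrector (spread Q)
  unfold driftFn; fun_prop

theorem PosDrift.integrable_driftFn (w : ℝ) : Integrable (fun y => driftFn Q (w - y)) Q := by
  have := h.prob
  unfold driftFn
  have h1 := (integrable_const w).sub h.int1
  exact ((h1.add (integrable_const _)).add
    ((h1.neg.sub (integrable_const _)).pos_part.const_mul 2)).add
    ((h.integrable_corrector _ w).const_mul 2)

/-- The drift inequality for `driftFn`. -/
theorem PosDrift.integral_driftFn_le (hw : 0 ≤ w) :
    ∫ y, driftFn Q (w - y) ∂Q ≤ driftFn Q w - ∫ y, y ∂Q := by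
  have := h.prob
  have h1 : Integrable (fun y => w - y) Q := (integrable_const w).sub h.int1
  have h2 : Integrable (fun y => max (-(w - y) - spread Q) 0) Q :=
    (h1.neg.sub (integrable_const _)).pos_part
  have h4 : ∫ y, max (-(w - y) - spread Q) 0 ∂Q = excess Q (spread Q) w := by
    unfold excess; congr 1; funext y; congr 1; ring
  have h5 : driftFn Q w = w + spread Q + 2 * corrector Q (spread Q) w := by
    unfold driftFn
    rw [max_eq_right (by linarith [h.spread_pos])]; ring
  have h6 : Integrable (fun y => w - y + spread Q) Q := h1.add (integrable_const _)
  have h7 : Integrable (fun y => w - y + spread Q + 2 * max (-(w - y) - spread Q) 0) Q :=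
    h6.add (h2.const_mul 2)
  rw [h5]
  unfold driftFn
  rw [integral_add h7 ((h.integrable_corrector (spread Q) w).const_mul 2), integral_add h6
    (h2.const_mul 2),
    integral_add h1 (integrable_const _), integral_sub (integrable_const _) h.int1,
    integral_const_mul, integral_const_mul, h4]
  have := h.integral_corrector_le (spread Q) hw
  simp only [integral_const, probReal_univ, smul_eq_mul, one_mul]
  linarith

theorem PosDrift.neg_spread_le_driftFn (w : ℝ) : -spread Q ≤ driftFn Q w := by
  have hs := h.slope_le
  have hC := h.spread_pos
  unfold driftFn
  rcases le_or_gt 0 w with hw | hw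
  · have := h.corrector_nonneg (spread Q) hw
    linarith [le_max_right (-w - spread Q) 0]
  · rw [h.corrector_of_neg _ hw]
    rcases max_cases (-w - spread Q) 0 with ⟨h1, _⟩ | ⟨h1, _⟩ <;> rw [h1] <;> nlinarith

theorem PosDrift.driftFn_le (hw : 0 ≤ w) : driftFn Q w ≤ w + 3 * spread Q := by
  have hC := h.spread_pos
  unfold driftFn
  rw [max_eq_right (by linarith)]
  have h1 := h.corrector_le (spread Q) w
  have h2 : (∫ y, max (y - spread Q) 0 ^ 2 ∂Q) / (2 * ∫ y, y ∂Q) ≤ spread Q := by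
    unfold spread
    refine div_le_div_of_nonneg_right ?_ (by linarith [h.mean_pos])
    refine integral_mono_of_nonneg (.of_forall fun y => sq_nonneg _) h.int2 (.of_forall fun y => ?_)
    change max (y - spread Q) 0 ^ 2 ≤ y ^ 2
    rcases max_cases (y - spread Q) 0 with ⟨h1, _⟩ | ⟨h1, _⟩ <;> rw [h1] <;> nlinarith
  linarith

theorem PosDrift.driftFn_sub_le {a b : ℝ} (hab : a ≤ b) :
    driftFn Q b ≤ driftFn Q a + 2 * (b - a) := by
  have h1 := h.corrector_sub_le (spread Q) hab
  have h2 := mul_le_mul_of_nonneg_right h.slope_le (sub_nonneg.mpr hab)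
  have h3 : max (-b - spread Q) 0 ≤ max (-a - spread Q) 0 := max_le_max (by linarith) le_rfl
  unfold driftFn
  linarith

theorem PosDrift.neg_le_overFn (hw : w < 0) : -w ≤ overFn Q w := by
  have hs := h.slope_le
  unfold overFn driftFn
  rw [h.corrector_of_neg _ hw]
  rcases max_cases (-w - spread Q) 0 with ⟨h1, _⟩ | ⟨h1, _⟩ <;> rw [h1] <;> nlinarith

theorem PosDrift.overFn_nonneg (w : ℝ) : 0 ≤ overFn Q w := by
  rcases le_or_gt 0 w with hw | hw
  · have := h.corrector_nonneg (spread Q) hw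
    unfold overFn driftFn
    linarith [le_max_right (-w - spread Q) 0, h.spread_pos]
  · linarith [h.neg_le_overFn hw]

theorem PosDrift.overFn_le (hw : 0 ≤ w) : overFn Q w ≤ 4 * spread Q := by
  unfold overFn; linarith [h.driftFn_le hw]

theorem PosDrift.integrable_overFn (w : ℝ) : Integrable (fun y => overFn Q (w - y)) Q := by
  have := h.prob
  exact ((h.integrable_driftFn w).sub ((integrable_const w).sub h.int1)).add (integrable_const _)

theorem PosDrift.integral_overFn_le (hw : 0 ≤ w) : ∫ y, overFn Q (w - y) ∂Q ≤ overFn Q w := by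
  have := h.prob
  have h1 : Integrable (fun y => w - y) Q := (integrable_const w).sub h.int1
  have h2 : Integrable (fun y => driftFn Q (w - y) - (w - y)) Q := (h.integrable_driftFn w).sub h1
  unfold overFn
  rw [integral_add h2 (integrable_const _),
    integral_sub (h.integrable_driftFn w) h1, integral_sub (integrable_const _) h.int1]
  have := h.integral_driftFn_le hw
  simp only [integral_const, probReal_univ, smul_eq_mul, one_mul]
  linarith

theorem PosDrift.max_le_overFnAbove (ε : ℝ) (hw : w < 0) : max (-w - ε) 0 ≤ overFnAbove Q ε w := by
  unfold overFnAbove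
  rw [h.corrector_of_neg _ hw]
  nlinarith [mul_le_mul_of_nonneg_left (h.neg_le_overFn hw) (div_nonneg (h.excess_nonneg ε 0)
    h.mean_pos.le)]

theorem PosDrift.overFnAbove_nonneg (ε w : ℝ) : 0 ≤ overFnAbove Q ε w := by
  rcases le_or_gt 0 w with hw | hw
  · exact add_nonneg (add_nonneg (le_max_right _ _) (h.corrector_nonneg ε hw))
      (mul_nonneg (div_nonneg (h.excess_nonneg ε 0) h.mean_pos.le) (h.overFn_nonneg w))
  · exact (le_max_right _ _).trans (h.max_le_overFnAbove ε hw)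

theorem PosDrift.overFnAbove_le {ε : ℝ} (hε : 0 ≤ ε) (hw : 0 ≤ w) :
    overFnAbove Q ε w ≤ (∫ y, max (y - ε) 0 ^ 2 ∂Q) / (2 * ∫ y, y ∂Q)
      + excess Q ε 0 / (∫ y, y ∂Q) * (4 * spread Q) := by
  unfold overFnAbove
  rw [max_eq_right (by linarith)]
  have := mul_le_mul_of_nonneg_left (h.overFn_le hw) (div_nonneg (h.excess_nonneg ε 0)
    h.mean_pos.le)
  linarith [h.corrector_le ε w]

theorem PosDrift.integrable_overFnAbove (ε w : ℝ) :
    Integrable (fun y => overFnAbove Q ε (w - y)) Q := by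
  have := h.prob
  exact ((((integrable_const w).sub h.int1).neg.sub (integrable_const _)).pos_part.add
    (h.integrable_corrector _ w)).add
    ((h.integrable_overFn w).const_mul _)

theorem PosDrift.integral_overFnAbove_le {ε : ℝ} (hε : 0 ≤ ε) (hw : 0 ≤ w) :
    ∫ y, overFnAbove Q ε (w - y) ∂Q ≤ overFnAbove Q ε w := by
  have := h.prob
  have h2 : Integrable (fun y => max (-(w - y) - ε) 0) Q :=
    (((integrable_const w).sub h.int1).neg.sub (integrable_const _)).pos_part
  have h4 : ∫ y, max (-(w - y) - ε) 0 ∂Q = excess Q ε w := by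
    unfold excess; congr 1; funext y; congr 1; ring
  have h5 := mul_le_mul_of_nonneg_left (h.integral_overFn_le hw) (div_nonneg (h.excess_nonneg ε 0)
    h.mean_pos.le)
  have h6 := h.integral_corrector_le ε hw
  have h7 : Integrable (fun y => max (-(w - y) - ε) 0 + corrector Q ε (w - y)) Q :=
    h2.add (h.integrable_corrector _ w)
  unfold overFnAbove
  rw [integral_add h7 ((h.integrable_overFn w).const_mul _),
    integral_add h2 (h.integrable_corrector _ w), integral_const_mul, h4,
    max_eq_right (by linarith : -w - ε ≤ 0)]
  linarith

theorem PosDrift.measurable_overFn : Measurable (overFn Q) := by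
  have := h.measurable_driftFn
  unfold overFn; fun_prop

theorem PosDrift.measurable_overFnAbove (ε : ℝ) : Measurable (overFnAbove Q ε) := by
  have := h.measurable_overFn
  have := h.measurable_corrector ε
  unfold overFnAbove; fun_prop

theorem PosDrift.excess_le_tail {ε m B : ℝ} (hε : 0 ≤ ε) (hm : 0 < m)
    (hmean : m ≤ ∫ y, y ∂Q) (hB : ∫ y, y ^ 2 ∂Q ≤ B) :
    excess Q ε 0 ≤ (2 / m + 4 * (B + 1) / m ^ 2) * ∫ y in {y | ε ≤ y}, y ^ 2 ∂Q := by
  have := h.prob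
  have hs : MeasurableSet {y : ℝ | ε ≤ y} := measurableSet_Ici
  have hT0 : 0 ≤ ∫ y in {y | ε ≤ y}, y ^ 2 ∂Q := integral_nonneg fun y => sq_nonneg y
  have hB0 : 0 ≤ B := h.second_nonneg.trans hB
  rcases le_or_gt (m / 2) ε with h1 | h1
  · -- a step that exceeds `ε ≥ m / 2` is at most `2 / m` times its square
    have h2 : excess Q ε 0 ≤ 2 / m * ∫ y in {y | ε ≤ y}, y ^ 2 ∂Q := by
      rw [← integral_const_mul, ← integral_indicator hs]
      refine integral_mono (h.integrable_excess _ _)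
        ((h.int2.const_mul (2 / m)).indicator hs) fun y => ?_
      by_cases hy : ε ≤ y
      · rw [indicator_of_mem (by exact hy), max_eq_left (by linarith)]
        have : y ≤ 2 / m * y ^ 2 := by rw [div_mul_eq_mul_div, le_div_iff₀ hm]; nlinarith
        linarith
      · rw [indicator_of_notMem (by exact hy), max_eq_right (by linarith)]
    refine h2.trans (mul_le_mul_of_nonneg_right ?_ hT0)
    have : 0 ≤ 4 * (B + 1) / m ^ 2 := by positivity
    linarith
  · -- for small `ε` the truncated second moment is bounded below
    have h2 : m / 2 ≤ ∫ y in {y | ε ≤ y}, y ∂Q := by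
      have h3 : ∫ y, y ∂Q ≤ ∫ y, ({y | ε ≤ y}.indicator (fun y => y) y + ε) ∂Q := by
        refine integral_mono h.int1 ((h.int1.indicator hs).add (integrable_const _)) fun y => ?_
        by_cases hy : ε ≤ y
        · rw [indicator_of_mem (by exact hy)]; linarith
        · rw [indicator_of_notMem (by exact hy)]; linarith
      rw [integral_add (h.int1.indicator hs) (integrable_const _), integral_indicator hs] at h3
      simp only [integral_const, probReal_univ, smul_eq_mul, one_mul] at h3
      linarith
    have h3 : m ^ 2 / 4 ≤ ∫ y in {y | ε ≤ y}, y ^ 2 ∂Q := by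
      have h4 : ∫ y in {y | ε ≤ y}, (m * y - m ^ 2 / 4) ∂Q ≤ ∫ y in {y | ε ≤ y}, y ^ 2 ∂Q := by
        refine integral_mono ((h.int1.integrableOn.const_mul m).sub (integrable_const _))
          h.int2.integrableOn fun y => ?_
        nlinarith [sq_nonneg (y - m / 2)]
      rw [integral_sub (h.int1.integrableOn.const_mul m) (integrable_const _),
        integral_const_mul] at h4
      have h5 : ∫ _ in {y : ℝ | ε ≤ y}, m ^ 2 / 4 ∂Q ≤ m ^ 2 / 4 := by
        rw [setIntegral_const, smul_eq_mul]
        exact mul_le_of_le_one_left (by positivity) measureReal_le_one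
      nlinarith
    have h4 : excess Q ε 0 ≤ B + 1 := by
      have : excess Q ε 0 ≤ ∫ y, (y ^ 2 + 1) ∂Q := by
        refine integral_mono (h.integrable_excess _ _) (h.int2.add (integrable_const _)) fun y => ?_
        change max (y - 0 - ε) 0 ≤ y ^ 2 + 1
        rcases max_cases (y - 0 - ε) 0 with ⟨h1, _⟩ | ⟨h1, _⟩ <;> rw [h1] <;>
          nlinarith [sq_nonneg (y - 1), sq_nonneg y]
      rw [integral_add h.int2 (integrable_const _)] at this
      simp only [integral_const, probReal_univ, smul_eq_mul, one_mul] at this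
      linarith
    calc excess Q ε 0 ≤ 4 * (B + 1) / m ^ 2 * (m ^ 2 / 4) := by
          rw [show 4 * (B + 1) / m ^ 2 * (m ^ 2 / 4) = B + 1 by field_simp]; exact h4
      _ ≤ 4 * (B + 1) / m ^ 2 * ∫ y in {y | ε ≤ y}, y ^ 2 ∂Q := by gcongr
      _ ≤ _ := mul_le_mul_of_nonneg_right (by have : 0 < 2 / m := by positivity
                                              linarith) hT0

end Lyapunov

/-! ### Bounds for the exit of a random walk from an interval -/

section Reflection

variable {Q : Measure ℝ} 

theorem stay_neg (hf : Measurable f) (x : ℝ) :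
    stay (Q.map Neg.neg) (Ioo (-hi) lo) (fun z => f (-z)) (-x) = stay Q 𝕀 f x := by
  unfold stay
  refine (lintegral_map_equiv _ (MeasurableEquiv.neg ℝ)).trans (lintegral_congr fun y => ?_)
  change Set.indicator _ _ (-x + -y) = _
  have : -x + -y ∈ Ioo (-hi) lo ↔ x + y ∈ 𝕀 := by
    constructor <;> rintro ⟨h1, h2⟩ <;> constructor <;> linarith
  by_cases h : x + y ∈ 𝕀
  · rw [indicator_of_mem h, indicator_of_mem (this.mpr h)]; congr 1; ring
  · rw [indicator_of_notMem h, indicator_of_notMem (fun h' => h (this.mp h'))]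

theorem leave_neg (hf : Measurable f) (x : ℝ) :
    leave (Q.map Neg.neg) (Ioo (-hi) lo) (fun z => f (-z)) (-x) = leave Q 𝕀 f x := by
  unfold leave
  refine (lintegral_map_equiv _ (MeasurableEquiv.neg ℝ)).trans (lintegral_congr fun y => ?_)
  change Set.indicator _ _ (-x + -y) = _
  have : -x + -y ∈ (Ioo (-hi) lo)ᶜ ↔ x + y ∈ 𝕀ᶜ := by
    rw [Set.mem_compl_iff, Set.mem_compl_iff, not_iff_not]
    constructor <;> rintro ⟨h1, h2⟩ <;> constructor <;> linarith
  by_cases h : x + y ∈ 𝕀ᶜ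
  · rw [indicator_of_mem h, indicator_of_mem (this.mpr h)]; congr 1; ring
  · rw [indicator_of_notMem h, indicator_of_notMem (fun h' => h (this.mp h'))]

theorem stay_iterate_neg [SFinite Q] (hf : Measurable f) (n : ℕ) (x : ℝ) :
    (stay (Q.map Neg.neg) (Ioo (-hi) lo))^[n] (fun z => f (-z)) (-x) = (stay Q 𝕀)^[n] f x := by
  induction n generalizing x with
  | zero => simp
  | succ n ih =>
    rw [iterate_succ_apply', iterate_succ_apply',
      ← stay_neg (measurable_stay_iterate measurableSet_Ioo hf n)]
    congr 1
    funext z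
    rw [← ih (-z), neg_neg]

theorem pot_neg [SFinite Q] {c : ℝ → ℝ≥0∞} (hc : Measurable c) (x : ℝ) :
    pot (Q.map Neg.neg) (Ioo (-hi) lo) (fun z => c (-z)) (-x) = pot Q 𝕀 c x :=
  tsum_congr fun n => stay_iterate_neg hc n x

theorem exitMean_neg [SFinite Q] {F : ℝ → ℝ≥0∞} (hF : Measurable F) (x : ℝ) :
    exitMean (Q.map Neg.neg) (Ioo (-hi) lo) (fun z => F (-z)) (-x) = exitMean Q 𝕀 F x := by
  unfold exitMean
  rw [← pot_neg (measurable_leave measurableSet_Ioo hF)]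
  congr 1
  funext z
  rw [← leave_neg hF (-z), neg_neg]

theorem meanTime_neg [SFinite Q] (x : ℝ) :
    meanTime (Q.map Neg.neg) (Ioo (-hi) lo) (-x) = meanTime Q 𝕀 x :=
  pot_neg (c := 1) measurable_one x

end Reflection

section UpperBarrier

variable {Q : Measure ℝ} (h : PosDrift Q) 
include h

theorem lintegral_ofReal_add_le {V : ℝ → ℝ} (hV : ∀ w, 0 ≤ V w)
    (hint : Integrable (fun y => V (hi - x - y)) Q) {A : ℝ}
    (hle : ∫ y, V (hi - x - y) ∂Q ≤ A) :
    ∫⁻ y, ofReal (V (hi - (x + y))) ∂Q ≤ ofReal A := by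
  simp_rw [← sub_sub]
  rw [← ofReal_integral_eq_lintegral_ofReal hint (.of_forall fun y => hV _)]
  exact ofReal_le_ofReal hle

/-- The mean overshoot in excess of `ε` over an upper barrier, uniformly in the starting point. -/
theorem PosDrift.exitMean_over_le {ε : ℝ} (hε : 0 ≤ ε) (hx : x ∈ 𝕀) :
    exitMean Q 𝕀 (fun z => ofReal (z - hi - ε)) x ≤ ofReal (overFnAbove Q ε (hi - x)) := by
  have := h.prob
  refine exitMean_le_of_superharmonic (W := fun z => ofReal (overFnAbove Q ε (hi - z)))
    measurableSet_Ioo (by fun_prop) ?_ (fun z hz => ?_) (fun z hz => ?_) hx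
  · exact ENNReal.measurable_ofReal.comp ((h.measurable_overFnAbove ε).comp
      (measurable_const.sub measurable_id))
  · refine ofReal_le_ofReal ?_
    rcases lt_or_ge (hi - z) 0 with h1 | h1
    · exact le_trans (by rw [neg_sub]; exact le_max_left _ _) (h.max_le_overFnAbove ε h1)
    · linarith [h.overFnAbove_nonneg ε (hi - z)]
  · exact lintegral_ofReal_add_le h (h.overFnAbove_nonneg ε) (h.integrable_overFnAbove ε _)
      (h.integral_overFnAbove_le hε (by linarith [hz.2]))

theorem PosDrift.meanTime_le (hx : x ∈ 𝕀) : meanTime Q 𝕀 x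
      ≤ ofReal ((hi - x + 4 * spread Q) / ∫ y, y ∂Q) := by
  have := h.prob
  have hμ := h.mean_pos
  set V : ℝ → ℝ := fun w => (driftFn Q w + spread Q) / ∫ y, y ∂Q with hV
  have hV0 : ∀ w, 0 ≤ V w := fun w => div_nonneg (by linarith [h.neg_spread_le_driftFn w]) hμ.le
  have hVm : Measurable V := by
    have := h.measurable_driftFn
    simp only [hV]; fun_prop
  refine (pot_le_of_supersolution (V := fun z => ofReal (V (hi - z))) measurableSet_Ioo
    measurable_one (fun z hz => ?_) hx).trans (ofReal_le_ofReal ?_)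
  · have h1 : stay Q 𝕀 (fun z => ofReal (V (hi - z))) z ≤ ofReal (V (hi - z) - 1) := by
      refine le_trans (le_add_self.trans_eq (leave_add_stay measurableSet_Ioo ?_ z)) ?_
      · exact ENNReal.measurable_ofReal.comp (hVm.comp (measurable_const.sub measurable_id))
      · have hi1 := h.integrable_driftFn (hi - z)
        refine lintegral_ofReal_add_le h hV0 ((hi1.add (integrable_const _)).div_const _) ?_
        have h2 := h.integral_driftFn_le (w := hi - z) (by linarith [hz.2])
        simp only [hV]
        rw [integral_div, integral_add hi1 (integrable_const _), div_sub_one hμ.ne']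
        refine div_le_div_of_nonneg_right ?_ hμ.le
        simp only [integral_const, probReal_univ, smul_eq_mul, one_mul]
        linarith
    have h3 : 1 ≤ V (hi - z) := by
      have h2 := h.integral_driftFn_le (w := hi - z) (by linarith [hz.2])
      have h4 : -spread Q ≤ ∫ y, driftFn Q (hi - z - y) ∂Q := by
        have := integral_mono (integrable_const (-spread Q)) (h.integrable_driftFn (hi - z))
          fun y => h.neg_spread_le_driftFn _
        simpa using this
      simp only [hV]
      rw [le_div_iff₀ hμ]; linarith
    calc (1 : ℝ≥0∞) + stay Q 𝕀 (fun z => ofReal (V (hi - z))) z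
        ≤ ofReal 1 + ofReal (V (hi - z) - 1) := by rw [ofReal_one]; gcongr
      _ = ofReal (V (hi - z)) := by rw [← ofReal_add zero_le_one (by linarith)]; congr 1; ring
  · exact div_le_div_of_nonneg_right (by linarith [h.driftFn_le (w := hi - x) (by linarith [hx.2])])
      hμ.le

end UpperBarrier

/-- The constant in the bounds for the mean overshoot above `ε` by tails of the second moment. -/
def overConst (m B : ℝ) : ℝ := 1 / (2 * m) + (2 / m + 4 * (B + 1) / m ^ 2) / m * (2 * B / m)

theorem PosDrift.overFnAbove_le_tail {Q : Measure ℝ} (hQ : PosDrift Q) {m B ε w : ℝ} (hm : 0 < m)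
    (hmean : m ≤ ∫ y, y ∂Q) (hB : ∫ y, y ^ 2 ∂Q ≤ B) (hε : 0 ≤ ε) (hw : 0 ≤ w) :
    overFnAbove Q ε w ≤ overConst m B * ∫ y in {y | ε ≤ y}, y ^ 2 ∂Q := by
  set T := ∫ y in {y | ε ≤ y}, y ^ 2 ∂Q
  have hB0 : 0 ≤ B := hQ.second_nonneg.trans hB
  have h1 : (∫ y, max (y - ε) 0 ^ 2 ∂Q) / (2 * ∫ y, y ∂Q) ≤ 1 / (2 * m) * T := by
    rw [one_div, inv_mul_eq_div]
    refine div_le_div₀ (integral_nonneg fun y => sq_nonneg y) ?_ (by linarith) (by linarith)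
    have hs : MeasurableSet {y : ℝ | ε ≤ y} := measurableSet_Ici
    rw [show T = _ from (integral_indicator hs).symm]
    refine integral_mono_of_nonneg (.of_forall fun y => sq_nonneg _) (hQ.int2.indicator hs)
      (.of_forall fun y => ?_)
    change max (y - ε) 0 ^ 2 ≤ {y | ε ≤ y}.indicator (fun y => y ^ 2) y
    by_cases hy : ε ≤ y
    · rw [indicator_of_mem (by exact hy), max_eq_left (by linarith)]; nlinarith
    · rw [indicator_of_notMem (by exact hy), max_eq_right (by linarith)]; simp
  have h3 : excess Q ε 0 / (∫ y, y ∂Q) ≤ (2 / m + 4 * (B + 1) / m ^ 2) / m * T := by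
    rw [div_mul_eq_mul_div]
    exact div_le_div₀ (by positivity) (hQ.excess_le_tail hε hm hmean hB) hm hmean
  have h4 : 4 * spread Q ≤ 2 * B / m := by
    have : spread Q ≤ B / (2 * m) := div_le_div₀ hB0 hB (by linarith) (by linarith)
    calc 4 * spread Q ≤ 4 * (B / (2 * m)) := by linarith
      _ = 2 * B / m := by field_simp; ring
  calc overFnAbove Q ε w ≤ _ := hQ.overFnAbove_le hε hw
    _ ≤ 1 / (2 * m) * T + (2 / m + 4 * (B + 1) / m ^ 2) / m * T * (2 * B / m) := add_le_add h1
      (mul_le_mul h3 h4 (by linarith [hQ.spread_pos]) (by positivity))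
    _ = _ := by unfold overConst; ring

/-- The step laws of a log-likelihood ratio walk before (`Q`) and after (`Q₀`) the change. -/
structure StepLaws (m B : ℝ) (Q Q₀ : Measure ℝ) : Prop where
  prob : IsProbabilityMeasure Q
  prob₀ : IsProbabilityMeasure Q₀
  tilt : Q₀ = Q.withDensity fun y => ofReal (exp y)
  int1 : Integrable (fun y => y) Q
  int2 : Integrable (fun y => y ^ 2) Q
  int1₀ : Integrable (fun y => y) Q₀
  int2₀ : Integrable (fun y => y ^ 2) Q₀
  second : ∫ y, y ^ 2 ∂Q ≤ B
  second₀ : ∫ y, y ^ 2 ∂Q₀ ≤ B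
  mean : m ≤ ∫ y, -y ∂Q
  mean₀ : m ≤ ∫ y, y ∂Q₀
  m_pos : 0 < m

section StepLaws

variable {m B : ℝ} {Q Q₀ : Measure ℝ} (h : StepLaws m B Q Q₀)
include h

theorem StepLaws.posDrift₀ : PosDrift Q₀ := ⟨h.prob₀, h.int1₀, h.int2₀, h.m_pos.trans_le h.mean₀⟩

theorem StepLaws.integral_map_neg (f : ℝ → ℝ) : ∫ y, f y ∂(Q.map Neg.neg) = ∫ y, f (-y) ∂Q :=
  integral_map_equiv (MeasurableEquiv.neg ℝ) f

theorem StepLaws.posDrift : PosDrift (Q.map Neg.neg) := by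
  have := h.prob
  refine ⟨isProbabilityMeasure_map measurable_neg.aemeasurable, ?_, ?_, ?_⟩
  · rw [integrable_map_measure (by fun_prop) (by fun_prop)]
    exact h.int1.neg
  · rw [integrable_map_measure (by fun_prop) (by fun_prop)]
    exact h.int2.congr (.of_forall fun y => by simp)
  · rw [h.integral_map_neg]
    exact h.m_pos.trans_le h.mean

theorem StepLaws.B_pos : 0 < B := by
  have h1 := h.posDrift₀.spread_pos
  have h2 := h.posDrift₀.mean_pos
  unfold spread at h1
  have h3 : 0 < ∫ y, y ^ 2 ∂Q₀ := by
    by_contra h4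
    have : (∫ y, y ^ 2 ∂Q₀) / (2 * ∫ y, y ∂Q₀) ≤ 0 :=
      div_nonpos_of_nonpos_of_nonneg (not_lt.mp h4) (by linarith)
    linarith
  exact h3.trans_le h.second₀

theorem StepLaws.spread₀_le : spread Q₀ ≤ B / (2 * m) := by
  unfold spread
  have := h.m_pos
  exact div_le_div₀ h.B_pos.le h.second₀ (by linarith) (by linarith [h.mean₀])

theorem StepLaws.spread_le : spread (Q.map Neg.neg) ≤ B / (2 * m) := by
  unfold spread
  have := h.m_pos
  rw [h.integral_map_neg, h.integral_map_neg]
  simp_rw [neg_sq]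
  exact div_le_div₀ h.B_pos.le h.second (by linarith) (by linarith [h.mean])

theorem StepLaws.overConst_pos : 0 < overConst m B := by
  have := h.m_pos
  have := h.B_pos
  unfold overConst; positivity

theorem StepLaws.exitMean_over_le {ε x : ℝ} (hε : 0 ≤ ε) (hx : x ∈ 𝕀) :
    exitMean Q₀ 𝕀 (fun z => ofReal (z - hi - ε)) x
      ≤ ofReal (overConst m B * ∫ y in {y | ε ≤ y}, y ^ 2 ∂Q₀) :=
  (h.posDrift₀.exitMean_over_le hε hx).trans <| ofReal_le_ofReal <|
    h.posDrift₀.overFnAbove_le_tail h.m_pos h.mean₀ h.second₀ hε (by linarith [hx.2])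

theorem StepLaws.exitMean_under_le {ε x : ℝ} (hε : 0 ≤ ε) (hx : x ∈ 𝕀) :
    exitMean Q 𝕀 (fun z => ofReal (-z - lo - ε)) x
      ≤ ofReal (overConst m B * ∫ y in {y | ε ≤ -y}, y ^ 2 ∂Q) := by
  have := h.prob
  have hx' : -x ∈ Ioo (-hi) lo := ⟨by linarith [hx.2], by linarith [hx.1]⟩
  have hB : ∫ y, y ^ 2 ∂(Q.map Neg.neg) ≤ B := by rw [h.integral_map_neg]; simpa using h.second
  have h1 := (h.posDrift.exitMean_over_le hε hx').trans <| ofReal_le_ofReal <|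
    h.posDrift.overFnAbove_le_tail h.m_pos (by rw [h.integral_map_neg]; exact h.mean) hB hε (by
      linarith [hx'.2])
  have h2 : ∫ y in {y | ε ≤ y}, y ^ 2 ∂(Q.map Neg.neg) = ∫ y in {y | ε ≤ -y}, y ^ 2 ∂Q := by
    have hs1 : MeasurableSet {y : ℝ | ε ≤ y} := measurableSet_Ici
    rw [← integral_indicator hs1, h.integral_map_neg, ← integral_indicator (measurableSet_le
      measurable_const measurable_neg)]
    congr 1
    funext y
    by_cases hy : ε ≤ -y
    · rw [indicator_of_mem (by exact hy), indicator_of_mem (by exact hy)]; ring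
    · rw [indicator_of_notMem (by exact hy), indicator_of_notMem (by exact hy)]
  rw [h2] at h1
  rw [← exitMean_neg (by fun_prop)]
  simp only [neg_neg]
  exact h1

theorem StepLaws.meanTime₀_le (hx : x ∈ 𝕀) :
    meanTime Q₀ 𝕀 x ≤ ofReal ((hi + lo + 2 * B / m) / m) := by
  refine (h.posDrift₀.meanTime_le hx).trans (ofReal_le_ofReal ?_)
  have hs := h.spread₀_le
  have hm := h.m_pos
  have e : 4 * (B / (2 * m)) = 2 * B / m := by field_simp; ring
  exact div_le_div₀ (by have := h.B_pos; have : 0 ≤ 2 * B / m := by positivity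
                        linarith [hx.1, hx.2]) (by linarith [hx.1]) hm h.mean₀

theorem StepLaws.meanTime_le (hx : x ∈ 𝕀) :
    meanTime Q 𝕀 x ≤ ofReal ((hi + lo + 2 * B / m) / m) := by
  have := h.prob
  rw [← meanTime_neg]
  refine (h.posDrift.meanTime_le ⟨by linarith [hx.2], by linarith [hx.1]⟩).trans (ofReal_le_ofReal
    ?_)
  have hs := h.spread_le
  have hm := h.m_pos
  have e : 4 * (B / (2 * m)) = 2 * B / m := by field_simp; ring
  refine div_le_div₀ (by have := h.B_pos; have : 0 ≤ 2 * B / m := by positivity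
                         linarith [hx.1, hx.2]) (by linarith [hx.2]) hm ?_
  rw [h.integral_map_neg]; exact h.mean

theorem StepLaws.lintegral_exp_mul (hf : Measurable f) :
    ∫⁻ y, f y ∂Q₀ = ∫⁻ y, ofReal (exp y) * f y ∂Q := by
  rw [h.tilt, lintegral_withDensity_eq_lintegral_mul _ (by fun_prop) hf]
  rfl

theorem StepLaws.lintegral_exp_neg : ∫⁻ y, ofReal (exp (-y)) ∂Q₀ = 1 := by
  have := h.prob
  rw [h.lintegral_exp_mul (by fun_prop)]
  simp_rw [← ofReal_mul (exp_pos _).le, ← exp_add]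
  simp

/-- An upper bound for the Hellinger affinity `E₀[exp (-u₁ / 2)]` of the two step laws. -/
def affinityBound (m B : ℝ) : ℝ := 1 - (1 - exp (-(m / 4))) ^ 2 / 2 * (m ^ 2 / (4 * B))

theorem StepLaws.tail_lower : m ^ 2 / (4 * B) ≤ Q₀.real {y | m / 2 ≤ y} := by
  have := h.prob₀
  have hm := h.m_pos
  have hB := h.B_pos
  have hs : MeasurableSet {y : ℝ | m / 2 ≤ y} := measurableSet_Ici
  have h1 : ∫ y, y ∂Q₀ ≤ ∫ y, (m / 2 + m / (4 * B) * y ^ 2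
      + {y : ℝ | m / 2 ≤ y}.indicator (fun _ => B / m) y) ∂Q₀ := by
    refine integral_mono h.int1₀ (((integrable_const _).add (h.int2₀.const_mul _)).add
      ((integrable_const _).indicator hs)) fun y => ?_
    have hq : 0 ≤ m / (4 * B) * y ^ 2 := by positivity
    by_cases hy : m / 2 ≤ y
    · rw [indicator_of_mem (by exact hy)]
      have : y ≤ m / (4 * B) * y ^ 2 + B / m := by
        have : m / (4 * B) * y ^ 2 + B / m - y = (m * y - 2 * B) ^ 2 / (4 * B * m) := by
          field_simp; ring
        have h2 : 0 ≤ (m * y - 2 * B) ^ 2 / (4 * B * m) := by positivity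
        linarith
      linarith
    · rw [indicator_of_notMem (by exact hy)]; push Not at hy; linarith
  have hi1 : Integrable (fun y => m / 2 + m / (4 * B) * y ^ 2) Q₀ :=
    (integrable_const _).add (h.int2₀.const_mul _)
  rw [integral_add hi1 ((integrable_const _).indicator hs),
    integral_add (integrable_const _) (h.int2₀.const_mul _), integral_const_mul,
    integral_indicator hs, setIntegral_const] at h1
  simp only [integral_const, probReal_univ, smul_eq_mul, one_mul] at h1
  have h2 : m / (4 * B) * ∫ y, y ^ 2 ∂Q₀ ≤ m / 4 := by
    calc m / (4 * B) * ∫ y, y ^ 2 ∂Q₀ ≤ m / (4 * B) * B := by gcongr; exact h.second₀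
      _ = m / 4 := by field_simp
  have h3 : m / 4 ≤ Q₀.real {y | m / 2 ≤ y} * (B / m) := by linarith [h.mean₀]
  calc m ^ 2 / (4 * B) = m / 4 * (m / B) := by field_simp
    _ ≤ Q₀.real {y | m / 2 ≤ y} * (B / m) * (m / B) := by gcongr
    _ = _ := by field_simp

theorem StepLaws.affinityBound_lt : affinityBound m B < 1 := by
  have hm := h.m_pos
  have hB := h.B_pos
  have : exp (-(m / 4)) < 1 := Real.exp_lt_one_iff.mpr (by linarith)
  unfold affinityBound
  have : 0 < (1 - exp (-(m / 4))) ^ 2 / 2 * (m ^ 2 / (4 * B)) := by positivity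
  linarith

theorem StepLaws.affinityBound_pos : 0 < affinityBound m B := by
  have := h.prob₀
  have hm := h.m_pos
  have h1 := h.tail_lower.trans measureReal_le_one
  have h3 : exp (-(m / 4)) < 1 := Real.exp_lt_one_iff.mpr (by linarith)
  have h4 := exp_pos (-(m / 4))
  unfold affinityBound
  nlinarith [sq_nonneg (1 - exp (-(m / 4)))]

theorem StepLaws.lintegral_exp_half_le :
    ∫⁻ y, ofReal (exp (-y / 2)) ∂Q₀ ≤ ofReal (affinityBound m B) := by
  have := h.prob₀
  have hs : MeasurableSet {y : ℝ | m / 2 ≤ y} := measurableSet_Ici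
  have hi : Integrable (fun y => exp (-y)) Q₀ := by
    refine ⟨by fun_prop, ?_⟩
    rw [hasFiniteIntegral_iff_ofReal (.of_forall fun y => (exp_pos _).le), h.lintegral_exp_neg]
    exact ENNReal.one_lt_top
  have hi1 : ∫ y, exp (-y) ∂Q₀ = 1 := by
    rw [integral_eq_lintegral_of_nonneg_ae (.of_forall fun y => (exp_pos _).le) (by fun_prop),
      h.lintegral_exp_neg, ENNReal.toReal_one]
  set c := (1 - exp (-(m / 4))) ^ 2 / 2
  have hc : 0 ≤ c := by positivity
  have hpt (y : ℝ) : exp (-y / 2)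
      ≤ (1 + exp (-y)) / 2 - {y : ℝ | m / 2 ≤ y}.indicator (fun _ => c) y := by
    have e : exp (-y) = exp (-y / 2) ^ 2 := by rw [← Real.exp_nat_mul]; congr 1; ring
    by_cases hy : m / 2 ≤ y
    · rw [indicator_of_mem (by exact hy), e]
      have h1 : exp (-y / 2) ≤ exp (-(m / 4)) := exp_le_exp.mpr (by linarith)
      have h2 : exp (-(m / 4)) < 1 := Real.exp_lt_one_iff.mpr (by linarith [h.m_pos])
      simp only [c]
      nlinarith
    · rw [indicator_of_notMem (by exact hy), e]
      nlinarith [sq_nonneg (exp (-y / 2) - 1)]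
  calc ∫⁻ y, ofReal (exp (-y / 2)) ∂Q₀ ≤ ∫⁻ y, ofReal ((1 + exp (-y)) / 2
          - {y : ℝ | m / 2 ≤ y}.indicator (fun _ => c) y) ∂Q₀ :=
        lintegral_mono fun y => ofReal_le_ofReal (hpt y)
    _ = ofReal (∫ y, ((1 + exp (-y)) / 2 - {y : ℝ | m / 2 ≤ y}.indicator (fun _ => c) y) ∂Q₀) :=
        (ofReal_integral_eq_lintegral_ofReal ((((integrable_const _).add hi).div_const 2).sub
          ((integrable_const _).indicator hs))
          (.of_forall fun y => (exp_pos _).le.trans (hpt y))).symm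
    _ ≤ _ := by
        refine ofReal_le_ofReal ?_
        have hi2 : Integrable (fun y => (1 + exp (-y)) / 2) Q₀ :=
          ((integrable_const _).add hi).div_const 2
        rw [integral_sub hi2 ((integrable_const _).indicator hs), integral_div,
          integral_add (integrable_const _) hi, hi1, integral_indicator hs, setIntegral_const]
        simp only [integral_const, probReal_univ, smul_eq_mul, one_mul]
        have := mul_le_mul_of_nonneg_right h.tail_lower hc
        have hcd : (1 - exp (-(m / 4))) ^ 2 / 2 = c := rfl
        unfold affinityBound
        rw [hcd]
        linarith

/-- Chernoff bound for the survival of the walk in the interval, after the change. -/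
theorem StepLaws.stay_iterate_one_le (n : ℕ) (hx : x ∈ 𝕀) :
    (stay Q₀ 𝕀)^[n] 1 x ≤ ofReal (exp ((hi - x) / 2) * affinityBound m B ^ n) := by
  have hρ := h.affinityBound_pos
  induction n generalizing x with
  | zero =>
    simp only [Function.iterate_zero, id, Pi.one_apply, pow_zero, mul_one]
    rw [← ofReal_one]
    exact ofReal_le_ofReal (Real.one_le_exp (by linarith [hx.2]))
  | succ n ih =>
    rw [iterate_succ_apply']
    calc stay Q₀ 𝕀 ((stay Q₀ 𝕀)^[n] 1) x ≤ ∫⁻ y, ofReal (exp ((hi - x) / 2) * affinityBound m B ^ n)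
            * ofReal (exp (-y / 2)) ∂Q₀ := by
          refine lintegral_mono fun y => ?_
          by_cases hy : x + y ∈ 𝕀
          · rw [indicator_of_mem hy, ← ofReal_mul₀]
            refine (ih hy).trans (le_of_eq ?_)
            congr 1
            rw [mul_right_comm, ← exp_add]
            congr 3; ring
          · rw [indicator_of_notMem hy]; exact zero_le
      _ ≤ ofReal (exp ((hi - x) / 2) * affinityBound m B ^ n) * ofReal (affinityBound m B) := by
          rw [lintegral_const_mul _ (by fun_prop)]
          gcongr
          exact h.lintegral_exp_half_le
      _ = _ := by rw [← ofReal_mul₀]; congr 1; ring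

theorem StepLaws.neg : StepLaws m B (Q₀.map Neg.neg) (Q.map Neg.neg) := by
  have := h.prob
  have := h.prob₀
  have hn (P : Measure ℝ) (f : ℝ → ℝ) : ∫ y, f y ∂(P.map Neg.neg) = ∫ y, f (-y) ∂P :=
    integral_map_equiv (MeasurableEquiv.neg ℝ) f
  have hi1 {P : Measure ℝ} (hP : Integrable (fun y => y) P) :
      Integrable (fun y => y) (P.map Neg.neg) := by
    rw [integrable_map_measure (by fun_prop) (by fun_prop)]; exact hP.neg
  have hi2 {P : Measure ℝ} (hP : Integrable (fun y => y ^ 2) P) :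
      Integrable (fun y => y ^ 2) (P.map Neg.neg) := by
    rw [integrable_map_measure (by fun_prop) (by fun_prop)]
    exact hP.congr (.of_forall fun y => by simp)
  refine ⟨isProbabilityMeasure_map measurable_neg.aemeasurable,
    isProbabilityMeasure_map measurable_neg.aemeasurable, ?_, hi1 h.int1₀, hi2 h.int2₀,
    hi1 h.int1, hi2 h.int2, ?_, ?_, ?_, ?_, h.m_pos⟩
  · refine Measure.ext fun s hs => ?_
    rw [withDensity_apply _ hs, map_apply measurable_neg hs, ← lintegral_indicator hs,
      lintegral_map (Measurable.indicator (by fun_prop) hs) measurable_neg]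
    have hm : Measurable fun y => s.indicator (fun a => ofReal (exp a)) (-y) :=
      (Measurable.indicator (by fun_prop) hs).comp measurable_neg
    rw [h.lintegral_exp_mul hm, ← lintegral_indicator_one (measurable_neg hs)]
    refine lintegral_congr fun y => ?_
    by_cases hy : -y ∈ s
    · rw [indicator_of_mem (by exact hy), indicator_of_mem hy,
        ← ofReal_mul (exp_pos _).le, ← exp_add]
      simp
    · rw [indicator_of_notMem (by exact hy), indicator_of_notMem hy, mul_zero]
  · rw [hn]; simpa using h.second₀
  · rw [hn]; simpa using h.second
  · rw [hn]; simpa using h.mean₀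
  · rw [hn]; exact h.mean

/-- Chernoff bound for the survival of the walk in the interval, before the change. -/
theorem StepLaws.stay_iterate_one_le' (n : ℕ) (hx : x ∈ 𝕀) :
    (stay Q 𝕀)^[n] 1 x ≤ ofReal (exp ((lo + x) / 2) * affinityBound m B ^ n) := by
  have := h.prob
  have hx' : -x ∈ Ioo (-hi) lo := ⟨by linarith [hx.2], by linarith [hx.1]⟩
  rw [← stay_iterate_neg measurable_one]
  have := h.neg.stay_iterate_one_le n hx'
  rwa [sub_neg_eq_add] at this

/-- The walk needs many steps to leave a long interval. -/
theorem StepLaws.le_meanTime₀ {r : ℝ} (hr : 0 < r) (hlo : r ≤ lo) (hhi : r ≤ hi) :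
    ofReal (r / (B + 1)) ≤ meanTime Q₀ 𝕀 0 := by
  have := h.prob₀
  have hB := h.B_pos
  set I := 𝕀
  have h0 : (0 : ℝ) ∈ I := ⟨by linarith, by linarith⟩
  have hIm : MeasurableSet I := measurableSet_Ioo
  have habs : ∫⁻ y, ofReal |y| ∂Q₀ ≤ ofReal (B + 1) := by
    calc ∫⁻ y, ofReal |y| ∂Q₀ ≤ ∫⁻ y, ofReal (y ^ 2 + 1) ∂Q₀ := by
          refine lintegral_mono fun y => ofReal_le_ofReal ?_
          nlinarith [sq_abs y, sq_nonneg (|y| - 1), abs_nonneg y]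
      _ = ofReal (∫ y, (y ^ 2 + 1) ∂Q₀) :=
          (ofReal_integral_eq_lintegral_ofReal (h.int2₀.add (integrable_const _))
            (.of_forall fun y => add_nonneg (sq_nonneg y) zero_le_one)).symm
      _ ≤ _ := by
          refine ofReal_le_ofReal ?_
          rw [integral_add h.int2₀ (integrable_const _)]
          simpa using h.second₀
  -- `|x| + (B + 1) E[remaining time]` is superharmonic and at least `r` outside the interval
  have key : ofReal r * exitMean Q₀ I 1 0 ≤ ofReal |0| + ofReal (B + 1) * meanTime Q₀ I 0 := by
    rw [← exitMean_const_mul hIm measurable_one]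
    refine pot_le_of_supersolution (V := fun x => ofReal |x| + ofReal (B + 1) * meanTime Q₀ I x) hIm
      (measurable_leave hIm (by fun_prop)) (fun x hx => ?_) h0
    have e1 : leave Q₀ I (fun z => ofReal r * (1 : ℝ → ℝ≥0∞) z) x
        ≤ leave Q₀ I (fun z => ofReal |z|) x := by
      refine leave_mono (fun z hz => ?_) x
      rw [Pi.one_apply, mul_one]
      refine ofReal_le_ofReal ?_
      by_contra h3
      rw [not_le, abs_lt] at h3
      exact hz ⟨by linarith, by linarith⟩
    have e2 : stay Q₀ I (fun x => ofReal |x| + ofReal (B + 1) * meanTime Q₀ I x) x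
        = stay Q₀ I (fun x => ofReal |x|) x + ofReal (B + 1) * stay Q₀ I (meanTime Q₀ I) x := by
      rw [← stay_const_mul hIm (measurable_meanTime hIm), ← stay_add hIm (by fun_prop)]
      rfl
    have e3 : leave Q₀ I (fun z => ofReal |z|) x + stay Q₀ I (fun x => ofReal |x|) x
        ≤ ofReal |x| + ofReal (B + 1) := by
      rw [leave_add_stay hIm (by fun_prop)]
      calc ∫⁻ y, ofReal |x + y| ∂Q₀ ≤ ∫⁻ y, (ofReal |x| + ofReal |y|) ∂Q₀ := by
            refine lintegral_mono fun y => ?_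
            rw [← ofReal_add (abs_nonneg _) (abs_nonneg _)]
            exact ofReal_le_ofReal (abs_add_le _ _)
        _ ≤ _ := by
            rw [lintegral_add_left measurable_const]
            simpa using by gcongr
    have e4 : meanTime Q₀ I x = 1 + stay Q₀ I (meanTime Q₀ I) x := pot_eq hIm measurable_one x
    rw [e2]
    calc _ ≤ leave Q₀ I (fun z => ofReal |z|) x + (stay Q₀ I (fun x => ofReal |x|) x
          + ofReal (B + 1) * stay Q₀ I (meanTime Q₀ I) x) := by gcongr
      _ = (leave Q₀ I (fun z => ofReal |z|) x + stay Q₀ I (fun x => ofReal |x|) x)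
          + ofReal (B + 1) * stay Q₀ I (meanTime Q₀ I) x := by ring
      _ ≤ (ofReal |x| + ofReal (B + 1)) + ofReal (B + 1) * stay Q₀ I (meanTime Q₀ I) x := by gcongr
      _ = ofReal |x| + ofReal (B + 1) * (1 + stay Q₀ I (meanTime Q₀ I) x) := by ring
      _ = _ := by rw [← e4]
  rw [exitMean_one hIm (((h.meanTime₀_le h0).trans_lt ofReal_lt_top).ne)] at key
  simp only [abs_zero, ofReal_zero, zero_add, mul_one] at key
  rw [ENNReal.ofReal_div_of_pos (by linarith)]
  exact ENNReal.div_le_of_le_mul' key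

end StepLaws

/-! ### Quantized log-likelihood ratios -/

/-- The laws `ν`, `ν₀` (before and after the change) of a local log-likelihood ratio at its exit
from `(-lo, hi)`. -/
structure ExitPair (lo hi : ℝ) (ν ν₀ : Measure ℝ) : Prop where
  prob : IsProbabilityMeasure ν
  prob₀ : IsProbabilityMeasure ν₀
  tilt : ν₀ = ν.withDensity fun y => ofReal (exp y)
  null : ν (Ioo (-lo) hi) = 0
  lo_pos : 0 < lo
  hi_pos : 0 < hi

/-- The cells into which the exit position is quantized. Each cell on the upper side has a lower
edge `e`; it either has width at most `gap`, or `e = hi + tu` (this is the unbounded cell, or the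
whole upper side with `tu = 0`); likewise on the lower side. Every cell is visited. -/
structure Quantizer (lo hi gap tu td : ℝ) (ν : Measure ℝ) (cell : ℝ → ℤ) : Prop where
  meas : Measurable cell
  up : ∀ z, hi ≤ z → ∃ e, hi ≤ e ∧ (∀ z', cell z' = cell z → e ≤ z') ∧
    ((∀ z', cell z' = cell z → z' ≤ e + gap) ∨ e = hi + tu)
  dn : ∀ z, z ≤ -lo → ∃ e, e ≤ -lo ∧ (∀ z', cell z' = cell z → z' ≤ e) ∧
    ((∀ z', cell z' = cell z → e - gap ≤ z') ∨ e = -lo - td)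
  pos : ∀ z, z ∉ Ioo (-lo) hi → ν (cell ⁻¹' {cell z}) ≠ 0

/-- The log-likelihood ratio of the message sent at the exit position `z`. -/
def cellLLR (ν ν₀ : Measure ℝ) (cell : ℝ → ℤ) (z : ℝ) : ℝ :=
  log (ν₀.real (cell ⁻¹' {cell z}) / ν.real (cell ⁻¹' {cell z}))

theorem Quantizer.coarsen {gap tu td : ℝ} {ν : Measure ℝ} {cell : ℝ → ℤ}
    (q : Quantizer lo hi gap tu td ν cell) : Quantizer lo hi 0 0 0 ν cell where
  meas := q.meas
  up z hz := by
    obtain ⟨e, he, h1, -⟩ := q.up z hz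
    exact ⟨hi, le_rfl, fun z' h => he.trans (h1 z' h), Or.inr (by simp)⟩
  dn z hz := by
    obtain ⟨e, he, h1, -⟩ := q.dn z hz
    exact ⟨-lo, le_rfl, fun z' h => (h1 z' h).trans he, Or.inr (by simp)⟩
  pos := q.pos

theorem lintegral_eq_tsum_fiber {cell : ℝ → ℤ} (hc : Measurable cell) (μ : Measure ℝ)
    (f : ℝ → ℝ≥0∞) : ∫⁻ z, f z ∂μ = ∑' i, ∫⁻ z in cell ⁻¹' {i}, f z ∂μ := by
  rw [← lintegral_iUnion (fun i => hc (measurableSet_singleton i))]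
  · have : (⋃ i, cell ⁻¹' {i}) = univ := by ext z; simp
    rw [this, restrict_univ]
  · intro i j hij
    refine Set.disjoint_left.mpr fun z h1 h2 => hij ?_
    rw [← Set.mem_singleton_iff.mp h1, ← Set.mem_singleton_iff.mp h2]

section
variable {gap tu td : ℝ} {ν ν₀ : Measure ℝ} {cell : ℝ → ℤ}
  (q : Quantizer lo hi gap tu td ν cell) (p : ExitPair lo hi ν ν₀)
include p

theorem ExitPair.lintegral_exp_mul (hf : Measurable f) {s : Set ℝ} (hs : MeasurableSet s) :
    ∫⁻ y in s, f y ∂ν₀ = ∫⁻ y in s, ofReal (exp y) * f y ∂ν := by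
  rw [p.tilt, setLIntegral_withDensity_eq_setLIntegral_mul _ (by fun_prop) hf hs]
  rfl

theorem ExitPair.apply₀ {s : Set ℝ} (hs : MeasurableSet s) :
    ν₀ s = ∫⁻ y in s, ofReal (exp y) ∂ν := by
  rw [p.tilt, withDensity_apply _ hs]

theorem ExitPair.lintegral_exp_neg {s : Set ℝ} (hs : MeasurableSet s) :
    ∫⁻ y in s, ofReal (exp (-y)) ∂ν₀ = ν s := by
  rw [p.lintegral_exp_mul (by fun_prop) hs]
  simp_rw [← ofReal_mul (exp_pos _).le, ← exp_add]
  simp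

theorem ExitPair.apply_eq_zero_iff {s : Set ℝ} (hs : MeasurableSet s) : ν₀ s = 0 ↔ ν s = 0 := by
  rw [p.apply₀ hs, lintegral_eq_zero_iff (by fun_prop)]
  constructor
  · intro h
    have : ∀ᵐ y ∂(ν.restrict s), False := by
      filter_upwards [h] with y hy
      simp at hy
      linarith [exp_pos y]
    rw [← Measure.restrict_apply_univ]
    simpa [ae_iff] using this
  · intro h
    rw [restrict_eq_zero.mpr h]
    exact ae_zero.le trivial

theorem ExitPair.null₀ : ν₀ 𝕀 = 0 := (p.apply_eq_zero_iff measurableSet_Ioo).mpr p.null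

omit p in
theorem measurable_cellLLR (hc : Measurable cell) : Measurable (cellLLR ν ν₀ cell) :=
  (measurable_of_countable fun i : ℤ =>
    log (ν₀.real (cell ⁻¹' {i}) / ν.real (cell ⁻¹' {i}))).comp hc

/-- The defining property of the log-likelihood ratio of a message. -/
theorem ExitPair.exp_cellLLR (hc : Measurable cell) (hz : ν (cell ⁻¹' {cell z}) ≠ 0) :
    ofReal (exp (cellLLR ν ν₀ cell z)) * ν (cell ⁻¹' {cell z}) = ν₀ (cell ⁻¹' {cell z}) := by
  have := p.prob
  have := p.prob₀
  have h0 : ν₀ (cell ⁻¹' {cell z}) ≠ 0 := fun h => hz ((p.apply_eq_zero_iff (hc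
    (measurableSet_singleton (cell z)))).mp h)
  have h1 : 0 < ν.real (cell ⁻¹' {cell z}) := ENNReal.toReal_pos hz (measure_ne_top _ _)
  have h2 : 0 < ν₀.real (cell ⁻¹' {cell z}) := ENNReal.toReal_pos h0 (measure_ne_top _ _)
  unfold cellLLR
  rw [exp_log (div_pos h2 h1), ← ofReal_measureReal (μ := ν), ← ofReal_measureReal (μ := ν₀),
    ← ofReal_mul (div_pos h2 h1).le, div_mul_cancel₀ _ h1.ne']

omit p in
theorem cellLLR_congr {z z' : ℝ} (h : cell z' = cell z) :
    cellLLR ν ν₀ cell z' = cellLLR ν ν₀ cell z := by unfold cellLLR; rw [h]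

theorem ExitPair.le_cellLLR (hc : Measurable cell) {z s : ℝ}
    (hz : ν (cell ⁻¹' {cell z}) ≠ 0) (h : ∀ z', cell z' = cell z → s ≤ z') :
    s ≤ cellLLR ν ν₀ cell z := by
  have := p.prob
  have h1 : ofReal (exp s) * ν (cell ⁻¹' {cell z}) ≤ ν₀ (cell ⁻¹' {cell z}) := by
    rw [p.apply₀ (hc (measurableSet_singleton (cell z))), ← setLIntegral_const]
    exact setLIntegral_mono (by fun_prop) fun y hy => ofReal_le_ofReal (exp_le_exp.mpr (h y hy))
  rw [← p.exp_cellLLR hc hz, ENNReal.mul_le_mul_iff_left hz (measure_ne_top _ _),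
    ofReal_le_ofReal_iff (exp_pos _).le] at h1
  exact exp_le_exp.mp h1

theorem ExitPair.cellLLR_le (hc : Measurable cell) {z s : ℝ}
    (hz : ν (cell ⁻¹' {cell z}) ≠ 0) (h : ∀ z', cell z' = cell z → z' ≤ s) :
    cellLLR ν ν₀ cell z ≤ s := by
  have := p.prob
  have h1 : ν₀ (cell ⁻¹' {cell z}) ≤ ofReal (exp s) * ν (cell ⁻¹' {cell z}) := by
    rw [p.apply₀ (hc (measurableSet_singleton (cell z))), ← setLIntegral_const]
    exact setLIntegral_mono (by fun_prop) fun y hy => ofReal_le_ofReal (exp_le_exp.mpr (h y hy))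
  rw [← p.exp_cellLLR hc hz, ENNReal.mul_le_mul_iff_left hz (measure_ne_top _ _),
    ofReal_le_ofReal_iff (exp_pos _).le] at h1
  exact exp_le_exp.mp h1

include q in
theorem Quantizer.hi_le (hz : hi ≤ z) : hi ≤ cellLLR ν ν₀ cell z := by
  obtain ⟨e, he, h1, -⟩ := q.up z hz
  exact he.trans (p.le_cellLLR q.meas (q.pos z fun h => absurd h.2 hz.not_gt) h1)

include q in
theorem Quantizer.le_neg_lo (hz : z ≤ -lo) : cellLLR ν ν₀ cell z ≤ -lo := by
  obtain ⟨e, he, h1, -⟩ := q.dn z hz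
  exact (p.cellLLR_le q.meas (q.pos z fun h => absurd h.1 hz.not_gt) h1).trans he

/-- Change of measure for functions of the message. -/
theorem ExitPair.lintegral_cellLLR (hc : Measurable cell) (F : ℝ → ℝ≥0∞) :
    ∫⁻ z, ofReal (exp (cellLLR ν ν₀ cell z)) * F (cellLLR ν ν₀ cell z) ∂ν
      = ∫⁻ z, F (cellLLR ν ν₀ cell z) ∂ν₀ := by
  rw [lintegral_eq_tsum_fiber hc ν, lintegral_eq_tsum_fiber hc ν₀]
  refine tsum_congr fun i => ?_
  have hs := hc (measurableSet_singleton i)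
  by_cases h0 : ν (cell ⁻¹' {i}) = 0
  · rw [restrict_eq_zero.mpr h0, restrict_eq_zero.mpr ((p.apply_eq_zero_iff hs).mpr h0)]
    simp
  obtain ⟨z, hz⟩ : (cell ⁻¹' {i}).Nonempty := by
    by_contra h; rw [Set.not_nonempty_iff_eq_empty.mp h] at h0; simp at h0
  obtain rfl : cell z = i := hz
  have h1 : ∀ z' ∈ cell ⁻¹' {cell z}, cellLLR ν ν₀ cell z' = cellLLR ν ν₀ cell z :=
    fun z' hz' => cellLLR_congr hz'
  rw [setLIntegral_congr_fun hs (fun z' hz' => by rw [h1 z' hz']),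
    setLIntegral_congr_fun (μ := ν₀) hs
      (g := fun _ => F (cellLLR ν ν₀ cell z)) (fun z' hz' => by simp only [h1 z' hz']),
    setLIntegral_const, setLIntegral_const, ← p.exp_cellLLR hc h0]
  ring

/-- If a cell lies below `e`, then the mean loss there is at most the mean of `e - ℓ` before the
change (Jensen's inequality for the exponential function). -/
theorem ExitPair.sub_cellLLR_mul_le (hc : Measurable cell) {z e : ℝ}
    (hz : ν (cell ⁻¹' {cell z}) ≠ 0) (h : ∀ z', cell z' = cell z → z' ≤ e) :
    ofReal (e - cellLLR ν ν₀ cell z) * ν (cell ⁻¹' {cell z})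
      ≤ ∫⁻ y in cell ⁻¹' {cell z}, ofReal (e - y) ∂ν := by
  have := p.prob
  set L := cellLLR ν ν₀ cell z with hL
  have hle : L ≤ e := p.cellLLR_le hc hz h
  -- integrate `exp (y - L) + (e - y) ≥ 1 + (e - L)`
  have key : ν (cell ⁻¹' {cell z}) + ofReal (e - L) * ν (cell ⁻¹' {cell z})
      ≤ ν (cell ⁻¹' {cell z}) + ∫⁻ y in cell ⁻¹' {cell z}, ofReal (e - y) ∂ν := by
    have e1 : ν (cell ⁻¹' {cell z}) = ∫⁻ y in cell ⁻¹' {cell z}, ofReal (exp (-L) * exp y) ∂ν := by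
      simp_rw [ofReal_mul (exp_pos (-L)).le]
      rw [lintegral_const_mul _ (by fun_prop), ← p.apply₀ (hc (measurableSet_singleton (cell z))),
        ← p.exp_cellLLR hc hz, ← hL,
        ← mul_assoc, ← ofReal_mul (exp_pos _).le, ← exp_add]
      simp
    conv_rhs => rw [e1]
    rw [← lintegral_add_right _ (by fun_prop),
      show ν (cell ⁻¹' {cell z}) + ofReal (e - L) * ν (cell ⁻¹' {cell z})
        = ∫⁻ _ in cell ⁻¹' {cell z}, (1 + ofReal (e - L)) ∂ν by
        rw [setLIntegral_const, add_mul, one_mul]]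
    refine setLIntegral_mono (by fun_prop) fun y hy => ?_
    rw [← ofReal_one, ← ofReal_add zero_le_one (by linarith),
      ← ofReal_add (by positivity) (by linarith [h y hy]), ← exp_add]
    exact ofReal_le_ofReal (by linarith [Real.add_one_le_exp (-L + y)])
  exact (ENNReal.add_le_add_iff_left (measure_ne_top _ _)).mp key

theorem ExitPair.ae_notMem : ∀ᵐ z ∂ν, z ∉ 𝕀 := measure_eq_zero_iff_ae_notMem.mp p.null

include q

/-- The mean information lost by quantization, after the change. -/
theorem Quantizer.lintegral_loss_le :
    ∫⁻ z, ofReal (z - cellLLR ν ν₀ cell z) ∂ν₀ ≤ ofReal gap + ∫⁻ z, ofReal (z - hi - tu) ∂ν₀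
        + ∫⁻ z, ofReal (-z - lo - td) ∂ν := by
  have := p.prob₀
  have e0 : ofReal gap = ∫⁻ _, ofReal gap ∂ν₀ := by simp
  rw [e0, lintegral_eq_tsum_fiber q.meas ν₀, lintegral_eq_tsum_fiber q.meas ν₀,
    lintegral_eq_tsum_fiber q.meas ν₀, lintegral_eq_tsum_fiber q.meas ν, ← tsum_add,
    ← tsum_add]
  refine tsum_le_tsum fun i => ?_
  by_cases hi' : ∃ z, cell z = i ∧ z ∉ 𝕀
  swap
  · push Not at hi'
    have : ν₀ (cell ⁻¹' {i}) = 0 := measure_mono_null (fun z hz => hi' z hz) p.null₀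
    rw [restrict_eq_zero.mpr this]; simp
  obtain ⟨z, rfl, hz⟩ := hi'
  have hpos := q.pos z hz
  have hL : ∀ z' ∈ cell ⁻¹' {cell z}, cellLLR ν ν₀ cell z' = cellLLR ν ν₀ cell z :=
    fun z' hz' => cellLLR_congr hz'
  rcases le_or_gt hi z with h | h
  · obtain ⟨e, he, h1, h2⟩ := q.up z h
    have hLe := p.le_cellLLR q.meas hpos h1
    rw [← lintegral_add_left (by fun_prop)]
    refine le_add_of_le_of_nonneg (setLIntegral_mono (by fun_prop) fun y hy => ?_) (zero_le)
    rw [hL y hy]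
    rcases h2 with h2 | h2
    · exact le_add_of_le_of_nonneg (ofReal_le_ofReal (by linarith [h2 y hy])) (zero_le)
    · exact le_add_of_nonneg_of_le (zero_le) (ofReal_le_ofReal (by linarith))
  · have hz' : z ≤ -lo := by by_contra h'; exact hz ⟨not_le.mp h', h⟩
    obtain ⟨e, he, h1, h2⟩ := q.dn z hz'
    have hLe := p.cellLLR_le q.meas hpos h1
    rcases h2 with h2 | h2
    · have hLe' := p.le_cellLLR q.meas hpos h2
      rw [add_assoc]
      refine le_add_of_le_of_nonneg (setLIntegral_mono (by fun_prop) fun y hy => ?_) (zero_le)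
      rw [hL y hy]
      exact ofReal_le_ofReal (by linarith [h1 y hy])
    · refine le_add_of_nonneg_of_le (zero_le) ?_
      calc ∫⁻ y in cell ⁻¹' {cell z}, ofReal (y - cellLLR ν ν₀ cell y) ∂ν₀
          ≤ ∫⁻ _ in cell ⁻¹' {cell z}, ofReal (e - cellLLR ν ν₀ cell z) ∂ν₀ :=
            setLIntegral_mono (by fun_prop) fun y hy => by
              rw [hL y hy]; exact ofReal_le_ofReal (by linarith [h1 y hy])
        _ = ofReal (exp (cellLLR ν ν₀ cell z))
            * (ofReal (e - cellLLR ν ν₀ cell z) * ν (cell ⁻¹' {cell z})) := by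
            rw [setLIntegral_const, ← p.exp_cellLLR q.meas hpos]; ring
        _ ≤ 1 * ∫⁻ y in cell ⁻¹' {cell z}, ofReal (e - y) ∂ν := by
            refine mul_le_mul' ?_ (p.sub_cellLLR_mul_le q.meas hpos h1)
            rw [ofReal_le_one]
            exact exp_le_one_iff.mpr (by linarith [p.lo_pos])
        _ = _ := by
            rw [one_mul]
            refine lintegral_congr fun y => ?_
            rw [h2]; congr 1; ring

/-- The mean of the positive part of the log-likelihood ratio of a message, after the change. -/
theorem Quantizer.lintegral_cellLLR_le :
    ∫⁻ z, ofReal (cellLLR ν ν₀ cell z) ∂ν₀ ≤ ofReal hi + ∫⁻ z, ofReal (z - hi) ∂ν₀ := by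
  have := p.prob₀
  have e0 : ofReal hi = ∫⁻ _, ofReal hi ∂ν₀ := by simp
  rw [e0, ← lintegral_add_left measurable_const, lintegral_eq_tsum_fiber q.meas ν₀,
    lintegral_eq_tsum_fiber q.meas ν₀]
  refine tsum_le_tsum fun i => ?_
  have hs := q.meas (measurableSet_singleton i)
  by_cases hi' : ∃ z, cell z = i ∧ z ∉ 𝕀
  swap
  · push Not at hi'
    have : ν₀ (cell ⁻¹' {i}) = 0 := measure_mono_null (fun z hz => hi' z hz) p.null₀
    rw [restrict_eq_zero.mpr this]; simp
  obtain ⟨z, rfl, hz⟩ := hi'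
  have hpos := q.pos z hz
  set L := cellLLR ν ν₀ cell z
  have hL : ∀ z' ∈ cell ⁻¹' {cell z}, cellLLR ν ν₀ cell z' = L := fun z' hz' => cellLLR_congr hz'
  rcases le_or_gt hi z with h | h
  swap
  · have hz' : z ≤ -lo := by by_contra h'; exact hz ⟨not_le.mp h', h⟩
    have hLlo : L ≤ -lo := q.le_neg_lo p hz'
    refine setLIntegral_mono (by fun_prop) fun y hy => ?_
    rw [hL y hy, ofReal_of_nonpos (by linarith [p.lo_pos])]
    exact zero_le
  · obtain ⟨e, he, h1, -⟩ := q.up z h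
    have hLe := p.le_cellLLR q.meas hpos h1
    -- integrate `y + exp (L - y) ≥ 1 + L`
    have key : ν₀ (cell ⁻¹' {cell z}) + ∫⁻ y in cell ⁻¹' {cell z}, ofReal (cellLLR ν ν₀ cell y) ∂ν₀
        ≤ ν₀ (cell ⁻¹' {cell z})
          + ∫⁻ y in cell ⁻¹' {cell z}, (ofReal hi + ofReal (y - hi)) ∂ν₀ := by
      have e1 : ν₀ (cell ⁻¹' {cell z})
          = ∫⁻ y in cell ⁻¹' {cell z}, ofReal (exp L * exp (-y)) ∂ν₀ := by
        simp_rw [ofReal_mul (exp_pos L).le]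
        rw [lintegral_const_mul _ (by fun_prop), p.lintegral_exp_neg hs,
          ← p.exp_cellLLR q.meas hpos]
      have e2 : ν₀ (cell ⁻¹' {cell z}) = ∫⁻ _ in cell ⁻¹' {cell z}, 1 ∂ν₀ := by simp
      conv_rhs => rw [e1]
      conv_lhs => rw [e2]
      rw [← lintegral_add_left (by fun_prop), ← lintegral_add_left (by fun_prop)]
      refine setLIntegral_mono (by fun_prop) fun y hy => ?_
      have hy1 := h1 y hy
      have := p.hi_pos
      rw [hL y hy, ← ofReal_one, ← ofReal_add zero_le_one (by linarith),
        ← ofReal_add (by linarith) (by linarith),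
        ← ofReal_add (by positivity) (by linarith), ← exp_add]
      exact ofReal_le_ofReal (by linarith [Real.add_one_le_exp (L + -y)])
    exact (ENNReal.add_le_add_iff_left (measure_ne_top _ _)).mp key

/-- The Hellinger affinity between the laws of a message before and after the change. -/
theorem Quantizer.lintegral_exp_half_le {r : ℝ} (hr : 0 ≤ r) (hlo : r ≤ lo) (hhi : r ≤ hi) :
    ∫⁻ z, ofReal (exp (cellLLR ν ν₀ cell z / 2)) ∂ν
      + ofReal ((1 - exp (-(r / 2))) ^ 2 / 2) ≤ 1 := by
  have := p.prob
  have := p.prob₀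
  have hm := measurable_cellLLR (ν := ν) (ν₀ := ν₀) q.meas
  have e1 : ∫⁻ z, ofReal ((1 + exp (cellLLR ν ν₀ cell z)) / 2) ∂ν = 1 := by
    have h1 := p.lintegral_cellLLR (cell := cell) q.meas (fun _ => 1)
    simp only [mul_one, lintegral_one, measure_univ] at h1
    have h2 (z : ℝ) : ofReal ((1 + exp (cellLLR ν ν₀ cell z)) / 2)
        = ofReal (1 / 2) * (1 + ofReal (exp (cellLLR ν ν₀ cell z))) := by
      rw [← ofReal_one, ← ofReal_add zero_le_one (exp_pos _).le, ← ofReal_mul (by norm_num)]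
      congr 1; ring
    simp_rw [h2]
    rw [lintegral_const_mul _ (by fun_prop), lintegral_add_left measurable_const, h1]
    simp only [lintegral_const, measure_univ, mul_one]
    rw [show (1 + 1 : ℝ≥0∞) = ofReal 2 by norm_num, ← ofReal_mul (by norm_num)]
    norm_num
  have e2 : ofReal ((1 - exp (-(r / 2))) ^ 2 / 2)
      = ∫⁻ _, ofReal ((1 - exp (-(r / 2))) ^ 2 / 2) ∂ν := by simp
  conv_lhs => rw [e2]
  rw [← lintegral_add_right _ measurable_const]
  conv_rhs => rw [← e1]
  refine lintegral_mono_ae ?_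
  filter_upwards [p.ae_notMem] with z hz
  rw [← ofReal_add (exp_pos _).le (by positivity)]
  refine ofReal_le_ofReal ?_
  set L := cellLLR ν ν₀ cell z
  have hsq : exp L = exp (L / 2) ^ 2 := by rw [sq, ← exp_add]; ring_nf
  have hA : (1 - exp (-(r / 2))) ^ 2 ≤ (1 - exp (L / 2)) ^ 2 := by
    rcases le_or_gt hi z with h | h
    · have h1 : exp (r / 2) ≤ exp (L / 2) := exp_le_exp.mpr (by linarith [q.hi_le p h])
      have h2 : exp (r / 2) * exp (-(r / 2)) = 1 := by rw [← exp_add]; simp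
      have h4 : exp (-(r / 2)) ≤ 1 := exp_le_one_iff.mpr (by linarith)
      have h5 : 1 ≤ exp (r / 2) := Real.one_le_exp (by linarith)
      have h6 : 1 - exp (-(r / 2)) ≤ exp (L / 2) - 1 := by
        nlinarith [mul_nonneg (sub_nonneg.mpr h5) (sub_nonneg.mpr h4)]
      rw [← neg_sq (1 - exp (L / 2)), neg_sub]
      exact pow_le_pow_left₀ (by linarith) h6 2
    · have h1 : exp (L / 2) ≤ exp (-(r / 2)) := exp_le_exp.mpr (by linarith [q.le_neg_lo p (by
        by_contra h'; exact hz ⟨not_le.mp h', h⟩)])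
      have h4 : exp (-(r / 2)) ≤ 1 := exp_le_one_iff.mpr (by linarith)
      nlinarith
  rw [hsq]
  nlinarith

/-- If the cells of the lower side are equally likely before the change, then the log-likelihood
ratios of the messages are bounded from below in terms of the number of cells. -/
theorem Quantizer.neg_le_cellLLR
    {d : ℕ} (hd : 1 ≤ d) (hcell : ∀ z, z ≤ -lo → ν (Iic (-lo)) ≤ d * ν (cell ⁻¹' {cell z}))
    {o : ℝ} (ho : 0 ≤ o) (hover : ∫⁻ z, ofReal (-z - lo) ∂ν ≤ ofReal o)
    (hz : z ∉ 𝕀) :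
    -(d * (lo + o) / (1 - exp (-hi))) ≤ cellLLR ν ν₀ cell z := by
  have := p.prob
  have := p.prob₀
  have hlo := p.lo_pos
  have hhi := p.hi_pos
  have hexp : exp (-hi) < 1 := Real.exp_lt_one_iff.mpr (by linarith)
  have hq : 0 < 1 - exp (-hi) := by linarith
  have hd' : (0 : ℝ) < d := by exact_mod_cast hd
  rcases le_or_gt hi z with h | h
  · have h1 := q.hi_le p h
    have : 0 ≤ d * (lo + o) / (1 - exp (-hi)) := by positivity
    linarith
  have hz' : z ≤ -lo := by by_contra h'; exact hz ⟨not_le.mp h', h⟩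
  have hL := q.le_neg_lo p hz'
  obtain ⟨e, he, h1, -⟩ := q.dn z hz'
  set L := cellLLR ν ν₀ cell z with hLdef
  -- the upper side has probability at most `exp (-hi)` before the change
  have hup : ν (Ici hi) ≤ ofReal (exp (-hi)) := by
    rw [← p.lintegral_exp_neg measurableSet_Ici]
    calc ∫⁻ y in Ici hi, ofReal (exp (-y)) ∂ν₀ ≤ ∫⁻ _ in Ici hi, ofReal (exp (-hi)) ∂ν₀ :=
          setLIntegral_mono (by fun_prop) fun y hy =>
            ofReal_le_ofReal (exp_le_exp.mpr (neg_le_neg hy))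
      _ ≤ ofReal (exp (-hi)) := by
          rw [setLIntegral_const]; exact mul_le_of_le_one_right (zero_le) prob_le_one
  have hdn : ofReal (1 - exp (-hi)) ≤ ν (Iic (-lo)) := by
    have h2 : (1 : ℝ≥0∞) ≤ ν (Iic (-lo)) + ν (Ici hi) := by
      have hun : (univ : Set ℝ) ⊆ Iic (-lo) ∪ 𝕀 ∪ Ici hi := by
        intro y _
        rcases le_or_gt y (-lo) with h3 | h3
        · exact Or.inl (Or.inl h3)
        rcases le_or_gt hi y with h4 | h4
        · exact Or.inr h4
        · exact Or.inl (Or.inr ⟨h3, h4⟩)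
      calc (1 : ℝ≥0∞) = ν univ := measure_univ.symm
        _ ≤ _ := (measure_mono hun).trans ((measure_union_le _ _).trans
          (add_le_add_left (measure_union_le _ _) _))
        _ = _ := by rw [p.null, add_zero]
    rw [ENNReal.ofReal_sub _ (exp_pos _).le, ofReal_one]
    exact tsub_le_iff_right.mpr (h2.trans (add_le_add_right hup _))
  have hJ := p.sub_cellLLR_mul_le q.meas (q.pos z hz) (e := -lo) (fun z' h' => (h1 z' h').trans he)
  rw [← hLdef] at hJ
  have hJ2 : ofReal (-lo - L) * ν (cell ⁻¹' {cell z}) ≤ ofReal o := by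
    refine hJ.trans ((setLIntegral_le_lintegral _ _).trans (le_trans (le_of_eq ?_) hover))
    exact lintegral_congr fun y => by congr 1; ring
  have hfin : ofReal ((-lo - L) * (1 - exp (-hi))) ≤ ofReal (d * o) := by
    rw [ofReal_mul (by linarith), ofReal_mul hd'.le, ofReal_natCast]
    calc ofReal (-lo - L) * ofReal (1 - exp (-hi))
        ≤ ofReal (-lo - L) * (d * ν (cell ⁻¹' {cell z})) :=
          mul_le_mul_right (hdn.trans (hcell z hz')) _
      _ = d * (ofReal (-lo - L) * ν (cell ⁻¹' {cell z})) := by ring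
      _ ≤ _ := mul_le_mul_right hJ2 _
  rw [ofReal_le_ofReal_iff (by positivity)] at hfin
  have hd1 : (1 : ℝ) ≤ d := by exact_mod_cast hd
  have h3 : -L ≤ d * (lo + o) / (1 - exp (-hi)) := by
    rw [le_div_iff₀ hq]
    nlinarith [exp_pos (-hi), mul_pos hlo hq]
  linarith

end

/-! ### Equally likely overshoot cells -/

/-- `z` lies in the `j`-th of the `d` cells `[h + e (j-1), h + e j)`, the last one unbounded. -/
def HalfCell (d : ℕ) (h : ℝ) (e : ℕ → ℝ) (z : ℝ) (j : ℕ) : Prop :=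
  e (j - 1) ≤ z - h ∧ (j = d ∨ z - h < e j)

/-- The thresholds `e` cut the law `μ` on the half line `[h, ∞)` into `d` equally likely cells. -/
structure Levels (d : ℕ) (h : ℝ) (e : ℕ → ℝ) (μ : Measure ℝ) : Prop where
  d_pos : 1 ≤ d
  zero : e 0 = 0
  pos : ∀ j, 1 ≤ j → j < d → 0 < e j
  level : ∀ j, 1 ≤ j → j < d → (cond μ {z | h ≤ z}).real {z | e j ≤ z - h} = 1 - (j : ℝ) / d

section
variable {d : ℕ} {h : ℝ} {e : ℕ → ℝ} {μ : Measure ℝ}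

theorem Levels.nonneg (l : Levels d h e μ) {j : ℕ} (hj : j < d) : 0 ≤ e j := by
  rcases Nat.eq_zero_or_pos j with rfl | h0
  · exact l.zero.ge
  · exact (l.pos j h0 hj).le

theorem Levels.lt (l : Levels d h e μ) {i j : ℕ} (hij : i < j) (hj : j < d) : e i < e j := by
  rcases Nat.eq_zero_or_pos i with rfl | h0
  · rw [l.zero]; exact l.pos j hij hj
  by_contra hle
  have h1 : (cond μ {z | h ≤ z}).real {z | e i ≤ z - h}
      ≤ (cond μ {z | h ≤ z}).real {z | e j ≤ z - h} :=
    measureReal_mono (fun z hz => le_trans (not_lt.mp hle) hz) (measure_ne_top _ _)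
  rw [l.level i h0 (hij.trans hj), l.level j (h0.trans hij) hj] at h1
  have : (j : ℝ) / d ≤ i / d := by linarith
  rw [div_le_div_iff_of_pos_right (by exact_mod_cast l.d_pos)] at this
  exact absurd (by exact_mod_cast this) hij.not_ge

theorem Levels.exists_cell (l : Levels d h e μ) (hz : h ≤ z) :
    ∃ j ∈ Icc 1 d, HalfCell d h e z j := by
  classical
  have h1 := l.d_pos
  set i := Nat.findGreatest (fun i => e i ≤ z - h) (d - 1)
  have hid : i ≤ d - 1 := Nat.findGreatest_le _
  refine ⟨i + 1, mem_Icc.mpr ⟨by omega, by omega⟩, (Nat.findGreatest_spec (P := fun i => e i ≤ z -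
    h) (Nat.zero_le _) (by rw [l.zero]; linarith)), ?_⟩
  by_cases hd : i + 1 = d
  · exact Or.inl hd
  · right
    by_contra hlt
    have := Nat.le_findGreatest (P := fun i => e i ≤ z - h) (n := d - 1) (m := i + 1) (by omega)
      (not_lt.mp hlt)
    omega

theorem Levels.cell_le (l : Levels d h e μ) {i j : ℕ} (hi : i ∈ Icc 1 d)
    (hj : j ∈ Icc 1 d) (h1 : HalfCell d h e z i) (h2 : HalfCell d h e z j) : j ≤ i := by
  rw [mem_Icc] at hi hj
  by_contra hlt
  have h3 : z - h < e i := h1.2.resolve_left (by omega)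
  have h4 : e i ≤ e (j - 1) := by
    rcases Nat.lt_or_ge i (j - 1) with h5 | h5
    · exact (l.lt h5 (by omega)).le
    · rw [show j - 1 = i by omega]
  linarith [h2.1]

theorem Levels.le_of_cell (l : Levels d h e μ) {j : ℕ} (hj : j ∈ Icc 1 d)
    (h1 : HalfCell d h e z j) : h ≤ z := by
  rw [mem_Icc] at hj
  linarith [h1.1, l.nonneg (j := j - 1) (by omega)]

open Classical in
theorem Levels.sum_cell (l : Levels d h e μ) {j : ℕ} (hj : j ∈ Icc 1 d) (h1 : HalfCell d h e z j) :
    ∑ i ∈ Icc 1 d, (if HalfCell d h e z i then (i : ℤ) else 0) = j := by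
  rw [Finset.sum_eq_single_of_mem j hj, if_pos h1]
  intro i hi hij
  rw [if_neg]
  intro h2
  exact hij (le_antisymm (l.cell_le hj hi h1 h2) (l.cell_le hi hj h2 h1))

open Classical in
theorem Levels.sum_cell_of_lt (l : Levels d h e μ) (hz : z < h) :
    ∑ i ∈ Icc 1 d, (if HalfCell d h e z i then (i : ℤ) else 0) = 0 := by
  refine Finset.sum_eq_zero fun i hi => if_neg fun h2 => ?_
  exact absurd (l.le_of_cell hi h2) hz.not_ge

theorem measurableSet_halfCell (j : ℕ) : MeasurableSet {z | HalfCell d h e z j} := by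
  unfold HalfCell
  refine (measurableSet_le measurable_const (measurable_id.sub_const _)).inter ?_
  exact (MeasurableSet.const _).union (measurableSet_lt (measurable_id.sub_const _)
    measurable_const)

theorem Levels.mass_cell (l : Levels d h e μ) [IsProbabilityMeasure μ] {j : ℕ}
    (hj : j ∈ Icc 1 d) : μ {z | h ≤ z} = d * μ {z | HalfCell d h e z j} := by
  rw [mem_Icc] at hj
  have hd : (0 : ℝ) < d := by exact_mod_cast l.d_pos
  have hU : MeasurableSet {z : ℝ | h ≤ z} := measurableSet_Ici
  have hA (i : ℕ) (hi : i < d) : μ.real {z | e i ≤ z - h} = μ.real {z | h ≤ z} * (1 - i / d) := by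
    rcases Nat.eq_zero_or_pos i with rfl | h0
    · rw [l.zero]; simp
    have h1 := l.level i h0 hi
    have hsub : {z | h ≤ z} ∩ {z | e i ≤ z - h} = {z | e i ≤ z - h} :=
      Set.inter_eq_right.mpr fun z hz => by
        have := l.nonneg hi
        simp only [mem_ofPred_eq] at hz ⊢; linarith
    by_cases hz : μ {z | h ≤ z} = 0
    · have h2 : μ {z | e i ≤ z - h} = 0 := by
        rw [← hsub]; exact measure_mono_null Set.inter_subset_left hz
      simp [measureReal_def, h2, hz]
    · have hz' : μ.real {z | h ≤ z} ≠ 0 := (ENNReal.toReal_pos hz (measure_ne_top _ _)).ne'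
      rw [measureReal_def, cond_apply hU, hsub, ENNReal.toReal_mul, ENNReal.toReal_inv,
        ← measureReal_def, ← measureReal_def] at h1
      rw [← h1, ← mul_assoc, mul_inv_cancel₀ hz', one_mul]
  have hmA (i : ℕ) : MeasurableSet {z : ℝ | e i ≤ z - h} :=
    measurableSet_le measurable_const (measurable_id.sub_const _)
  have hreal : μ.real {z | HalfCell d h e z j} = μ.real {z | h ≤ z} / d := by
    have h1 := hA (j - 1) (by omega)
    have hcast : ((j - 1 : ℕ) : ℝ) = j - 1 := by rw [Nat.cast_sub hj.1]; simp
    rw [hcast] at h1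
    rcases hj.2.eq_or_lt with hjd | hjd
    · have : {z | HalfCell d h e z j} = {z | e (j - 1) ≤ z - h} := by ext z; simp [HalfCell, hjd]
      rw [this, h1, hjd]; field_simp; ring
    · have h2 := hA j hjd
      have : {z | HalfCell d h e z j} = {z | e (j - 1) ≤ z - h} \ {z | e j ≤ z - h} := by
        ext z; simp [HalfCell, hjd.ne]
      have hsub : {z | e j ≤ z - h} ⊆ {z | e (j - 1) ≤ z - h} := fun z hz =>
        (l.lt (i := j - 1) (by omega) hjd).le.trans hz
      rw [this, measureReal_sdiff hsub (hmA j), h1, h2]; field_simp; ring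
  rw [← ofReal_measureReal (μ := μ) (s := {z | h ≤ z}),
    ← ofReal_measureReal (μ := μ) (s := {z | HalfCell d h e z j}), hreal,
    ← ofReal_natCast, ← ofReal_mul hd.le]
  congr 1; field_simp

end

open Classical in
/-- The message in `{±1, …, ±d}` sent at the exit position `z` (`0` inside the interval). -/
def quantize (d : ℕ) (hi lo : ℝ) (eu ed : ℕ → ℝ) (z : ℝ) : ℤ :=
  ∑ j ∈ Icc 1 d, ((if HalfCell d hi eu z j then (j : ℤ) else 0)
    - (if HalfCell d lo ed (-z) j then (j : ℤ) else 0))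

section
variable {d : ℕ} {gap : ℝ} {eu ed : ℕ → ℝ} {ν ν₀ μ : Measure ℝ}

theorem measurable_quantize : Measurable (quantize d hi lo eu ed) := by
  unfold quantize
  refine Finset.measurable_fun_sum _ fun j _ => Measurable.sub ?_ ?_
  · exact Measurable.ite (measurableSet_halfCell j) measurable_const measurable_const
  · exact Measurable.ite (measurable_neg (measurableSet_halfCell j)) measurable_const
      measurable_const

theorem quantize_up (lu : Levels d hi eu ν₀) (ld : Levels d lo ed μ) (hpos : 0 < lo) {j : ℕ}
    (hj : j ∈ Icc 1 d) (hi0 : 0 < hi) (h : HalfCell d hi eu z j) :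
    quantize d hi lo eu ed z = j := by
  classical
  have hz := lu.le_of_cell hj h
  unfold quantize
  rw [sum_sub_distrib, lu.sum_cell hj h, ld.sum_cell_of_lt (by linarith), sub_zero]

theorem quantize_dn (lu : Levels d hi eu ν₀) (ld : Levels d lo ed μ) (hpos : 0 < lo) {j : ℕ}
    (hj : j ∈ Icc 1 d) (hi0 : 0 < hi) (h : HalfCell d lo ed (-z) j) :
    quantize d hi lo eu ed z = -j := by
  classical
  have hz := ld.le_of_cell hj h
  unfold quantize
  rw [sum_sub_distrib, ld.sum_cell hj h, lu.sum_cell_of_lt (by linarith), zero_sub]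

theorem quantize_in (lu : Levels d hi eu ν₀) (ld : Levels d lo ed μ)
    (hz : z ∈ 𝕀) : quantize d hi lo eu ed z = 0 := by
  classical
  unfold quantize
  rw [sum_sub_distrib, lu.sum_cell_of_lt hz.2, ld.sum_cell_of_lt (by linarith [hz.1]), sub_zero]

theorem quantize_eq_up (lu : Levels d hi eu ν₀) (ld : Levels d lo ed μ) (hlo : 0 < lo)
    (hhi : 0 < hi) {j : ℕ} (hj : j ∈ Icc 1 d) :
    quantize d hi lo eu ed z = j ↔ HalfCell d hi eu z j := by
  have hj1 := (mem_Icc.mp hj).1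
  refine ⟨fun h => ?_, quantize_up lu ld hlo hj hhi⟩
  rcases le_or_gt hi z with h1 | h1
  · obtain ⟨i, hi', h2⟩ := lu.exists_cell h1
    rw [quantize_up lu ld hlo hi' hhi h2] at h
    obtain rfl : i = j := by exact_mod_cast h
    exact h2
  · exfalso
    rcases le_or_gt z (-lo) with h3 | h3
    · obtain ⟨i, hi', h2⟩ := ld.exists_cell (z := -z) (by linarith)
      rw [quantize_dn lu ld hlo hi' hhi h2] at h
      omega
    · rw [quantize_in lu ld ⟨h3, h1⟩] at h
      omega

theorem quantize_eq_dn (lu : Levels d hi eu ν₀) (ld : Levels d lo ed μ) (hlo : 0 < lo)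
    (hhi : 0 < hi) {j : ℕ} (hj : j ∈ Icc 1 d) :
    quantize d hi lo eu ed z = -j ↔ HalfCell d lo ed (-z) j := by
  have hj1 := (mem_Icc.mp hj).1
  refine ⟨fun h => ?_, quantize_dn lu ld hlo hj hhi⟩
  rcases le_or_gt z (-lo) with h3 | h3
  · obtain ⟨i, hi', h2⟩ := ld.exists_cell (z := -z) (by linarith)
    rw [quantize_dn lu ld hlo hi' hhi h2] at h
    obtain rfl : i = j := by omega
    exact h2
  · exfalso
    rcases le_or_gt hi z with h1 | h1
    · obtain ⟨i, hi', h2⟩ := lu.exists_cell h1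
      rw [quantize_up lu ld hlo hi' hhi h2] at h
      omega
    · rw [quantize_in lu ld ⟨h3, h1⟩] at h
      omega

theorem map_neg_setOf (p : ℝ → Prop) : (ν.map Neg.neg) {z | p z} = ν {z | p (-z)} :=
  (MeasurableEquiv.neg ℝ).map_apply _

theorem mass_dn_cell [IsProbabilityMeasure ν] (lu : Levels d hi eu ν₀)
    (ld : Levels d lo ed (ν.map Neg.neg)) (hlo : 0 < lo) (hhi : 0 < hi) (hz : z ≤ -lo) :
    ν (Iic (-lo)) = d * ν (quantize d hi lo eu ed ⁻¹' {quantize d hi lo eu ed z}) := by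
  have : IsProbabilityMeasure (ν.map Neg.neg) := isProbabilityMeasure_map (by fun_prop)
  obtain ⟨j, hj, h1⟩ := ld.exists_cell (z := -z) (by linarith)
  have h2 := ld.mass_cell hj
  rw [map_neg_setOf, map_neg_setOf] at h2
  have e1 : Iic (-lo) = {z : ℝ | lo ≤ -z} := by
    ext y; simp only [Set.mem_Iic, mem_ofPred_eq]; exact le_neg
  have e2 : quantize d hi lo eu ed ⁻¹' {quantize d hi lo eu ed z}
      = {z | HalfCell d lo ed (-z) j} := by
    ext y
    rw [Set.mem_preimage, Set.mem_singleton_iff, quantize_dn lu ld hlo hj hhi h1,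
      quantize_eq_dn lu ld hlo hhi hj, mem_ofPred_eq]
  rw [e1, e2, h2]

/-- The quantization of the exit position into equally likely cells on each side. -/
theorem quantizer (p : ExitPair lo hi ν ν₀) (lu : Levels d hi eu ν₀)
    (ld : Levels d lo ed (ν.map Neg.neg))
    (hgu : ∀ j, j + 1 < d → eu (j + 1) - eu j ≤ gap)
    (hgd : ∀ j, j + 1 < d → ed (j + 1) - ed j ≤ gap) :
    Quantizer lo hi gap (eu (d - 1)) (ed (d - 1)) ν (quantize d hi lo eu ed) where
  meas := measurable_quantize
  up z hz := by
    obtain ⟨j, hj, h1⟩ := lu.exists_cell hz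
    have hj' := mem_Icc.mp hj
    have hfib (z' : ℝ) (h : quantize d hi lo eu ed z' = quantize d hi lo eu ed z) :
        HalfCell d hi eu z' j := by
      rw [quantize_up lu ld p.lo_pos hj p.hi_pos h1] at h
      exact (quantize_eq_up lu ld p.lo_pos p.hi_pos hj).mp h
    refine ⟨hi + eu (j - 1), ?_, fun z' h => by linarith [(hfib z' h).1], ?_⟩
    · linarith [lu.nonneg (j := j - 1) (by omega)]
    by_cases hd : j = d
    · right; rw [hd]
    · left
      intro z' h
      have h2 := (hfib z' h).2.resolve_left hd
      have h3 := hgu (j - 1) (by omega)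
      rw [show j - 1 + 1 = j by omega] at h3
      linarith
  dn z hz := by
    obtain ⟨j, hj, h1⟩ := ld.exists_cell (z := -z) (by linarith)
    have hj' := mem_Icc.mp hj
    have hfib (z' : ℝ) (h : quantize d hi lo eu ed z' = quantize d hi lo eu ed z) :
        HalfCell d lo ed (-z') j := by
      rw [quantize_dn lu ld p.lo_pos hj p.hi_pos h1] at h
      exact (quantize_eq_dn lu ld p.lo_pos p.hi_pos hj).mp h
    refine ⟨-lo - ed (j - 1), ?_, fun z' h => by linarith [(hfib z' h).1], ?_⟩
    · linarith [ld.nonneg (j := j - 1) (by omega)]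
    by_cases hd : j = d
    · right; rw [hd]
    · left
      intro z' h
      have h2 := (hfib z' h).2.resolve_left hd
      have h3 := hgd (j - 1) (by omega)
      rw [show j - 1 + 1 = j by omega] at h3
      linarith
  pos z hz := by
    have := p.prob
    have := p.prob₀
    have hone (μ : Measure ℝ) [IsProbabilityMeasure μ] (hμ : μ 𝕀 = 0) :
        1 ≤ μ (Iic (-lo)) + μ (Ici hi) := by
      have hun : (univ : Set ℝ) ⊆ Iic (-lo) ∪ 𝕀 ∪ Ici hi := by
        intro y _
        rcases le_or_gt y (-lo) with h3 | h3
        · exact Or.inl (Or.inl h3)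
        rcases le_or_gt hi y with h4 | h4
        · exact Or.inr h4
        · exact Or.inl (Or.inr ⟨h3, h4⟩)
      calc (1 : ℝ≥0∞) = μ univ := measure_univ.symm
        _ ≤ _ := (measure_mono hun).trans ((measure_union_le _ _).trans
          (add_le_add_left (measure_union_le _ _) _))
        _ = _ := by rw [hμ, add_zero]
    rcases le_or_gt hi z with h | h
    · -- the upper side is charged by `ν₀`, since the lower one has mass at most `exp (-lo)`
      obtain ⟨j, hj, h1⟩ := lu.exists_cell h
      have h2 : ν₀ (Ici hi) ≠ 0 := by
        intro h0
        have h3 := hone ν₀ p.null₀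
        rw [h0, add_zero, p.apply₀ measurableSet_Iic] at h3
        have h4 : ∫⁻ y in Iic (-lo), ofReal (exp y) ∂ν ≤ ofReal (exp (-lo)) := by
          calc _ ≤ ∫⁻ _ in Iic (-lo), ofReal (exp (-lo)) ∂ν :=
                setLIntegral_mono (by fun_prop) fun y hy => ofReal_le_ofReal (exp_le_exp.mpr hy)
            _ ≤ _ := by rw [setLIntegral_const]; exact mul_le_of_le_one_right (zero_le) prob_le_one
        have h5 := h3.trans h4
        rw [← ofReal_one, ofReal_le_ofReal_iff (exp_pos _).le, Real.one_le_exp_iff] at h5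
        linarith [p.lo_pos]
      have e2 : quantize d hi lo eu ed ⁻¹' {quantize d hi lo eu ed z}
          = {z | HalfCell d hi eu z j} := by
        ext y
        rw [Set.mem_preimage, Set.mem_singleton_iff, quantize_up lu ld p.lo_pos hj p.hi_pos h1,
          quantize_eq_up lu ld p.lo_pos p.hi_pos hj, mem_ofPred_eq]
      rw [e2, ne_eq, ← p.apply_eq_zero_iff (measurableSet_halfCell j)]
      intro h0
      have h6 := lu.mass_cell hj
      rw [h0, mul_zero] at h6
      exact h2 h6
    · have h6 := mass_dn_cell lu ld p.lo_pos p.hi_pos (by by_contra h'; exact hz ⟨not_le.mp h', h⟩)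
      intro h0
      rw [h0, mul_zero] at h6
      have h3 := hone ν p.null
      rw [h6, zero_add, ← p.lintegral_exp_neg measurableSet_Ici] at h3
      have h4 : ∫⁻ y in Ici hi, ofReal (exp (-y)) ∂ν₀ ≤ ofReal (exp (-hi)) := by
        calc _ ≤ ∫⁻ _ in Ici hi, ofReal (exp (-hi)) ∂ν₀ :=
              setLIntegral_mono (by fun_prop) fun y hy =>
                ofReal_le_ofReal (exp_le_exp.mpr (neg_le_neg hy))
          _ ≤ _ := by rw [setLIntegral_const]; exact mul_le_of_le_one_right (zero_le) prob_le_one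
      have h5 := h3.trans h4
      rw [← ofReal_one, ofReal_le_ofReal_iff (exp_pos _).le, Real.one_le_exp_iff] at h5
      linarith [p.hi_pos]

end

/-! ### The messages of one sensor -/

/-- One sensor: the laws `Q`, `Q₀` of the steps of its local statistic, the interval `(-lo, hi)` and
the log-likelihood ratio `Lam z` of the message sent at the exit position `z`; `lam` bounds the mean
information lost per message after the change. -/
structure Sensor (m B a b Δ lam : ℝ) (Q Q₀ : Measure ℝ) (lo hi : ℝ) (Lam : ℝ → ℝ) : Prop where
  laws : StepLaws m B Q Q₀
  a_pos : 0 < a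
  Δ_pos : 0 < Δ
  le_lo : a * Δ ≤ lo
  lo_le : lo ≤ b * Δ
  le_hi : a * Δ ≤ hi
  hi_le : hi ≤ b * Δ
  meas : Measurable Lam
  change : ∀ F : ℝ → ℝ≥0∞, Measurable F →
    exitMean Q (Ioo (-lo) hi) (fun z => ofReal (exp (Lam z)) * F (Lam z)) 0
      = exitMean Q₀ (Ioo (-lo) hi) (fun z => F (Lam z)) 0
  lam_nonneg : 0 ≤ lam
  loss_le : exitMean Q₀ (Ioo (-lo) hi) (fun z => ofReal (z - Lam z)) 0 ≤ ofReal lam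
  pos_le : exitMean Q₀ (Ioo (-lo) hi) (fun z => ofReal (Lam z)) 0
    ≤ ofReal (b * Δ + overConst m B * B)
  half_le : exitMean Q (Ioo (-lo) hi) (fun z => ofReal (exp (Lam z / 2))) 0
    + ofReal ((1 - exp (-(a * Δ / 2))) ^ 2 / 2) ≤ 1

section
variable {m B : ℝ} {Q Q₀ : Measure ℝ} {gap tu td : ℝ} {cell : ℝ → ℤ}

theorem isProbabilityMeasure_exitLaw [IsProbabilityMeasure Q] {I : Set ℝ} (hI : MeasurableSet I)
    (h : meanTime Q I 0 ≠ ∞) : IsProbabilityMeasure (exitLaw Q I) := by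
  constructor
  have h1 := lintegral_exitLaw (Q := Q) hI measurable_one
  rw [exitMean_one hI h] at h1
  simpa using h1

theorem exitLaw_apply_self (Q : Measure ℝ) [SFinite Q] {I : Set ℝ} (hI : MeasurableSet I) :
    exitLaw Q I I = 0 := by
  rw [exitLaw, Measure.sum_apply _ hI]
  refine ENNReal.tsum_eq_zero.mpr fun n => ?_
  rw [restrict_apply hI, Set.inter_compl_self, measure_empty]

theorem StepLaws.exitPair (h : StepLaws m B Q Q₀) (hlo : 0 < lo) (hhi : 0 < hi) :
    ExitPair lo hi (exitLaw Q 𝕀) (exitLaw Q₀ 𝕀) := by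
  have := h.prob
  have := h.prob₀
  have h0 : (0 : ℝ) ∈ 𝕀 := ⟨by linarith, hhi⟩
  exact ⟨isProbabilityMeasure_exitLaw measurableSet_Ioo
      ((h.meanTime_le h0).trans_lt ofReal_lt_top).ne,
    isProbabilityMeasure_exitLaw measurableSet_Ioo ((h.meanTime₀_le h0).trans_lt ofReal_lt_top).ne,
    exitLaw_tilt measurableSet_Ioo h.tilt, exitLaw_apply_self Q measurableSet_Ioo, hlo, hhi⟩

/-- The constant in the bound for the information lost by quantization. -/
def lossConst (m B : ℝ) : ℝ := 1 + overConst m B + 2 * (overConst m B * B)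

theorem StepLaws.tail_le (h : StepLaws m B Q Q₀) (ε : ℝ) : ∫ y in {y | ε ≤ y}, y ^ 2 ∂Q₀ ≤ B :=
  (setIntegral_le_integral h.int2₀ (.of_forall fun y => sq_nonneg y)).trans h.second₀

theorem StepLaws.tail_le' (h : StepLaws m B Q Q₀) (ε : ℝ) : ∫ y in {y | ε ≤ -y}, y ^ 2 ∂Q ≤ B :=
  (setIntegral_le_integral h.int2 (.of_forall fun y => sq_nonneg y)).trans h.second

theorem StepLaws.exitMean_over_le_const (h : StepLaws m B Q Q₀) (hx : x ∈ 𝕀) :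
    exitMean Q₀ 𝕀 (fun z => ofReal (z - hi)) x ≤ ofReal (overConst m B * B) := by
  have h1 := h.exitMean_over_le le_rfl hx
  simp only [sub_zero] at h1
  exact h1.trans (ofReal_le_ofReal (mul_le_mul_of_nonneg_left (h.tail_le 0) h.overConst_pos.le))

theorem StepLaws.exitMean_under_le_const (h : StepLaws m B Q Q₀) (hx : x ∈ 𝕀) :
    exitMean Q 𝕀 (fun z => ofReal (-z - lo)) x ≤ ofReal (overConst m B * B) := by
  have h1 := h.exitMean_under_le le_rfl hx
  simp only [sub_zero] at h1
  exact h1.trans (ofReal_le_ofReal (mul_le_mul_of_nonneg_left (h.tail_le' 0) h.overConst_pos.le))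

theorem Quantizer.loss_le (h : StepLaws m B Q Q₀) (hlo : 0 < lo) (hhi : 0 < hi)
    (q : Quantizer lo hi gap tu td (exitLaw Q 𝕀) cell) (hgap : 0 ≤ gap)
    (htu : 0 ≤ tu) (htd : 0 ≤ td) :
    ∫⁻ z, ofReal (z - cellLLR (exitLaw Q 𝕀) (exitLaw Q₀ 𝕀) cell z) ∂(exitLaw Q₀ 𝕀)
      ≤ ofReal (gap + overConst m B * ∫ y in {y | tu ≤ y}, y ^ 2 ∂Q₀
        + overConst m B * ∫ y in {y | td ≤ -y}, y ^ 2 ∂Q) := by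
  have := h.prob
  have := h.prob₀
  have h0 : (0 : ℝ) ∈ 𝕀 := ⟨by linarith, hhi⟩
  have hc := h.overConst_pos.le
  have h1 := h.exitMean_over_le htu h0
  have h2 := h.exitMean_under_le htd h0
  rw [← lintegral_exitLaw measurableSet_Ioo (by fun_prop)] at h1 h2
  rw [ofReal_add₀, ofReal_add hgap (by positivity)]
  exact (q.lintegral_loss_le (h.exitPair hlo hhi)).trans (add_le_add (add_le_add_right h1 _) h2)

theorem Quantizer.sensor (h : StepLaws m B Q Q₀) {a b Δ θ : ℝ} (ha : 0 < a) (hΔ : 0 < Δ)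
    (le_lo : a * Δ ≤ lo) (lo_le : lo ≤ b * Δ) (le_hi : a * Δ ≤ hi) (hi_le : hi ≤ b * Δ)
    (q : Quantizer lo hi gap tu td (exitLaw Q 𝕀) cell) (hgap : 0 ≤ gap)
    (htu : 0 ≤ tu) (htd : 0 ≤ td)
    (hθ : gap + ∫ y in {y | tu ≤ y}, y ^ 2 ∂Q₀ + ∫ y in {y | td ≤ -y}, y ^ 2 ∂Q ≤ θ) :
    Sensor m B a b Δ (lossConst m B * min θ 1) Q Q₀ lo hi
      (cellLLR (exitLaw Q 𝕀) (exitLaw Q₀ 𝕀) cell) := by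
  have := h.prob
  have := h.prob₀
  have haΔ : 0 < a * Δ := mul_pos ha hΔ
  have hlo : 0 < lo := haΔ.trans_le le_lo
  have hhi : 0 < hi := haΔ.trans_le le_hi
  have p := h.exitPair hlo hhi
  have hc := h.overConst_pos.le
  have hB := h.B_pos.le
  have hI : MeasurableSet 𝕀 := measurableSet_Ioo
  have hm := measurable_cellLLR (ν := exitLaw Q 𝕀) (ν₀ := exitLaw Q₀ 𝕀) q.meas
  have t1 : 0 ≤ ∫ y in {y | tu ≤ y}, y ^ 2 ∂Q₀ := integral_nonneg fun y => sq_nonneg y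
  have t2 : 0 ≤ ∫ y in {y | td ≤ -y}, y ^ 2 ∂Q := integral_nonneg fun y => sq_nonneg y
  have hθ0 : 0 ≤ θ := le_trans (by positivity) hθ
  refine ⟨h, ha, hΔ, le_lo, lo_le, le_hi, hi_le, hm, fun F hF => ?_, ?_, ?_, ?_, ?_⟩
  · rw [← lintegral_exitLaw hI (by fun_prop), ← lintegral_exitLaw hI (by fun_prop)]
    exact p.lintegral_cellLLR q.meas F
  · have : 0 ≤ lossConst m B := by unfold lossConst; positivity
    exact mul_nonneg this (le_min hθ0 zero_le_one)
  · rw [← lintegral_exitLaw hI (by fun_prop)]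
    rcases le_total θ 1 with hθ1 | hθ1
    · refine (q.loss_le h hlo hhi hgap htu htd).trans (ofReal_le_ofReal ?_)
      rw [min_eq_left hθ1]
      unfold lossConst
      nlinarith [mul_nonneg (mul_nonneg hc hB) hθ0, mul_nonneg hc hgap]
    · refine (q.coarsen.loss_le h hlo hhi le_rfl le_rfl le_rfl).trans (ofReal_le_ofReal ?_)
      rw [min_eq_right hθ1]
      have h3 := mul_le_mul_of_nonneg_left (h.tail_le 0) hc
      have h4 := mul_le_mul_of_nonneg_left (h.tail_le' 0) hc
      unfold lossConst
      linarith
  · rw [← lintegral_exitLaw hI (by fun_prop)]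
    refine (q.lintegral_cellLLR_le p).trans ?_
    rw [lintegral_exitLaw hI (by fun_prop), ofReal_add (by linarith) (by positivity)]
    exact add_le_add (ofReal_le_ofReal hi_le) (h.exitMean_over_le_const ⟨by linarith, hhi⟩)
  · rw [← lintegral_exitLaw hI (by fun_prop)]
    exact q.lintegral_exp_half_le p haΔ.le le_lo le_hi

end

section
variable {m B a b Δ lam : ℝ} {Q Q₀ : Measure ℝ} {Lam : ℝ → ℝ}
  (s : Sensor m B a b Δ lam Q Q₀ lo hi Lam)
include s

theorem Sensor.lo_pos : 0 < lo := (mul_pos s.a_pos s.Δ_pos).trans_le s.le_lo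

theorem Sensor.hi_pos : 0 < hi := (mul_pos s.a_pos s.Δ_pos).trans_le s.le_hi

theorem Sensor.zero_mem : (0 : ℝ) ∈ 𝕀 := ⟨by linarith [s.lo_pos], s.hi_pos⟩

theorem Sensor.b_pos : 0 < b := pos_of_mul_pos_left (s.hi_pos.trans_le s.hi_le) s.Δ_pos.le

/-- A bound for the mean time between two messages. -/
def timeBound (m B b Δ : ℝ) : ℝ := (2 * (b * Δ) + 2 * B / m) / m

theorem Sensor.meanTime₀_le (hx : x ∈ 𝕀) : meanTime Q₀ 𝕀 x ≤ ofReal (timeBound m B b Δ) := by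
  refine (s.laws.meanTime₀_le hx).trans (ofReal_le_ofReal ?_)
  unfold timeBound
  have := s.laws.m_pos
  gcongr
  linarith [s.lo_le, s.hi_le]

theorem Sensor.le_meanTime₀ : ofReal (a * Δ / (B + 1)) ≤ meanTime Q₀ 𝕀 0 :=
  s.laws.le_meanTime₀ (mul_pos s.a_pos s.Δ_pos) s.le_lo s.le_hi

theorem Sensor.exitMean₀_one (hx : x ∈ 𝕀) : exitMean Q₀ 𝕀 1 x = 1 := by
  have := s.laws.prob₀
  exact exitMean_one measurableSet_Ioo ((s.laws.meanTime₀_le hx).trans_lt ofReal_lt_top).ne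

theorem Sensor.exitMean_one (hx : x ∈ 𝕀) : exitMean Q 𝕀 1 x = 1 := by
  have := s.laws.prob
  exact _root_.exitMean_one measurableSet_Ioo ((s.laws.meanTime_le hx).trans_lt ofReal_lt_top).ne

/-- The gain of information per message, as seen by the function `2 (1 - exp (-y / 2)) ≤ y`. -/
theorem Sensor.exitMean_exp_neg_half_le : exitMean Q₀ 𝕀 (fun z => ofReal (exp (-Lam z / 2))) 0
      + ofReal ((1 - exp (-(a * Δ / 2))) ^ 2 / 2) ≤ 1 := by
  rw [← (s.change (fun y => ofReal (exp (-y / 2))) (by fun_prop))]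
  refine le_trans (le_of_eq ?_) s.half_le
  congr 2
  funext z
  rw [← ofReal_mul (exp_pos _).le, ← exp_add]
  congr 2; ring

end

/-! ### Adapted sequences of independent steps -/

/-- From time `t₀` on, each `X t` has law `π` and is independent of the past `ℱ t`. -/
structure IIDSteps {Ω : Type*} {E : Type*} [mΩ : MeasurableSpace Ω] [MeasurableSpace E]
    (ℱ : ℕ → MeasurableSpace Ω) (P : Measure Ω) (X : ℕ → Ω → E) (π : Measure E) (t₀ : ℕ) :
    Prop where
  prob : IsProbabilityMeasure P
  prob_step : IsProbabilityMeasure π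
  le : ∀ t, ℱ t ≤ mΩ
  mono : Monotone ℱ
  meas : ∀ t, Measurable[ℱ (t + 1)] (X t)
  law : ∀ t, t₀ ≤ t → ∀ A, MeasurableSet[ℱ t] A → ∀ C, MeasurableSet C →
    P (A ∩ X t ⁻¹' C) = P A * π C

section
variable {Ω E E' α : Type*} [mΩ : MeasurableSpace Ω] [MeasurableSpace E] [MeasurableSpace E']
  [MeasurableSpace α] {ℱ : ℕ → MeasurableSpace Ω} {P : Measure Ω} {X : ℕ → Ω → E} {π : Measure E}
  {t₀ : ℕ}

theorem IIDSteps.measurable (h : IIDSteps ℱ P X π t₀) (t : ℕ) : Measurable (X t) :=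
  (h.meas t).mono (h.le _) le_rfl

theorem IIDSteps.comp (h : IIDSteps ℱ P X π t₀) {φ : E → E'} (hφ : Measurable φ) :
    IIDSteps ℱ P (fun t ω => φ (X t ω)) (π.map φ) t₀ := by
  have := h.prob_step
  exact ⟨h.prob, isProbabilityMeasure_map hφ.aemeasurable, h.le, h.mono,
    fun t => hφ.comp (h.meas t), fun t ht A hA C hC => by
      rw [map_apply hφ hC]; exact h.law t ht A hA _ (hφ hC)⟩

/-- Integration over the next step, given the past. -/
theorem IIDSteps.setLIntegral (h : IIDSteps ℱ P X π t₀) (ht : t₀ ≤ t) {A : Set Ω}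
    (hA : MeasurableSet[ℱ t] A) {Z : Ω → α} (hZ : Measurable[ℱ t] Z) {F : α → E → ℝ≥0∞}
    (hF : Measurable fun p : α × E => F p.1 p.2) :
    ∫⁻ ω in A, F (Z ω) (X t ω) ∂P = ∫⁻ ω in A, ∫⁻ x, F (Z ω) x ∂π ∂P := by
  have := h.prob
  have := h.prob_step
  have hZ' : Measurable Z := hZ.mono (h.le _) le_rfl
  have hX := h.measurable t
  have hmap : (P.restrict A).map (fun ω => (Z ω, X t ω)) = ((P.restrict A).map Z).prod π := by
    refine (Measure.prod_eq fun S C hS hC => ?_).symm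
    rw [map_apply (hZ'.prodMk hX) (hS.prod hC), map_apply hZ' hS,
      restrict_apply ((hZ'.prodMk hX) (hS.prod hC)), restrict_apply (hZ' hS),
      ← h.law t ht _ (MeasurableSet.inter (hZ hS) hA) C hC]
    congr 1
    ext ω
    simp only [Set.mem_inter_iff, Set.mem_preimage, Set.mem_prod]
    tauto
  rw [((lintegral_map hF (hZ'.prodMk hX)).symm), hmap, lintegral_prod _ hF.aemeasurable,
    lintegral_map (Measurable.lintegral_prod_right' hF) hZ']

end

/-! ### Lyapunov functions up to a stopping time

The sets `alive t` decrease; `alive t` is to be thought of as the event that a stopping time exceeds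
`t`. -/

section
variable {Ω : Type*} [mΩ : MeasurableSpace Ω] {P : Measure Ω} {alive : ℕ → Set Ω}
  {V : ℕ → Ω → ℝ≥0∞} {c d : ℕ → ℝ≥0∞} {τ : ℕ}
  (hmeas : ∀ t, τ ≤ t → MeasurableSet (alive t)) (hanti : ∀ t, τ ≤ t → alive (t + 1) ⊆ alive t)
include hmeas hanti

theorem lintegral_alive_succ (ht : τ ≤ t) (f : Ω → ℝ≥0∞) : ∫⁻ ω in alive t, f ω ∂P
      = ∫⁻ ω in alive (t + 1), f ω ∂P + ∫⁻ ω in alive t \ alive (t + 1), f ω ∂P := by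
  have h1 := lintegral_inter_add_sdiff (μ := P) f (alive t) (hmeas (t + 1) (by omega))
  rw [Set.inter_eq_right.mpr (hanti t ht)] at h1
  exact h1.symm

/-- The expected running gain `c` is at most the initial value plus the expected running loss `d`,
if `V + ∑ c - ∑ d` is a supermartingale; the final value of `V` is kept. -/
theorem lyapunov_le
   
    (step : ∀ t, τ ≤ t → ∫⁻ ω in alive t, V (t + 1) ω ∂P + c t
      ≤ ∫⁻ ω in alive t, V t ω ∂P + d t) (n : ℕ) :
    ∫⁻ ω in alive (τ + n), V (τ + n) ω ∂P
        + ∑ i ∈ range n, ∫⁻ ω in alive (τ + i) \ alive (τ + i + 1), V (τ + i + 1) ω ∂P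
        + ∑ i ∈ range n, c (τ + i)
      ≤ ∫⁻ ω in alive τ, V τ ω ∂P + ∑ i ∈ range n, d (τ + i) := by
  induction n with
  | zero => simp
  | succ n ih =>
    have h1 := step (τ + n) (by omega)
    rw [lintegral_alive_succ hmeas hanti (by omega)] at h1
    simp only [sum_range_succ]
    set A := ∫⁻ ω in alive (τ + (n + 1)), V (τ + (n + 1)) ω ∂P
    have hA : ∫⁻ ω in alive (τ + n + 1), V (τ + n + 1) ω ∂P = A := rfl
    rw [hA] at h1
    set D := ∫⁻ ω in alive (τ + n) \ alive (τ + n + 1), V (τ + n + 1) ω ∂P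
    set S := ∑ i ∈ range n, ∫⁻ ω in alive (τ + i) \ alive (τ + i + 1), V (τ + i + 1) ω ∂P
    set Sc := ∑ i ∈ range n, c (τ + i)
    calc A + (S + D) + (Sc + c (τ + n)) = (A + D + c (τ + n)) + (S + Sc) := by ring
      _ ≤ (∫⁻ ω in alive (τ + n), V (τ + n) ω ∂P + d (τ + n)) + (S + Sc) := by gcongr
      _ = (∫⁻ ω in alive (τ + n), V (τ + n) ω ∂P + S + Sc) + d (τ + n) := by ring
      _ ≤ (∫⁻ ω in alive τ, V τ ω ∂P + ∑ i ∈ range n, d (τ + i)) + d (τ + n) := by gcongr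
      _ = _ := by ring

theorem le_lyapunov
   
    (step : ∀ t, τ ≤ t → ∫⁻ ω in alive t, V t ω ∂P + d t
      ≤ ∫⁻ ω in alive t, V (t + 1) ω ∂P + c t) (n : ℕ) :
    ∫⁻ ω in alive τ, V τ ω ∂P + ∑ i ∈ range n, d (τ + i) ≤ ∫⁻ ω in alive (τ + n), V (τ + n) ω ∂P
        + ∑ i ∈ range n, ∫⁻ ω in alive (τ + i) \ alive (τ + i + 1), V (τ + i + 1) ω ∂P
        + ∑ i ∈ range n, c (τ + i) := by
  induction n with
  | zero => simp
  | succ n ih =>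
    have h1 := step (τ + n) (by omega)
    rw [lintegral_alive_succ hmeas hanti (by omega) (f := V (τ + n + 1))] at h1
    simp only [sum_range_succ]
    set A := ∫⁻ ω in alive (τ + (n + 1)), V (τ + (n + 1)) ω ∂P
    have hA : ∫⁻ ω in alive (τ + n + 1), V (τ + n + 1) ω ∂P = A := rfl
    rw [hA] at h1
    set D := ∫⁻ ω in alive (τ + n) \ alive (τ + n + 1), V (τ + n + 1) ω ∂P
    set S := ∑ i ∈ range n, ∫⁻ ω in alive (τ + i) \ alive (τ + i + 1), V (τ + i + 1) ω ∂P
    set Sc := ∑ i ∈ range n, c (τ + i)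
    calc _ = (∫⁻ ω in alive τ, V τ ω ∂P + ∑ i ∈ range n, d (τ + i)) + d (τ + n) := by ring
      _ ≤ (∫⁻ ω in alive (τ + n), V (τ + n) ω ∂P + S + Sc) + d (τ + n) := by gcongr
      _ = (∫⁻ ω in alive (τ + n), V (τ + n) ω ∂P + d (τ + n)) + (S + Sc) := by ring
      _ ≤ (A + D + c (τ + n)) + (S + Sc) := by gcongr
      _ = _ := by ring

/-- The remaining mass of the sets that partition `alive τ`. -/
theorem measure_alive_add (n : ℕ) :
    P (alive (τ + n)) + ∑ i ∈ range n, P (alive (τ + i) \ alive (τ + i + 1)) = P (alive τ) := by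
  induction n with
  | zero => simp
  | succ n ih =>
    have h1 := lintegral_alive_succ (P := P) hmeas hanti (t := τ + n) (by omega) 1
    simp only [Pi.one_apply, lintegral_one, Measure.restrict_apply_univ] at h1
    rw [sum_range_succ, ← ih, h1]
    rw [show τ + (n + 1) = τ + n + 1 from rfl]
    ring

/-- If `V ≤ s` throughout, the final value of `V` contributes at most `s`. -/
theorem final_le {s : ℝ≥0∞} (hV : ∀ t ω, V t ω ≤ s) (n : ℕ) : ∫⁻ ω in alive (τ + n), V (τ + n) ω ∂P
        + ∑ i ∈ range n, ∫⁻ ω in alive (τ + i) \ alive (τ + i + 1), V (τ + i + 1) ω ∂P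
      ≤ s * P (alive τ) := by
  rw [← measure_alive_add hmeas hanti n, mul_add, mul_sum]
  refine add_le_add ?_ (sum_le_sum fun i _ => ?_)
  · exact (lintegral_mono fun ω => hV _ ω).trans (setLIntegral_const _ _).le
  · exact (lintegral_mono fun ω => hV _ ω).trans (setLIntegral_const _ _).le

end

/-! ### Wald's identity -/

section
variable {Ω : Type*} [mΩ : MeasurableSpace Ω] {ℱ : ℕ → MeasurableSpace Ω} {P : Measure Ω}
  {X : ℕ → Ω → ℝ} {π : Measure ℝ} {τ : ℕ}

theorem IIDSteps.integral_indicator_step (h : IIDSteps ℱ P X π τ) (ht : τ ≤ t) {A : Set Ω}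
    (hA : MeasurableSet[ℱ t] A) (hπ : Integrable (fun x => x) π) :
    Integrable (A.indicator (X t)) P ∧ ∫ ω, A.indicator (X t) ω ∂P = P.real A * ∫ x, x ∂π ∧
      ∫ ω, ‖A.indicator (X t) ω‖ ∂P = P.real A * ∫ x, |x| ∂π := by
  have := h.prob
  have hA' : MeasurableSet A := h.le t _ hA
  have hX := h.measurable t
  have hmap : (P.restrict A).map (X t) = P A • π := by
    ext C hC
    rw [map_apply hX hC, restrict_apply (hX hC), Set.inter_comm, h.law t ht A hA C hC]; rfl
  have hi : Integrable (X t) (P.restrict A) := by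
    have h1 : Integrable (fun x => x) ((P.restrict A).map (X t)) := by
      rw [hmap]; exact hπ.smul_measure (measure_ne_top _ _)
    exact h1.comp_measurable hX
  refine ⟨(integrable_indicator_iff hA').mpr hi, ?_, ?_⟩
  · have h2 := integral_map (μ := P.restrict A) hX.aemeasurable (f := fun x => x) (by fun_prop)
    rw [integral_indicator hA', ← h2, hmap, integral_smul_measure]; rfl
  · have h2 := integral_map (μ := P.restrict A) hX.aemeasurable (f := fun x => |x|) (by fun_prop)
    simp_rw [norm_indicator_eq_indicator_norm, Real.norm_eq_abs]
    rw [integral_indicator hA', ← h2, hmap, integral_smul_measure]; rfl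

/-- Wald's identity, for the sum of the steps from time `τ` up to a stopping time `T` with finite
mean, on an event `A` of the past. -/
theorem IIDSteps.wald (h : IIDSteps ℱ P X π τ) (hπ : Integrable (fun x => x) π) {T : Ω → ℕ∞}
    (hT : ∀ t, MeasurableSet[ℱ t] {ω | (t : ℕ∞) < T ω}) {A : Set Ω} (hA : MeasurableSet[ℱ τ] A)
    (hfin : ∑' i, P (A ∩ {ω | ((τ + i : ℕ) : ℕ∞) < T ω}) ≠ ∞) {U : ℕ → Ω → ℝ}
    (hU : ∀ t ω, U (t + 1) ω = U t ω + X t ω) :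
    (∀ᵐ ω ∂P, ω ∈ A → T ω ≠ ⊤) ∧
    IntegrableOn ({ω | (τ : ℕ∞) < T ω}.indicator fun ω => U (T ω).toNat ω - U τ ω) A P ∧
    ∫ ω in A, {ω | (τ : ℕ∞) < T ω}.indicator (fun ω => U (T ω).toNat ω - U τ ω) ω ∂P
      = (∑' i, P (A ∩ {ω | ((τ + i : ℕ) : ℕ∞) < T ω})).toReal * ∫ x, x ∂π := by
  have := h.prob
  set S : ℕ → Set Ω := fun i => A ∩ {ω | ((τ + i : ℕ) : ℕ∞) < T ω} with hS
  have hSm (i : ℕ) : MeasurableSet[ℱ (τ + i)] (S i) :=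
    MeasurableSet.inter (h.mono (Nat.le_add_right _ _) _ hA) (hT _)
  have hA' : MeasurableSet A := h.le _ _ hA
  have hae : ∀ᵐ ω ∂P, ω ∈ A → T ω ≠ ⊤ := by
    have h1 := ENNReal.tendsto_atTop_zero_of_tsum_ne_top hfin
    have h2 : P {ω | ω ∈ A ∧ T ω = ⊤} = 0 := by
      refine le_antisymm (ge_of_tendsto' h1 fun i => measure_mono ?_) (zero_le)
      rintro ω ⟨h3, h4⟩
      exact ⟨h3, by simp [h4]⟩
    rw [ae_iff]
    convert h2 using 2
    ext ω; simp
  set f : ℕ → Ω → ℝ := fun i => (S i).indicator (X (τ + i))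
  have hI (i : ℕ) := h.integral_indicator_step (t := τ + i) (Nat.le_add_right _ _) (hSm i) hπ
  have hsum : Summable fun i => ∫ ω, ‖f i ω‖ ∂P := by
    exact ((ENNReal.summable_toReal hfin).mul_right _).congr fun i => (hI i).2.2.symm
  have h1 := hasSum_integral_of_summable_integral_norm (fun i => (hI i).1) hsum
  have h2 : ∀ᵐ ω ∂P, ∑' i, f i ω
      = A.indicator ({ω | (τ : ℕ∞) < T ω}.indicator fun ω => U (T ω).toNat ω - U τ ω) ω := by
    filter_upwards [hae] with ω hω
    by_cases hωA : ω ∈ A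
    swap
    · rw [indicator_of_notMem hωA]
      convert tsum_zero with i
      exact indicator_of_notMem (fun h => hωA h.1) _
    obtain ⟨n, hn⟩ := ENat.ne_top_iff_exists.mp (hω hωA)
    rw [indicator_of_mem hωA]
    have hfi (i : ℕ) : f i ω = if τ + i < n then X (τ + i) ω else 0 := by
      have hmem : ω ∈ S i ↔ τ + i < n := by
        rw [hS]
        change (ω ∈ A ∧ ((τ + i : ℕ) : ℕ∞) < T ω) ↔ _
        rw [← hn, Nat.cast_lt]
        exact and_iff_right hωA
      by_cases h5 : τ + i < n
      · rw [if_pos h5]; exact indicator_of_mem (hmem.mpr h5) _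
      · rw [if_neg h5]; exact indicator_of_notMem (fun h6 => h5 (hmem.mp h6)) _
    have htel (j : ℕ) : ∑ i ∈ range j, X (τ + i) ω = U (τ + j) ω - U τ ω := by
      induction j with
      | zero => simp
      | succ j ih => rw [sum_range_succ, ih, ← add_assoc, hU]; ring
    by_cases hτ : τ < n
    · rw [indicator_of_mem (by simpa [← hn] using hτ), ← hn, ENat.toNat_natCast,
        tsum_eq_sum (s := range (n - τ)) (fun i hi => by
          rw [hfi, if_neg]; rw [mem_range] at hi; omega)]
      rw [sum_congr rfl fun i hi => by
        rw [hfi, if_pos (by rw [mem_range] at hi; omega)], htel,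
        Nat.add_sub_cancel' hτ.le]
    · rw [indicator_of_notMem (by simpa [← hn] using hτ)]
      convert tsum_zero with i
      rw [hfi, if_neg (by omega)]
  have h3 : Integrable (fun ω => ∑' i, f i ω) P := by
    have hfm (i : ℕ) : Measurable (f i) := (h.measurable _).indicator (h.le _ _ (hSm i))
    refine ⟨(Measurable.tsum hfm).aestronglyMeasurable, ?_⟩
    calc ∫⁻ ω, ‖∑' i, f i ω‖ₑ ∂P ≤ ∫⁻ ω, ∑' i, ‖f i ω‖ₑ ∂P :=
          lintegral_mono fun ω => enorm_tsum_le_tsum_enorm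
      _ = ∑' i, ofReal (∫ ω, ‖f i ω‖ ∂P) := by
          rw [lintegral_tsum fun i => (hfm i).enorm.aemeasurable]
          exact tsum_congr fun i => (ofReal_integral_norm_eq_lintegral_enorm (hI i).1).symm
      _ < ∞ := hsum.tsum_ofReal_ne_top.lt_top
  refine ⟨hae, (integrable_indicator_iff hA').mp (h3.congr h2), ?_⟩
  rw [← integral_indicator hA', ← integral_congr_ae h2, ← h1.tsum_eq]
  rw [tsum_congr fun i => (hI i).2.1, tsum_mul_right, ENNReal.tsum_toReal_eq (fun i =>
    measure_ne_top _ _)]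
  rfl

end

/-! ### The lower bound for the delay of an arbitrary stopping time -/

section
variable {Ω : Type*}

/-- The exponential of the CUSUM statistic: `r 0 = 0`, `r (t + 1) = max (r t) 1 * exp (X t)`. -/
def expCusum (X : ℕ → Ω → ℝ) : ℕ → Ω → ℝ
  | 0, _ => 0
  | t + 1, ω => max (expCusum X t ω) 1 * exp (X t ω)

theorem expCusum_nonneg (X : ℕ → Ω → ℝ) (t : ℕ) (ω : Ω) : 0 ≤ expCusum X t ω := by
  cases t with
  | zero => exact le_rfl
  | succ t => exact mul_nonneg (le_max_of_le_right zero_le_one) (exp_pos _).le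

theorem sum_expCusum {X U : ℕ → Ω → ℝ} (hU : ∀ t ω, U (t + 1) ω = U t ω + X t ω) (s : ℕ) (ω : Ω) :
    ∑ t ∈ range (s + 1), max (1 - expCusum X t ω) 0 * exp (U s ω - U t ω)
      = max (expCusum X s ω) 1 := by
  induction s with
  | zero => simp [expCusum]
  | succ s ih =>
    have h1 : ∑ t ∈ range (s + 1), max (1 - expCusum X t ω) 0 * exp (U (s + 1) ω - U t ω)
        = expCusum X (s + 1) ω := by
      rw [expCusum, ← ih, Finset.sum_mul]
      refine sum_congr rfl fun t _ => ?_
      rw [mul_assoc, ← exp_add, hU]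
      congr 2; ring
    rw [sum_range_succ, h1, sub_self, exp_zero, mul_one]
    rcases le_total (expCusum X (s + 1) ω) 1 with h | h
    · rw [max_eq_right h, max_eq_left (by linarith)]; ring
    · rw [max_eq_left h, max_eq_right (by linarith)]; ring

variable [mΩ : MeasurableSpace Ω] {ℱ : ℕ → MeasurableSpace Ω} {P : Measure Ω}
  {X U : ℕ → Ω → ℝ} {Q Q₀ : Measure ℝ} {m B : ℝ} {alive : ℕ → Set Ω}

theorem IIDSteps.measurable_expCusum {t₀ : ℕ} (h : IIDSteps ℱ P X Q t₀) (t : ℕ) :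
    Measurable[ℱ t] (expCusum X t) := by
  induction t with
  | zero => exact @measurable_const _ _ _ (ℱ 0) _
  | succ t ih =>
    exact (Measurable.max (ih.mono (h.mono (Nat.le_succ t)) le_rfl) (@measurable_const _ _ _ (ℱ (t
      + 1)) _)).mul
      (Real.measurable_exp.comp (h.meas t))

/-- The expected total weight `∑_{i < n} (1 - r_i)⁺` up to the stopping time. -/
def weight (P : Measure Ω) (X : ℕ → Ω → ℝ) (alive : ℕ → Set Ω) (i : ℕ) : ℝ≥0∞ :=
  ∫⁻ ω in alive i, ofReal (1 - expCusum X i ω) ∂P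

theorem weight_le (i : ℕ) : weight P X alive i ≤ P (alive i) := by
  unfold weight
  refine (lintegral_mono fun ω => ?_).trans (setLIntegral_one _).le
  rw [ofReal_le_one]
  linarith [expCusum_nonneg X i ω]

theorem IIDSteps.expCusum_step (h : IIDSteps ℱ P X Q 0) (hR : StepLaws m B Q Q₀)
    (hal : ∀ t, MeasurableSet[ℱ t] (alive t)) (t : ℕ) :
    ∫⁻ ω in alive t, ofReal (expCusum X (t + 1) ω) ∂P
      = ∫⁻ ω in alive t, ofReal (expCusum X t ω) ∂P + weight P X alive t := by
  have := hR.prob₀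
  have hone : ∫⁻ y, ofReal (exp y) ∂Q = 1 := by
    have := hR.lintegral_exp_mul (f := 1) measurable_one
    simpa using this.symm
  have hm := (h.measurable_expCusum t).mono (h.le t) le_rfl
  have h2 : ∀ ω, ∫⁻ x, ofReal (max (expCusum X t ω) 1 * exp x) ∂Q
      = ofReal (expCusum X t ω) + ofReal (1 - expCusum X t ω) := fun ω => by
    simp_rw [ofReal_mul (le_max_of_le_right zero_le_one)]
    rw [lintegral_const_mul _ (by fun_prop), hone, mul_one]
    rcases le_total (expCusum X t ω) 1 with h3 | h3
    · rw [max_eq_right h3, ← ofReal_add (expCusum_nonneg X t ω) (by linarith)]; congr 1; ring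
    · rw [max_eq_left h3, ofReal_of_nonpos (show 1 - expCusum X t ω ≤ 0 by linarith), add_zero]
  rw [weight, ← lintegral_add_left (by fun_prop)]
  refine Eq.trans ?_ ((h.setLIntegral (Nat.zero_le t) (hal t) (h.measurable_expCusum t) (F := fun r
    x => ofReal (max r 1 * exp x)) (by fun_prop)).trans (lintegral_congr h2))
  rfl

theorem IIDSteps.expCusum_total (h : IIDSteps ℱ P X Q 0) (hR : StepLaws m B Q Q₀)
    (hal : ∀ t, MeasurableSet[ℱ t] (alive t)) (hanti : ∀ t, alive (t + 1) ⊆ alive t) (n : ℕ) :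
    ∫⁻ ω in alive n, ofReal (expCusum X n ω) ∂P + ∑ i ∈ range n, ∫⁻ ω in alive i \ alive (i + 1),
            ofReal (expCusum X (i + 1) ω) ∂P
      = ∑ i ∈ range n, weight P X alive i := by
  have hmeas : ∀ t, 0 ≤ t → MeasurableSet (alive t) := fun t _ => h.le t _ (hal t)
  have hstep := h.expCusum_step hR hal
  have h1 := lyapunov_le (V := fun t ω => ofReal (expCusum X t ω)) (c := 0)
    (d := weight P X alive) (τ := 0) (P := P) hmeas (fun t _ => hanti t)
    (fun t _ => by simpa using (hstep t).le) n
  have h2 := le_lyapunov (V := fun t ω => ofReal (expCusum X t ω)) (c := 0)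
    (d := weight P X alive) (τ := 0) (P := P) hmeas (fun t _ => hanti t)
    (fun t _ => by simpa using (hstep t).ge) n
  simp only [Pi.zero_apply, sum_const_zero, add_zero, zero_add, expCusum,
    ofReal_zero, lintegral_zero] at h1 h2
  exact le_antisymm h1 h2

/-- The false alarm period of a stopping time that waits for the CUSUM statistic to reach `x` is at
least `exp x`. -/
theorem IIDSteps.exp_le_period (h : IIDSteps ℱ P X Q 0) (hR : StepLaws m B Q Q₀)
    (hal : ∀ t, MeasurableSet[ℱ t] (alive t)) (hanti : ∀ t, alive (t + 1) ⊆ alive t)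
    (h0 : alive 0 = univ)
    (hhit : ∀ t ω, ω ∈ alive t → ω ∉ alive (t + 1) → exp x ≤ expCusum X (t + 1) ω)
    (hfin : ∑' i, P (alive i) ≠ ∞) : ofReal (exp x) ≤ ∑' i, P (alive i) := by
  have := h.prob
  have hmeas : ∀ t, 0 ≤ t → MeasurableSet (alive t) := fun t _ => h.le t _ (hal t)
  have key (n : ℕ) : ofReal (exp x) ≤ ofReal (exp x) * P (alive n) + ∑' i, P (alive i) := by
    have h1 := measure_alive_add (P := P) hmeas (fun t _ => hanti t) n
    simp only [zero_add, h0, measure_univ] at h1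
    calc ofReal (exp x) = ofReal (exp x) * P (alive n)
          + ∑ i ∈ range n, ofReal (exp x) * P (alive i \ alive (i + 1)) := by
          rw [← mul_sum, ← mul_add, h1, mul_one]
      _ ≤ ofReal (exp x) * P (alive n) + ∑' i, P (alive i) := by
          refine add_le_add_right ?_ _
          calc _ ≤ ∑ i ∈ range n, ∫⁻ ω in alive i \ alive (i + 1),
                ofReal (expCusum X (i + 1) ω) ∂P := by
                refine sum_le_sum fun i _ => ?_
                rw [← setLIntegral_const]
                refine setLIntegral_mono' ((hmeas i (Nat.zero_le i)).diff
                  (hmeas (i + 1) (Nat.zero_le _))) fun ω hω => ?_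
                exact ofReal_le_ofReal (hhit i ω hω.1 hω.2)
            _ ≤ ∑ i ∈ range n, weight P X alive i := le_trans le_add_self ((h.expCusum_total hR hal
              hanti n).le)
            _ ≤ ∑ i ∈ range n, P (alive i) := sum_le_sum fun i _ => weight_le i
            _ ≤ _ := sum_le_tsum _
  have h3 := (ENNReal.Tendsto.const_mul (ENNReal.tendsto_atTop_zero_of_tsum_ne_top hfin) (Or.inr
    (ofReal_ne_top
    (r := exp x)))).add_const (∑' i, P (alive i))
  rw [mul_zero, zero_add] at h3
  exact ge_of_tendsto' h3 key

/-- The stopping time is short if the expected weight is small. -/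
theorem IIDSteps.period_le_weight (h : IIDSteps ℱ P X Q 0) (hR : StepLaws m B Q Q₀)
    (hal : ∀ t, MeasurableSet[ℱ t] (alive t)) (hanti : ∀ t, alive (t + 1) ⊆ alive t) :
    ofReal ((∫ x, -x ∂Q) / 2) * ∑' i, P (alive i)
      ≤ ofReal (1 + B / (2 * m)) * ∑' i, weight P X alive i := by
  have := hR.prob
  have hm := hR.m_pos
  have hB := hR.B_pos
  set A := B / (2 * m) with hA
  have hA0 : 0 < A := by positivity
  set μ := ∫ x, -x ∂Q with hμ
  have hμm : m ≤ μ := hR.mean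
  have hmeas : ∀ t, 0 ≤ t → MeasurableSet (alive t) := fun t _ => h.le t _ (hal t)
  -- the mean of a step truncated at `-A`
  have hint : Integrable (fun x => x + x ^ 2 / (4 * A)) Q := hR.int1.add (hR.int2.div_const _)
  have hmean : ∫ x, (x + x ^ 2 / (4 * A)) ∂Q ≤ -(μ / 2) := by
    rw [integral_add hR.int1 (hR.int2.div_const _), integral_div]
    have h1 : (∫ x, x ^ 2 ∂Q) / (4 * A) ≤ m / 2 := by
      rw [div_le_iff₀ (by positivity)]
      refine hR.second.trans (le_of_eq ?_)
      rw [hA]; field_simp; ring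
    have h2 : ∫ x, x ∂Q = -μ := by rw [hμ, integral_neg, neg_neg]
    linarith
  have hpt (l x : ℝ) (hl : 0 ≤ l) : max (l + x) (-A) + A ≤ l + A + (x + x ^ 2 / (4 * A)) := by
    have h1 : 0 ≤ (x + 2 * A) ^ 2 / (4 * A) := by positivity
    have h2 : (x + 2 * A) ^ 2 / (4 * A) = x ^ 2 / (4 * A) + x + A := by field_simp; ring
    have h3 : 0 ≤ x ^ 2 / (4 * A) := by positivity
    rcases max_cases (l + x) (-A) with h | h <;> linarith
  set ψ : ℝ → ℝ := fun r => A + log (max r (exp (-A))) with hψ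
  have hψ0 (r : ℝ) : 0 ≤ ψ r := by
    have h1 : log (exp (-A)) ≤ log (max r (exp (-A))) :=
      log_le_log (exp_pos _) (le_max_right _ _)
    rw [log_exp] at h1
    simp only [hψ]; linarith
  have hstep1 (r : ℝ) (hr : 0 ≤ r) : ∫⁻ x, ofReal (ψ (max r 1 * exp x)) ∂Q + ofReal (μ / 2)
        ≤ ofReal (ψ r) + ofReal (1 + A) * ofReal (1 - r) := by
    set l := log (max r 1) with hl
    have hl0 : 0 ≤ l := log_nonneg (le_max_right _ _)
    have e1 (x : ℝ) : ψ (max r 1 * exp x) = max (l + x) (-A) + A := by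
      simp only [hψ]
      have : max r 1 * exp x = exp (l + x) := by rw [exp_add, hl, exp_log (lt_max_of_lt_right
        zero_lt_one)]
      rw [this, ← Real.exp_monotone.map_max, log_exp, add_comm]
    have hnn (x : ℝ) : 0 ≤ l + A + (x + x ^ 2 / (4 * A)) := by
      refine le_trans ?_ (hpt l x hl0)
      linarith [le_max_right (l + x) (-A)]
    have e2 : ∫⁻ x, ofReal (ψ (max r 1 * exp x)) ∂Q ≤ ofReal (l + A - μ / 2) := by
      calc _ ≤ ∫⁻ x, ofReal (l + A + (x + x ^ 2 / (4 * A))) ∂Q :=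
            lintegral_mono fun x => ofReal_le_ofReal (by rw [e1]; exact hpt l x hl0)
        _ = ofReal (∫ x, (l + A + (x + x ^ 2 / (4 * A))) ∂Q) :=
            (ofReal_integral_eq_lintegral_ofReal ((integrable_const _).add hint) (.of_forall
              hnn)).symm
        _ ≤ _ := by
            refine ofReal_le_ofReal ?_
            rw [integral_add (integrable_const _) hint]
            simp only [integral_const, probReal_univ, smul_eq_mul, one_mul]
            linarith
    have hneg : 0 ≤ l + A - μ / 2 := by
      have h3 : 0 ≤ ∫ x, (l + A + (x + x ^ 2 / (4 * A))) ∂Q := integral_nonneg hnn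
      rw [integral_add (integrable_const _) hint] at h3
      simp only [integral_const, probReal_univ, smul_eq_mul, one_mul] at h3
      linarith
    refine (add_le_add_left e2 _).trans ?_
    rw [← ofReal_add hneg (by linarith), sub_add_cancel]
    rcases le_or_gt 1 r with h1 | h1
    · refine le_add_of_le_of_nonneg (ofReal_le_ofReal ?_) (zero_le)
      simp only [hψ]
      rw [hl, max_eq_left h1, max_eq_left]
      · linarith
      · exact (exp_le_one_iff.mpr (by linarith)).trans h1
    · rw [← ofReal_mul (by linarith), ← ofReal_add (hψ0 r) (mul_nonneg (by linarith) (by linarith))]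
      refine ofReal_le_ofReal ?_
      have e3 : l = 0 := by rw [hl, max_eq_right h1.le, Real.log_one]
      rw [e3]
      simp only [hψ]
      set s := max r (exp (-A))
      have hs1 : s ≤ 1 := max_le h1.le (exp_le_one_iff.mpr (by linarith))
      set z := -log s with hz
      have hzA : z ≤ A := by
        have h2 : log (exp (-A)) ≤ log s := log_le_log (exp_pos _) (le_max_right _ _)
        rw [log_exp] at h2; linarith
      have hsz : s = exp (-z) := by rw [hz, neg_neg, exp_log (lt_max_of_lt_right (exp_pos _))]
      have h4 : s * (1 + z) ≤ 1 := by
        rw [hsz]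
        have h5 := Real.add_one_le_exp z
        have h6 : exp (-z) * exp z = 1 := by rw [← exp_add]; simp
        nlinarith [exp_pos (-z)]
      have h7 : z ≤ (1 + A) * (1 - s) := by nlinarith
      have h8 : (1 + A) * (1 - s) ≤ (1 + A) * (1 - r) :=
        mul_le_mul_of_nonneg_left (by linarith [le_max_left r (exp (-A))]) (by linarith)
      linarith
  have hstep (t : ℕ) : ∫⁻ ω in alive t, ofReal (ψ (expCusum X (t + 1) ω)) ∂P
        + ofReal (μ / 2) * P (alive t)
      ≤ ∫⁻ ω in alive t, ofReal (ψ (expCusum X t ω)) ∂P + ofReal (1 + A) * weight P X alive t := by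
    have hme := (h.measurable_expCusum t).mono (h.le t) le_rfl
    have h1 := h.setLIntegral (Nat.zero_le t) (hal t) (h.measurable_expCusum t)
      (F := fun r x => ofReal (ψ (max r 1 * exp x))) (by fun_prop)
    have h2 : ∫⁻ ω in alive t, ofReal (ψ (expCusum X (t + 1) ω)) ∂P = _ := h1
    rw [h2, ← setLIntegral_const, ← lintegral_add_right _ measurable_const, weight,
      ← lintegral_const_mul _ (by fun_prop), ← lintegral_add_left (by fun_prop)]
    exact lintegral_mono fun ω => hstep1 _ (expCusum_nonneg X t ω)
  have key (n : ℕ) : ∑ i ∈ range n, ofReal (μ / 2) * P (alive i)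
      ≤ ofReal (1 + A) * ∑' i, weight P X alive i := by
    have h1 := lyapunov_le (V := fun t ω => ofReal (ψ (expCusum X t ω)))
      (c := fun t => ofReal (μ / 2) * P (alive t))
      (d := fun t => ofReal (1 + A) * weight P X alive t) (τ := 0) (P := P) hmeas
      (fun t _ => hanti t) (fun t _ => hstep t) n
    have e0 : ψ 0 = 0 := by simp only [hψ]; rw [max_eq_right (exp_pos _).le, log_exp]; ring
    simp only [zero_add, expCusum, e0, ofReal_zero, lintegral_zero] at h1
    refine le_trans (le_trans le_add_self h1) ?_
    rw [← mul_sum]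
    exact mul_le_mul_right (sum_le_tsum _) _
  rw [← ENNReal.tsum_mul_left]
  exact tsum_le_of_sum_range_le key

/-- The relative entropy accumulated by the CUSUM statistic. -/
theorem IIDSteps.log_mul_weight_le (h : IIDSteps ℱ P X Q 0) (hR : StepLaws m B Q Q₀)
    (hal : ∀ t, MeasurableSet[ℱ t] (alive t)) (hanti : ∀ t, alive (t + 1) ⊆ alive t) {c : ℝ}
    (hc : 1 ≤ c) (n : ℕ) :
    ofReal (log c) * ∑ i ∈ range n, weight P X alive i ≤ ofReal (c - 1) + ∑ i ∈ range n,
          ∫⁻ ω in alive i, ofReal ((∫ x, x ∂Q₀) * max (expCusum X i ω) 1) ∂P := by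
  have := hR.prob
  have := hR.prob₀
  have := h.prob
  have hm := hR.m_pos
  have hlogc : 0 ≤ log c := log_nonneg hc
  set μ := ∫ x, x ∂Q₀ with hμ
  have hmeas : ∀ t, 0 ≤ t → MeasurableSet (alive t) := fun t _ => h.le t _ (hal t)
  set Φ : ℝ → ℝ := fun r => max r 1 * log (max r 1) - max r 1 + c with hΦ
  have hkl (y : ℝ) (hy : 0 < y) : y * log c - c ≤ y * log y - y := by
    have h1 := Real.log_le_sub_one_of_pos (div_pos (by linarith : 0 < c) hy)
    rw [Real.log_div (by linarith) hy.ne'] at h1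
    have h2 := mul_le_mul_of_nonneg_left h1 hy.le
    have h3 : y * (c / y - 1) = c - y := by field_simp
    linarith
  have hkl1 (y : ℝ) (hy : 0 < y) : -1 ≤ y * log y - y := by
    have h1 := Real.log_le_sub_one_of_pos (inv_pos.mpr hy)
    rw [log_inv] at h1
    have h2 := mul_le_mul_of_nonneg_left h1 hy.le
    have h3 : y * (y⁻¹ - 1) = 1 - y := by field_simp
    linarith
  have hge (r : ℝ) : log c * r ≤ Φ r := by
    simp only [hΦ]
    have hM : 0 < max r 1 := lt_max_of_lt_right zero_lt_one
    have h1 := hkl _ hM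
    have h2 : log c * r ≤ log c * max r 1 := mul_le_mul_of_nonneg_left (le_max_left _ _) hlogc
    linarith
  have hle (r : ℝ) (hr : 0 < r) : Φ r ≤ r * log r - r + c := by
    simp only [hΦ]
    rcases le_total r 1 with h1 | h1
    · rw [max_eq_right h1]
      have := hkl1 r hr
      simp; linarith
    · rw [max_eq_left h1]
  have hexp : Integrable (fun x => exp x) Q ∧ ∫ x, exp x ∂Q = 1 := by
    have hone : ∫⁻ y, ofReal (exp y) ∂Q = 1 := by
      have := hR.lintegral_exp_mul (f := 1) measurable_one
      simpa using this.symm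
    have hi : Integrable (fun x => exp x) Q := by
      refine ⟨by fun_prop, ?_⟩
      rw [hasFiniteIntegral_iff_ofReal (.of_forall fun x => (exp_pos x).le), hone]
      exact ENNReal.one_lt_top
    refine ⟨hi, ?_⟩
    rw [integral_eq_lintegral_of_nonneg_ae (.of_forall fun x => (exp_pos x).le) (by fun_prop),
      hone]; simp
  have hxexp : Integrable (fun x => exp x * x) Q ∧ ∫ x, exp x * x ∂Q = μ := by
    have hR' := hR.int1₀
    have hfm : Measurable fun y : ℝ => ofReal (exp y) := by fun_prop
    rw [hR.tilt, integrable_withDensity_iff_integrable_smul' hfm (by simp)] at hR'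
    have e : ∀ x : ℝ, (ofReal (exp x)).toReal • x = exp x * x := fun x => by
      rw [ENNReal.toReal_ofReal (exp_pos x).le, smul_eq_mul]
    simp_rw [e] at hR'
    refine ⟨hR', ?_⟩
    rw [hμ, hR.tilt, integral_withDensity_eq_integral_toReal_smul hfm (by simp)]
    simp_rw [e]
  have hstep1 (r : ℝ) : ∫⁻ x, ofReal (Φ (max r 1 * exp x)) ∂Q
      ≤ ofReal (Φ r) + ofReal (μ * max r 1) := by
    set M := max r 1 with hM
    have hM0 : 0 < M := lt_max_of_lt_right zero_lt_one
    have e1 (x : ℝ) : (M * exp x) * log (M * exp x) - M * exp x + c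
        = (M * log M - M) * exp x + M * (exp x * x) + c := by
      rw [log_mul hM0.ne' (exp_pos x).ne', log_exp]; ring
    have hi1 : Integrable (fun x => (M * log M - M) * exp x) Q := hexp.1.const_mul _
    have hi2 : Integrable (fun x => M * (exp x * x)) Q := hxexp.1.const_mul _
    have hi12 : Integrable (fun x => (M * log M - M) * exp x + M * (exp x * x)) Q := hi1.add hi2
    have hi : Integrable (fun x => (M * log M - M) * exp x
      + M * (exp x * x) + c) Q := hi12.add (integrable_const _)
    calc _ ≤ ∫⁻ x, ofReal ((M * log M - M) * exp x + M * (exp x * x) + c) ∂Q := by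
          refine lintegral_mono fun x => ofReal_le_ofReal ?_
          rw [← e1]; exact hle _ (mul_pos hM0 (exp_pos x))
      _ = ofReal (∫ x, ((M * log M - M) * exp x + M * (exp x * x) + c) ∂Q) := by
          refine (ofReal_integral_eq_lintegral_ofReal hi (.of_forall fun x => ?_)).symm
          change 0 ≤ (M * log M - M) * exp x + M * (exp x * x) + c
          rw [← e1]
          linarith [hkl1 (M * exp x) (mul_pos hM0 (exp_pos x))]
      _ = ofReal (Φ r + μ * M) := by
          rw [integral_add hi12 (integrable_const _), integral_add hi1 hi2, integral_const_mul,
            integral_const_mul, hexp.2, hxexp.2]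
          simp only [integral_const, probReal_univ, smul_eq_mul, one_mul, hΦ]
          rw [← hM]
          congr 1; ring
      _ ≤ _ := ENNReal.ofReal_add_le
  have hstep (t : ℕ) : ∫⁻ ω in alive t, ofReal (Φ (expCusum X (t + 1) ω)) ∂P + 0
      ≤ ∫⁻ ω in alive t, ofReal (Φ (expCusum X t ω)) ∂P
        + ∫⁻ ω in alive t, ofReal (μ * max (expCusum X t ω) 1) ∂P := by
    have hme : Measurable (expCusum X t) := (h.measurable_expCusum t).mono (h.le t) le_rfl
    have h1 := h.setLIntegral (Nat.zero_le t) (hal t) (h.measurable_expCusum t)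
      (F := fun r x => ofReal (Φ (max r 1 * exp x))) (by fun_prop)
    have h2 : ∫⁻ ω in alive t, ofReal (Φ (expCusum X (t + 1) ω)) ∂P = _ := h1
    rw [add_zero, h2, ← lintegral_add_left (by fun_prop)]
    exact lintegral_mono fun ω => hstep1 _
  have h1 := lyapunov_le (V := fun t ω => ofReal (Φ (expCusum X t ω))) (c := 0)
      (d := fun t => ∫⁻ ω in alive t, ofReal (μ * max (expCusum X t ω) 1) ∂P)
      (τ := 0) (P := P) hmeas (fun t _ => hanti t) (fun t _ => hstep t) n
  simp only [zero_add, Pi.zero_apply, sum_const_zero, add_zero] at h1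
  have hrhs : ∫⁻ ω in alive 0, ofReal (Φ (expCusum X 0 ω)) ∂P ≤ ofReal (c - 1) := by
    have e0 : Φ 0 = c - 1 := by simp [hΦ]; ring
    simp only [expCusum, e0]
    rw [setLIntegral_const]
    exact mul_le_of_le_one_right (zero_le) prob_le_one
  refine le_trans ?_ (h1.trans (add_le_add_left hrhs _))
  rw [← h.expCusum_total hR hal hanti n, mul_add, mul_sum]
  have hV (t : ℕ) (S : Set Ω) : ofReal (log c) * ∫⁻ ω in S, ofReal (expCusum X t ω) ∂P
        ≤ ∫⁻ ω in S, ofReal (Φ (expCusum X t ω)) ∂P := by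
    have hme : Measurable (expCusum X t) := (h.measurable_expCusum t).mono (h.le t) le_rfl
    rw [← lintegral_const_mul _ (by fun_prop)]
    refine lintegral_mono fun ω => ?_
    rw [← ofReal_mul hlogc]
    exact ofReal_le_ofReal (hge _)
  exact add_le_add (hV _ _) (sum_le_sum fun i _ => hV _ _)

/-- A conditional bound, stated on the events of the past, extends to the weights that depend on
the past. -/
theorem lintegral_weight_le {Ω : Type*} {𝒢 mΩ : MeasurableSpace Ω} {P : Measure[mΩ] Ω} (h𝒢 : 𝒢 ≤
  mΩ) {S : ℕ → Set Ω} {S' : Set Ω}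
    {g : ℕ → Ω → ℝ≥0∞}
    (hg : ∀ i, Measurable (g i)) {J : ℝ≥0∞}
    (h : ∀ A, MeasurableSet[𝒢] A → ∑' i, ∫⁻ ω in A ∩ S i, g i ω ∂P ≤ J * P (A ∩ S'))
    {w : Ω → ℝ≥0∞} (hw : Measurable[𝒢] w) :
    ∑' i, ∫⁻ ω in S i, g i ω * w ω ∂P ≤ J * ∫⁻ ω in S', w ω ∂P := by
  set μ₁ : Measure Ω := Measure.sum fun i => (P.restrict (S i)).withDensity (g i)
  set μ₂ : Measure Ω := J • P.restrict S'
  have hle : μ₁.trim h𝒢 ≤ μ₂.trim h𝒢 := by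
    refine Measure.le_iff.mpr fun A hA => ?_
    have hA' := h𝒢 _ hA
    rw [trim_measurableSet_eq h𝒢 hA, trim_measurableSet_eq h𝒢 hA, Measure.sum_apply _ hA',
      Measure.smul_apply, restrict_apply hA', smul_eq_mul]
    refine le_trans (le_of_eq (tsum_congr fun i => ?_)) (h A hA)
    rw [withDensity_apply _ hA', restrict_restrict hA']
  have h1 := lintegral_mono' hle (le_refl w)
  rw [lintegral_trim h𝒢 hw, lintegral_trim h𝒢 hw, lintegral_sum_measure, lintegral_smul_measure,
    smul_eq_mul] at h1
  refine le_trans (le_of_eq (tsum_congr fun i => ?_)) h1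
  rw [lintegral_withDensity_eq_lintegral_mul _ (hg i) (hw.mono h𝒢 le_rfl)]
  rfl

/-- The expected relative entropy is controlled by the worst conditional delay `J`. -/
theorem IIDSteps.entropy_le {t₀ : ℕ} (h : IIDSteps ℱ P X Q t₀)
    (hal : ∀ t, MeasurableSet[ℱ t] (alive t)) (hUm : ∀ t, Measurable[ℱ t] (U t))
    (hU : ∀ t ω, U (t + 1) ω = U t ω + X t ω) {J μ : ℝ} (hμ : 0 ≤ μ)
    (hJ : ∀ t, ∀ A, MeasurableSet[ℱ t] A →
      ∑' i, ∫⁻ ω in A ∩ alive (t + i), ofReal (μ * exp (U (t + i) ω - U t ω)) ∂P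
        ≤ ofReal J * P (A ∩ alive t)) (n : ℕ) :
    ∑ s ∈ range n, ∫⁻ ω in alive s, ofReal (μ * max (expCusum X s ω) 1) ∂P
      ≤ ofReal J * ∑ t ∈ range n, weight P X alive t := by
  have hUm' (t : ℕ) : Measurable (U t) := (hUm t).mono (h.le t) le_rfl
  have hrm (t : ℕ) := h.measurable_expCusum t
  have hrm' (t : ℕ) : Measurable (expCusum X t) := (hrm t).mono (h.le t) le_rfl
  have h1 (t : ℕ) : ∑' i, ∫⁻ ω in alive (t + i), ofReal
        (μ * exp (U (t + i) ω - U t ω)) * ofReal (1 - expCusum X t ω) ∂P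
      ≤ ofReal J * weight P X alive t := by
    refine lintegral_weight_le (h.le t) (fun i => ?_) (hJ t) ?_
    · have := hUm' t; have := hUm' (t + i); fun_prop
    · exact ENNReal.measurable_ofReal.comp ((@measurable_const _ _ _ (ℱ t) _).sub (hrm t))
  have h2 (s : ℕ) : ∫⁻ ω in alive s, ofReal (μ * max (expCusum X s ω) 1) ∂P
      = ∑ t ∈ range (s + 1), ∫⁻ ω in alive s, ofReal
        (μ * exp (U s ω - U t ω)) * ofReal (1 - expCusum X t ω) ∂P := by
    rw [← lintegral_finsetSum]
    · refine lintegral_congr fun ω => ?_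
      rw [← sum_expCusum hU s ω, mul_sum, ENNReal.ofReal_sum_of_nonneg fun t _ => by positivity]
      refine sum_congr rfl fun t _ => ?_
      have e : ofReal (1 - expCusum X t ω) = ofReal (max (1 - expCusum X t ω) 0) := by
        rcases max_cases (1 - expCusum X t ω) 0 with h | h
        · rw [h.1]
        · rw [h.1, ofReal_of_nonpos h.2.le, ofReal_zero]
      rw [e, ← ofReal_mul₀]
      congr 1; ring
    · intro t _
      have := hUm' t; have := hUm' s; have := hrm' t; fun_prop
  simp_rw [h2]
  rw [Finset.sum_comm' (t' := range n) (s' := fun t => Ico t n) (by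
    intro x y; simp only [mem_range, mem_Ico]; omega), mul_sum]
  refine sum_le_sum fun t _ => ?_
  rw [Finset.sum_Ico_eq_sum_range]
  exact (sum_le_tsum _).trans (h1 t)

/-- The lower bound for the delay of a stopping time with a given false alarm period. -/
theorem IIDSteps.log_period_le (h : IIDSteps ℱ P X Q 0) (hQ : StepLaws m B Q Q₀)
    (hal : ∀ t, MeasurableSet[ℱ t] (alive t)) (hanti : ∀ t, alive (t + 1) ⊆ alive t)
    (h0 : alive 0 = univ) (hfin : ∑' i, P (alive i) ≠ ∞) (hUm : ∀ t, Measurable[ℱ t] (U t))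
    (hU : ∀ t ω, U (t + 1) ω = U t ω + X t ω) {J : ℝ} (hJ0 : 0 ≤ J)
    (hJ : ∀ t, ∀ A, MeasurableSet[ℱ t] A → ∑' i, ∫⁻ ω in A ∩ alive (t + i),
        ofReal ((∫ x, x ∂Q₀) * exp (U (t + i) ω - U t ω)) ∂P
        ≤ ofReal J * P (A ∩ alive t)) :
    log ((∑' i, P (alive i)).toReal * ∫ x, -x ∂Q) ≤ J + 1 + log (2 * (1 + B / (2 * m))) := by
  have := h.prob
  have hm := hQ.m_pos
  have hB := hQ.B_pos
  set W := ∑' i, weight P X alive i with hW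
  have hw0 : weight P X alive 0 = 1 := by simp [weight, expCusum, h0]
  have hW1 : 1 ≤ W := hw0 ▸ ENNReal.le_tsum 0
  set c := W.toReal
  have hWc : W = ofReal c := (ofReal_toReal (ne_top_of_le_ne_top hfin (tsum_le_tsum fun i =>
    weight_le i))).symm
  have hc1 : 1 ≤ c := by
    rw [hWc, ← ofReal_one, ofReal_le_ofReal_iff toReal_nonneg] at hW1
    exact hW1
  have key : ofReal (log c) * W ≤ ofReal (c - 1) + ofReal J * W := by
    rw [hW, ← ENNReal.tsum_mul_left]
    refine tsum_le_of_sum_range_le fun n => ?_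
    rw [← mul_sum]
    refine (h.log_mul_weight_le hQ hal hanti hc1 n).trans (add_le_add_right ?_ _)
    refine (h.entropy_le hal hUm hU (hm.trans_le hQ.mean₀).le hJ n).trans ?_
    exact mul_le_mul_right (sum_le_tsum _) _
  have hlog : log c ≤ J + 1 := by
    rw [hWc, ← ofReal_mul (log_nonneg hc1), ← ofReal_mul hJ0,
      ← ofReal_add (by linarith) (by positivity),
      ofReal_le_ofReal_iff (by nlinarith)] at key
    by_contra hlt
    push Not at hlt
    nlinarith
  have hper := h.period_le_weight hQ hal hanti
  set S := ∑' i, P (alive i)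
  have hS1 : 1 ≤ S := by
    have : P (alive 0) = 1 := by rw [h0, measure_univ]
    exact this ▸ ENNReal.le_tsum 0
  have hSc := (ofReal_toReal hfin).symm
  have hSr : 1 ≤ S.toReal := by
    rw [hSc, ← ofReal_one, ofReal_le_ofReal_iff toReal_nonneg] at hS1
    exact hS1
  have hμ := hm.trans_le hQ.mean
  change ofReal _ * S ≤ ofReal _ * W at hper
  rw [hSc, hWc, ← ofReal_mul (by linarith), ← ofReal_mul₀,
    ofReal_le_ofReal_iff (by positivity)] at hper
  calc log (S.toReal * ∫ x, -x ∂Q) ≤ log (2 * (1 + B / (2 * m)) * c) :=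
        log_le_log (by positivity) (by linarith)
    _ = log (2 * (1 + B / (2 * m))) + log c := by rw [log_mul (by positivity) (by positivity)]
    _ ≤ _ := by linarith

/-! ### Upper bounds for the delay -/

/-- If a stopping time can only be exceeded, once the flag `st` is set, while the process `w` is
nonnegative, where `w` moves by `-X + loss`, then the expected time spent with the flag set is
controlled by the initial value of `w` and the expected total `loss`. -/
theorem IIDSteps.drift_bound {τ : ℕ} (h : IIDSteps ℱ P X Q₀ τ) (hQ : PosDrift Q₀)
    {st : ℕ → Set Ω} {w loss : ℕ → Ω → ℝ}
    (hal : ∀ t, τ ≤ t → MeasurableSet[ℱ t] (alive t))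
    (hanti : ∀ t, τ ≤ t → alive (t + 1) ⊆ alive t)
    (hst : ∀ t, τ ≤ t → MeasurableSet[ℱ t] (st t)) (hw : ∀ t, τ ≤ t → Measurable[ℱ t] (w t))
    (hloss : ∀ t, Measurable (loss t)) (hloss0 : ∀ t ω, 0 ≤ loss t ω)
    (hpos : ∀ t ω, τ ≤ t → ω ∈ alive t → ω ∈ st t → 0 ≤ w t ω)
    (hstep : ∀ t ω, τ ≤ t → ω ∈ st t → w (t + 1) ω = w t ω - X t ω + loss t ω)
    (hhalt : ∀ t ω, τ ≤ t → ω ∉ st t → w (t + 1) ω = w t ω) (n : ℕ) :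
    ∑ i ∈ range n, ofReal (∫ x, x ∂Q₀) * P (alive (τ + i) ∩ st (τ + i))
      ≤ ∫⁻ ω in alive τ, ofReal (driftFn Q₀ (w τ ω) + spread Q₀) ∂P + ∑ i ∈ range n,
          2 * ∫⁻ ω in alive (τ + i) ∩ st (τ + i), ofReal (loss (τ + i) ω) ∂P := by
  have := h.prob_step
  have hal' : ∀ t, τ ≤ t → MeasurableSet (alive t) := fun t ht => h.le t _ (hal t ht)
  have hst' : ∀ t, τ ≤ t → MeasurableSet (st t) := fun t ht => h.le t _ (hst t ht)
  have hH := hQ.measurable_driftFn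
  set H := driftFn Q₀
  set s := spread Q₀
  set μ := ∫ x, x ∂Q₀
  have hH0 (x : ℝ) : 0 ≤ H x + s := by linarith [hQ.neg_spread_le_driftFn x]
  have hone (x : ℝ) (hx : 0 ≤ x) :
      ∫⁻ y, ofReal (H (x - y) + s) ∂Q₀ + ofReal μ ≤ ofReal (H x + s) := by
    have hi : Integrable (fun y => H (x - y) + s) Q₀ :=
      (hQ.integrable_driftFn x).add (integrable_const _)
    rw [← ofReal_integral_eq_lintegral_ofReal hi (.of_forall fun y => hH0 _),
      ← ofReal_add (integral_nonneg fun y => hH0 _) hQ.mean_pos.le]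
    refine ofReal_le_ofReal ?_
    rw [integral_add (hQ.integrable_driftFn x) (integrable_const _)]
    have := hQ.integral_driftFn_le hx
    simp only [integral_const, probReal_univ, smul_eq_mul, one_mul]
    linarith
  have hmain := lyapunov_le (P := P) (alive := alive) (τ := τ)
    (V := fun t ω => ofReal (H (w t ω) + s))
    (c := fun t => ofReal μ * P (alive t ∩ st t))
    (d := fun t => 2 * ∫⁻ ω in alive t ∩ st t, ofReal (loss t ω) ∂P) hal' hanti
    (fun t ht => by
      rw [← lintegral_inter_add_sdiff (fun ω => ofReal (H (w (t + 1) ω) + s)) (alive t) (hst' t ht),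
        ← lintegral_inter_add_sdiff (fun ω => ofReal (H (w t ω) + s)) (alive t) (hst' t ht)]
      have e1 : ∫⁻ ω in alive t \ st t, ofReal (H (w (t + 1) ω) + s) ∂P
          = ∫⁻ ω in alive t \ st t, ofReal (H (w t ω) + s) ∂P :=
        setLIntegral_congr_fun ((hal' t ht).diff (hst' t ht)) fun ω hω => by
          simp only [hhalt t ω ht hω.2]
      have e2 : ∫⁻ ω in alive t ∩ st t, ofReal (H (w (t + 1) ω) + s) ∂P
          ≤ ∫⁻ ω in alive t ∩ st t, ofReal (H (w t ω - X t ω) + s) ∂P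
            + 2 * ∫⁻ ω in alive t ∩ st t, ofReal (loss t ω) ∂P := by
        have hm2 : Measurable fun ω => ofReal (loss t ω) := by have := hloss t; fun_prop
        rw [← lintegral_const_mul _ hm2, ← lintegral_add_right _ (hm2.const_mul _)]
        refine setLIntegral_mono' ((hal' t ht).inter (hst' t ht)) fun ω hω => ?_
        have h2 : (2 : ℝ≥0∞) = ofReal 2 := by norm_num
        rw [h2, ← ofReal_mul (by norm_num),
          ← ofReal_add (hH0 _) (by have := hloss0 t ω; positivity)]
        refine ofReal_le_ofReal ?_
        have h3 := hQ.driftFn_sub_le (a := w t ω - X t ω) (b := w (t + 1) ω) (by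
          rw [hstep t ω ht hω.2]; linarith [hloss0 t ω])
        rw [hstep t ω ht hω.2] at h3 ⊢
        linarith
      have e3 : ∫⁻ ω in alive t ∩ st t, ofReal (H (w t ω - X t ω) + s) ∂P
            + ofReal μ * P (alive t ∩ st t)
          ≤ ∫⁻ ω in alive t ∩ st t, ofReal (H (w t ω) + s) ∂P := by
        rw [(h.setLIntegral ht ((hal t ht).inter (hst t ht)) (hw t ht) (F := fun r x => ofReal (H
          (r - x) + s)) (by fun_prop)), ← setLIntegral_const, ← lintegral_add_right _
          measurable_const]
        exact setLIntegral_mono' ((hal' t ht).inter (hst' t ht)) fun ω hω =>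
          hone _ (hpos t ω ht hω.1 hω.2)
      rw [e1]
      refine (add_le_add_left (add_le_add_left e2 _) _).trans ?_
      calc _ = (∫⁻ ω in alive t ∩ st t, ofReal (H (w t ω - X t ω) + s) ∂P
            + ofReal μ * P (alive t ∩ st t))
            + ∫⁻ ω in alive t \ st t, ofReal (H (w t ω) + s) ∂P
            + 2 * ∫⁻ ω in alive t ∩ st t, ofReal (loss t ω) ∂P := by ring
        _ ≤ _ := by gcongr) n
  exact le_trans le_add_self hmain

/-- The delay of a stopping time that can only be exceeded while the sum of the steps is at most
`x`. -/
theorem IIDSteps.delay_le {τ : ℕ} (h : IIDSteps ℱ P X Q₀ τ) (hQ : PosDrift Q₀)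
    (hal : ∀ t, τ ≤ t → MeasurableSet[ℱ t] (alive t))
    (hanti : ∀ t, τ ≤ t → alive (t + 1) ⊆ alive t) (hUm : ∀ t, Measurable[ℱ t] (U t))
    (hU : ∀ t ω, U (t + 1) ω = U t ω + X t ω) (hx : 0 ≤ x)
    (hle : ∀ t ω, τ ≤ t → ω ∈ alive t → U t ω - U τ ω ≤ x) :
    ofReal (∫ x, x ∂Q₀) * ∑' i, P (alive (τ + i)) ≤ ofReal (x + 4 * spread Q₀) * P (alive τ) := by
  rw [← ENNReal.tsum_mul_left]
  refine tsum_le_of_sum_range_le fun n => ?_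
  have h1 := h.drift_bound hQ hal hanti (st := fun _ => univ)
    (w := fun t ω => x - (U t ω - U τ ω)) (loss := fun _ _ => 0)
    (fun t _ => @MeasurableSet.univ _ (ℱ t))
    (fun t ht => (@measurable_const _ _ _ (ℱ t) _).sub
      ((hUm t).sub ((hUm τ).mono (h.mono ht) le_rfl)))
    (fun _ => measurable_const) (fun _ _ => le_rfl)
    (fun t ω ht hω _ => by have := hle t ω ht hω; linarith)
    (fun t ω _ _ => by rw [hU]; ring) (fun t ω _ h => absurd (mem_univ ω) h) n
  simp only [Set.inter_univ, sub_self, sub_zero, ofReal_zero, lintegral_zero, mul_zero,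
    sum_const_zero, add_zero] at h1
  refine h1.trans ?_
  rw [setLIntegral_const]
  exact mul_le_mul_left (ofReal_le_ofReal (by linarith [hQ.driftFn_le hx])) _

end

/-! ### The residual of a local statistic and the number of messages -/

section
variable {Ω : Type*}

open Classical in
/-- The local statistic with steps `x`, restarted from `0` at each message, that is, whenever it
leaves `(-lo, hi)`. -/
def resid (lo hi : ℝ) (x : ℕ → Ω → ℝ) : ℕ → Ω → ℝ
  | 0, _ => 0
  | t + 1, ω => if resid lo hi x t ω + x t ω ∈ Ioo (-lo) hi then
      resid lo hi x t ω + x t ω else 0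

/-- A message is sent at time `t + 1`. -/
def sends (lo hi : ℝ) (x : ℕ → Ω → ℝ) (t : ℕ) : Set Ω :=
  {ω | resid lo hi x t ω + x t ω ∉ Ioo (-lo) hi}

variable {x : ℕ → Ω → ℝ}

theorem resid_mem (hlo : 0 < lo) (hhi : 0 < hi) (t : ℕ) (ω : Ω) : resid lo hi x t ω ∈ 𝕀 := by
  have h0 : (0 : ℝ) ∈ 𝕀 := ⟨by linarith, hhi⟩
  cases t with
  | zero => exact h0
  | succ t =>
    rw [resid]
    split_ifs with h
    · exact h
    · exact h0

theorem resid_of_sends {ω : Ω} (h : ω ∈ sends lo hi x t) : resid lo hi x (t + 1) ω = 0 := by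
  rw [resid, if_neg h]

theorem resid_of_not_sends {ω : Ω} (h : ω ∉ sends lo hi x t) :
    resid lo hi x (t + 1) ω = resid lo hi x t ω + x t ω := by
  rw [resid, if_pos (not_not.mp h)]

variable [mΩ : MeasurableSpace Ω] {ℱ : ℕ → MeasurableSpace Ω} {P : Measure Ω} {Q : Measure ℝ}
  {τ : ℕ} {alive act st : ℕ → Set Ω} (h : IIDSteps ℱ P x Q τ)
include h

theorem IIDSteps.measurable_resid (t : ℕ) : Measurable[ℱ t] (resid lo hi x t) := by
  induction t with
  | zero => exact @measurable_const _ _ _ (ℱ 0) _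
  | succ t ih =>
    have h1 := (ih.mono (h.mono (Nat.le_succ t)) le_rfl).add (h.meas t)
    exact Measurable.ite (h1 measurableSet_Ioo) h1 (@measurable_const _ _ _ (ℱ (t + 1)) _)

theorem IIDSteps.measurableSet_sends (t : ℕ) : MeasurableSet[ℱ (t + 1)] (sends lo hi x t) := by
  exact (((h.measurable_resid t).mono (h.mono (Nat.le_succ t)) le_rfl).add (h.meas t))
    measurableSet_Ioo.compl

/-- One step of the residual, with a reward `G` for staying and a reward `F` for leaving. -/
theorem IIDSteps.resid_step (ht : τ ≤ t) {A : Set Ω}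
    (hA : MeasurableSet[ℱ t] A) {F G : ℝ → ℝ≥0∞} (hF : Measurable F) (hG : Measurable G) :
    ∫⁻ ω in A \ sends lo hi x t, G (resid lo hi x (t + 1) ω) ∂P
        + ∫⁻ ω in A ∩ sends lo hi x t, F (resid lo hi x t ω + x t ω) ∂P
      = ∫⁻ ω in A, (stay Q 𝕀 G (resid lo hi x t ω) + leave Q 𝕀 F (resid lo hi x t ω)) ∂P := by
  have hI : MeasurableSet 𝕀 := measurableSet_Ioo
  have hA' : MeasurableSet A := h.le t _ hA
  have hS : MeasurableSet (sends lo hi x t) := h.le _ _ (h.measurableSet_sends t)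
  have h1 := h.setLIntegral ht hA (h.measurable_resid (lo := lo) (hi := hi) t)
    (F := fun y z => (𝕀).indicator G (y + z) + 𝕀ᶜ.indicator F (y + z))
    (((hG.indicator hI).comp (measurable_fst.add measurable_snd)).add
      ((hF.indicator hI.compl).comp (measurable_fst.add measurable_snd)))
  have h2 : ∀ y, ∫⁻ z, ((𝕀).indicator G (y + z) + 𝕀ᶜ.indicator F (y + z)) ∂Q
      = stay Q 𝕀 G y + leave Q 𝕀 F y := fun y => by
    rw [lintegral_add_left (measurable_indicator_add hI hG y)]; rfl
  simp_rw [h2] at h1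
  rw [← h1, ← lintegral_inter_add_sdiff (fun ω =>
    (𝕀).indicator G (resid lo hi x t ω + x t ω)
      + 𝕀ᶜ.indicator F (resid lo hi x t ω + x t ω)) A hS, add_comm]
  congr 1
  · refine setLIntegral_congr_fun (hA'.inter hS) fun ω hω => ?_
    have h3 : resid lo hi x t ω + x t ω ∉ 𝕀 := hω.2
    rw [indicator_of_notMem h3, indicator_of_mem h3, zero_add]
  · refine setLIntegral_congr_fun (hA'.diff hS) fun ω hω => ?_
    have h3 := not_not.mp hω.2
    rw [resid_of_not_sends hω.2, indicator_of_mem h3,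
      indicator_of_notMem (Set.notMem_compl_iff.mpr h3), add_zero]

/-- The first-step equation for the mean exit reward along the residual. -/
theorem IIDSteps.exitMean_step (ht : τ ≤ t) {A : Set Ω}
    (hA : MeasurableSet[ℱ t] A) {F : ℝ → ℝ≥0∞} (hF : Measurable F) :
    ∫⁻ ω in A, exitMean Q 𝕀 F (resid lo hi x (t + 1) ω) ∂P
        + ∫⁻ ω in A ∩ sends lo hi x t, F (resid lo hi x t ω + x t ω) ∂P
      = ∫⁻ ω in A, exitMean Q 𝕀 F (resid lo hi x t ω) ∂P
        + exitMean Q 𝕀 F 0 * P (A ∩ sends lo hi x t) := by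
  have := h.prob_step
  have hI : MeasurableSet 𝕀 := measurableSet_Ioo
  have hS : MeasurableSet (sends lo hi x t) := h.le _ _ (h.measurableSet_sends t)
  set G := exitMean Q 𝕀 F with hGdef
  have hG : Measurable G := measurable_exitMean hI hF
  have h1 := h.resid_step (lo := lo) (hi := hi) ht hA hF hG
  have h2 : ∀ y, stay Q 𝕀 G y + leave Q 𝕀 F y = G y := fun y => by
    rw [hGdef, exitMean_eq hI hF y, add_comm]
  simp_rw [h2] at h1
  have h3 : ∫⁻ ω in A ∩ sends lo hi x t, G (resid lo hi x (t + 1) ω) ∂P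
      = G 0 * P (A ∩ sends lo hi x t) := by
    rw [← setLIntegral_const]
    exact setLIntegral_congr_fun ((h.le t _ hA).inter hS) fun ω hω => by simp only [resid_of_sends
      hω.2]
  rw [← lintegral_inter_add_sdiff (fun ω => G (resid lo hi x (t + 1) ω)) A hS, h3, ← h1]
  ring

/-- The first-step equation for the mean time to the next message along the residual. -/
theorem IIDSteps.meanTime_step (ht : τ ≤ t) {A : Set Ω} (hA : MeasurableSet[ℱ t] A) :
    ∫⁻ ω in A, meanTime Q 𝕀 (resid lo hi x (t + 1) ω) ∂P + P A
      = ∫⁻ ω in A, meanTime Q 𝕀 (resid lo hi x t ω) ∂P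
        + meanTime Q 𝕀 0 * P (A ∩ sends lo hi x t) := by
  have := h.prob_step
  have hI : MeasurableSet 𝕀 := measurableSet_Ioo
  have hS : MeasurableSet (sends lo hi x t) := h.le _ _ (h.measurableSet_sends t)
  set G := meanTime Q 𝕀
  have hG : Measurable G := measurable_meanTime hI
  have h2 : ∀ y, G y = 1 + (stay Q 𝕀 G y + leave Q 𝕀 0 y) := fun y => by
      have e1 : leave Q 𝕀 0 y = 0 := by simp [leave]
      rw [e1, add_zero]
      exact pot_eq hI measurable_one y
  have h3 : ∫⁻ ω in A ∩ sends lo hi x t, G (resid lo hi x (t + 1) ω) ∂P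
      = G 0 * P (A ∩ sends lo hi x t) := by
    rw [← setLIntegral_const]
    exact setLIntegral_congr_fun ((h.le t _ hA).inter hS) fun ω hω => by simp only [resid_of_sends
      hω.2]
  have h4 : ∫⁻ ω in A, G (resid lo hi x t ω) ∂P
      = P A + ∫⁻ ω in A \ sends lo hi x t, G (resid lo hi x (t + 1) ω) ∂P := by
    rw [lintegral_congr fun ω => h2 (resid lo hi x t ω), lintegral_add_left measurable_const,
      setLIntegral_const, one_mul, ← (h.resid_step (lo := lo) (hi := hi) ht hA (F := 0)
        measurable_zero hG)]
    simp
  rw [← lintegral_inter_add_sdiff (fun ω => G (resid lo hi x (t + 1) ω)) A hS, h3, h4]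
  ring

/-- Total reward for the messages of a sensor, counted from the time when the flag `act` is set;
the flag is set at each message. -/
theorem IIDSteps.reward_le (hal : ∀ t, τ ≤ t → MeasurableSet[ℱ t] (alive t))
    (hanti : ∀ t, τ ≤ t → alive (t + 1) ⊆ alive t)
    (hact : ∀ t, τ ≤ t → MeasurableSet[ℱ t] (act t))
    (hsucc : ∀ t, τ ≤ t → act (t + 1) = act t ∪ sends lo hi x t) {F : ℝ → ℝ≥0∞}
    (hF : Measurable F) (n : ℕ) :
    ∑ i ∈ range n, ∫⁻ ω in alive (τ + i) ∩ act (τ + i) ∩ sends lo hi x (τ + i),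
        F (resid lo hi x (τ + i) ω + x (τ + i) ω) ∂P
      ≤ ∫⁻ ω in alive τ ∩ act τ, exitMean Q 𝕀 F (resid lo hi x τ ω) ∂P
        + ∑ i ∈ range n, exitMean Q 𝕀 F 0 * P (alive (τ + i) ∩ sends lo hi x (τ + i)) := by
  have hS (t : ℕ) : MeasurableSet (sends lo hi x t) := h.le _ _ (h.measurableSet_sends t)
  have hal' : ∀ t, τ ≤ t → MeasurableSet (alive t) := fun t ht => h.le t _ (hal t ht)
  have hact' : ∀ t, τ ≤ t → MeasurableSet (act t) := fun t ht => h.le t _ (hact t ht)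
  set G := exitMean Q 𝕀 F
  have hV (A : Set Ω) (t s : ℕ) (ht : τ ≤ t) : ∫⁻ ω in A, (act t).indicator
      (fun ω => G (resid lo hi x s ω)) ω ∂P
      = ∫⁻ ω in A ∩ act t, G (resid lo hi x s ω) ∂P := by
    rw [lintegral_indicator (hact' t ht), restrict_restrict (hact' t ht), Set.inter_comm]
  have h1 := lyapunov_le (P := P) (alive := alive) (τ := τ)
    (V := fun t => (act t).indicator fun ω => G (resid lo hi x t ω))
    (c := fun t => ∫⁻ ω in alive t ∩ act t ∩ sends lo hi x t, F (resid lo hi x t ω + x t ω) ∂P)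
    (d := fun t => G 0 * P (alive t ∩ sends lo hi x t)) hal' hanti
    (fun t ht => by
      rw [hV _ _ _ (by omega), hV _ _ _ ht, hsucc t ht]
      have e1 := h.exitMean_step (lo := lo) (hi := hi) ht ((hal t ht).inter (hact t ht)) hF
      -- the newly activated part of the event sends a message, so its residual is `0`
      have e2 : alive t ∩ (act t ∪ sends lo hi x t)
          = (alive t ∩ act t) ∪ ((alive t \ act t) ∩ sends lo hi x t) := by
        ext ω; simp only [Set.mem_inter_iff, Set.mem_union, Set.mem_sdiff]; tauto
      have e3 : ∫⁻ ω in (alive t \ act t) ∩ sends lo hi x t, G (resid lo hi x (t + 1) ω) ∂P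
          = G 0 * P ((alive t \ act t) ∩ sends lo hi x t) := by
        rw [← setLIntegral_const]
        exact setLIntegral_congr_fun (((hal' t ht).diff (hact' t ht)).inter (hS t))
          fun ω hω => by simp only [resid_of_sends hω.2]
      have e4 : P (alive t ∩ sends lo hi x t) = P (alive t ∩ act t ∩ sends lo hi x t)
            + P ((alive t \ act t) ∩ sends lo hi x t) := by
        rw [← measure_union _ (((hal' t ht).diff (hact' t ht)).inter (hS t))]
        · congr 1
          ext ω; simp only [Set.mem_inter_iff, Set.mem_union, Set.mem_sdiff]; tauto
        · exact Set.disjoint_left.mpr fun ω h1 h2 => h2.1.2 h1.1.2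
      rw [e2, lintegral_union (((hal' t ht).diff (hact' t ht)).inter (hS t))
        (Set.disjoint_left.mpr fun ω h1 h2 => h2.1.2 h1.2), e3, e4, mul_add]
      calc _ = (∫⁻ ω in alive t ∩ act t, G (resid lo hi x (t + 1) ω) ∂P
            + ∫⁻ ω in alive t ∩ act t ∩ sends lo hi x t, F (resid lo hi x t ω + x t ω) ∂P)
            + G 0 * P ((alive t \ act t) ∩ sends lo hi x t) := by ring
        _ = _ := by rw [e1]; ring
        _ ≤ _ := le_rfl) n
  rw [hV _ _ _ le_rfl] at h1
  exact le_trans le_add_self h1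

/-- The number of messages, in terms of the time. -/
theorem IIDSteps.count_le (hal : ∀ t, τ ≤ t → MeasurableSet[ℱ t] (alive t))
    (hanti : ∀ t, τ ≤ t → alive (t + 1) ⊆ alive t) (hlo : 0 < lo) (hhi : 0 < hi) {s : ℝ≥0∞}
    (hs : ∀ y ∈ 𝕀, meanTime Q 𝕀 y ≤ s) (n : ℕ) :
    ∑ i ∈ range n, meanTime Q 𝕀 0 * P (alive (τ + i) ∩ sends lo hi x (τ + i))
      ≤ s * P (alive τ) + ∑ i ∈ range n, P (alive (τ + i)) := by
  have hal' : ∀ t, τ ≤ t → MeasurableSet (alive t) := fun t ht => h.le t _ (hal t ht)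
  refine le_trans le_add_self ((le_lyapunov (P := P) (alive := alive) (τ := τ) (V := fun t ω =>
    meanTime Q 𝕀 (resid lo hi x t ω)) (c := fun t => P (alive t)) (d := fun t =>
    meanTime Q 𝕀 0 * P (alive t ∩ sends lo hi x t)) hal' hanti (fun t ht =>
    (h.meanTime_step ht (hal t ht)).ge) n).trans (add_le_add_left ?_ _))
  exact final_le hal' hanti (fun t ω => hs _ (resid_mem hlo hhi t ω)) n

/-- The time after the flag `st` is set, in terms of the number of messages. -/
theorem IIDSteps.le_count (hal : ∀ t, τ ≤ t → MeasurableSet[ℱ t] (alive t))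
    (hanti : ∀ t, τ ≤ t → alive (t + 1) ⊆ alive t)
    (hst : ∀ t, τ ≤ t → MeasurableSet[ℱ t] (st t))
    (hmono : ∀ t, τ ≤ t → st t ⊆ st (t + 1)) (hlo : 0 < lo) (hhi : 0 < hi) {s : ℝ≥0∞}
    (hs : ∀ y ∈ 𝕀, meanTime Q 𝕀 y ≤ s) (n : ℕ) :
    ∑ i ∈ range n, P (alive (τ + i) ∩ st (τ + i)) ≤ s * P (alive τ) + ∑ i ∈ range n, meanTime Q 𝕀 0
        * P (alive (τ + i) ∩ st (τ + i) ∩ sends lo hi x (τ + i)) := by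
  classical
  have hal' : ∀ t, τ ≤ t → MeasurableSet (alive t) := fun t ht => h.le t _ (hal t ht)
  have hst' : ∀ t, τ ≤ t → MeasurableSet (st t) := fun t ht => h.le t _ (hst t ht)
  set V : ℕ → Ω → ℝ≥0∞ := fun t ω => if ω ∈ st t then
    meanTime Q 𝕀 (resid lo hi x t ω) else s with hV
  have hVs (t : ℕ) (ω : Ω) : V t ω ≤ s := by
    simp only [hV]
    split_ifs
    · exact hs _ (resid_mem hlo hhi t ω)
    · exact le_rfl
  have h1 := lyapunov_le (P := P) (alive := alive) (τ := τ) (V := V)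
    (c := fun t => P (alive t ∩ st t))
    (d := fun t => meanTime Q 𝕀 0 * P (alive t ∩ st t ∩ sends lo hi x t))
    hal' hanti
    (fun t ht => by
      rw [← lintegral_inter_add_sdiff (V (t + 1)) (alive t) (hst' t ht),
        ← lintegral_inter_add_sdiff (V t) (alive t) (hst' t ht)]
      have e2 : ∫⁻ ω in alive t ∩ st t, V (t + 1) ω ∂P = ∫⁻ ω in alive t ∩ st t,
          meanTime Q 𝕀 (resid lo hi x (t + 1) ω) ∂P :=
        setLIntegral_congr_fun ((hal' t ht).inter (hst' t ht)) fun ω hω => by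
          simp only [hV, if_pos (hmono t ht hω.2)]
      have e3 : ∫⁻ ω in alive t ∩ st t, V t ω ∂P = ∫⁻ ω in alive t ∩ st t,
          meanTime Q 𝕀 (resid lo hi x t ω) ∂P :=
        setLIntegral_congr_fun ((hal' t ht).inter (hst' t ht)) fun ω hω => by
          simp only [hV, if_pos hω.2]
      have e4 : ∫⁻ ω in alive t \ st t, V (t + 1) ω ∂P ≤ ∫⁻ ω in alive t \ st t, V t ω ∂P :=
        setLIntegral_mono' ((hal' t ht).diff (hst' t ht)) fun ω hω => by
          refine (hVs _ _).trans (le_of_eq ?_)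
          simp only [hV, if_neg hω.2]
      rw [e2, e3]
      calc _ ≤ (∫⁻ ω in alive t ∩ st t, meanTime Q 𝕀
              (resid lo hi x (t + 1) ω) ∂P + P (alive t ∩ st t))
            + ∫⁻ ω in alive t \ st t, V t ω ∂P := by
            rw [add_right_comm]; gcongr
        _ = _ := by rw [(h.meanTime_step (lo := lo) (hi := hi) ht ((hal t ht).inter (hst t ht))),
          add_right_comm]) n
  refine le_trans le_add_self (h1.trans (add_le_add_left ?_ _))
  exact (lintegral_mono fun ω => hVs _ _).trans (setLIntegral_const _ _).le

/-- A lower bound for the reward collected after the flag `st` is set. -/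
theorem IIDSteps.le_reward (hal : ∀ t, τ ≤ t → MeasurableSet[ℱ t] (alive t))
    (hanti : ∀ t, τ ≤ t → alive (t + 1) ⊆ alive t)
    (hst : ∀ t, τ ≤ t → MeasurableSet[ℱ t] (st t))
    (hmono : ∀ t, τ ≤ t → st t ⊆ st (t + 1)) (hlo : 0 < lo) (hhi : 0 < hi) {F : ℝ → ℝ≥0∞}
    (hF : Measurable F) {s : ℝ≥0∞}
    (hs : ∀ y ∈ 𝕀, exitMean Q 𝕀 F y ≤ s) (n : ℕ) :
    ∑ i ∈ range n, exitMean Q 𝕀 F 0 * P (alive (τ + i) ∩ st (τ + i) ∩ sends lo hi x (τ + i))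
      ≤ s * P (alive τ) + ∑ i ∈ range n, ∫⁻ ω in alive (τ + i) ∩ st (τ + i) ∩ sends lo hi x (τ + i),
          F (resid lo hi x (τ + i) ω + x (τ + i) ω) ∂P := by
  have hal' : ∀ t, τ ≤ t → MeasurableSet (alive t) := fun t ht => h.le t _ (hal t ht)
  have hst' : ∀ t, τ ≤ t → MeasurableSet (st t) := fun t ht => h.le t _ (hst t ht)
  set G := exitMean Q 𝕀 F
  have hV (A : Set Ω) (t s : ℕ) (ht : τ ≤ t) : ∫⁻ ω in A, (st t).indicator
      (fun ω => G (resid lo hi x s ω)) ω ∂P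
      = ∫⁻ ω in A ∩ st t, G (resid lo hi x s ω) ∂P := by
    rw [lintegral_indicator (hst' t ht), restrict_restrict (hst' t ht), Set.inter_comm]
  have h1 := le_lyapunov (P := P) (alive := alive) (τ := τ)
    (V := fun t => (st t).indicator fun ω => G (resid lo hi x t ω))
    (c := fun t => ∫⁻ ω in alive t ∩ st t ∩ sends lo hi x t, F (resid lo hi x t ω + x t ω) ∂P)
    (d := fun t => G 0 * P (alive t ∩ st t ∩ sends lo hi x t)) hal' hanti
    (fun t ht => by
      rw [hV (alive t) t t ht, hV (alive t) (t + 1) (t + 1) (by omega),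
        ← h.exitMean_step (lo := lo) (hi := hi) ht ((hal t ht).inter (hst t ht)) hF]
      refine add_le_add_left (lintegral_mono_set ?_) _
      exact Set.inter_subset_inter_right _ (hmono t ht)) n
  refine le_trans le_add_self (h1.trans (add_le_add_left ?_ _))
  refine final_le (V := fun t => (st t).indicator fun ω => G (resid lo hi x t ω))
    hal' hanti (fun t ω => ?_) n
  exact Set.indicator_apply_le' (fun _ => hs _ (resid_mem hlo hhi t ω)) (fun _ => zero_le)

/-- The time until the first message. -/
theorem IIDSteps.measure_silent_le {A : Set Ω}
    (hA : MeasurableSet[ℱ τ] A) (hact : ∀ t, τ ≤ t → MeasurableSet[ℱ t] (act t))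
    (hsucc : ∀ t, τ ≤ t → act (t + 1) = act t ∪ sends lo hi x t) (n : ℕ) :
    P (A \ act (τ + n)) ≤ ∫⁻ ω in A, (stay Q 𝕀)^[n] 1 (resid lo hi x τ ω) ∂P := by
  have := h.prob_step
  have key : ∀ n : ℕ, ∀ f : ℝ → ℝ≥0∞, Measurable f →
      ∫⁻ ω in A \ act (τ + n), f (resid lo hi x (τ + n) ω) ∂P
        ≤ ∫⁻ ω in A, (stay Q 𝕀)^[n] f (resid lo hi x τ ω) ∂P := by
    intro n
    induction n with
    | zero => intro f _; exact lintegral_mono_set Set.sdiff_subset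
    | succ n ih =>
      intro f hf
      have h1 := h.resid_step (lo := lo) (hi := hi) (Nat.le_add_right τ n) ((h.mono
        (Nat.le_add_right _ _) _ hA).diff (hact _ (Nat.le_add_right _ _))) (F := 0)
        measurable_zero hf
      have h2 : ∀ y, leave Q 𝕀 0 y = 0 := fun y => by simp [leave]
      simp only [h2, add_zero, Pi.zero_apply, lintegral_zero] at h1
      have h3 : A \ act (τ + (n + 1)) = (A \ act (τ + n)) \ sends lo hi x (τ + n) := by
        rw [← add_assoc, hsucc _ (Nat.le_add_right _ _), Set.sdiff_sdiff]
      rw [h3]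
      refine h1.le.trans ?_
      rw [Function.iterate_succ_apply]
      exact ih _ (measurable_stay measurableSet_Ioo hf)
  have h1 := key n 1 measurable_one
  simpa using h1

end

/-! ### The delay of the test of the fusion center -/

theorem sum_fin_const {K : ℕ} (c : ℝ≥0∞) : ∑ _k : Fin K, c = K * c := by simp

theorem exists_ofReal {c : ℝ≥0∞} (hc : c ≠ ∞) : ∃ r : ℝ, 0 ≤ r ∧ c = ofReal r :=
  ⟨c.toReal, toReal_nonneg, (ofReal_toReal hc).symm⟩

/-- `∑ min 1 (c ρ ^ i)`, for `c = exp r`. -/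
theorem sum_le_of_geometric {ρ r : ℝ} (hρ : 0 < ρ) (hρ1 : ρ < 1) (hr : 0 ≤ r) {v : ℕ → ℝ≥0∞}
    {q : ℝ≥0∞} (h1 : ∀ i, v i ≤ q) (h2 : ∀ i, v i ≤ ofReal (exp r * ρ ^ i) * q)
    (n : ℕ) :
    ∑ i ∈ range n, v i ≤ ofReal (r / log ρ⁻¹ + 1 + (1 - ρ)⁻¹) * q := by
  have hlog : 0 < log ρ⁻¹ := log_pos (one_lt_inv₀ hρ |>.mpr hρ1)
  set k := ⌈r / log ρ⁻¹⌉₊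
  have hk1 : (k : ℝ) ≤ r / log ρ⁻¹ + 1 := (Nat.ceil_lt_add_one (by positivity)).le
  have hk2 : exp r * ρ ^ k ≤ 1 := by
    have h3 : r ≤ k * log ρ⁻¹ := by rw [← div_le_iff₀ hlog]; exact Nat.le_ceil _
    have h4 : ρ ^ k = exp (-(k * log ρ⁻¹)) := by
      rw [log_inv, mul_neg, neg_neg, mul_comm, Real.exp_mul, exp_log hρ, Real.rpow_natCast]
    rw [h4, ← exp_add]
    exact exp_le_one_iff.mpr (by linarith)
  calc ∑ i ∈ range n, v i ≤ ∑ i ∈ range (k + n), v i :=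
        Finset.sum_le_sum_of_subset (Finset.range_mono (by omega))
    _ = ∑ i ∈ range k, v i + ∑ i ∈ range n, v (k + i) := Finset.sum_range_add _ _ _
    _ ≤ ∑ _i ∈ range k, q + ∑ i ∈ range n, ofReal (ρ ^ i) * q := by
        refine add_le_add (sum_le_sum fun i _ => h1 i) (sum_le_sum fun i _ => ?_)
        refine (h2 _).trans (mul_le_mul_left (ofReal_le_ofReal ?_) _)
        rw [pow_add, ← mul_assoc]
        exact mul_le_of_le_one_left (by positivity) hk2
    _ = ofReal (k + ∑ i ∈ range n, ρ ^ i) * q := by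
        rw [ofReal_add₀, ofReal_natCast, add_mul,
          ENNReal.ofReal_sum_of_nonneg (fun i _ => by positivity), Finset.sum_mul,
          sum_const, card_range, nsmul_eq_mul]
    _ ≤ _ := by
        refine mul_le_mul_left (ofReal_le_ofReal ?_) _
        have h5 : ∑ i ∈ range n, ρ ^ i ≤ (1 - ρ)⁻¹ := by
          rw [← tsum_geometric_of_lt_one hρ.le hρ1]
          exact (summable_geometric_of_lt_one hρ.le hρ1).sum_le_tsum _ fun i _ => by positivity
        linarith

section
variable {Ω : Type*}

/-- The statistic of the fusion center: at each message of sensor `k`, sent at the exit position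
`z`, it increases by `Lam k z`. -/
def fusion {K : ℕ} (lo hi : Fin K → ℝ) (Lam : Fin K → ℝ → ℝ) (X : ℕ → Ω → Fin K → ℝ) : ℕ → Ω → ℝ
  | 0, _ => 0
  | t + 1, ω => fusion lo hi Lam X t ω
      + ∑ k, (sends (lo k) (hi k) (fun t ω => X t ω k) t).indicator
        (fun ω => Lam k (resid (lo k) (hi k) (fun t ω => X t ω k) t ω + X t ω k)) ω

/-- Network data after the change time `τ`, for a test of the fusion center with threshold `x`
whose alarm is raised after time `t` on the event `alive t`. -/
structure Network [mΩ : MeasurableSpace Ω] {K : ℕ} (m B a b Δ lam : ℝ) (ℱ : ℕ → MeasurableSpace Ω)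
    (P : Measure Ω) (X : ℕ → Ω → Fin K → ℝ) (Q Q₀ : Fin K → Measure ℝ) (Qsum : Measure ℝ)
    (lo hi : Fin K → ℝ) (Lam : Fin K → ℝ → ℝ) (τ : ℕ) (x : ℝ) (alive : ℕ → Set Ω) :
    Prop where
  sensor : ∀ k, Sensor m B a b Δ lam (Q k) (Q₀ k) (lo k) (hi k) (Lam k)
  steps : ∀ k, IIDSteps ℱ P (fun t ω => X t ω k) (Q₀ k) τ
  sum_steps : IIDSteps ℱ P (fun t ω => ∑ k, X t ω k) Qsum τ
  drift : PosDrift Qsum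
  pos : 0 < K
  nonneg : 0 ≤ x
  meas : ∀ t, τ ≤ t → MeasurableSet[ℱ t] (alive t)
  anti : ∀ t, τ ≤ t → alive (t + 1) ⊆ alive t
  le : ∀ t ω, τ ≤ t → ω ∈ alive t → ∀ s, τ ≤ s → s ≤ t →
    fusion lo hi Lam X t ω - fusion lo hi Lam X s ω ≤ x

/-- The event `act k t` that the messages of sensor `k` count at time `t`: whatever happens at time
`τ`, they count from the first message sent after time `τ` on. -/
structure Flags {K : ℕ} (ℱ : ℕ → MeasurableSpace Ω) (X : ℕ → Ω → Fin K → ℝ) (lo hi : Fin K → ℝ)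
    (τ : ℕ) (act : Fin K → ℕ → Set Ω) : Prop where
  meas : ∀ k t, τ ≤ t → MeasurableSet[ℱ t] (act k t)
  succ : ∀ k t, τ ≤ t → act k (t + 1) = act k t ∪ sends (lo k) (hi k) (fun t ω => X t ω k) t

/-- A process that moves, once the flag `st` is set, at least by minus the increment of `φ`. -/
theorem exists_le_flag_sum {st : ℕ → Set Ω} {τ : ℕ} (hmono : ∀ t, τ ≤ t → st t ⊆ st (t + 1))
    {inc φ : ℕ → Ω → ℝ} (h : ∀ t ω, τ ≤ t → ω ∈ st t → -(φ (t + 1) ω - φ t ω) ≤ inc t ω) (ω : Ω)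
    (A : ℝ) : ∀ t, τ ≤ t → ω ∈ st t → ∃ s, τ ≤ s ∧ s ≤ t ∧
      A - (φ t ω - φ s ω) ≤ A + ∑ r ∈ Ico τ t, (st r).indicator (inc r) ω := by
  intro t ht
  induction t, ht using Nat.le_induction with
  | base => intro _; exact ⟨τ, le_rfl, le_rfl, by simp⟩
  | succ t ht ih =>
    intro hω
    rw [sum_Ico_succ_top ht]
    by_cases h1 : ω ∈ st t
    · obtain ⟨s, hs, hst, h2⟩ := ih h1
      refine ⟨s, hs, hst.trans (Nat.le_succ t), ?_⟩
      rw [indicator_of_mem h1]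
      linarith [h t ω ht h1]
    · refine ⟨t + 1, by omega, le_rfl, ?_⟩
      have h3 : ∀ r ∈ Ico τ t, (st r).indicator (inc r) ω = 0 := fun r hr => by
        refine indicator_of_notMem (fun h4 => h1 ?_) _
        have : ∀ t, r ≤ t → ω ∈ st t := fun t hrt => by
          induction t, hrt using Nat.le_induction with
          | base => exact h4
          | succ t ht ih => exact hmono t (by have := (mem_Ico.mp hr).1; omega) ih
        exact this t (mem_Ico.mp hr).2.le
      rw [Finset.sum_eq_zero h3, indicator_of_notMem h1]
      simp

variable [mΩ : MeasurableSpace Ω] {K : ℕ} {m B a b Δ lam : ℝ} {ℱ : ℕ → MeasurableSpace Ω}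
  {P : Measure Ω} {X : ℕ → Ω → Fin K → ℝ} {Q Q₀ : Fin K → Measure ℝ} {Qsum : Measure ℝ}
  {lo hi : Fin K → ℝ} {Lam : Fin K → ℝ → ℝ} {τ : ℕ} {x : ℝ} {alive : ℕ → Set Ω}
  {act : Fin K → ℕ → Set Ω}

/-- All sensors count. -/
theorem Flags.measurableSet_started (g : Flags ℱ X lo hi τ act) (t : ℕ) (ht : τ ≤ t) :
    MeasurableSet[ℱ t] (⋂ k, act k t) :=
  MeasurableSet.iInter fun k => g.meas k t ht

theorem Flags.started_mono (g : Flags ℱ X lo hi τ act) (t : ℕ) (ht : τ ≤ t) :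
    ⋂ k, act k t ⊆ ⋂ k, act k (t + 1) :=
  Set.iInter_mono fun k => by rw [g.succ k t ht]; exact Set.subset_union_left

namespace Network

/-- The residuals of sensor `k`. -/
local notation:max "res_" k:max => resid (lo k) (hi k) (fun t ω => X t ω k)

/-- The exit position of sensor `k`, if it sends a message at time `t + 1`. -/
local notation "pos_" => fun (k : Fin K) (t : ℕ) (ω : Ω) =>
  resid (lo k) (hi k) (fun t ω => X t ω k) t ω + X t ω k

/-- The events that sensor `k` sends a message. -/
local notation:max "snd_" k:max => sends (lo k) (hi k) (fun t ω => X t ω k)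

/-- The expectation after the change, at the exit position of sensor `k`. -/
local notation:max "exit_" k:max => exitMean (Q₀ k) (Ioo (-lo k) (hi k))

/-- A bounded and concave minorant of the information in the message of sensor `k`. -/
local notation:max "info_" k:max z:max => 2 * (1 - exp (-Lam k z / 2))

variable (h : Network m B a b Δ lam ℱ P X Q Q₀ Qsum lo hi Lam τ x alive)
include h

theorem measurable_pos (k : Fin K) (t : ℕ) : Measurable[ℱ (t + 1)] (pos_ k t) :=
  (((h.steps k).measurable_resid t).mono ((h.steps k).mono (Nat.le_succ t)) le_rfl).add
    ((h.steps k).meas t)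

theorem lintegral_sends (t : ℕ) {A : Set Ω} (F : Fin K → ℝ → ℝ≥0∞) (hF : ∀ k, Measurable (F k)) :
    ∫⁻ ω in A, ∑ k, (snd_ k t).indicator (fun ω => F k (pos_ k t ω)) ω ∂P
      = ∑ k, ∫⁻ ω in A ∩ snd_ k t, F k (pos_ k t ω) ∂P := by
  have hS (k : Fin K) : MeasurableSet (snd_ k t) :=
    (h.steps k).le _ _ ((h.steps k).measurableSet_sends t)
  have hp (k : Fin K) : Measurable (pos_ k t) :=
    (h.measurable_pos k t).mono ((h.steps k).le _) le_rfl
  have hm (k : Fin K) : Measurable ((snd_ k t).indicator fun ω => F k (pos_ k t ω)) :=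
    ((hF k).comp (hp k)).indicator (hS k)
  rw [lintegral_finsetSum _ fun k _ => hm k]
  refine sum_congr rfl fun k _ => ?_
  rw [lintegral_indicator (hS k), restrict_restrict (hS k), Set.inter_comm]

/-- The number of messages of a sensor. -/
theorem ofReal_mul_count_le (k : Fin K) (n : ℕ) :
    ofReal (a * Δ / (B + 1)) * ∑ i ∈ range n, P (alive (τ + i) ∩ snd_ k (τ + i))
      ≤ ofReal (timeBound m B b Δ) * P (alive τ) + ∑ i ∈ range n, P (alive (τ + i)) := by
  have s := h.sensor k
  refine le_trans ?_ ((h.steps k).count_le h.meas h.anti s.lo_pos s.hi_pos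
    (fun y hy => s.meanTime₀_le hy) n)
  rw [mul_sum]
  exact sum_le_sum fun i _ => mul_le_mul_left s.le_meanTime₀ _

/-- The delay, when the information lost by quantization is small compared to the information in a
message. -/
theorem fine_le (g : Flags ℱ X lo hi τ act) {p : ℝ≥0∞} (hp : ∀ k, ∫⁻ ω in alive τ ∩ act k τ, exit_ k
      (fun z => ofReal (z - Lam k z)) (res_ k τ ω) ∂P ≤ p * P (alive τ)) (n : ℕ) :
    ofReal (∫ x, x ∂Qsum) * ∑ i ∈ range n, P (alive (τ + i) ∩ ⋂ k, act k (τ + i))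
      ≤ ofReal (x + 2 * (K * (b * Δ)) + 4 * spread Qsum) * P (alive τ)
        + 2 * ∑ k, (p * P (alive τ) + ofReal lam
          * ∑ i ∈ range n, P (alive (τ + i) ∩ snd_ k (τ + i))) := by
  have hS (k : Fin K) (t : ℕ) : MeasurableSet[ℱ (t + 1)] (snd_ k t) :=
    (h.steps k).measurableSet_sends t
  have hmono := h.sum_steps.mono
  set st : ℕ → Set Ω := fun t => ⋂ k, act k t with hst
  set los : ℕ → Ω → ℝ := fun t ω => ∑ k, (snd_ k t).indicator
    (fun ω => max (pos_ k t ω - Lam k (pos_ k t ω)) 0) ω with hlos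
  set inc : ℕ → Ω → ℝ := fun t ω => -(∑ k, X t ω k) + los t ω with hinc
  set A : ℝ := x + 2 * (K * (b * Δ)) with hA
  set w : ℕ → Ω → ℝ := fun t ω => A + ∑ r ∈ Ico τ t, (st r).indicator (inc r) ω with hw
  have hbΔ : 0 ≤ b * Δ := by
    have s := h.sensor ⟨0, h.pos⟩
    exact (mul_pos s.b_pos s.Δ_pos).le
  have hA0 : 0 ≤ A := by have := h.nonneg; positivity
  have hlosm (t : ℕ) : Measurable[ℱ (t + 1)] (los t) := by
    refine Finset.measurable_fun_sum _ fun k _ => ?_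
    have h1 := h.measurable_pos k t
    exact ((h1.sub ((h.sensor k).meas.comp h1)).max
      (@measurable_const _ _ _ (ℱ (t + 1)) _)).indicator (hS k t)
  have hincm (t : ℕ) : Measurable[ℱ (t + 1)] (inc t) := (h.sum_steps.meas t).neg.add (hlosm t)
  have hwm : ∀ t, τ ≤ t → Measurable[ℱ t] (w t) := fun t _ => by
    refine (@measurable_const _ _ _ (ℱ t) _).add (Finset.measurable_fun_sum _ fun r hr => ?_)
    have hr' := mem_Ico.mp hr
    exact ((hincm r).mono (hmono hr'.2) le_rfl).indicator
      (hmono hr'.2.le _ (g.measurableSet_started r hr'.1))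
  -- between two times the fusion statistic and the residuals together lose at most `los`
  have hpos : ∀ t ω, τ ≤ t → ω ∈ alive t → ω ∈ st t → 0 ≤ w t ω := by
    intro t ω ht hal hωt
    obtain ⟨s, hs, hst', h1⟩ := exists_le_flag_sum (st := st) g.started_mono (inc := inc)
      (φ := fun t ω => fusion lo hi Lam X t ω + ∑ k, res_ k t ω)
      (fun t ω _ _ => by
        simp only [hinc, hlos, fusion]
        have h2 : ∀ k ∈ Finset.univ, X t ω k ≤ ((snd_ k t).indicator (fun ω => Lam k (pos_ k t ω)) ω
              + (resid (lo k) (hi k) (fun t ω => X t ω k) (t + 1) ω - res_ k t ω))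
              + (snd_ k t).indicator
                (fun ω => max (pos_ k t ω - Lam k (pos_ k t ω)) 0) ω := fun k _ => by
          by_cases h3 : ω ∈ snd_ k t
          · rw [indicator_of_mem h3, indicator_of_mem h3, resid_of_sends h3]
            have := le_max_left (pos_ k t ω - Lam k (pos_ k t ω)) 0
            simp only at this ⊢
            linarith
          · rw [indicator_of_notMem h3, indicator_of_notMem h3, resid_of_not_sends h3]
            linarith
        have h4 := sum_le_sum h2
        rw [sum_add_distrib, sum_add_distrib, sum_sub_distrib] at h4
        linarith) ω A t ht hωt
    refine le_trans ?_ h1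
    have h2 := h.le t ω ht hal s hs hst'
    have h3 : ∀ k ∈ Finset.univ, res_ k t ω
        - resid (lo k) (hi k) (fun t ω => X t ω k) s ω ≤ 2 * (b * Δ) := fun k _ => by
      have s' := h.sensor k
      linarith [(resid_mem (x := fun t ω => X t ω k) s'.lo_pos s'.hi_pos t ω).2, (resid_mem (x :=
        fun t ω => X t ω k) s'.lo_pos s'.hi_pos s ω).1, s'.lo_le,
        s'.hi_le]
    have h4 := sum_le_sum h3
    rw [sum_sub_distrib, sum_const, card_univ, Fintype.card_fin, nsmul_eq_mul] at h4
    simp only [hA]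
    linarith
  have key := h.sum_steps.drift_bound h.drift (st := st) (w := w) (loss := los) h.meas h.anti
    g.measurableSet_started hwm (fun t => (hlosm t).mono (h.sum_steps.le _) le_rfl)
    (fun t ω => Finset.sum_nonneg fun k _ => Set.indicator_nonneg (fun _ _ => le_max_right _ _) _)
    hpos
    (fun t ω ht hω => by
      simp only [hw]
      rw [sum_Ico_succ_top ht, indicator_of_mem hω]
      simp only [hinc]; ring)
    (fun t ω ht hω => by
      simp only [hw]
      rw [sum_Ico_succ_top ht, indicator_of_notMem hω, add_zero]) n
  rw [mul_sum]
  refine key.trans (add_le_add ?_ ?_)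
  · simp only [hw, Finset.Ico_self, Finset.sum_empty, add_zero]
    rw [setLIntegral_const]
    refine mul_le_mul_left (ofReal_le_ofReal ?_) _
    linarith [h.drift.driftFn_le hA0]
  · rw [← mul_sum]
    refine mul_le_mul_right ?_ 2
    have e1 (i : ℕ) : ∫⁻ ω in alive (τ + i) ∩ st (τ + i), ofReal (los (τ + i) ω) ∂P
        = ∑ k, ∫⁻ ω in alive (τ + i) ∩ st (τ + i) ∩ snd_ k (τ + i),
          ofReal (pos_ k (τ + i) ω - Lam k (pos_ k (τ + i) ω)) ∂P := by
      rw [← h.lintegral_sends (τ + i) (fun k z => ofReal (z - Lam k z))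
        fun k => by have := (h.sensor k).meas; fun_prop]
      refine lintegral_congr fun ω => ?_
      simp only [hlos]
      rw [ENNReal.ofReal_sum_of_nonneg fun k _ =>
        Set.indicator_nonneg (fun _ _ => le_max_right _ _) _]
      refine sum_congr rfl fun k _ => ?_
      by_cases h3 : ω ∈ snd_ k (τ + i)
      · rw [indicator_of_mem h3, indicator_of_mem h3, ENNReal.ofReal_max]
        simp
      · rw [indicator_of_notMem h3, indicator_of_notMem h3, ofReal_zero]
    simp_rw [e1]
    rw [Finset.sum_comm]
    refine sum_le_sum fun k _ => ?_
    have s := h.sensor k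
    have e2 := (h.steps k).reward_le (lo := lo k) (hi := hi k) h.meas h.anti (g.meas k)
      (g.succ k) (F := fun z => ofReal (z - Lam k z))
      (by have := s.meas; fun_prop) n
    refine le_trans (sum_le_sum fun i _ => ?_) (e2.trans (add_le_add (hp k) ?_))
    · exact lintegral_mono_set (Set.inter_subset_inter_left _
        (Set.inter_subset_inter_right _ (Set.iInter_subset _ k)))
    · rw [← mul_sum]
      exact mul_le_mul_left s.loss_le _

/-- The delay, without any condition on the information lost by quantization. The gain from a
message is measured by `2 (1 - exp (-Lam / 2)) ≤ Lam`, which is at most `2`. -/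
theorem crude_le (g : Flags ℱ X lo hi τ act) {p : ℝ≥0∞}
    (hp : ∀ k, ∫⁻ ω in alive τ ∩ act k τ, exit_ k (fun z => ofReal (-info_ k z))
        (res_ k τ ω) ∂P ≤ p * P (alive τ)) (n : ℕ) :
    ∑ k, exit_ k (fun z => ofReal (info_ k z)) 0
        * ∑ i ∈ range n, P (alive (τ + i) ∩ (⋂ k, act k (τ + i)) ∩ snd_ k (τ + i))
      ≤ ofReal (x + 4 * K) * P (alive τ) + ∑ k, (p * P (alive τ) + exit_ k
            (fun z => ofReal (-info_ k z)) 0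
          * ∑ i ∈ range n, P (alive (τ + i) ∩ snd_ k (τ + i))) := by
  have hS (k : Fin K) (t : ℕ) : MeasurableSet[ℱ (t + 1)] (snd_ k t) :=
    (h.steps k).measurableSet_sends t
  have hle := h.sum_steps.le
  set f : Fin K → ℝ → ℝ := fun k z => info_ k z with hf
  have hfm (k : Fin K) : Measurable (f k) := by have := (h.sensor k).meas; fun_prop
  have hf2 (k : Fin K) (z : ℝ) : f k z ≤ 2 := by simp only [hf]; linarith [exp_pos (-Lam k z / 2)]
  have hfL (k : Fin K) (z : ℝ) : f k z ≤ Lam k z := by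
    simp only [hf]; linarith [Real.add_one_le_exp (-Lam k z / 2)]
  set st : ℕ → Set Ω := fun t => ⋂ k, act k t with hst
  have hst' : ∀ t, τ ≤ t → MeasurableSet (st t) := fun t ht =>
    hle t _ (g.measurableSet_started t ht)
  have hal' : ∀ t, τ ≤ t → MeasurableSet (alive t) := fun t ht => hle t _ (h.meas t ht)
  set gain : ℕ → Ω → ℝ := fun t ω =>
    ∑ k, (snd_ k t).indicator (fun ω => max (f k (pos_ k t ω)) 0) ω with hgain
  set los : ℕ → Ω → ℝ := fun t ω =>
    ∑ k, (snd_ k t).indicator (fun ω => max (-f k (pos_ k t ω)) 0) ω with hlos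
  have hgain0 (t : ℕ) (ω : Ω) : 0 ≤ gain t ω := Finset.sum_nonneg fun k _ =>
    Set.indicator_nonneg (fun _ _ => le_max_right _ _) _
  have hlos0 (t : ℕ) (ω : Ω) : 0 ≤ los t ω := Finset.sum_nonneg fun k _ =>
    Set.indicator_nonneg (fun _ _ => le_max_right _ _) _
  have hgain2 (t : ℕ) (ω : Ω) : gain t ω ≤ 2 * K := by
    have h1 := Finset.sum_le_card_nsmul Finset.univ (fun k => (snd_ k t).indicator
      (fun ω => max (f k (pos_ k t ω)) 0) ω) 2 fun k _ =>
        Set.indicator_apply_le' (fun _ => max_le (hf2 _ _) (by norm_num)) (fun _ => by norm_num)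
    rw [card_univ, Fintype.card_fin, nsmul_eq_mul] at h1
    linarith
  have hsumm (g : Fin K → ℝ → ℝ) (hg : ∀ k, Measurable (g k)) (t : ℕ) :
      Measurable[ℱ (t + 1)] fun ω =>
        ∑ k, (snd_ k t).indicator (fun ω => max (g k (pos_ k t ω)) 0) ω := by
    refine Finset.measurable_fun_sum _ fun k _ => ?_
    exact (((hg k).comp (h.measurable_pos k t)).max
      (@measurable_const _ _ _ (ℱ (t + 1)) _)).indicator (hS k t)
  have hgainm' (t : ℕ) : Measurable (gain t) := ((hsumm f hfm) t).mono (hle _) le_rfl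
  have hlosm' (t : ℕ) : Measurable (los t) := ((hsumm (fun k z => -f k z) fun k => (hfm k).neg)
    t).mono (hle _) le_rfl
  set inc : ℕ → Ω → ℝ := fun t ω => los t ω - gain t ω with hinc
  set w : ℕ → Ω → ℝ := fun t ω => x + ∑ r ∈ Ico τ t, (st r).indicator (inc r) ω with hw
  have hpos : ∀ t ω, τ ≤ t → ω ∈ alive t → ω ∈ st t → 0 ≤ w t ω := by
    intro t ω ht hal hωt
    obtain ⟨s, hs, hst', h1⟩ := exists_le_flag_sum (st := st) g.started_mono (inc := inc)
      (φ := fusion lo hi Lam X)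
      (fun t ω _ _ => by
        simp only [hinc, hlos, hgain, fusion]
        rw [← sum_sub_distrib, add_sub_cancel_left, ← Finset.sum_neg_distrib]
        refine sum_le_sum fun k _ => ?_
        by_cases h3 : ω ∈ snd_ k t
        · rw [indicator_of_mem h3, indicator_of_mem h3, indicator_of_mem h3]
          have := hfL k (pos_ k t ω)
          rcases max_cases (f k (pos_ k t ω)) 0 with h4 | h4 <;>
            rcases max_cases (-f k (pos_ k t ω)) 0 with h5 | h5 <;> rw [h4.1, h5.1] <;>
            linarith [h4.2, h5.2]
        · rw [indicator_of_notMem h3, indicator_of_notMem h3, indicator_of_notMem h3]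
          simp) ω x t ht hωt
    exact le_trans (by linarith [h.le t ω ht hal s hs hst']) h1
  have hsplit (g : Fin K → ℝ → ℝ) (hg : ∀ k, Measurable (g k)) (i : ℕ) :
      ∫⁻ ω in alive (τ + i) ∩ st (τ + i), ofReal (∑ k, (snd_ k (τ + i)).indicator
          (fun ω => max (g k (pos_ k (τ + i) ω)) 0) ω) ∂P
        = ∑ k, ∫⁻ ω in alive (τ + i) ∩ st (τ + i) ∩ snd_ k (τ + i),
          ofReal (g k (pos_ k (τ + i) ω)) ∂P := by
    rw [← h.lintegral_sends (τ + i) (fun k z => ofReal (g k z)) fun k => (hg k).ennreal_ofReal]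
    refine lintegral_congr fun ω => ?_
    rw [ENNReal.ofReal_sum_of_nonneg fun k _ =>
      Set.indicator_nonneg (fun _ _ => le_max_right _ _) _]
    refine sum_congr rfl fun k _ => ?_
    by_cases h3 : ω ∈ snd_ k (τ + i)
    · rw [indicator_of_mem h3, indicator_of_mem h3, ENNReal.ofReal_max]
      simp
    · rw [indicator_of_notMem h3, indicator_of_notMem h3, ofReal_zero]
  have key := lyapunov_le (P := P) (alive := alive) (τ := τ)
    (V := fun t ω => ofReal (w t ω + 2 * K))
    (c := fun t => ∫⁻ ω in alive t ∩ st t, ofReal (gain t ω) ∂P)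
    (d := fun t => ∫⁻ ω in alive t ∩ st t, ofReal (los t ω) ∂P) hal' h.anti
    (fun t ht => by
      rw [← lintegral_inter_add_sdiff (fun ω => ofReal (w (t + 1) ω + 2 * K)) (alive t) (hst' t ht),
        ← lintegral_inter_add_sdiff (fun ω => ofReal (w t ω + 2 * K)) (alive t) (hst' t ht)]
      have e1 : ∫⁻ ω in alive t \ st t, ofReal (w (t + 1) ω + 2 * K) ∂P
          = ∫⁻ ω in alive t \ st t, ofReal (w t ω + 2 * K) ∂P :=
        setLIntegral_congr_fun ((hal' t ht).diff (hst' t ht)) fun ω hω => by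
          simp only [hw]
          rw [sum_Ico_succ_top ht, indicator_of_notMem hω.2, add_zero]
      have e2 : ∫⁻ ω in alive t ∩ st t, ofReal (w (t + 1) ω + 2 * K) ∂P
            + ∫⁻ ω in alive t ∩ st t, ofReal (gain t ω) ∂P
          ≤ ∫⁻ ω in alive t ∩ st t, ofReal (w t ω + 2 * K) ∂P
            + ∫⁻ ω in alive t ∩ st t, ofReal (los t ω) ∂P := by
        rw [← lintegral_add_right _ (hgainm' t).ennreal_ofReal,
          ← lintegral_add_right _ (hlosm' t).ennreal_ofReal]
        refine setLIntegral_mono' ((hal' t ht).inter (hst' t ht)) fun ω hω => ?_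
        have h1 := hpos t ω ht hω.1 hω.2
        have h3 := hlos0 t ω
        have h4 := hgain2 t ω
        have h5 : w (t + 1) ω = w t ω + (los t ω - gain t ω) := by
          simp only [hw]
          rw [sum_Ico_succ_top ht, indicator_of_mem hω.2]
          simp only [hinc]; ring
        rw [h5, ← ofReal_add (by linarith) (hgain0 t ω), ← ofReal_add (by positivity) h3]
        exact ofReal_le_ofReal (by linarith)
      rw [e1]
      calc _ = (∫⁻ ω in alive t ∩ st t, ofReal (w (t + 1) ω + 2 * K) ∂P
            + ∫⁻ ω in alive t ∩ st t, ofReal (gain t ω) ∂P)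
            + ∫⁻ ω in alive t \ st t, ofReal (w t ω + 2 * K) ∂P := by ring
        _ ≤ _ := (add_le_add_left e2 _).trans (le_of_eq (by ring))) n
  have key' := le_trans le_add_self key
  have hw0 : ∫⁻ ω in alive τ, ofReal (w τ ω + 2 * K) ∂P = ofReal (x + 2 * K) * P (alive τ) := by
    simp only [hw, Finset.Ico_self, Finset.sum_empty, add_zero]
    rw [setLIntegral_const]
  rw [hw0] at key'
  have hup : ∀ k ∈ Finset.univ, exit_ k (fun z => ofReal (f k z)) 0
        * ∑ i ∈ range n, P (alive (τ + i) ∩ st (τ + i) ∩ snd_ k (τ + i))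
      ≤ 2 * P (alive τ) + ∑ i ∈ range n, ∫⁻ ω in alive (τ + i) ∩ st (τ + i)
          ∩ snd_ k (τ + i), ofReal (f k (pos_ k (τ + i) ω)) ∂P := fun k _ => by
    have s := h.sensor k
    rw [mul_sum]
    have := s.laws.prob₀
    refine (h.steps k).le_reward h.meas h.anti g.measurableSet_started g.started_mono s.lo_pos
      s.hi_pos (hfm k).ennreal_ofReal (fun y hy => ?_) n
    refine (exitMean_mono (g := fun _ => 2 * 1) (fun z _ => ?_) y).trans ?_
    · rw [mul_one]
      exact ENNReal.ofReal_le_of_le_toReal (by simpa using hf2 k z)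
    · rw [exitMean_const_mul measurableSet_Ioo measurable_const]
      have := s.exitMean₀_one hy
      rw [show (fun _ => 1 : ℝ → ℝ≥0∞) = 1 from rfl, this, mul_one]
  have hdn : ∀ k ∈ Finset.univ, ∑ i ∈ range n, ∫⁻ ω in alive (τ + i) ∩ st (τ + i)
          ∩ snd_ k (τ + i), ofReal (-f k (pos_ k (τ + i) ω)) ∂P
      ≤ p * P (alive τ) + exit_ k (fun z => ofReal (-f k z)) 0
          * ∑ i ∈ range n, P (alive (τ + i) ∩ snd_ k (τ + i)) := fun k _ => by
    have e2 := (h.steps k).reward_le (lo := lo k) (hi := hi k) h.meas h.anti (g.meas k)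
      (g.succ k) (hfm k).neg.ennreal_ofReal n
    refine le_trans (sum_le_sum fun i _ => ?_) (e2.trans (add_le_add (hp k) ?_))
    · exact lintegral_mono_set (Set.inter_subset_inter_left _
        (Set.inter_subset_inter_right _ (Set.iInter_subset _ k)))
    · rw [← mul_sum]; rfl
  calc _ ≤ ∑ k : Fin K, (2 * P (alive τ) + ∑ i ∈ range n, ∫⁻ ω in alive (τ + i) ∩ st (τ + i)
          ∩ snd_ k (τ + i), ofReal (f k (pos_ k (τ + i) ω)) ∂P) := sum_le_sum hup
    _ = ofReal (2 * K) * P (alive τ) + ∑ i ∈ range n,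
          ∫⁻ ω in alive (τ + i) ∩ st (τ + i), ofReal (gain (τ + i) ω) ∂P := by
        rw [sum_add_distrib, Finset.sum_comm]
        congr 1
        · rw [sum_fin_const,
            ofReal_mul (by norm_num), ofReal_natCast]
          norm_num
          ring
        · exact sum_congr rfl fun i _ => (hsplit f hfm i).symm
    _ ≤ ofReal (2 * K) * P (alive τ) + (ofReal (x + 2 * K) * P (alive τ) + ∑ i ∈ range n,
            ∫⁻ ω in alive (τ + i) ∩ st (τ + i), ofReal (los (τ + i) ω) ∂P) :=
        add_le_add_right key' _
    _ = ofReal (x + 4 * K) * P (alive τ) + ∑ i ∈ range n,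
            ∫⁻ ω in alive (τ + i) ∩ st (τ + i), ofReal (los (τ + i) ω) ∂P := by
        rw [← add_assoc, ← add_mul, ← ofReal_add (by positivity) (by have := h.nonneg; positivity)]
        congr 3; ring
    _ ≤ _ := by
        refine add_le_add_right ?_ _
        refine le_trans (le_of_eq ?_) (sum_le_sum hdn)
        rw [Finset.sum_comm]
        exact sum_congr rfl fun i _ => hsplit (fun k z => -f k z) (fun k => (hfm k).neg) i

/-- The time until every sensor has sent a message. -/
theorem silent_le (g : Flags ℱ X lo hi τ act) (n : ℕ) :
    ∑ i ∈ range n, P (alive (τ + i) \ ⋂ k, act k (τ + i))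
      ≤ ofReal ((log K + b * Δ) / log (affinityBound m B)⁻¹ + 1
        + (1 - affinityBound m B)⁻¹) * P (alive τ) := by
  have s0 := h.sensor ⟨0, h.pos⟩
  have hbΔ : 0 ≤ b * Δ := (mul_pos s0.b_pos s0.Δ_pos).le
  have hK : (1 : ℝ) ≤ K := by exact_mod_cast h.pos
  have hanti (i : ℕ) : alive (τ + i) ⊆ alive τ := by
    induction i with
    | zero => exact subset_rfl
    | succ i ih => exact (h.anti _ (Nat.le_add_right _ _)).trans ih
  refine sum_le_of_geometric s0.laws.affinityBound_pos s0.laws.affinityBound_lt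
    (by have := log_nonneg hK; positivity) (fun i => ?_) (fun i => ?_) n
  · exact measure_mono (Set.sdiff_subset.trans (hanti i))
  · have h1 : alive (τ + i) \ ⋂ k, act k (τ + i) ⊆ ⋃ k, alive τ \ act k (τ + i) := by
      intro ω hω
      simp only [Set.mem_sdiff, Set.mem_iInter, not_forall, Set.mem_iUnion] at hω ⊢
      obtain ⟨k, hk⟩ := hω.2
      exact ⟨k, hanti i hω.1, hk⟩
    refine (measure_mono h1).trans ((measure_iUnion_fintype_le _ _).trans ?_)
    have h2 : ∀ k ∈ Finset.univ, P (alive τ \ act k (τ + i))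
        ≤ ofReal (exp (b * Δ) * affinityBound m B ^ i) * P (alive τ) := fun k _ => by
      have s := h.sensor k
      refine ((h.steps k).measure_silent_le (h.meas τ le_rfl) (g.meas k) (g.succ k) i).trans ?_
      rw [← setLIntegral_const]
      refine lintegral_mono fun ω => ?_
      have hy := resid_mem (x := fun t ω => X t ω k) s.lo_pos s.hi_pos τ ω
      refine (s.laws.stay_iterate_one_le i hy).trans (ofReal_le_ofReal ?_)
      have := s.laws.affinityBound_pos
      gcongr
      linarith [hy.1, s.lo_le, s.hi_le]
    refine (sum_le_sum h2).trans (le_of_eq ?_)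
    rw [sum_fin_const, ← mul_assoc,
      ← ofReal_natCast, ← ofReal_mul₀, exp_add,
      exp_log (by linarith)]
    congr 2; ring

variable {μ z p σ : ℝ}

omit h in
theorem sum_split (hz : ∀ n, ∑ i ∈ range n, P (alive (τ + i) \ ⋂ k, act k (τ + i))
      ≤ ofReal z * P (alive τ)) (C : ℕ → Set Ω) (n : ℕ) :
    ∑ i ∈ range n, P (alive (τ + i) ∩ C (τ + i))
      ≤ ∑ i ∈ range n, P (alive (τ + i) ∩ (⋂ k, act k (τ + i)) ∩ C (τ + i))
        + ofReal z * P (alive τ) := by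
  refine le_trans ?_ (add_le_add_right (hz n) _)
  rw [← sum_add_distrib]
  refine sum_le_sum fun i _ => ?_
  refine (measure_mono ?_).trans (measure_union_le _ _)
  intro ω hω
  by_cases h1 : ω ∈ ⋂ k, act k (τ + i)
  · exact Or.inl ⟨⟨hω.1, h1⟩, hω.2⟩
  · exact Or.inr ⟨hω.1, h1⟩

theorem sum_ne_top (C : ℕ → Set Ω) (n : ℕ) : ∑ i ∈ range n, P (C i) ≠ ∞ := by
  have := h.sum_steps.prob
  exact (ENNReal.sum_lt_top.mpr fun i _ => measure_lt_top _ _).ne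

/-- The delay, when the information lost by quantization is small compared to the information in a
message, that is, for small `κ`. -/
theorem fine_total (g : Flags ℱ X lo hi τ act) (hp0 : 0 ≤ p) (hz0 : 0 ≤ z)
    (hp : ∀ k, ∫⁻ ω in alive τ ∩ act k τ, exit_ k (fun z => ofReal (z - Lam k z)) (res_ k τ ω) ∂P
        ≤ ofReal p * P (alive τ))
    (hz : ∀ n, ∑ i ∈ range n, P (alive (τ + i) \ ⋂ k, act k (τ + i)) ≤ ofReal z * P (alive τ))
    (hμ : K * m ≤ ∫ x, x ∂Qsum) (hμ' : ∫ x, x ∂Qsum ≤ K * (1 + B))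
    (hσ : spread Qsum ≤ K * (B / (2 * m))) {κ : ℝ} (hκ : κ = lam * (B + 1) / (a * Δ))
    (hκm : 4 * κ ≤ m) (n : ℕ) :
    ofReal (∫ x, x ∂Qsum) * ∑ i ∈ range n, P (alive (τ + i))
      ≤ ofReal ((1 + 4 * κ / m) * x + K * (4 * (b * Δ) + 4 * B / m + 4 * p
        + m * (timeBound m B b Δ + z) + (1 + B) * z)) * P (alive τ) := by
  have := h.sum_steps.prob
  have s0 := h.sensor ⟨0, h.pos⟩
  have hK : (1 : ℝ) ≤ K := by exact_mod_cast h.pos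
  have hm := s0.laws.m_pos
  have hB := s0.laws.B_pos
  have hx := h.nonneg
  have hbΔ : 0 ≤ b * Δ := (mul_pos s0.b_pos s0.Δ_pos).le
  have haΔ : 0 < a * Δ := mul_pos s0.a_pos s0.Δ_pos
  have htb : 0 ≤ timeBound m B b Δ := by unfold timeBound; positivity
  have hlam := s0.lam_nonneg
  have hκ0 : 0 ≤ κ := by rw [hκ]; positivity
  have hσ0 := h.drift.spread_pos
  set μ := ∫ x, x ∂Qsum
  have h1 := h.fine_le g hp n
  have h2 := fun k => h.ofReal_mul_count_le k n
  have h3 := sum_split hz (fun _ => univ) n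
  simp only [Set.inter_univ] at h3
  set q := P (alive τ)
  set E := ∑ i ∈ range n, P (alive (τ + i) ∩ ⋂ k, act k (τ + i))
  have hlamM : lam = κ * (a * Δ / (B + 1)) := by
    have := s0.a_pos
    have := s0.Δ_pos
    rw [hκ]; field_simp
  have h4 : ∀ k ∈ (Finset.univ : Finset (Fin K)), ofReal p * q + ofReal lam
      * ∑ i ∈ range n, P (alive (τ + i) ∩ snd_ k (τ + i))
      ≤ ofReal p * q + ofReal κ *
        (ofReal (timeBound m B b Δ) * q + (E + ofReal z * q)) := fun k _ => by
    refine add_le_add_right ?_ _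
    rw [hlamM, ofReal_mul hκ0, mul_assoc]
    exact mul_le_mul_right ((h2 k).trans (add_le_add_right h3 _)) _
  have h5 := h1.trans (add_le_add_right (mul_le_mul_right (sum_le_sum h4) 2) _)
  rw [sum_fin_const] at h5
  obtain ⟨e, he0, he⟩ := exists_ofReal (c := E) (h.sum_ne_top _ n)
  obtain ⟨r, hr0, hr⟩ := exists_ofReal (c := q) (measure_ne_top _ _)
  have hμ0 : 0 < μ := lt_of_lt_of_le (by positivity) hμ
  rw [he, hr, ← ofReal_natCast, ← ENNReal.ofReal_ofNat 2,
    ← ofReal_mul hμ0.le, ← ofReal_mul₀,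
    ← ofReal_mul₀, ← ofReal_mul₀,
    ← ofReal_mul₀, ← ofReal_add₀,
    ← ofReal_add₀, ← ofReal_mul₀,
    ← ofReal_add₀, ← ofReal_mul₀,
    ← ofReal_mul₀, ← ofReal_add₀,
    ofReal_le_ofReal_iff (by positivity)] at h5
  rw [he, hr, ← ofReal_mul₀, ← ofReal_add₀] at h3
  refine (mul_le_mul_right h3 _).trans ?_
  rw [hr, ← ofReal_mul hμ0.le, ← ofReal_mul₀]
  refine ofReal_le_ofReal ?_
  set y := 4 * κ / m with hy
  have hy0 : 0 ≤ y := by positivity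
  have hy1 : y ≤ 1 := by rw [hy, div_le_one hm]; exact hκm
  have hym : y * m = 4 * κ := by rw [hy]; field_simp
  set T := timeBound m B b Δ
  -- absorb the delay on the right-hand side into the left-hand side
  set N := (x + 2 * (K * (b * Δ)) + 4 * spread Qsum + 2 * K * (p + κ * (T + z))) * r with hN
  have h6 : μ * e ≤ N + y / 2 * (μ * e) := by
    have : 2 * K * κ * e ≤ y / 2 * (μ * e) := by
      have : (K * m) * (y / 2 * e) ≤ μ * (y / 2 * e) :=
        mul_le_mul_of_nonneg_right hμ (by positivity)
      calc 2 * K * κ * e = K * (y * m) / 2 * e := by rw [hym]; ring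
        _ ≤ _ := by linarith
    linarith
  have h7 : μ * e ≤ (1 + y) * N := by
    have h8 : 0 ≤ μ * e := by positivity
    nlinarith [mul_nonneg hy0 h8, mul_nonneg (mul_nonneg hy0 (sub_nonneg.mpr hy1)) h8]
  have h9 : (1 + y) * N ≤ ((1 + y) * x + K * (4 * (b * Δ) + 4 * B / m + 4 * p
      + m * (T + z))) * r := by
    rw [hN, ← mul_assoc]
    refine mul_le_mul_of_nonneg_right ?_ hr0
    have h10 : 4 * spread Qsum ≤ K * (2 * B / m) := by
      have : K * (2 * B / m) = 4 * (K * (B / (2 * m))) := by field_simp; ring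
      linarith
    have h11 : 2 * K * (κ * (T + z)) ≤ K * (m * (T + z) / 2) := by
      have h12 : κ * (T + z) ≤ m / 4 * (T + z) :=
        mul_le_mul_of_nonneg_right (by linarith) (by linarith)
      nlinarith [mul_le_mul_of_nonneg_left h12 (by positivity)]
    have h16 : (1 + y) * (2 * (K * (b * Δ)) + 4 * spread Qsum + 2 * K * (p + κ * (T + z)))
        ≤ 2 * (K * (2 * (b * Δ) + 2 * B / m + 2 * p + m * (T + z) / 2)) := by
      refine mul_le_mul (by linarith) (by linarith) (by positivity) (by norm_num)
    have e1 : 2 * (K * (2 * (b * Δ) + 2 * B / m + 2 * p + m * (T + z) / 2))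
        = K * (4 * (b * Δ) + 4 * B / m + 4 * p + m * (T + z)) := by ring
    linarith
  calc μ * (e + z * r) = μ * e + μ * (z * r) := by ring
    _ ≤ ((1 + y) * x + K * (4 * (b * Δ) + 4 * B / m + 4 * p
      + m * (T + z))) * r + K * (1 + B) * (z * r) := add_le_add (h7.trans h9)
        (mul_le_mul_of_nonneg_right hμ' (by positivity))
    _ = _ := by ring

/-- The delay, without any condition on the information lost by quantization. -/
theorem crude_total (g : Flags ℱ X lo hi τ act) (hp0 : 0 ≤ p) (hz0 : 0 ≤ z)
    (hp : ∀ k, ∫⁻ ω in alive τ ∩ act k τ, exit_ k (fun z => ofReal (-info_ k z))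
        (res_ k τ ω) ∂P ≤ ofReal p * P (alive τ))
    (hz : ∀ n, ∑ i ∈ range n, P (alive (τ + i) \ ⋂ k, act k (τ + i)) ≤ ofReal z * P (alive τ))
    (hμ' : ∫ x, x ∂Qsum ≤ K * (1 + B)) (n : ℕ) :
    ofReal (∫ x, x ∂Qsum) * ∑ i ∈ range n, P (alive (τ + i))
      ≤ ofReal ((1 + B) * (K * timeBound m B b Δ + timeBound m B b Δ
        * ((x + 4 * K + K * p + K * (2 * z)) / (1 - exp (-(a * Δ / 2))) ^ 2) + K * z))
        * P (alive τ) := by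
  have := h.sum_steps.prob
  have s0 := h.sensor ⟨0, h.pos⟩
  have hm := s0.laws.m_pos
  have hB := s0.laws.B_pos
  have hx := h.nonneg
  have hbΔ : 0 ≤ b * Δ := (mul_pos s0.b_pos s0.Δ_pos).le
  have haΔ : 0 < a * Δ := mul_pos s0.a_pos s0.Δ_pos
  have htb : 0 ≤ timeBound m B b Δ := by unfold timeBound; positivity
  have hβ : 0 < (1 - exp (-(a * Δ / 2))) ^ 2 := by
    have : exp (-(a * Δ / 2)) < 1 := by rw [← exp_zero]; exact exp_lt_exp.mpr (by linarith)
    positivity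
  set β := (1 - exp (-(a * Δ / 2))) ^ 2
  have h3 := sum_split hz (fun _ => univ) n
  simp only [Set.inter_univ] at h3
  set q := P (alive τ)
  set T := timeBound m B b Δ
  set E := ∑ i ∈ range n, P (alive (τ + i) ∩ ⋂ k, act k (τ + i))
  set G : Fin K → ℝ≥0∞ := fun k => exit_ k (fun z => ofReal (info_ k z)) 0 with hG
  set L : Fin K → ℝ≥0∞ := fun k => exit_ k (fun z => ofReal (-info_ k z)) 0 with hL
  set N : Fin K → ℝ≥0∞ := fun k => ∑ i ∈ range n, P (alive (τ + i)
    ∩ (⋂ k, act k (τ + i)) ∩ snd_ k (τ + i)) with hN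
  have hNt (k : Fin K) : N k ≠ ∞ := h.sum_ne_top (fun i => alive (τ + i)
    ∩ (⋂ k, act k (τ + i)) ∩ snd_ k (τ + i)) n
  have hLG (k : Fin K) : L k ≤ 2 ∧ L k + ofReal β ≤ G k := by
    have s := h.sensor k
    have hLm := s.meas
    have := s.laws.prob₀
    set A := exit_ k (fun z => ofReal (exp (-Lam k z / 2))) 0 with hA
    have h4 := s.exitMean_exp_neg_half_le
    have hA1 : A ≤ 1 := le_trans le_self_add h4
    have hm2 : Measurable fun z => ofReal (exp (-Lam k z / 2)) := by fun_prop
    have h5 : G k + 2 * A = 2 + L k := by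
      have e3 : (2 : ℝ≥0∞) = exit_ k (fun _ => 2 * 1) 0 := by
        rw [exitMean_const_mul measurableSet_Ioo measurable_const]
        rw [show (fun _ => 1 : ℝ → ℝ≥0∞) = 1 from rfl, (s.exitMean₀_one s.zero_mem), mul_one]
      rw [((exitMean_const_mul measurableSet_Ioo hm2 2 0).symm)]
      nth_rw 2 [e3]
      simp only [hG, hL]
      rw [← exitMean_add measurableSet_Ioo (by fun_prop),
        ← exitMean_add measurableSet_Ioo measurable_const]
      congr 1
      funext z
      have e4 : (2 : ℝ≥0∞) = ofReal 2 := by norm_num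
      simp only [Pi.add_apply]
      rw [mul_one, e4, ← ofReal_mul (by norm_num)]
      rcases le_total 0 info_ k z with h6 | h6
      · rw [ofReal_of_nonpos (p := -info_ k z) (by linarith),
          add_zero, ← ofReal_add h6 (by positivity)]
        congr 1; ring
      · rw [ofReal_of_nonpos h6, zero_add, ← ofReal_add (by norm_num) (by linarith)]
        congr 1; ring
    have h2A : 2 * A ≠ ∞ := ENNReal.mul_ne_top (by norm_num) (ne_top_of_le_ne_top (by simp) hA1)
    constructor
    · have h6 : L k ≤ 2 * A := by
        simp only [hL, hA]
        rw [← exitMean_const_mul measurableSet_Ioo hm2]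
        refine exitMean_mono (fun z _ => ?_) 0
        rw [← ENNReal.ofReal_ofNat 2, ← ofReal_mul (by norm_num)]
        exact ofReal_le_ofReal (by linarith)
      refine h6.trans ?_
      calc 2 * A ≤ 2 * 1 := mul_le_mul_right hA1 2
        _ = 2 := mul_one 2
    · refine (ENNReal.add_le_add_iff_right h2A).mp ?_
      rw [h5]
      have e6 : ofReal β = 2 * ofReal (β / 2) := by
        rw [← ENNReal.ofReal_ofNat 2, ← ofReal_mul (by norm_num)]
        congr 1; ring
      calc L k + ofReal β + 2 * A = 2 * (A + ofReal (β / 2)) + L k := by rw [e6]; ring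
        _ ≤ 2 * 1 + L k := by gcongr
        _ = 2 + L k := by rw [mul_one]
  have h7 : ofReal β * ∑ k, N k ≤ ofReal (x + 4 * K + K * p + K * (2 * z)) * q := by
    have h8 : ∑ k, (L k * N k + ofReal β * N k)
        ≤ ofReal (x + 4 * K) * q + ∑ k, (L k * N k + (ofReal p * q + 2 * (ofReal z * q))) := by
      refine le_trans (sum_le_sum fun k _ => ?_) ((h.crude_le g hp n).trans (add_le_add_right
        (sum_le_sum fun k _ => ?_) _))
      · rw [← add_mul]; exact mul_le_mul_left (hLG k).2 _
      · have h9 := sum_split hz (fun t => snd_ k t) n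
        calc _ ≤ ofReal p * q + L k * (N k + ofReal z * q) := by gcongr
          _ = L k * N k + (ofReal p * q + L k * (ofReal z * q)) := by ring
          _ ≤ _ := by gcongr; exact (hLG k).1
    rw [sum_add_distrib, sum_add_distrib, ← add_assoc,
      add_comm (ofReal (x + 4 * K) * q), add_assoc, ← mul_sum] at h8
    refine ((ENNReal.add_le_add_iff_left ((ENNReal.sum_lt_top.mpr fun k _ => ENNReal.mul_lt_top
      ((hLG k).1.trans_lt (by simp)) (hNt k).lt_top).ne)).mp h8).trans (le_of_eq ?_)
    rw [sum_fin_const,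
      ← ofReal_natCast, ← ENNReal.ofReal_ofNat 2,
      ofReal_add₀,
      ofReal_add₀,
      ofReal_add₀,
      ofReal_add₀, ofReal_mul₀,
      ofReal_mul₀, ofReal_mul₀,
      ofReal_mul₀]
    ring
  have h11 : K * E ≤ K * (ofReal T * q) + ofReal T * ∑ k, N k := by
    have h12 : ∀ k ∈ (Finset.univ : Finset (Fin K)),
        E ≤ ofReal T * q + ofReal T * N k := fun k _ => by
      have s := h.sensor k
      refine ((h.steps k).le_count h.meas h.anti g.measurableSet_started g.started_mono s.lo_pos
        s.hi_pos (fun y hy => s.meanTime₀_le hy) n).trans (add_le_add_right ?_ _)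
      rw [← mul_sum]
      exact mul_le_mul_left (s.meanTime₀_le s.zero_mem) _
    have h13 := sum_le_sum h12
    rwa [sum_add_distrib, sum_fin_const, sum_fin_const, ← mul_sum] at h13
  obtain ⟨e, he0, he⟩ := exists_ofReal (c := E) (h.sum_ne_top _ n)
  obtain ⟨r, hr0, hr⟩ := exists_ofReal (c := q) (measure_ne_top _ _)
  obtain ⟨s, hs0, hs⟩ := exists_ofReal (c := ∑ k, N k)
    (ENNReal.sum_lt_top.mpr fun k _ => (hNt k).lt_top).ne
  rw [hs, hr, ← ofReal_mul hβ.le, ← ofReal_mul₀, ofReal_le_ofReal_iff (by positivity)] at h7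
  rw [he, hr, hs, ← ofReal_natCast, ← ofReal_mul₀, ← ofReal_mul₀, ← ofReal_mul₀,
    ← ofReal_mul₀, ← ofReal_add₀,
    ofReal_le_ofReal_iff (by positivity)] at h11
  rw [he, hr, ← ofReal_mul₀, ← ofReal_add₀] at h3
  refine (mul_le_mul' (ofReal_le_ofReal hμ') h3).trans ?_
  rw [hr, ← ofReal_mul₀, ← ofReal_mul₀]
  refine ofReal_le_ofReal ?_
  have h14 : s ≤ (x + 4 * K + K * p + K * (2 * z)) / β * r := by
    rw [div_mul_eq_mul_div, le_div_iff₀ hβ]; linarith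
  have h15 := mul_le_mul_of_nonneg_left h14 htb
  calc K * (1 + B) * (e + z * r) = (1 + B) * (K * e + K * z * r) := by ring
    _ ≤ (1 + B) * (K * (T * r) + T * ((x + 4 * K + K * p + K * (2 * z)) / β * r)
        + K * z * r) := by gcongr; linarith
    _ = _ := by ring

/-- The information lost in the messages that follow the change. -/
theorem fine_init_le {D : ℝ}
    (hD : ∀ k, ∀ z ∉ Ioo (-lo k) (hi k), -(D * Δ) ≤ Lam k z) (hD0 : 0 ≤ D) (k : Fin K) :
    ∫⁻ ω in alive τ ∩ act k τ, exit_ k (fun z => ofReal (z - Lam k z)) (res_ k τ ω) ∂P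
      ≤ ofReal (overConst m B * B + (b + D) * Δ) * P (alive τ) := by
  have s := h.sensor k
  have := s.laws.prob₀
  have hDΔ : 0 ≤ D * Δ := mul_nonneg hD0 s.Δ_pos.le
  have hbΔ : 0 ≤ b * Δ := (mul_pos s.b_pos s.Δ_pos).le
  refine (lintegral_mono_set Set.inter_subset_left).trans ?_
  rw [← setLIntegral_const]
  refine lintegral_mono fun ω => ?_
  have hy := resid_mem (x := fun t ω => X t ω k) s.lo_pos s.hi_pos τ ω
  set y := res_ k τ ω
  have e : (fun _ => ofReal ((b + D) * Δ) * 1 : ℝ → ℝ≥0∞)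
      = fun z => ofReal ((b + D) * Δ) * (1 : ℝ → ℝ≥0∞) z := rfl
  calc exit_ k (fun z => ofReal (z - Lam k z)) y ≤ exit_ k ((fun z => ofReal (z - hi k))
        + fun _ => ofReal ((b + D) * Δ) * 1) y := by
        refine exitMean_mono (fun z hz => ?_) y
        simp only [Pi.add_apply, mul_one]
        refine (ofReal_le_ofReal ?_).trans ENNReal.ofReal_add_le
        linarith [hD k z hz, s.hi_le]
    _ ≤ _ := by
        rw [exitMean_add measurableSet_Ioo (by fun_prop), ofReal_add (mul_nonneg
          s.laws.overConst_pos.le s.laws.B_pos.le) (by linarith)]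
        refine add_le_add (s.laws.exitMean_over_le_const hy) ?_
        rw [e, exitMean_const_mul measurableSet_Ioo measurable_one, s.exitMean₀_one hy, mul_one]

theorem crude_init_le {D : ℝ} (hD : ∀ k, ∀ z ∉ Ioo (-lo k) (hi k), -(D * Δ) ≤ Lam k z) (k : Fin K) :
    ∫⁻ ω in alive τ ∩ act k τ, exit_ k (fun z => ofReal (-info_ k z)) (res_ k τ ω) ∂P
      ≤ ofReal (2 * exp (D * Δ / 2)) * P (alive τ) := by
  have s := h.sensor k
  have := s.laws.prob₀
  refine (lintegral_mono_set Set.inter_subset_left).trans ?_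
  rw [← setLIntegral_const]
  refine lintegral_mono fun ω => ?_
  set y := res_ k τ ω
  calc _ ≤ exit_ k (fun z => ofReal (2 * exp (D * Δ / 2)) * (1 : ℝ → ℝ≥0∞) z) y := by
        refine exitMean_mono (fun z hz => ?_) y
        rw [Pi.one_apply, mul_one]
        refine ofReal_le_ofReal ?_
        have : exp (-Lam k z / 2) ≤ exp (D * Δ / 2) := exp_le_exp.mpr (by linarith [hD k z hz])
        linarith
    _ ≤ _ := by
        rw [exitMean_const_mul measurableSet_Ioo measurable_one, s.exitMean₀_one (resid_mem (x :=
          fun t ω => X t ω k) s.lo_pos s.hi_pos τ ω), mul_one]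

end Network

end

set_option maxHeartbeats 800000 in
/-- The delay of the test of the fusion center, if either the information in a message is bounded
below or the number of sensors is not too large. In the second case the messages of a sensor are
disregarded until, and including, its first message after the change. -/
theorem exists_network_delay {m B a b Δ₀ D N : ℝ} (hm : 0 < m) (hB : 0 < B) (ha : 0 < a)
    (hb : 0 < b) (hΔ₀ : 0 < Δ₀) (hD : 0 ≤ D) (hN : 0 ≤ N) : ∃ C : ℝ, 0 < C ∧
    ∀ (K : ℕ) (Ω : Type u) [mΩ : MeasurableSpace Ω] (Δ θ : ℝ) (ℱ : ℕ → MeasurableSpace Ω)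
      (P : Measure Ω) (X : ℕ → Ω → Fin K → ℝ) (Q Q₀ : Fin K → Measure ℝ) (Qsum : Measure ℝ)
      (lo hi : Fin K → ℝ) (Lam : Fin K → ℝ → ℝ) (τ : ℕ) (x : ℝ) (alive : ℕ → Set Ω),
      Network m B a b Δ (lossConst m B * min θ 1) ℱ P X Q Q₀ Qsum lo hi Lam τ x alive →
      Δ₀ ≤ Δ → 0 ≤ θ →
      ((∀ k, ∀ z ∉ Ioo (-lo k) (hi k), -(D * Δ) ≤ Lam k z) ∨ log K ≤ N * Δ) →
      K * m ≤ ∫ x, x ∂Qsum → ∫ x, x ∂Qsum ≤ K * (1 + B) → spread Qsum ≤ K * (B / (2 * m)) →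
      ofReal (∫ x, x ∂Qsum) * ∑' i, P (alive (τ + i))
        ≤ ofReal ((1 + C * min θ 1 / Δ) * x + K * (C * Δ)) * P (alive τ) := by
  set L := lossConst m B with hL
  set ρ := affinityBound m B
  set c₀ := overConst m B * B
  set zc := (N + b) / log ρ⁻¹ + (1 + (1 - ρ)⁻¹) / Δ₀ with hzc
  set c₁ := 4 * L * (B + 1) / (a * m) with hc₁
  set c₂ := 4 * b + 4 * (B / m) / Δ₀ + 4 * (c₀ / Δ₀ + (b + D))
    + m * ((2 * b / m + 2 * B / m / m / Δ₀) + zc) + (1 + B) * zc with hc₂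
  set T₁ := timeBound m B b c₁ with hT₁
  set β := (1 - exp (-(a * Δ₀ / 2))) ^ 2 with hβ
  set p₁ := 2 * exp (D * c₁ / 2) with hp₁
  set c₃ := (1 + B) * (T₁ * (1 / β)) with hc₃
  set c₄ := (1 + B) * (T₁ + T₁ * ((4 + p₁ + 2 * (zc * c₁)) / β) + zc * c₁) / Δ₀ with hc₄
  refine ⟨1 + |c₁| + |c₂| + |c₃ * c₁| + |c₄|, by positivity, ?_⟩
  intro K Ω mΩ Δ θ ℱ P X Q Q₀ Qsum lo hi Lam τ x alive h hΔ hθ hmode hμ hμ' hσ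
  have s0 := h.sensor ⟨0, h.pos⟩
  have hΔp : 0 < Δ := hΔ₀.trans_le hΔ
  have hx := h.nonneg
  have hoc := s0.laws.overConst_pos
  have hL0 : 0 < L := by rw [hL, lossConst]; positivity
  have hρ1 : ρ < 1 := s0.laws.affinityBound_lt
  have hlog : 0 < log ρ⁻¹ := log_pos (one_lt_inv₀ s0.laws.affinityBound_pos |>.mpr hρ1)
  have hc₁0 : 0 < c₁ := by positivity
  have hc₂0 : 0 ≤ c₂ := by positivity
  have hT₁0 : 0 ≤ T₁ := by rw [hT₁, timeBound]; positivity
  have hexp : exp (-(a * Δ₀ / 2)) < 1 := by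
    rw [← exp_zero]
    refine exp_lt_exp.mpr ?_
    have := mul_pos ha hΔ₀
    linarith
  have hc₃0 : 0 ≤ c₃ := by positivity
  have hc₄0 : 0 ≤ c₄ := by positivity
  rw [abs_of_pos hc₁0, abs_of_nonneg hc₂0, abs_of_nonneg (mul_nonneg hc₃0 hc₁0.le),
    abs_of_nonneg hc₄0]
  set C := 1 + c₁ + c₂ + c₃ * c₁ + c₄
  have hc31 : 0 ≤ c₃ * c₁ := by positivity
  -- the flags, and the bound for the time until they are set
  obtain ⟨act, g, hz, hpf, hpc⟩ : ∃ act : Fin K → ℕ → Set Ω, Flags ℱ X lo hi τ act ∧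
      (∀ n, ∑ i ∈ range n, P (alive (τ + i) \ ⋂ k, act k (τ + i)) ≤ ofReal (zc * Δ) * P (alive τ)) ∧
      (∀ k, ∫⁻ ω in alive τ ∩ act k τ, exitMean (Q₀ k) (Ioo (-lo k) (hi k))
        (fun z => ofReal (z - Lam k z)) (resid (lo k) (hi k) (fun t ω => X t ω k) τ ω) ∂P
        ≤ ofReal (c₀ + (b + D) * Δ) * P (alive τ)) ∧
      (∀ k, ∫⁻ ω in alive τ ∩ act k τ, exitMean (Q₀ k) (Ioo (-lo k) (hi k))
        (fun z => ofReal (-(2 * (1 - exp (-Lam k z / 2)))))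
          (resid (lo k) (hi k) (fun t ω => X t ω k) τ ω) ∂P
        ≤ ofReal (2 * exp (D * Δ / 2)) * P (alive τ)) := by
    rcases hmode with hmode | hmode
    · refine ⟨fun _ _ => univ, ⟨fun _ t _ => @MeasurableSet.univ _ (ℱ t), fun _ _ _ => by simp⟩,
        fun n => by simp, fun k => h.fine_init_le (act := fun _ _ => univ) hmode hD k,
        fun k => h.crude_init_le (act := fun _ _ => univ) hmode k⟩
    · set act : Fin K → ℕ → Set Ω := fun k t =>
        ⋃ s ∈ Set.Ico τ t, sends (lo k) (hi k) (fun t ω => X t ω k) s with hact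
      have hact0 (k : Fin K) : act k τ = ∅ := by simp [hact]
      have g : Flags ℱ X lo hi τ act := by
        refine ⟨fun k t ht => ?_, fun k t ht => ?_⟩
        · refine MeasurableSet.biUnion (Set.to_countable _) fun s hs => ?_
          exact (h.steps k).mono hs.2 _ ((h.steps k).measurableSet_sends s)
        · simp only [hact]
          rw [show Set.Ico τ (t + 1) = Set.Ico τ t ∪ {t} by
            ext s; simp only [Set.mem_Ico, Set.mem_union, Set.mem_singleton_iff]; omega,
            Set.biUnion_union, Set.biUnion_singleton]
      refine ⟨act, g, fun n => (h.silent_le g n).trans (mul_le_mul_left (ofReal_le_ofReal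
        ?_) _), fun k => ?_, fun k => ?_⟩
      · have e1 : (log K + b * Δ) / log ρ⁻¹ ≤ (N + b) / log ρ⁻¹ * Δ := by
          rw [div_mul_eq_mul_div]; gcongr; linarith
        have e2 : 1 + (1 - ρ)⁻¹ ≤ (1 + (1 - ρ)⁻¹) / Δ₀ * Δ := by
          rw [div_mul_eq_mul_div, le_div_iff₀ hΔ₀]; gcongr
        rw [hzc, add_mul]
        linarith
      · rw [hact0]; simp
      · rw [hact0]; simp
  rw [← ENNReal.tsum_mul_left]
  refine tsum_le_of_sum_range_le fun n => ?_
  rw [← mul_sum]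
  have hgrow {y : ℝ} (hy : 0 ≤ y) : y ≤ y / Δ₀ * Δ := by
    rw [div_mul_eq_mul_div, le_div_iff₀ hΔ₀]; gcongr
  by_cases hκ : 4 * (L * min θ 1 * (B + 1) / (a * Δ)) ≤ m
  · refine (h.fine_total g (by positivity) (by positivity) hpf hz hμ hμ' hσ rfl hκ n).trans
      (mul_le_mul_left (ofReal_le_ofReal ?_) _)
    have e1 : 4 * (L * min θ 1 * (B + 1) / (a * Δ)) / m = c₁ * min θ 1 / Δ := by
      rw [hc₁]; field_simp
    rw [e1]
    have e2 : c₁ * min θ 1 / Δ ≤ C * min θ 1 / Δ := by gcongr; linarith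
    have e3 : 4 * (b * Δ) + 4 * B / m + 4 * (c₀ + (b + D) * Δ)
        + m * (timeBound m B b Δ + zc * Δ) + (1 + B) * (zc * Δ) ≤ c₂ * Δ := by
      have t1 := hgrow (y := 4 * (B / m)) (by positivity)
      have t2 := hgrow (y := c₀) (by positivity)
      have t3 := hgrow (y := 2 * B / m / m) (by positivity)
      have t4 : timeBound m B b Δ = 2 * b / m * Δ + 2 * B / m / m := by rw [timeBound]; field_simp
      rw [t4, hc₂]
      have t5 : m * (2 * b / m * Δ + 2 * B / m / m + zc * Δ)
          ≤ m * ((2 * b / m + 2 * B / m / m / Δ₀) + zc) * Δ := by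
        rw [mul_assoc]
        refine mul_le_mul_of_nonneg_left ?_ hm.le
        linarith
      have t6 : 4 * B / m = 4 * (B / m) := by ring
      linarith
    have e4 : c₂ * Δ ≤ C * Δ := by gcongr; linarith
    gcongr
    exact e3.trans e4
  · -- here the interval of the residuals has bounded length
    push Not at hκ
    have hθΔ : Δ < c₁ * min θ 1 := by
      have e1 : 4 * (L * min θ 1 * (B + 1) / (a * Δ)) = c₁ * min θ 1 / Δ * m := by
        rw [hc₁]; field_simp
      rw [e1] at hκ
      have e2 := (lt_mul_iff_one_lt_left hm).mp hκ
      rwa [one_lt_div hΔp] at e2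
    have hΔ₁ : Δ ≤ c₁ := by
      have := mul_le_mul_of_nonneg_left (min_le_right θ 1) hc₁0.le
      linarith
    refine (h.crude_total g (by positivity) (by positivity) hpc hz hμ' n).trans
      (mul_le_mul_left (ofReal_le_ofReal ?_) _)
    have hT : timeBound m B b Δ ≤ T₁ := by rw [hT₁, timeBound, timeBound]; gcongr
    have hβΔ : β ≤ (1 - exp (-(a * Δ / 2))) ^ 2 := by
      have e1 : exp (-(a * Δ / 2)) ≤ exp (-(a * Δ₀ / 2)) :=
        exp_le_exp.mpr (by have := mul_le_mul_of_nonneg_left hΔ ha.le; linarith)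
      rw [hβ]
      exact pow_le_pow_left₀ (by linarith) (by linarith) 2
    have hp : 2 * exp (D * Δ / 2) ≤ p₁ := by rw [hp₁]; gcongr
    have e1 : (1 + B) * (K * timeBound m B b Δ + timeBound m B b Δ
        * ((x + 4 * K + K * (2 * exp (D * Δ / 2)) + K * (2 * (zc * Δ)))
          / (1 - exp (-(a * Δ / 2))) ^ 2) + K * (zc * Δ))
        ≤ (1 + B) * (K * T₁ + T₁
        * ((x + 4 * K + K * p₁ + K * (2 * (zc * c₁))) / β) + K * (zc * c₁)) := by
      gcongr
    refine e1.trans ?_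
    have e2 : (1 + B) * (K * T₁ + T₁
        * ((x + 4 * K + K * p₁ + K * (2 * (zc * c₁))) / β) + K * (zc * c₁))
        = c₃ * x + K * (c₄ * Δ₀) := by
      rw [hc₃, hc₄]; field_simp; ring
    rw [e2]
    have e3 : c₃ ≤ 1 + C * min θ 1 / Δ := by
      have e4 : 1 ≤ c₁ * min θ 1 / Δ := by rw [one_le_div hΔp]; exact hθΔ.le
      have e5 := mul_le_mul_of_nonneg_left e4 hc₃0
      have e6 : c₃ * (c₁ * min θ 1 / Δ) ≤ C * min θ 1 / Δ := by
        rw [← mul_div_assoc, ← mul_assoc]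
        gcongr; linarith
      linarith
    have e4 : c₄ * Δ₀ ≤ C * Δ := mul_le_mul (by linarith) hΔ hΔ₀.le (by positivity)
    gcongr

/-! ### Exponential moments of the messages before the change -/

theorem exitMean_one_le {Q : Measure ℝ} [IsProbabilityMeasure Q] {I : Set ℝ}
    (hI : MeasurableSet I) (x : ℝ) : exitMean Q I 1 x ≤ 1 := by
  have h1 : ∀ z ∈ I, exitMean Q I 1 z ≤ 1 := fun z hz =>
    exitMean_le_of_superharmonic hI measurable_one (W := fun _ => 1) measurable_const
      (fun _ _ => le_rfl) (fun _ _ => by simp) hz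
  rw [exitMean_eq hI measurable_one]
  refine (add_le_add_right (stay_mono (g := 1) h1 x) _).trans ?_
  rw [leave_add_stay hI measurable_one]
  simp

section
variable {m B a b Δ lam L : ℝ} {Q Q₀ : Measure ℝ} {Lam : ℝ → ℝ}

/-- The exponent by which the threshold of the fusion center is effectively reduced: the
information lost in a message is at least `L` only with a small probability. -/
def tiltDefect (a Δ lam L : ℝ) : ℝ :=
  exp (-L) * min 1 (lam / L) / ((1 - exp (-(a * Δ / 2))) ^ 2 / 2)

/-- The exponential of the message, where the loss of information is cut off at `L`. -/
def score (η L : ℝ) (Lam : ℝ → ℝ) (z : ℝ) : ℝ≥0∞ := ofReal (exp ((1 - η) * max (Lam z) (z - L)))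

theorem measurable_score (η L : ℝ) (h : Measurable Lam) : Measurable (score η L Lam) := by
  unfold score; fun_prop

theorem exp_convex {η : ℝ} (h0 : 0 ≤ η) (h1 : η ≤ 1 / 2) (y : ℝ) :
    exp ((1 - η) * y) ≤ (1 - 2 * η) * exp y + 2 * η * exp (y / 2) := by
  have h := convexOn_exp.2 (mem_univ y) (mem_univ (y / 2))
    (show 0 ≤ 1 - 2 * η by linarith) (show 0 ≤ 2 * η by linarith) (by ring)
  simp only [smul_eq_mul] at h
  rwa [show (1 - 2 * η) * y + 2 * η * (y / 2) = (1 - η) * y by ring] at h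

variable (s : Sensor m B a b Δ lam Q Q₀ lo hi Lam)
include s

theorem Sensor.tiltDefect_mem (hL : 0 < L)
    (hLβ : exp (-L / 2) ≤ (1 - exp (-(a * Δ / 2))) ^ 2 / 2 / 2) :
    0 ≤ tiltDefect a Δ lam L ∧ tiltDefect a Δ lam L ≤ 1 / 2 := by
  set β := (1 - exp (-(a * Δ / 2))) ^ 2 / 2
  have hβ0 : 0 < β := by linarith [exp_pos (-L / 2)]
  have hmin := le_min zero_le_one (div_nonneg s.lam_nonneg hL.le)
  refine ⟨by unfold tiltDefect; positivity, ?_⟩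
  unfold tiltDefect
  rw [div_le_iff₀ hβ0]
  have h1 : exp (-L) ≤ exp (-L / 2) := exp_le_exp.mpr (by linarith)
  have h2 : exp (-L) * min 1 (lam / L) ≤ exp (-L) * 1 :=
    mul_le_mul_of_nonneg_left (min_le_left _ _) (exp_pos _).le
  linarith

/-- The exponential moment of the cut-off message is at most `1`: the exponent `1 - η` makes up for
the cut-off, by convexity, since the messages are far from deterministic. -/
theorem Sensor.exitMean_score_le_one (hL : 0 < L)
    (hLβ : exp (-L / 2) ≤ (1 - exp (-(a * Δ / 2))) ^ 2 / 2 / 2) :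
    exitMean Q 𝕀 (score (tiltDefect a Δ lam L) L Lam) 0 ≤ 1 := by
  have := s.laws.prob
  have := s.laws.prob₀
  have hLam := s.meas
  have hI : MeasurableSet 𝕀 := measurableSet_Ioo
  obtain ⟨hη0, hη1⟩ := s.tiltDefect_mem hL hLβ
  set η := tiltDefect a Δ lam L with hη
  set β := (1 - exp (-(a * Δ / 2))) ^ 2 / 2 with hβ
  set I := 𝕀
  have hβ0 : 0 < β := by linarith [exp_pos (-L / 2)]
  have hmin := le_min zero_le_one (div_nonneg s.lam_nonneg hL.le)
  set δ := exp (-L) * min 1 (lam / L)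
  have hδ0 : 0 ≤ δ := by positivity
  have hδη : δ = η * β := by rw [hη, tiltDefect, div_mul_cancel₀ _ hβ0.ne']
  have e1 : exitMean Q I (fun z => ofReal (exp z)) 0 = 1 := by
    have h1 := exitMean_tilt hI s.laws.tilt measurable_one (F := 1) 0
    rw [s.exitMean₀_one s.zero_mem] at h1
    simpa using h1.symm
  have e2 : exitMean Q I (fun z => ofReal (exp (Lam z))) 0 = 1 := by
    have h1 := s.change 1 measurable_one
    simp only [Pi.one_apply, mul_one] at h1
    rw [h1]
    exact s.exitMean₀_one s.zero_mem
  -- the first exponential moment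
  have h1 : exitMean Q I (fun z => ofReal (exp (max (Lam z) (z - L)))) 0 ≤ ofReal (1 + δ) := by
    set G : ℝ → ℝ≥0∞ := {z | L < z - Lam z}.indicator 1 with hG
    have hGm : Measurable G :=
      measurable_one.indicator (measurableSet_lt measurable_const (measurable_id.sub hLam))
    have h2 : exitMean Q₀ I G 0 ≤ ofReal (min 1 (lam / L)) := by
      rw [ENNReal.ofReal_min, ofReal_one]
      refine le_min ?_ ?_
      · rw [← s.exitMean₀_one s.zero_mem]
        exact exitMean_mono (fun z _ => Set.indicator_le_self' (fun _ _ => zero_le) z) 0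
      · have h3 := s.loss_le
        have h4 : exitMean Q₀ I G 0 ≤ ofReal (1 / L) * ofReal lam := by
          refine le_trans ?_ (mul_le_mul_right h3 _)
          rw [← exitMean_const_mul hI (by fun_prop)]
          refine exitMean_mono (fun z _ => Set.indicator_apply_le' (fun hz => ?_)
            (fun _ => zero_le)) 0
          rw [← ofReal_mul₀, Pi.one_apply, ← ofReal_one]
          refine ofReal_le_ofReal ?_
          rw [one_div, inv_mul_eq_div, one_le_div hL]
          exact le_of_lt hz
        refine h4.trans (le_of_eq ?_)
        rw [← ofReal_mul₀]
        congr 1; ring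
    have h3 := exitMean_tilt hI s.laws.tilt hGm 0
    rw [exp_zero, ofReal_one, one_mul] at h3
    calc _ ≤ exitMean Q I ((fun z => ofReal (exp (Lam z)))
          + fun z => ofReal (exp (-L)) * (ofReal (exp z) * G z)) 0 := by
          refine exitMean_mono (fun z _ => ?_) 0
          simp only [Pi.add_apply]
          rcases le_total (z - L) (Lam z) with h4 | h4
          · rw [max_eq_left h4]; exact le_self_add
          · rcases eq_or_lt_of_le h4 with h5 | h5
            · rw [← h5, max_self]; exact le_self_add
            · have h6 : z ∈ {z | L < z - Lam z} := by
                show L < z - Lam z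
                linarith
              rw [max_eq_right h4, hG, indicator_of_mem h6, Pi.one_apply, mul_one,
                ← ofReal_mul (exp_pos _).le, ← exp_add,
                show -L + z = z - L by ring]
              exact le_add_self
      _ = 1 + ofReal (exp (-L)) * exitMean Q₀ I G 0 := by
          have h5 : Measurable fun z : ℝ => ofReal (exp z) * G z := by fun_prop
          rw [exitMean_add hI (by fun_prop), e2, exitMean_const_mul hI h5, h3]
      _ ≤ 1 + ofReal (exp (-L)) * ofReal (min 1 (lam / L)) := by gcongr
      _ = _ := by rw [← ofReal_mul (exp_pos _).le, ofReal_add zero_le_one hδ0, ofReal_one]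
  -- the exponential moment of order one half
  have h2 : exitMean Q I (fun z => ofReal (exp (max (Lam z) (z - L) / 2))) 0
      ≤ ofReal (1 - β / 2) := by
    have h3 := s.half_le
    have hβ1 : β ≤ 1 := by
      have h4 := le_trans le_add_self h3
      rwa [ofReal_le_one] at h4
    have h5 : exitMean Q I (fun z => ofReal (exp (max (Lam z) (z - L) / 2))) 0
        ≤ exitMean Q I (fun z => ofReal (exp (Lam z / 2))) 0 + ofReal (β / 2) := by
      calc _ ≤ exitMean Q I ((fun z => ofReal (exp (Lam z / 2)))
            + fun z => ofReal (exp (-L / 2) / 2) * ((fun z => ofReal (exp z)) + 1) z) 0 := by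
            refine exitMean_mono (fun z _ => ?_) 0
            simp only [Pi.add_apply, Pi.one_apply]
            rcases le_total (z - L) (Lam z) with h4 | h4
            · rw [max_eq_left h4]; exact le_self_add
            · rw [max_eq_right h4, ← ofReal_one, ← ofReal_add (exp_pos _).le zero_le_one,
                ← ofReal_mul₀]
              refine le_trans (ofReal_le_ofReal ?_) le_add_self
              have h6 : exp (z / 2) ≤ (exp z + 1) / 2 := by
                have h7 : exp z = exp (z / 2) ^ 2 := by
                  rw [← Real.exp_nat_mul]; congr 1; push_cast; ring
                rw [h7]; nlinarith [sq_nonneg (exp (z / 2) - 1)]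
              calc exp ((z - L) / 2) = exp (-L / 2) * exp (z / 2) := by
                    rw [← exp_add]; congr 1; ring
                _ ≤ exp (-L / 2) * ((exp z + 1) / 2) := by gcongr
                _ = _ := by ring
        _ = exitMean Q I (fun z => ofReal (exp (Lam z / 2))) 0
            + ofReal (exp (-L / 2) / 2) * (1 + 1) := by
            rw [exitMean_add hI (by fun_prop), exitMean_const_mul hI
              ((by fun_prop : Measurable fun z : ℝ => ofReal (exp z)).add
                measurable_one), exitMean_add hI (by fun_prop), e1, s.exitMean_one s.zero_mem]
        _ ≤ _ := by
            refine add_le_add_right ?_ _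
            rw [show (1 + 1 : ℝ≥0∞) = ofReal 2 by norm_num,
              ← ofReal_mul₀]
            exact ofReal_le_ofReal (by linarith)
    have h6 : exitMean Q I (fun z => ofReal (exp (Lam z / 2))) 0 ≤ ofReal (1 - β) := by
      rw [ENNReal.ofReal_sub _ hβ0.le, ofReal_one]
      exact ENNReal.le_sub_of_add_le_right ofReal_ne_top h3
    refine h5.trans ((add_le_add_left h6 _).trans (le_of_eq ?_))
    rw [← ofReal_add (by linarith) (by linarith)]
    congr 1; ring
  have hβ2 : 0 ≤ 1 - β / 2 := by
    have h4 := le_trans le_add_self s.half_le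
    rw [ofReal_le_one] at h4
    linarith
  calc _ ≤ exitMean Q I ((fun z => ofReal (1 - 2 * η) * ofReal (exp (max (Lam z) (z - L))))
        + fun z => ofReal (2 * η) * ofReal (exp (max (Lam z) (z - L) / 2))) 0 := by
        refine exitMean_mono (fun z _ => ?_) 0
        simp only [Pi.add_apply, score]
        rw [← ofReal_mul (by linarith), ← ofReal_mul (by linarith),
          ← ofReal_add (mul_nonneg (by linarith) (exp_pos _).le) (by positivity)]
        exact ofReal_le_ofReal (exp_convex hη0 hη1 _)
    _ ≤ ofReal (1 - 2 * η) * ofReal (1 + δ) + ofReal (2 * η) * ofReal (1 - β / 2) := by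
        rw [exitMean_add hI (by fun_prop), exitMean_const_mul hI (by fun_prop),
          exitMean_const_mul hI (by fun_prop)]
        gcongr
    _ ≤ 1 := by
        rw [← ofReal_mul (by linarith), ← ofReal_mul (by linarith),
          ← ofReal_add (mul_nonneg (by linarith) (by linarith)) (by positivity),
          ofReal_le_one]
        nlinarith [mul_nonneg hη0 hδ0]

/-- A lower bound for the exponential moment of the next message of a sensor, whatever its present
state is. -/
theorem Sensor.le_exitMean_score (hL : 0 < L) {η : ℝ} (hη0 : 0 ≤ η) (hη1 : η ≤ 1 / 2) (hx : x ∈ 𝕀) :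
    ofReal (exp (-(b * Δ + 2 * (overConst m B * B) + L)) / 2) ≤ exitMean Q 𝕀 (score η L Lam) x := by
  have hLam := s.meas
  have := s.laws.prob
  have hI : MeasurableSet 𝕀 := measurableSet_Ioo
  set I := 𝕀
  set c := overConst m B * B
  have hc0 : 0 < c := mul_pos s.laws.overConst_pos s.laws.B_pos
  set A := b * Δ + 2 * c + L
  set g := exitMean Q I (score η L Lam) x with hg
  have hbΔ : 0 < b * Δ := mul_pos s.b_pos s.Δ_pos
  have hA0 : 0 ≤ A := by linarith
  have h1 : (1 : ℝ≥0∞) ≤ ofReal (exp A) * g + ofReal (1 / (2 * c)) * ofReal c := by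
    rw [← s.exitMean_one hx]
    refine le_trans ?_ (add_le_add_right (mul_le_mul_right (s.laws.exitMean_under_le_const hx) _) _)
    rw [hg, ← exitMean_const_mul hI (measurable_score η L hLam),
      ← exitMean_const_mul hI (by fun_prop),
      ← exitMean_add hI ((measurable_score η L hLam).const_mul _)]
    refine exitMean_mono (fun z _ => ?_) x
    simp only [Pi.add_apply, Pi.one_apply]
    rcases le_total (-z - lo) (2 * c) with h2 | h2
    · refine le_trans ?_ le_self_add
      rw [score, ← ofReal_mul (exp_pos _).le, ← exp_add, ← ofReal_one]
      refine ofReal_le_ofReal (Real.one_le_exp ?_)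
      have h3 : -A ≤ max (Lam z) (z - L) := by
        refine le_trans ?_ (le_max_right _ _)
        linarith [s.lo_le]
      nlinarith [mul_nonneg hη0 hA0]
    · refine le_trans ?_ le_add_self
      rw [← ofReal_mul₀, ← ofReal_one]
      refine ofReal_le_ofReal ?_
      rw [one_div, inv_mul_eq_div, one_le_div (by positivity)]
      exact h2
  rw [← ofReal_mul₀, show 1 / (2 * c) * c = 1 / 2 by field_simp] at h1
  have h2 : ofReal (1 / 2) ≤ ofReal (exp A) * g := by
    have h3 : (1 : ℝ≥0∞) = ofReal (1 / 2) + ofReal (1 / 2) := by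
      rw [← ofReal_add (by norm_num) (by norm_num)]; norm_num
    rw [h3] at h1
    exact (ENNReal.add_le_add_iff_right ofReal_ne_top).mp h1
  calc ofReal (exp (-A) / 2) = ofReal (exp (-A)) * ofReal (1 / 2) := by
        rw [← ofReal_mul (exp_pos _).le]; congr 1; ring
    _ ≤ ofReal (exp (-A)) * (ofReal (exp A) * g) := by gcongr
    _ = g := by
        rw [← mul_assoc, ← ofReal_mul (exp_pos _).le, ← exp_add]
        simp

/-- A bound for the exponential moment of the next message at a fixed time. -/
def startBound (m B b Δ : ℝ) : ℝ :=
  2 * timeBound m B b Δ + exp (b * Δ / 2) / (1 - sqrt (affinityBound m B)) + 1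
    + (b * Δ + overConst m B * B) / (log (affinityBound m B)⁻¹ / 2)

/-- The sensor that is in its `j`-th step after the last message at the given time has survived `j`
steps; this is unlikely for large `j`, and outweighs the exponential moment of the next message. -/
theorem Sensor.tsum_stay_score_le (hL : 0 < L) {η : ℝ} (hη0 : 0 ≤ η) (hη1 : η ≤ 1 / 2) :
    ∑' j, (stay Q 𝕀)^[j] (exitMean Q 𝕀 (score η L Lam)) 0 ≤ ofReal (startBound m B b Δ) := by
  have := s.laws.prob
  have := s.laws.prob₀
  have hLam := s.meas
  have hI : MeasurableSet 𝕀 := measurableSet_Ioo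
  set I := 𝕀
  set ρ := affinityBound m B
  have hρ0 : 0 < ρ := s.laws.affinityBound_pos
  have hρ1 : ρ < 1 := s.laws.affinityBound_lt
  have hlog : 0 < log ρ⁻¹ := log_pos (one_lt_inv₀ hρ0 |>.mpr hρ1)
  set c := log ρ⁻¹ / 2 with hc
  have hc0 : 0 < c := by positivity
  have hsq : sqrt ρ = exp (-c) := by
    rw [Real.sqrt_eq_rpow, Real.rpow_def_of_pos hρ0, hc, log_inv]; congr 1; ring
  have hsq0 : 0 < sqrt ρ := Real.sqrt_pos.mpr hρ0
  have hsq1 : sqrt ρ < 1 := by rw [← Real.sqrt_one]; exact Real.sqrt_lt_sqrt hρ0.le hρ1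
  have hbΔ : 0 < b * Δ := mul_pos s.b_pos s.Δ_pos
  have hc00 := mul_pos s.laws.overConst_pos s.laws.B_pos
  set E₁ : ℝ → ℝ≥0∞ := fun z => ofReal (exp (Lam z)) with hE₁
  set E₂ : ℝ → ℝ≥0∞ := fun z => ofReal (exp z) with hE₂
  have hE₁m : Measurable E₁ := by fun_prop
  have hsplit (j : ℕ) : (stay Q I)^[j] (exitMean Q I (score η L Lam)) 0
      ≤ (stay Q I)^[j] 1 0 + (stay Q I)^[j] (exitMean Q I E₁) 0
        + (stay Q I)^[j] (exitMean Q I E₂) 0 := by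
    have h1 (y : ℝ) : exitMean Q I (score η L Lam) y ≤ ((1 + exitMean Q I E₁) + exitMean Q I E₂) y
      := by
      simp only [Pi.add_apply]
      calc _ ≤ exitMean Q I ((1 + E₁) + E₂) y := by
            refine exitMean_mono (fun z _ => ?_) y
            simp only [Pi.add_apply, Pi.one_apply, score, hE₁, hE₂]
            rw [← ofReal_one, ← ofReal_add zero_le_one (exp_pos _).le,
              ← ofReal_add (by positivity) (exp_pos _).le]
            refine ofReal_le_ofReal ?_
            have h2 := exp_pos (Lam z)
            have h3 := exp_pos z
            rcases le_total (max (Lam z) (z - L)) 0 with h4 | h4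
            · have : exp ((1 - η) * max (Lam z) (z - L)) ≤ 1 :=
                exp_le_one_iff.mpr (mul_nonpos_of_nonneg_of_nonpos (by linarith) h4)
              linarith
            · have h5 : exp ((1 - η) * max (Lam z) (z - L)) ≤ exp (max (Lam z) (z - L)) :=
                exp_le_exp.mpr (mul_le_of_le_one_left h4 (by linarith))
              rcases max_cases (Lam z) (z - L) with h6 | h6
              · rw [h6.1] at h5 ⊢; linarith
              · rw [h6.1] at h5 ⊢
                have : exp (z - L) ≤ exp z := exp_le_exp.mpr (by linarith)
                linarith
        _ ≤ _ := by
            rw [exitMean_add hI (measurable_one.add hE₁m), exitMean_add hI measurable_one]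
            gcongr
            exact exitMean_one_le hI y
    refine (stay_iterate_mono h1 j 0).trans (le_of_eq ?_)
    rw [stay_iterate_add hI (measurable_one.add (measurable_exitMean hI hE₁m)),
      stay_iterate_add hI measurable_one]
    rfl
  have t0 : ∑' j, (stay Q I)^[j] 1 0 ≤ ofReal (timeBound m B b Δ) := by
    refine (s.laws.meanTime_le s.zero_mem).trans (ofReal_le_ofReal ?_)
    unfold timeBound
    have := s.laws.m_pos
    gcongr
    linarith [s.lo_le, s.hi_le]
  have t2 : ∑' j, (stay Q I)^[j] (exitMean Q I E₂) 0 ≤ ofReal (timeBound m B b Δ) := by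
    refine le_trans (tsum_le_tsum fun j => ?_) (s.meanTime₀_le s.zero_mem)
    have h1 (y : ℝ) : exitMean Q I E₂ y = ofReal (exp y) * exitMean Q₀ I 1 y := by
      rw [exitMean_tilt hI s.laws.tilt measurable_one]
      simp [hE₂]
    rw [funext h1, ← stay_iterate_tilt hI s.laws.tilt (measurable_exitMean hI measurable_one)]
    rw [exp_zero, ofReal_one, one_mul]
    exact stay_iterate_mono (fun y => exitMean_one_le hI y) j 0
  have t1 : ∑' j, (stay Q I)^[j] (exitMean Q I E₁) 0 ≤ ofReal (exp (b * Δ / 2) / (1 - sqrt ρ))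
        + ofReal (1 + (b * Δ + overConst m B * B) / c) := by
    -- messages beyond the level `c * j` are rare after the change
    set T : ℕ → ℝ → ℝ≥0∞ := fun j => {z | c * j < Lam z}.indicator 1 with hT
    have hTm (j : ℕ) : MeasurableSet {z | c * (j : ℝ) < Lam z} :=
      measurableSet_lt measurable_const hLam
    have hTmm (j : ℕ) : Measurable (T j) := measurable_one.indicator (hTm j)
    have h1 (j : ℕ) : (stay Q I)^[j] (exitMean Q I E₁) 0
        ≤ ofReal (exp (b * Δ / 2) * sqrt ρ ^ j) + exitMean Q₀ I (T j) 0 := by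
      have h2 (y : ℝ) : exitMean Q I E₁ y ≤ ((fun y => ofReal (exp (c * j))
          * (1 : ℝ → ℝ≥0∞) y) + exitMean Q I (fun z => E₁ z * T j z)) y := by
        simp only [Pi.add_apply]
        calc _ ≤ exitMean Q I ((fun z => ofReal (exp (c * j)) * (1 : ℝ → ℝ≥0∞) z)
              + fun z => E₁ z * T j z) y := by
              refine exitMean_mono (fun z _ => ?_) y
              simp only [Pi.add_apply, Pi.one_apply, mul_one]
              by_cases hz : z ∈ {z | c * (j : ℝ) < Lam z}
              · rw [hT]
                simp only
                rw [indicator_of_mem hz, Pi.one_apply, mul_one]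
                exact le_add_self
              · refine le_trans (ofReal_le_ofReal (exp_le_exp.mpr ?_)) le_self_add
                exact not_lt.mp hz
          _ ≤ _ := by
              rw [exitMean_add hI (measurable_one.const_mul _),
                exitMean_const_mul hI measurable_one]
              gcongr
              exact exitMean_one_le hI y
      refine (stay_iterate_mono h2 j 0).trans ?_
      rw [stay_iterate_add hI (measurable_one.const_mul _), Pi.add_apply,
        stay_iterate_const_mul hI measurable_one]
      refine add_le_add ?_ ((stay_iterate_exitMean_le hI (hE₁m.mul (hTmm j)) j 0).trans (le_of_eq
        ?_))
      · refine (mul_le_mul_right (s.laws.stay_iterate_one_le' j s.zero_mem) _).trans ?_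
        rw [← ofReal_mul (exp_pos _).le]
        refine ofReal_le_ofReal ?_
        have h3 : ρ ^ j = sqrt ρ ^ j * exp (-(c * j)) := by
          have h4 : exp (-(c * j)) = sqrt ρ ^ j := by rw [hsq, ← Real.exp_nat_mul]; congr 1; ring
          rw [h4, ← mul_pow, Real.mul_self_sqrt hρ0.le]
        rw [h3]
        have h5 : exp (c * j) * (exp ((lo + 0) / 2)
            * (sqrt ρ ^ j * exp (-(c * j)))) = exp ((lo + 0) / 2) * sqrt ρ ^ j := by
          calc _ = exp ((lo + 0) / 2) * sqrt ρ ^ j * (exp (c * j) * exp (-(c * j))) := by ring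
            _ = _ := by rw [← exp_add]; simp
        rw [h5]
        gcongr
        linarith [s.lo_le]
      · exact s.change (fun y => {y | c * (j : ℝ) < y}.indicator (1 : ℝ → ℝ≥0∞) y)
          (measurable_one.indicator (measurableSet_lt measurable_const measurable_id))
    refine (tsum_le_tsum h1).trans ?_
    rw [tsum_add]
    refine add_le_add (le_of_eq ?_) ?_
    · rw [← ENNReal.ofReal_tsum_of_nonneg (fun j => by positivity)
        ((summable_geometric_of_lt_one hsq0.le hsq1).mul_left _), tsum_mul_left,
        tsum_geometric_of_lt_one hsq0.le hsq1, ← div_eq_mul_inv]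
    · refine tsum_le_of_sum_range_le fun n => ?_
      have h2 : ∑ j ∈ range n, exitMean Q₀ I (T j) 0
          ≤ exitMean Q₀ I (1 + fun z => ofReal (1 / c) * ofReal (Lam z)) 0 := by
        have h3 : ∑ j ∈ range n, exitMean Q₀ I (T j) 0 = exitMean Q₀ I (∑ j ∈ range n, T j) 0 := by
          rw [← lintegral_exitLaw hI (by
            have : (∑ j ∈ range n, T j) = fun z => ∑ j ∈ range n, T j z := by ext z; simp
            rw [this]; exact Finset.measurable_fun_sum _ fun j _ => hTmm j)]
          simp only [Finset.sum_apply]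
          rw [lintegral_finsetSum _ fun j _ => hTmm j]
          exact sum_congr rfl fun j _ => (lintegral_exitLaw hI (hTmm j)).symm
        rw [h3]
        refine exitMean_mono (fun z _ => ?_) 0
        rw [Finset.sum_apply, Pi.add_apply, Pi.one_apply, ← ofReal_mul₀]
        -- the number of `j` with `c * j < Lam z`
        have h4 : ∑ j ∈ range n, T j z ≤ (⌈Lam z / c⌉₊ : ℝ≥0∞) := by
          have h5 : ∀ j ∈ range n, T j z ≤ if j ∈ range ⌈Lam z / c⌉₊ then 1 else 0 := fun j _ => by
              refine Set.indicator_apply_le' (fun hz => ?_) (fun _ => zero_le)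
              have hz' : c * (j : ℝ) < Lam z := hz
              rw [if_pos]
              · rfl
              · rw [mem_range, Nat.lt_ceil, lt_div_iff₀ hc0]; linarith
          refine (sum_le_sum h5).trans ?_
          rw [Finset.sum_ite_mem]
          simp only [sum_const, nsmul_eq_mul, mul_one]
          exact_mod_cast (Finset.card_le_card Finset.inter_subset_right).trans
            (card_range _).le
        refine h4.trans ?_
        rcases le_total (Lam z) 0 with h6 | h6
        · rw [Nat.ceil_eq_zero.mpr (div_nonpos_of_nonpos_of_nonneg h6 hc0.le)]
          simp
        · rw [← ofReal_natCast, ← ofReal_one, ← ofReal_add zero_le_one (by positivity)]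
          refine ofReal_le_ofReal ?_
          have := (Nat.ceil_lt_add_one (div_nonneg h6 hc0.le)).le
          calc _ ≤ Lam z / c + 1 := this
            _ = _ := by ring
      refine h2.trans ?_
      rw [exitMean_add hI measurable_one, exitMean_const_mul hI (by fun_prop),
        s.exitMean₀_one s.zero_mem, ofReal_add zero_le_one (by positivity),
        ofReal_one]
      refine add_le_add_right ((mul_le_mul_right s.pos_le _).trans (le_of_eq ?_)) _
      rw [← ofReal_mul₀]
      congr 1; ring
  refine (tsum_le_tsum hsplit).trans ?_
  rw [tsum_add, tsum_add]
  refine (add_le_add (add_le_add t0 t1) t2).trans (le_of_eq ?_)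
  have htb : 0 ≤ timeBound m B b Δ := by
    unfold timeBound; have := s.laws.m_pos; have := s.laws.B_pos; positivity
  rw [← ofReal_add₀, ← ofReal_add htb (by positivity), ← ofReal_add (by positivity) htb, startBound]
  congr 1; ring

end

/-! ### False alarms of the fusion center -/

theorem Sensor.startBound_pos {m B a b Δ lam : ℝ} {Q Q₀ : Measure ℝ} {Lam : ℝ → ℝ}
    (s : Sensor m B a b Δ lam Q Q₀ lo hi Lam) : 0 < startBound m B b Δ := by
  have hρ1 := s.laws.affinityBound_lt
  have hρ0 := s.laws.affinityBound_pos
  have := s.laws.m_pos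
  have := s.laws.B_pos
  have := s.laws.overConst_pos
  have := mul_pos s.b_pos s.Δ_pos
  have h1 := log_pos (one_lt_inv₀ hρ0 |>.mpr hρ1)
  have h2 : sqrt (affinityBound m B) < 1 := by
    rw [← Real.sqrt_one]; exact Real.sqrt_lt_sqrt hρ0.le hρ1
  unfold startBound timeBound
  positivity

theorem lintegral_pi_prod {K : ℕ} (Q : Fin K → Measure ℝ) [∀ k, IsProbabilityMeasure (Q k)]
    {f : Fin K → ℝ → ℝ≥0∞} (hf : ∀ k, Measurable (f k)) :
    ∫⁻ x, ∏ k, f k (x k) ∂(pi Q) = ∏ k, ∫⁻ x, f k x ∂(Q k) := by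
  refine (lintegral_prod_eq_prod_lintegral_of_indepFun (μ := pi Q) Finset.univ (fun k x =>
    f k (x k)) (iIndepFun_pi (X := f) fun k => (hf k).aemeasurable) fun k => (hf k).comp
    (measurable_pi_apply k)).trans (prod_congr rfl fun k _ => ?_)
  have h2 := lintegral_map (μ := pi Q) (hf k) (measurable_pi_apply k)
  rw [show (fun x : Fin K → ℝ => x k) = Function.eval k from rfl,
    (measurePreserving_eval Q k).map_eq] at h2
  exact h2.symm

section
variable {Ω : Type*} [mΩ : MeasurableSpace Ω] {K : ℕ} {ℱ : ℕ → MeasurableSpace Ω}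
  {P : Measure Ω} {X : ℕ → Ω → Fin K → ℝ} {Q : Fin K → Measure ℝ}
  {lo hi : Fin K → ℝ} {Lam : Fin K → ℝ → ℝ}

/-- The residuals of sensor `k`. -/
local notation:max "res_" k:max => resid (lo k) (hi k) (fun t ω => X t ω k)

theorem IIDSteps.marginal {τ : ℕ} [∀ k, IsProbabilityMeasure (Q k)]
    (h : IIDSteps ℱ P X (pi Q) τ) (k : Fin K) :
    IIDSteps ℱ P (fun t ω => X t ω k) (Q k) τ := by
  have h1 := h.comp (measurable_pi_apply k)
  rwa [(measurePreserving_eval Q k).map_eq] at h1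

theorem measurable_fusion {Q : Fin K → Measure ℝ} {τ : ℕ}
    (h : ∀ k, IIDSteps ℱ P (fun t ω => X t ω k) (Q k) τ) (hmono : Monotone ℱ)
    (hLam : ∀ k, Measurable (Lam k)) (t : ℕ) : Measurable[ℱ t] (fusion lo hi Lam X t) := by
  induction t with
  | zero => exact @measurable_const _ _ _ (ℱ 0) _
  | succ t ih =>
    refine (ih.mono (hmono (Nat.le_succ t)) le_rfl).add (Finset.measurable_fun_sum _ fun k _ => ?_)
    exact ((hLam k).comp ((((h k).measurable_resid t).mono (hmono (Nat.le_succ t)) le_rfl).add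
      ((h k).meas t))).indicator ((h k).measurableSet_sends t)

/-- Integration over the next step of all sensors, given the past. -/
theorem IIDSteps.prod_step {τ : ℕ} [∀ k, IsProbabilityMeasure (Q k)] (h : IIDSteps ℱ P X (pi Q) τ)
    (ht : τ ≤ t) {A : Set Ω} (hA : MeasurableSet[ℱ t] A) {W : Ω → ℝ≥0∞}
    (hW : Measurable[ℱ t] W) {φ : Fin K → ℝ → ℝ → ℝ≥0∞}
    (hφ : ∀ k, Measurable fun p : ℝ × ℝ => φ k p.1 p.2) :
    ∫⁻ ω in A, W ω * ∏ k, φ k (res_ k t ω) (X t ω k) ∂P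
      = ∫⁻ ω in A, W ω * ∏ k, ∫⁻ x, φ k (res_ k t ω) x ∂(Q k) ∂P := by
  have hY : Measurable[ℱ t] fun ω => (W ω, fun k => res_ k t ω) :=
    @Measurable.prodMk _ (ℱ t) _ _ _ _ _ _ hW (@measurable_pi_lambda _ _ _ (ℱ t) _ _ fun k =>
      (h.marginal k).measurable_resid t)
  have h1 := h.setLIntegral ht hA hY
    (F := fun (z : ℝ≥0∞ × (Fin K → ℝ)) (x : Fin K → ℝ) => z.1 * ∏ k, φ k (z.2 k) (x k)) (by
      refine (measurable_fst.comp measurable_fst).mul (Finset.measurable_fun_prod _ fun k _ => ?_)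
      have h2 : Measurable fun p : (ℝ≥0∞ × (Fin K → ℝ)) × (Fin K → ℝ) => (p.1.2 k, p.2 k) := by
        fun_prop
      exact (hφ k).comp h2)
  refine h1.trans (lintegral_congr fun ω => ?_)
  have hm (k : Fin K) (y : ℝ) : Measurable (φ k y) := (hφ k).comp measurable_prodMk_left
  simp only
  have hp : Measurable fun x : Fin K → ℝ => ∏ k, φ k (res_ k t ω) (x k) :=
    Finset.measurable_fun_prod _ fun k _ => (hm k _).comp (measurable_pi_apply k)
  rw [lintegral_const_mul _ hp, lintegral_pi_prod Q fun k => hm k _]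

/-- The residuals of the sensors are independent. -/
theorem IIDSteps.lintegral_prod_resid [∀ k, IsProbabilityMeasure (Q k)]
    (h : IIDSteps ℱ P X (pi Q) 0) (s : ℕ) {f : Fin K → ℝ → ℝ≥0∞}
    (hf : ∀ k, Measurable (f k)) :
    ∫⁻ ω, ∏ k, f k (res_ k s ω) ∂P = ∏ k, (refresh (Q k) (Ioo (-lo k) (hi k)))^[s] (f k) 0 := by
  have := h.prob
  induction s generalizing f with
  | zero => simp [resid]
  | succ s ih =>
    have hI (k : Fin K) : MeasurableSet (Ioo (-lo k) (hi k)) := measurableSet_Ioo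
    set φ : Fin K → ℝ → ℝ → ℝ≥0∞ := fun k y x => (Ioo (-lo k) (hi k)).indicator (f k) (y + x)
      + (Ioo (-lo k) (hi k))ᶜ.indicator 1 (y + x) * f k 0 with hφ
    have hφm (k : Fin K) : Measurable fun p : ℝ × ℝ => φ k p.1 p.2 :=
      (((hf k).indicator (hI k)).comp (measurable_fst.add measurable_snd)).add
        (((measurable_one.indicator (hI k).compl).comp
          (measurable_fst.add measurable_snd)).mul_const _)
    have h1 := h.prod_step (lo := lo) (hi := hi) (Nat.zero_le s) (A := univ)
      (@MeasurableSet.univ _ (ℱ s)) (W := fun _ => 1) (@measurable_const _ _ _ (ℱ s) _) hφm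
    simp only [restrict_univ, one_mul] at h1
    have h2 (k : Fin K) (y : ℝ) : ∫⁻ x, φ k y x ∂(Q k)
        = refresh (Q k) (Ioo (-lo k) (hi k)) (f k) y := by
      simp only [hφ]
      rw [lintegral_add_left (measurable_indicator_add (hI k) (hf k) y),
        lintegral_mul_const _ (measurable_indicator_add (hI k).compl measurable_one y)]
      rfl
    simp_rw [h2] at h1
    have h3 : ∫⁻ ω, ∏ k, f k (res_ k (s + 1) ω) ∂P = ∫⁻ ω, ∏ k, φ k (res_ k s ω) (X s ω k) ∂P := by
      refine lintegral_congr fun ω => prod_congr rfl fun k _ => ?_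
      simp only [hφ]
      by_cases hω : ω ∈ sends (lo k) (hi k) (fun t ω => X t ω k) s
      · have h4 : res_ k s ω + X s ω k ∉ Ioo (-lo k) (hi k) := hω
        rw [resid_of_sends hω, indicator_of_notMem h4, indicator_of_mem h4, zero_add,
          Pi.one_apply, one_mul]
      · have h4 := not_not.mp hω
        rw [resid_of_not_sends hω, indicator_of_mem h4,
          indicator_of_notMem (Set.notMem_compl_iff.mpr h4), zero_mul, add_zero]
    rw [h3, h1, ih fun k => measurable_refresh (hI k) (hf k)]
    rfl

variable {m B a b Δ lam L x : ℝ} {Q₀ : Fin K → Measure ℝ}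

/-- The probability that the statistic of the fusion center increases by `x` after time `s`. -/
theorem IIDSteps.crossing_le (h : IIDSteps ℱ P X (pi Q) 0)
    (hs : ∀ k, Sensor m B a b Δ lam (Q k) (Q₀ k) (lo k) (hi k) (Lam k)) (hL : 0 < L) (hx : 0 < x)
    (hLβ : exp (-L / 2) ≤ (1 - exp (-(a * Δ / 2))) ^ 2 / 2 / 2) (hK : 0 < K)
    (s n : ℕ) :
    ofReal (exp ((1 - tiltDefect a Δ lam L) * x)
        * (exp (-(b * Δ + 2 * (overConst m B * B) + L)) / 2) ^ K)
        * P {ω | ∃ r, s ≤ r ∧ r ≤ s + n ∧ x ≤ fusion lo hi Lam X r ω - fusion lo hi Lam X s ω}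
      ≤ ofReal (startBound m B b Δ ^ K) := by
  have := h.prob
  have hprob (k : Fin K) := (hs k).laws.prob
  set η := tiltDefect a Δ lam L
  obtain ⟨hη0, hη1⟩ := (hs ⟨0, hK⟩).tiltDefect_mem hL hLβ
  have hmarg := fun k => h.marginal k
  have hLam := fun k => (hs k).meas
  have hfm := measurable_fusion (lo := lo) (hi := hi) hmarg h.mono hLam
  set U := fusion lo hi Lam X with hU
  set I : Fin K → Set ℝ := fun k => Ioo (-lo k) (hi k)
  have hI (k : Fin K) : MeasurableSet (I k) := measurableSet_Ioo
  set S : Fin K → ℝ → ℝ≥0∞ := fun k => score η L (Lam k)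
  have hSm (k : Fin K) : Measurable (S k) := measurable_score η L (hLam k)
  set g : Fin K → ℝ → ℝ≥0∞ := fun k => exitMean (Q k) (I k) (S k) with hg
  have hgm (k : Fin K) : Measurable (g k) := measurable_exitMean (hI k) (hSm k)
  set y : Fin K → ℕ → Ω → ℝ := fun k => res_ k with hy
  set V : ℕ → Ω → ℝ≥0∞ := fun t ω => ofReal (exp ((1 - η) * (U t ω - U s ω)))
    * ∏ k, g k (y k t ω) with hV
  set alive : ℕ → Set Ω := fun t => {ω | ∀ r, s ≤ r → r ≤ t → U r ω - U s ω < x} with halive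
  have hal : ∀ t, s ≤ t → MeasurableSet[ℱ t] (alive t) := fun t ht => by
    have e : alive t = ⋂ r ∈ Set.Icc s t, {ω | U r ω - U s ω < x} := by ext ω; simp [halive]
    rw [e]
    refine MeasurableSet.biInter (Set.to_countable _) fun r hr => ?_
    exact ((hfm r).mono (h.mono hr.2) le_rfl).sub ((hfm s).mono (h.mono (hr.1.trans hr.2)) le_rfl)
      measurableSet_Iio
  have hal' : ∀ t, s ≤ t → MeasurableSet (alive t) := fun t ht => h.le t _ (hal t ht)
  have hanti : ∀ t, s ≤ t → alive (t + 1) ⊆ alive t := fun t _ ω hω r hr hrt => hω r hr (by omega)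
  have hals : alive s = univ := by
    ext ω
    simp only [halive, mem_univ, iff_true]
    intro r hr hrs
    rw [le_antisymm hrs hr, sub_self]
    exact hx
  have key := lyapunov_le (P := P) (alive := alive) (τ := s) (V := V) (c := fun _ => 0)
    (d := fun _ => 0) hal' hanti (fun t ht => by
      rw [add_zero, add_zero]
      set φ : Fin K → ℝ → ℝ → ℝ≥0∞ := fun k y x => (I k).indicator (g k) (y + x)
        + (I k)ᶜ.indicator (S k) (y + x) with hφ
      have hφm (k : Fin K) : Measurable fun p : ℝ × ℝ => φ k p.1 p.2 :=
        (((hgm k).indicator (hI k)).comp (measurable_fst.add measurable_snd)).add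
          (((hSm k).indicator (hI k).compl).comp (measurable_fst.add measurable_snd))
      have hWm : Measurable[ℱ t] fun ω => ofReal (exp ((1 - η) * (U t ω - U s ω))) := by
        have h1 := (hfm t).sub ((hfm s).mono (h.mono ht) le_rfl)
        exact ENNReal.measurable_ofReal.comp (Real.measurable_exp.comp (h1.const_mul (1 - η)))
      have h1 := h.prod_step (lo := lo) (hi := hi) (Nat.zero_le t) (hal t ht) hWm hφm
      have h2 (k : Fin K) (z : ℝ) : ∫⁻ x, φ k z x ∂(Q k) = g k z := by
        simp only [hφ]
        rw [lintegral_add_left (measurable_indicator_add (hI k) (hgm k) z)]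
        simp only [hg]
        rw [exitMean_eq (hI k) (hSm k) z, add_comm]
        rfl
      simp_rw [h2] at h1
      refine le_trans (lintegral_mono fun ω => ?_) h1.le
      have h3 : U (t + 1) ω - U s ω = (U t ω - U s ω)
          + ∑ k, (sends (lo k) (hi k) (fun t ω => X t ω k) t).indicator
            (fun ω => Lam k (y k t ω + X t ω k)) ω := by
        simp only [hU, fusion, hy]; ring
      simp only [hV]
      rw [h3, mul_add, exp_add, ofReal_mul (exp_pos _).le, mul_assoc,
        mul_sum, Real.exp_sum, ENNReal.ofReal_prod_of_nonneg fun k _ => (exp_pos _).le,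
        ← Finset.prod_mul_distrib]
      refine mul_le_mul_right (Finset.prod_le_prod' fun k _ => ?_) _
      simp only [hφ]
      by_cases hω : ω ∈ sends (lo k) (hi k) (fun t ω => X t ω k) t
      · have h4 : y k t ω + X t ω k ∉ I k := hω
        have h5 : y k (t + 1) ω = 0 := resid_of_sends hω
        rw [h5, indicator_of_mem hω]
        change _ ≤ (I k).indicator (g k) (y k t ω + X t ω k)
          + (I k)ᶜ.indicator (S k) (y k t ω + X t ω k)
        rw [indicator_of_notMem h4, indicator_of_mem h4, zero_add]
        calc _ ≤ S k (y k t ω + X t ω k) * 1 := by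
              refine mul_le_mul' (ofReal_le_ofReal (exp_le_exp.mpr ?_))
                ((hs k).exitMean_score_le_one hL hLβ)
              exact mul_le_mul_of_nonneg_left (le_max_left _ _) (by linarith)
          _ = _ := mul_one _
      · have h4 := not_not.mp hω
        have h5 : y k (t + 1) ω = y k t ω + X t ω k := resid_of_not_sends hω
        rw [h5, indicator_of_notMem hω, mul_zero, exp_zero, ofReal_one, one_mul]
        change _ ≤ (I k).indicator (g k) (y k t ω + X t ω k)
          + (I k)ᶜ.indicator (S k) (y k t ω + X t ω k)
        rw [indicator_of_mem h4]
        exact le_self_add) n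
  simp only [sum_const_zero, add_zero] at key
  -- the value of `V` at a crossing
  set κ := exp (-(b * Δ + 2 * (overConst m B * B) + L)) / 2
  have hκ0 : 0 < κ := by positivity
  have hcross (i : ℕ) : ofReal (exp ((1 - η) * x) * κ ^ K) * P (alive (s + i) \ alive (s + i + 1))
      ≤ ∫⁻ ω in alive (s + i) \ alive (s + i + 1), V (s + i + 1) ω ∂P := by
    rw [← setLIntegral_const]
    refine setLIntegral_mono' ((hal' _ (by omega)).diff (hal' _ (by omega))) fun ω hω => ?_
    have h1 : x ≤ U (s + i + 1) ω - U s ω := by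
      by_contra h2
      push Not at h2
      refine hω.2 fun r hr hrt => ?_
      rcases Nat.lt_or_ge r (s + i + 1) with h3 | h3
      · exact hω.1 r hr (by omega)
      · rw [le_antisymm hrt h3]; exact h2
    rw [ofReal_mul (exp_pos _).le, ENNReal.ofReal_pow hκ0.le]
    refine mul_le_mul' (ofReal_le_ofReal (exp_le_exp.mpr
      (mul_le_mul_of_nonneg_left h1 (by linarith)))) ?_
    calc ofReal κ ^ K = ∏ _k : Fin K, ofReal κ := by simp
      _ ≤ _ := Finset.prod_le_prod' fun k _ => (hs k).le_exitMean_score hL hη0 hη1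
        (resid_mem (hs k).lo_pos (hs k).hi_pos _ ω)
  have hsum := sum_le_sum fun i (_ : i ∈ range n) => hcross i
  rw [← mul_sum] at hsum
  have hstart : ∫⁻ ω in alive s, V s ω ∂P ≤ ofReal (startBound m B b Δ ^ K) := by
    rw [hals, restrict_univ]
    simp only [hV, sub_self, mul_zero, exp_zero, ofReal_one, one_mul]
    rw [h.lintegral_prod_resid s hgm]
    have hb (k : Fin K) : (refresh (Q k) (I k))^[s] (g k) 0 ≤ ofReal (startBound m B b Δ) := by
      refine (refresh_iterate_le (hI k) (hgm k) s 0).trans ?_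
      rw [add_comm, ← sum_range_succ]
      exact (sum_le_tsum _).trans ((hs k).tsum_stay_score_le hL hη0 hη1)
    refine (Finset.prod_le_prod' fun k _ => hb k).trans (le_of_eq ?_)
    rw [Finset.prod_const, card_univ, Fintype.card_fin, ENNReal.ofReal_pow]
    exact (hs ⟨0, hK⟩).startBound_pos.le
  refine le_trans ?_ (hsum.trans ((le_trans le_add_self key).trans hstart))
  refine mul_le_mul_right ?_ _
  have h1 := measure_alive_add (P := P) hal' hanti n
  have h2 : {ω | ∃ r, s ≤ r ∧ r ≤ s + n ∧ x ≤ U r ω - U s ω} = (alive (s + n))ᶜ := by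
    ext ω
    simp only [halive, Set.mem_compl_iff, mem_ofPred_eq, not_forall, not_lt]
    exact ⟨fun ⟨r, h1, h2, h3⟩ => ⟨r, h1, h2, h3⟩, fun ⟨r, h1, h2, h3⟩ => ⟨r, h1, h2, h3⟩⟩
  rw [h2, measure_compl (hal' _ (by omega)) (measure_ne_top _ _), ← hals, ← h1]
  rw [ENNReal.add_sub_cancel_left (measure_ne_top _ _)]

end

/-- If an alarm is raised by time `t` with probability at most `(t + 1) q`, then the mean time to
the alarm is at least of the order of `1 / q`. -/
theorem inv_le_of_sum_alive {Ω : Type*} [MeasurableSpace Ω] {P : Measure Ω} [IsProbabilityMeasure P]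
    {alive : ℕ → Set Ω} {q G : ℝ} (hq : 0 < q) (hG : 0 ≤ G) (hal : ∀ t, MeasurableSet (alive t))
    (h : ∀ t : ℕ, P (alive t)ᶜ ≤ ofReal ((t + 1) * q))
    (hsum : ∑' t, P (alive t) ≤ ofReal G) : q⁻¹ ≤ 8 * G + 2 := by
  rcases le_or_gt q (1 / 2) with hq1 | hq1
  · set n := ⌊(2 * q)⁻¹⌋₊
    have h2q : 0 < 2 * q := by positivity
    have hn1 : (n : ℝ) ≤ (2 * q)⁻¹ := Nat.floor_le (by positivity)
    have hn2 : (2 * q)⁻¹ < n + 1 := Nat.lt_floor_add_one _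
    have h1 : ∀ t ∈ range n, ofReal (1 / 2) ≤ P (alive t) := fun t ht => by
      have ht' : ((t : ℝ) + 1) ≤ n := by exact_mod_cast mem_range.mp ht
      have h2 : P (alive t)ᶜ ≤ ofReal (1 / 2) := by
        refine (h t).trans (ofReal_le_ofReal ?_)
        have h3 : (t + 1) * q ≤ (2 * q)⁻¹ * q := by gcongr; linarith
        refine h3.trans (le_of_eq ?_)
        field_simp
      have h3 : ofReal (1 / 2) + ofReal (1 / 2) = 1 := by
        rw [← ofReal_add (by norm_num) (by norm_num)]; norm_num
      rw [← ENNReal.add_le_add_iff_right (ofReal_ne_top (r := 1 / 2)), h3, ← (prob_add_prob_compl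
        (μ := P) (hal t))]
      gcongr
    have h5 := (sum_le_sum h1).trans ((sum_le_tsum _).trans hsum)
    rw [sum_const, card_range, nsmul_eq_mul, ← ofReal_natCast,
      ← ofReal_mul₀, ofReal_le_ofReal_iff hG] at h5
    have h6 : q⁻¹ = 2 * (2 * q)⁻¹ := by field_simp
    rw [h6]
    linarith
  · have : q⁻¹ ≤ 2 := by rw [inv_le_comm₀ hq (by norm_num)]; linarith
    linarith

theorem Sensor.log_startBound_le {m B a b Δ lam : ℝ} {Q Q₀ : Measure ℝ} {Lam : ℝ → ℝ}
    (s : Sensor m B a b Δ lam Q Q₀ lo hi Lam) :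
    log (startBound m B b Δ) ≤ b * Δ / 2 + (2 * timeBound m B b Δ
      + 1 / (1 - sqrt (affinityBound m B)) + 1
      + (b * Δ + overConst m B * B) / (log (affinityBound m B)⁻¹ / 2)) := by
  have hρ1 := s.laws.affinityBound_lt
  have hρ0 := s.laws.affinityBound_pos
  have := s.laws.m_pos
  have := s.laws.B_pos
  have := s.laws.overConst_pos
  have := mul_pos s.b_pos s.Δ_pos
  have h1 := log_pos (one_lt_inv₀ hρ0 |>.mpr hρ1)
  have h2 : sqrt (affinityBound m B) < 1 := by
    rw [← Real.sqrt_one]; exact Real.sqrt_lt_sqrt hρ0.le hρ1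
  have htb : 0 < timeBound m B b Δ := by unfold timeBound; positivity
  set Z := 2 * timeBound m B b Δ + 1 / (1 - sqrt (affinityBound m B)) + 1
      + (b * Δ + overConst m B * B) / (log (affinityBound m B)⁻¹ / 2) with hZ
  have hZ0 : 0 < Z := by positivity
  have h5 : startBound m B b Δ ≤ exp (b * Δ / 2) * Z := by
    have h6 : 1 ≤ exp (b * Δ / 2) := Real.one_le_exp (by positivity)
    have h7 : 0 ≤ 2 * timeBound m B b Δ + 1
      + (b * Δ + overConst m B * B) / (log (affinityBound m B)⁻¹ / 2) := by positivity
    have h8 := mul_le_mul_of_nonneg_right h6 h7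
    have h9 : exp (b * Δ / 2) / (1 - sqrt (affinityBound m B))
        = exp (b * Δ / 2) * (1 / (1 - sqrt (affinityBound m B))) := by ring
    rw [startBound, hZ, h9]
    linarith
  refine (log_le_log s.startBound_pos h5).trans ?_
  rw [log_mul (exp_pos _).ne' hZ0.ne', log_exp]
  linarith [Real.log_le_sub_one_of_pos hZ0]

set_option maxHeartbeats 800000 in
/-- The threshold of the test of the fusion center, in terms of its mean time to a false alarm. -/
theorem exists_fusion_threshold {m B a b Δ₀ : ℝ} (hm : 0 < m) (hB : 0 < B) (ha : 0 < a)
    (hb : 0 < b) (hΔ₀ : 0 < Δ₀) : ∃ C : ℝ, 0 < C ∧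
    ∀ (K : ℕ) (Ω : Type u) [_mΩ : MeasurableSpace Ω] (Δ θ : ℝ) (ℱ : ℕ → MeasurableSpace Ω)
      (P : Measure Ω) (X : ℕ → Ω → Fin K → ℝ) (Q Q₀ : Fin K → Measure ℝ)
      (lo hi : Fin K → ℝ) (Lam : Fin K → ℝ → ℝ) (x γ : ℝ) (alive : ℕ → Set Ω), 0 < K →
      IIDSteps ℱ P X (pi Q) 0 →
      (∀ k, Sensor m B a b Δ (lossConst m B * min θ 1) (Q k) (Q₀ k) (lo k) (hi k) (Lam k)) →
      Δ₀ ≤ Δ → 0 ≤ θ → 0 < x → 1 ≤ γ → (∀ t, MeasurableSet (alive t)) →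
      (∀ t ω, ω ∉ alive t → ∃ s r, s ≤ r ∧ r ≤ t ∧
        x ≤ fusion lo hi Lam X r ω - fusion lo hi Lam X s ω) →
      ∑' t, P (alive t) ≤ ofReal (γ / m) →
      x ≤ (1 + C * min θ 1 / Δ) * log γ + K * (C * Δ) := by
  set c := overConst m B * B
  set ρ := affinityBound m B
  set β₀ := (1 - exp (-(a * Δ₀ / 2))) ^ 2 / 2 with hβ₀
  set l₀ := 2 * log (2 / β₀) / Δ₀ with hl₀
  set D := log ρ⁻¹ / 2
  set c₁ := b / 2 + (4 * b / m + 4 * B / m / m / Δ₀) + (1 / (1 - sqrt ρ) + 1) / Δ₀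
    + (b / D + c / D / Δ₀) + (b + l₀ + (2 * c + log 2) / Δ₀) with hc₁
  set c₂ := lossConst m B / (l₀ * β₀) with hc₂
  set c₃ := log (8 / m + 2) / Δ₀
  refine ⟨1 + 2 * |c₁| + 2 * |c₂| + 2 * |c₃|, by positivity, ?_⟩
  intro K Ω mΩ Δ θ ℱ P X Q Q₀ lo hi Lam x γ alive hK h hs hΔ hθ hx hγ hal hdead hsum
  have := h.prob
  have s0 := hs ⟨0, hK⟩
  have hΔp : 0 < Δ := hΔ₀.trans_le hΔ
  have hc0 : 0 < c := mul_pos s0.laws.overConst_pos hB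
  have hρ0 : 0 < ρ := s0.laws.affinityBound_pos
  have hρ1 : ρ < 1 := s0.laws.affinityBound_lt
  have hD0 : 0 < D := by
    have := log_pos (one_lt_inv₀ hρ0 |>.mpr hρ1)
    positivity
  have hsq : 0 < 1 - sqrt ρ := by
    have : sqrt ρ < 1 := by rw [← Real.sqrt_one]; exact Real.sqrt_lt_sqrt hρ0.le hρ1
    linarith
  have hβe (r : ℝ) (hr : 0 < r) : 0 < 1 - exp (-(a * r / 2)) := by
    have : exp (-(a * r / 2)) < 1 := by
      rw [← exp_zero]
      refine exp_lt_exp.mpr ?_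
      have := mul_pos ha hr
      linarith
    linarith
  have hβ₀0 : 0 < β₀ := by have := hβe Δ₀ hΔ₀; positivity
  have hβ₀1 : β₀ ≤ 1 := by
    have h1 := hβe Δ₀ hΔ₀
    have h2 := exp_pos (-(a * Δ₀ / 2))
    rw [hβ₀]
    nlinarith
  have hl₀0 : 0 < l₀ := by
    have : 0 < log (2 / β₀) := log_pos (by rw [one_lt_div hβ₀0]; linarith)
    positivity
  have hLp : 0 < lossConst m B := by have := s0.laws.overConst_pos; unfold lossConst; positivity
  have hlog8 : 0 < log (8 / m + 2) := log_pos (by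
    have : 0 < 8 / m := by positivity
    linarith)
  have hc₁0 : 0 < c₁ := by positivity
  have hc₂0 : 0 < c₂ := by positivity
  have hc₃0 : 0 < c₃ := by positivity
  rw [abs_of_pos hc₁0, abs_of_pos hc₂0, abs_of_pos hc₃0]
  set lam := lossConst m B * min θ 1 with hlam
  set L := l₀ * Δ with hL
  have hL0 : 0 < L := by positivity
  have hββ : β₀ ≤ (1 - exp (-(a * Δ / 2))) ^ 2 / 2 := by
    have e1 : exp (-(a * Δ / 2)) ≤ exp (-(a * Δ₀ / 2)) :=
      exp_le_exp.mpr (by have := mul_le_mul_of_nonneg_left hΔ ha.le; linarith)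
    have := pow_le_pow_left₀ (hβe Δ₀ hΔ₀).le (sub_le_sub_left e1 1) 2
    linarith
  have hLβ : exp (-L / 2) ≤ (1 - exp (-(a * Δ / 2))) ^ 2 / 2 / 2 := by
    have h1 : log (2 / β₀) ≤ L / 2 := by
      have h2 : l₀ * Δ₀ = 2 * log (2 / β₀) := by rw [hl₀]; field_simp
      have h3 : l₀ * Δ₀ ≤ l₀ * Δ := by gcongr
      linarith
    have h2 : exp (-L / 2) ≤ exp (-log (2 / β₀)) := exp_le_exp.mpr (by linarith)
    rw [Real.exp_neg, exp_log (by positivity), inv_div] at h2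
    linarith
  obtain ⟨hη0, hη1⟩ := s0.tiltDefect_mem hL0 hLβ
  have hcross := fun s n => h.crossing_le hs hL0 hx hLβ hK s n
  set η := tiltDefect a Δ lam L with hη
  set κ := exp (-(b * Δ + 2 * c + L)) / 2 with hκ
  set U := startBound m B b Δ
  have hU0 : 0 < U := s0.startBound_pos
  set q := U ^ K / (exp ((1 - η) * x) * κ ^ K) with hq
  have hden : 0 < exp ((1 - η) * x) * κ ^ K := by positivity
  have hdead' (t : ℕ) : P (alive t)ᶜ ≤ ofReal ((t + 1) * q) := by
    have h1 : (alive t)ᶜ ⊆ ⋃ s ∈ range (t + 1), {ω | ∃ r, s ≤ r ∧ r ≤ s + t ∧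
        x ≤ fusion lo hi Lam X r ω - fusion lo hi Lam X s ω} := by
      intro ω hω
      obtain ⟨s, r, h2, h3, h4⟩ := hdead t ω hω
      simp only [Set.mem_iUnion, mem_range]
      exact ⟨s, by omega, r, h2, by omega, h4⟩
    refine (measure_mono h1).trans ((measure_biUnion_finset_le _ _).trans ?_)
    refine (sum_le_sum fun s _ => (?_ : _ ≤ ofReal q)).trans (le_of_eq ?_)
    · have h2 := hcross s t
      rw [hq, ENNReal.ofReal_div_of_pos hden]
      rw [ENNReal.le_div_iff_mul_le (Or.inl (by simpa using hden)) (Or.inl ofReal_ne_top)]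
      rwa [mul_comm]
    · rw [sum_const, card_range, nsmul_eq_mul, ofReal_mul₀]
      congr 1
      rw [← ofReal_natCast]; push_cast; rfl
  have h1 := inv_le_of_sum_alive (by positivity) (by positivity) hal hdead' hsum
  have h2 : q⁻¹ ≤ (8 / m + 2) * γ := by
    refine h1.trans ?_
    have : 8 * (γ / m) = 8 / m * γ := by ring
    linarith
  have h3 : log q⁻¹ ≤ log (8 / m + 2) + log γ := by
    rw [← log_mul (by positivity) (by positivity)]
    exact log_le_log (by positivity) h2
  have h4 : log q⁻¹ = (1 - η) * x - K * (log U - log κ) := by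
    rw [hq, log_inv, Real.log_div (by positivity) (by positivity),
      log_mul (by positivity) (by positivity), log_exp, Real.log_pow, Real.log_pow]
    ring
  have hgrow {y : ℝ} (hy : 0 ≤ y) : y ≤ y / Δ₀ * Δ := by
    rw [div_mul_eq_mul_div, le_div_iff₀ hΔ₀]; gcongr
  have hlogκ : -log κ = b * Δ + 2 * c + L + log 2 := by
    rw [hκ, Real.log_div (exp_pos _).ne' (by norm_num), log_exp]; ring
  have hlogU : log U ≤ b * Δ / 2 + (2 * timeBound m B b Δ + 1 / (1 - sqrt ρ) + 1
      + (b * Δ + c) / D) := s0.log_startBound_le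
  have hratio : log U - log κ ≤ c₁ * Δ := by
    have t1 := hgrow (y := 4 * B / m / m) (by positivity)
    have t2 := hgrow (y := 1 / (1 - sqrt ρ) + 1) (by positivity)
    have t3 := hgrow (y := c / D) (by positivity)
    have t4 := hgrow (y := 2 * c + log 2) (by positivity)
    have t5 : 2 * timeBound m B b Δ = 4 * b / m * Δ + 4 * B / m / m := by
      rw [timeBound]; field_simp; ring
    have t6 : (b * Δ + c) / D = b / D * Δ + c / D := by ring
    rw [hc₁]
    linarith
  have hηle : η ≤ c₂ * min θ 1 / Δ := by
    have t1 : exp (-L) * min 1 (lam / L) ≤ lam / L := by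
      have t2 : exp (-L) ≤ 1 := exp_le_one_iff.mpr (by linarith)
      calc _ ≤ 1 * min 1 (lam / L) := by gcongr
        _ ≤ lam / L := by rw [one_mul]; exact min_le_right _ _
    calc η ≤ (lam / L) / β₀ := by
          rw [hη, tiltDefect]
          exact div_le_div₀ (by positivity) t1 hβ₀0 hββ
      _ = _ := by rw [hlam, hL, hc₂]; field_simp
  have hlogγ : 0 ≤ log γ := log_nonneg hγ
  have h5 : (1 - η) * x ≤ log γ + K * ((c₃ + c₁) * Δ) := by
    have t1 := hgrow hlog8.le
    have t2 : K * (log U - log κ) ≤ K * (c₁ * Δ) := by gcongr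
    have t3 : c₃ * Δ ≤ K * (c₃ * Δ) := le_mul_of_one_le_left (by positivity) (by exact_mod_cast hK)
    linarith
  set R := K * ((c₃ + c₁) * Δ) with hR
  have h6 : x ≤ (1 + 2 * η) * (log γ + R) := by
    have t1 : (1 + 2 * η) * ((1 - η) * x) ≤ (1 + 2 * η) * (log γ + R) := by gcongr
    have t2 : 0 ≤ η * (1 - 2 * η) * x := by
      have : 0 ≤ 1 - 2 * η := by linarith
      positivity
    linarith
  have h7 : (1 + 2 * η) * R ≤ 2 * R := by gcongr; linarith
  have h8 : 2 * η * log γ ≤ 2 * (c₂ * min θ 1 / Δ) * log γ := by gcongr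
  have h9 : 2 * (c₂ * min θ 1 / Δ) ≤ (1 + 2 * c₁ + 2 * c₂ + 2 * c₃) * min θ 1 / Δ := by
    rw [← mul_div_assoc, ← mul_assoc]
    gcongr
    linarith
  have h10 : 2 * R ≤ K * ((1 + 2 * c₁ + 2 * c₂ + 2 * c₃) * Δ) := by
    rw [hR, show 2 * (K * ((c₃ + c₁) * Δ)) = K * (2 * (c₃ + c₁) * Δ) by ring]
    gcongr
    linarith
  have h11 := mul_le_mul_of_nonneg_right h9 hlogγ
  linarith

/-! ### The increments of the log-likelihood ratios -/

/-- If each coordinate of `X` is independent of the past of its own sensor and the sensors are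
independent, then `X` has independent coordinates and is independent of the joint past. -/
theorem measure_inter_preimage_pi {K : ℕ} {Ω : Type*} {m m' : Fin K → MeasurableSpace Ω}
    [mΩ : MeasurableSpace Ω] {P : Measure Ω} [IsProbabilityMeasure P] (hle : ∀ k, m' k ≤ mΩ)
    (hm : ∀ k, m k ≤ m' k) (hind : iIndep m' P) {X : Ω → Fin K → ℝ}
    (hX : ∀ k, Measurable[m' k] fun ω => X ω k) {Q : Fin K → Measure ℝ}
    [∀ k, IsProbabilityMeasure (Q k)]
    (h : ∀ k A, MeasurableSet[m k] A → ∀ C, MeasurableSet C →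
      P (A ∩ (fun ω => X ω k) ⁻¹' C) = P A * Q k C)
    {A : Set Ω} (hA : MeasurableSet[⨆ k, m k] A) {C : Set (Fin K → ℝ)} (hC : MeasurableSet C) :
    P (A ∩ X ⁻¹' C) = P A * pi Q C := by
  classical
  have hsup := iSup_le fun k => (hm k).trans (hle k)
  have hXm : Measurable X := measurable_pi_lambda _ fun k => (hX k).mono (hle k) le_rfl
  have box : ∀ D : Fin K → Set ℝ, (∀ k, MeasurableSet (D k)) → ∀ A, MeasurableSet[⨆ k, m k] A →
      P (A ∩ X ⁻¹' univ.pi D) = P A * pi Q (univ.pi D) := by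
    intro D hD
    have hpre : X ⁻¹' univ.pi D = ⋂ k, (fun ω => X ω k) ⁻¹' D k := by
      ext ω
      simp
    have key : ∀ F : Fin K → Set Ω, (∀ k, MeasurableSet[m k] (F k)) →
        P ((⋂ k, F k) ∩ X ⁻¹' univ.pi D) = P (⋂ k, F k) * pi Q (univ.pi D) := by
      intro F hF
      have hmeas : ∀ k, MeasurableSet[m' k] (F k ∩ (fun ω => X ω k) ⁻¹' D k) := fun k =>
        (hm k _ (hF k)).inter (hX k (hD k))
      rw [hpre, ← Set.iInter_inter_distrib, hind.meas_iInter hmeas,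
        hind.meas_iInter fun k => hm k _ (hF k), Measure.pi_pi, ← Finset.prod_mul_distrib]
      exact prod_congr rfl fun k _ => h k _ (hF k) _ (hD k)
    have hgen := generateFrom_piiUnionInter_measurableSet m univ
    simp only [mem_univ, iSup_pos] at hgen
    have heq : (P.restrict (X ⁻¹' univ.pi D)).trim hsup = (pi Q (univ.pi D) • P).trim hsup := by
      refine @ext_of_generate_finite _ (⨆ k, m k) _ _ _ hgen.symm
        (isPiSystem_piiUnionInter _ (fun k => @MeasurableSpace.isPiSystem_measurableSet _ (m k)) _)
        (isFiniteMeasure_trim hsup) ?_ ?_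
      · rintro s ⟨J, -, f, hf, rfl⟩
        have hs : (⋂ x ∈ J, f x) = ⋂ k, (if k ∈ J then f k else univ) := by
          ext ω
          simp only [Set.mem_iInter]
          exact ⟨fun hx k => by split_ifs with hk <;> simp [hx k, hk],
            fun hx k hk => by simpa [hk] using hx k⟩
        have hF : ∀ k, MeasurableSet[m k] (if k ∈ J then f k else univ) := fun k => by
          split_ifs with hk
          · exact hf k hk
          · exact @MeasurableSet.univ _ (m k)
        have hs' := MeasurableSet.iInter fun k => le_iSup m k _ (hF k)
        rw [hs, trim_measurableSet_eq hsup hs', trim_measurableSet_eq hsup hs',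
          restrict_apply (hsup _ hs'), key _ hF, Measure.smul_apply, smul_eq_mul, mul_comm]
      · have := key (fun _ => univ) fun k => @MeasurableSet.univ _ (m k)
        simp only [Set.iInter_univ, Set.univ_inter, measure_univ, one_mul] at this
        rw [trim_measurableSet_eq hsup (@MeasurableSet.univ _ (⨆ k, m k)),
          trim_measurableSet_eq hsup (@MeasurableSet.univ _ (⨆ k, m k)),
          restrict_apply MeasurableSet.univ, Set.univ_inter, this]
        simp
    intro A hA
    have := congrArg (fun μ => μ A) heq
    beta_reduce at this
    rwa [trim_measurableSet_eq hsup hA, trim_measurableSet_eq hsup hA,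
      restrict_apply (hsup _ hA), Measure.smul_apply, smul_eq_mul, mul_comm] at this
  have heq : (P.restrict A).map X = P A • pi Q := by
    refine ext_of_generate_finite _ generateFrom_pi.symm isPiSystem_pi ?_ ?_
    · rintro s ⟨D, hD, rfl⟩
      have hD' : ∀ k, MeasurableSet (D k) := fun k => hD k (mem_univ k)
      rw [map_apply hXm (MeasurableSet.univ_pi hD'),
        restrict_apply (hXm (MeasurableSet.univ_pi hD')), Set.inter_comm, box D hD' A hA,
        Measure.smul_apply, smul_eq_mul]
    · simp [map_apply hXm MeasurableSet.univ]
  have := congrArg (fun μ => μ C) heq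
  beta_reduce at this
  rwa [map_apply hXm hC, restrict_apply (hXm hC), Set.inter_comm,
    Measure.smul_apply, smul_eq_mul] at this

namespace ChangeModel

variable {K : ℕ} {Ω : Type u} [mΩ : MeasurableSpace Ω]

/-- The increments of the local log-likelihood ratios after time `t`. -/
def incr (M : ChangeModel.{u, v} K Ω) (t : ℕ) (ω : Ω) (k : Fin K) : ℝ :=
  M.uLoc k (t + 1) ω - M.uLoc k t ω

/-- The law of the increments of sensor `k` before the change. -/
def pre (M : ChangeModel.{u, v} K Ω) (k : Fin K) : Measure ℝ := (M.P ⊤).map (M.uLoc k 1)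

/-- The law of the increments of sensor `k` after the change. -/
def post (M : ChangeModel.{u, v} K Ω) (k : Fin K) : Measure ℝ := (M.P 0).map (M.uLoc k 1)

variable {M : ChangeModel.{u, v} K Ω}

theorem localSigma_mono (k : Fin K) : Monotone (M.localSigma k) := fun _ _ hst =>
  iSup_le fun r => le_iSup_of_le (⟨r, r.2.trans_le hst⟩ : Fin _) le_rfl

theorem localSigma_le_sigma (k : Fin K) (t : ℕ) : M.localSigma k t ≤ M.sigma t :=
  le_iSup (fun k => M.localSigma k t) k

theorem sigma_le (t : ℕ) : M.sigma t ≤ mΩ := iSup_le fun k => M.localSigma_le k t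

theorem sigma_mono : Monotone M.sigma := fun _ _ hst => iSup_mono fun k => localSigma_mono k hst

theorem measurable_uLoc (k : Fin K) (t : ℕ) : Measurable[M.localSigma k t] (M.uLoc k t) :=
  measurable_llr _ _

theorem measurable_uLoc' (k : Fin K) (t : ℕ) : Measurable (M.uLoc k t) :=
  (measurable_uLoc k t).mono (M.localSigma_le k t) le_rfl

theorem measurable_u (t : ℕ) : Measurable[M.sigma t] (M.u t) :=
  Finset.measurable_fun_sum _ fun k _ => (measurable_uLoc k t).mono (localSigma_le_sigma k t) le_rfl

theorem measurable_incr_local (k : Fin K) (t : ℕ) :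
    Measurable[M.localSigma k (t + 1)] fun ω => M.incr t ω k :=
  (measurable_uLoc k (t + 1)).sub ((measurable_uLoc k t).mono (localSigma_mono k t.le_succ) le_rfl)

theorem measurable_incr (t : ℕ) : Measurable[M.sigma (t + 1)] (M.incr t) :=
  @measurable_pi_lambda _ _ _ (M.sigma (t + 1)) _ _ fun k =>
    (measurable_incr_local k t).mono (localSigma_le_sigma k _) le_rfl

theorem u_succ (t : ℕ) (ω : Ω) : M.u (t + 1) ω = M.u t ω + ∑ k, M.incr t ω k := by
  simp only [u, incr, sum_sub_distrib]
  ring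

/-- At time `0` there is no observation. -/
theorem uLoc_zero (k : Fin K) (ω : Ω) : M.uLoc k 0 ω = 0 := by
  have := M.isProb 0
  have := M.isProb ⊤
  have hbot : M.localSigma k 0 = ⊥ := by simp [localSigma]
  have htrim : (M.P 0).trim (M.localSigma_le k 0) = (M.P ⊤).trim (M.localSigma_le k 0) := by
    refine @Measure.ext _ (M.localSigma k 0) _ _ fun s hs => ?_
    rw [trim_measurableSet_eq _ hs, trim_measurableSet_eq _ hs]
    rw [hbot] at hs
    rcases MeasurableSpace.measurableSet_bot_iff.mp hs with rfl | rfl <;> simp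
  have hae : ∀ᵐ ω ∂(M.P ⊤), M.uLoc k 0 ω = 0 := by
    refine ae_of_ae_trim (M.localSigma_le k 0) ?_
    have h := @llr_self _ (M.localSigma k 0) ((M.P ⊤).trim (M.localSigma_le k 0)) inferInstance
    unfold uLoc
    rw [htrim]
    exact h
  have hs : MeasurableSet[M.localSigma k 0] {ω | M.uLoc k 0 ω = 0} :=
    measurable_uLoc k 0 (measurableSet_singleton 0)
  rw [hbot] at hs
  rcases MeasurableSpace.measurableSet_bot_iff.mp hs with h | h
  · exact absurd (h ▸ (mem_ae_iff_prob_eq_one (h ▸ MeasurableSet.empty)).mp hae) (by simp)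
  · exact h.ge (mem_univ ω)

theorem u_zero (ω : Ω) : M.u 0 ω = 0 := by simp [u, uLoc_zero]

instance (k : Fin K) : IsProbabilityMeasure (M.pre k) := have := M.isProb ⊤
  isProbabilityMeasure_map (measurable_uLoc' k 1).aemeasurable

instance (k : Fin K) : IsProbabilityMeasure (M.post k) := have := M.isProb 0
  isProbabilityMeasure_map (measurable_uLoc' k 1).aemeasurable

namespace IsRandomWalkModel

variable (h : M.IsRandomWalkModel)
include h

theorem post_eq (k : Fin K) : M.post k = (M.pre k).withDensity fun y => ofReal (exp y) := by
  have := M.isProb 0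
  have := M.isProb ⊤
  have hle := M.localSigma_le k 1
  have hac : ∀ s, MeasurableSet[M.localSigma k 1] s → (M.P 0 s = 0 ↔ M.P ⊤ s = 0) := fun s hs =>
    h.equiv 1 s (localSigma_le_sigma k 1 _ hs)
  have h1 : (M.P 0).trim hle ≪ (M.P ⊤).trim hle := Measure.AbsolutelyContinuous.mk fun s hs h0 => by
      rw [trim_measurableSet_eq hle hs] at h0 ⊢
      exact (hac s hs).mpr h0
  have h2 : (M.P ⊤).trim hle ≪ (M.P 0).trim hle := Measure.AbsolutelyContinuous.mk fun s hs h0 => by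
      rw [trim_measurableSet_eq hle hs] at h0 ⊢
      exact (hac s hs).mp h0
  refine Measure.ext fun C hC => ?_
  have hs : MeasurableSet[M.localSigma k 1] (M.uLoc k 1 ⁻¹' C) := measurable_uLoc k 1 hC
  have hexp : ∀ᵐ ω ∂((M.P ⊤).trim hle), ofReal (exp (M.uLoc k 1 ω))
      = ((M.P 0).trim hle).rnDeriv ((M.P ⊤).trim hle) ω := by
    filter_upwards [exp_llr_of_ac' _ _ h2, Measure.rnDeriv_lt_top ((M.P 0).trim hle)
      ((M.P ⊤).trim hle)] with ω h3 h4
    unfold uLoc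
    rw [h3, ofReal_toReal h4.ne]
  have hE := (Real.continuous_exp.measurable).ennreal_ofReal
  have hEu : Measurable[M.localSigma k 1] fun ω => ofReal (exp (M.uLoc k 1 ω)) :=
    hE.comp (measurable_uLoc k 1)
  rw [withDensity_apply _ hC, post, pre, map_apply (measurable_uLoc' k 1) hC,
    setLIntegral_map hC hE (measurable_uLoc' k 1), ← trim_measurableSet_eq hle hs,
    ← Measure.setLIntegral_rnDeriv h1, ← setLIntegral_trim hle hEu hs]
  exact setLIntegral_congr_fun_ae hs (hexp.mono fun ω hω _ => hω.symm)

theorem steps_of_indep {P : Measure Ω} [IsProbabilityMeasure P]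
    (hind : iIndep (fun k => ⨆ t, M.localSigma k t) P) {Q : Fin K → Measure ℝ}
    [∀ k, IsProbabilityMeasure (Q k)]
    (hincr : ∀ k t, Indep (MeasurableSpace.comap (fun ω => M.uLoc k (t + 1) ω - M.uLoc k t ω)
      inferInstance) (M.localSigma k t) P)
    (hlaw : ∀ k t, P.map (fun ω => M.uLoc k (t + 1) ω - M.uLoc k t ω) = Q k) :
    IIDSteps M.sigma P M.incr (pi Q) 0 where
  prob := inferInstance
  prob_step := inferInstance
  le := sigma_le
  mono := sigma_mono
  meas := measurable_incr
  law t _ A hA C hC := by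
    refine measure_inter_preimage_pi (fun k => iSup_le fun t => M.localSigma_le k t)
      (fun k => le_iSup (M.localSigma k) t) hind
      (fun k => (measurable_incr_local k t).mono (le_iSup (M.localSigma k) (t + 1)) le_rfl)
      (fun k A hA C hC => ?_) hA hC
    have hX : Measurable fun ω => M.uLoc k (t + 1) ω - M.uLoc k t ω :=
      (measurable_uLoc' k (t + 1)).sub (measurable_uLoc' k t)
    rw [← hlaw k t, map_apply hX hC, Set.inter_comm, mul_comm]
    exact (Indep_iff _ _ _).mp (hincr k t) _ _ ⟨C, hC, rfl⟩ hA

theorem steps_pre : IIDSteps M.sigma (M.P ⊤) M.incr (pi M.pre) 0 := by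
  have := M.isProb ⊤
  exact h.steps_of_indep h.indep_pre h.indep_incr_pre fun k t => (h.ident_incr_pre k t).map_eq

theorem pi_post : pi M.post = (pi M.pre).withDensity fun x => ofReal (exp (∑ k, x k)) := by
  refine Measure.pi_eq fun C hC => ?_
  have hf : ∀ k, Measurable ((C k).indicator fun y : ℝ => ofReal (exp y)) :=
    fun k => ((Real.continuous_exp.measurable).ennreal_ofReal).indicator (hC k)
  rw [withDensity_apply _ (MeasurableSet.univ_pi hC), ← lintegral_indicator
    (MeasurableSet.univ_pi hC)]
  have : (fun x : Fin K → ℝ => (univ.pi C).indicator (fun x => ofReal (exp (∑ k, x k))) x)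
      = fun x => ∏ k, (C k).indicator (fun y : ℝ => ofReal (exp y)) (x k) := by
    funext x
    by_cases hx : x ∈ univ.pi C
    · rw [indicator_of_mem hx, Real.exp_sum, ENNReal.ofReal_prod_of_nonneg
        fun k _ => (exp_pos _).le]
      exact prod_congr rfl fun k _ =>
        (indicator_of_mem (hx k trivial) fun y : ℝ => ofReal (exp y)).symm
    · rw [indicator_of_notMem hx]
      simp only [Set.mem_pi, mem_univ, true_imp_iff, not_forall] at hx
      obtain ⟨k, hk⟩ := hx
      exact (Finset.prod_eq_zero (Finset.mem_univ k) (indicator_of_notMem hk _)).symm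
  rw [this, lintegral_pi_prod _ hf]
  refine prod_congr rfl fun k _ => ?_
  rw [lintegral_indicator (hC k), h.post_eq k, withDensity_apply _ (hC k)]

/-- From the change time on, the increments are independent with the post-change laws: the
density of `P τ` multiplies the law of each later step by the exponential of its total. -/
theorem steps_post (τ : ℕ) : IIDSteps M.sigma (M.P τ) M.incr (pi M.post) τ where
  prob := M.isProb τ
  prob_step := inferInstance
  le := sigma_le
  mono := sigma_mono
  meas := measurable_incr
  law t ht A hA C hC := by
    have hZ : Measurable[M.sigma t] fun ω => M.u t ω - M.u τ ω :=
      (measurable_u t).sub ((measurable_u τ).mono (sigma_mono ht) le_rfl)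
    have hg : Measurable fun x : Fin K → ℝ => C.indicator (fun x => ofReal (exp (∑ k, x k))) x :=
      Measurable.indicator (by fun_prop) hC
    rw [h.density τ (t + 1) (ht.trans t.le_succ) _ ((sigma_mono t.le_succ _ hA).inter
      (measurable_incr t hC)),
      h.density τ t ht _ hA, Set.inter_comm, ← setLIntegral_indicator ((h.steps_pre.measurable t)
        hC)]
    have hpt : ∀ ω, (M.incr t ⁻¹' C).indicator (fun ω => ofReal (exp (M.u (t + 1) ω - M.u τ ω))) ω
        = ofReal (exp (M.u t ω - M.u τ ω))
          * C.indicator (fun x => ofReal (exp (∑ k, x k))) (M.incr t ω) := by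
      intro ω
      by_cases hω : M.incr t ω ∈ C
      · rw [indicator_of_mem (show ω ∈ M.incr t ⁻¹' C from hω), indicator_of_mem hω,
          ← ofReal_mul (exp_pos _).le, ← exp_add, u_succ]
        ring_nf
      · rw [indicator_of_notMem (show ω ∉ M.incr t ⁻¹' C from hω), indicator_of_notMem hω, mul_zero]
    rw [lintegral_congr hpt, h.steps_pre.setLIntegral (F := fun y x => ofReal (exp y)
        * C.indicator (fun x => ofReal (exp (∑ k, x k))) x) t.zero_le hA hZ (Measurable.mul (by
          fun_prop) (hg.comp measurable_snd)), h.pi_post,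
      withDensity_apply _ hC, ← lintegral_indicator hC,
      ← lintegral_mul_const' _ _ (ne_of_lt ?_)]
    · exact lintegral_congr fun ω => lintegral_const_mul _ hg
    · rw [lintegral_indicator hC, ← withDensity_apply _ hC, ← h.pi_post]
      exact measure_lt_top _ _

/-- The laws before and after the change agree up to the change time. -/
theorem apply_eq (τ : ℕ) {A : Set Ω} (hA : MeasurableSet[M.sigma τ] A) : M.P τ A = M.P ⊤ A := by
  rw [h.density τ τ le_rfl A hA]
  simp

end IsRandomWalkModel

end ChangeModel

/-! ### The laws of the total increments -/

section
variable {K : ℕ} {Q : Fin K → Measure ℝ} [∀ k, IsProbabilityMeasure (Q k)]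

theorem integrable_pi_eval (k : Fin K) {f : ℝ → ℝ} (hf : Integrable f (Q k)) :
    Integrable (fun x : Fin K → ℝ => f (x k)) (pi Q) :=
  (measurePreserving_eval Q k).integrable_comp_of_integrable hf

theorem integral_pi_eval (k : Fin K) {f : ℝ → ℝ} (hf : Integrable f (Q k)) :
    ∫ x : Fin K → ℝ, f (x k) ∂(pi Q) = ∫ y, f y ∂(Q k) := by
  have hm := measurePreserving_eval Q k
  have hf' : AEStronglyMeasurable f ((pi Q).map (Function.eval k)) := by
    rw [hm.map_eq]
    exact hf.aestronglyMeasurable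
  rw [← hm.map_eq, integral_map hm.measurable.aemeasurable hf']

theorem measurable_total : Measurable fun x : Fin K → ℝ => ∑ k, x k := by fun_prop

theorem integrable_map_total {f : ℝ → ℝ} (hf : Measurable f) :
    Integrable f ((pi Q).map fun x => ∑ k, x k)
      ↔ Integrable (fun x : Fin K → ℝ => f (∑ k, x k)) (pi Q) :=
  integrable_map_measure hf.aestronglyMeasurable measurable_total.aemeasurable

theorem integral_map_total {f : ℝ → ℝ} (hf : Measurable f) :
    ∫ y, f y ∂((pi Q).map fun x => ∑ k, x k) = ∫ x : Fin K → ℝ, f (∑ k, x k) ∂(pi Q) :=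
  integral_map measurable_total.aemeasurable hf.aestronglyMeasurable

theorem integral_total (h1 : ∀ k, Integrable (fun y => y) (Q k)) :
    ∫ y, y ∂((pi Q).map fun x => ∑ k, x k) = ∑ k, ∫ y, y ∂(Q k) := by
  rw [integral_map_total measurable_id', integral_finsetSum _ fun k _ => integrable_pi_eval k (h1
    k)]
  exact sum_congr rfl fun k _ => integral_pi_eval k (h1 k)

theorem integrable_total (h1 : ∀ k, Integrable (fun y => y) (Q k)) :
    Integrable (fun y => y) ((pi Q).map fun x => ∑ k, x k) :=
  (integrable_map_total measurable_id').mpr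
    (integrable_finsetSum _ fun k _ => integrable_pi_eval k (h1 k))

theorem total_sq (h2 : ∀ k, Integrable (fun y => y ^ 2) (Q k)) {B : ℝ}
    (hB : ∀ k, ∫ y, y ^ 2 ∂(Q k) ≤ B) :
    Integrable (fun y => y ^ 2) ((pi Q).map fun x => ∑ k, x k) ∧
      ∫ y, y ^ 2 ∂((pi Q).map fun x => ∑ k, x k) ≤ K ^ 2 * B := by
  have hsq : Measurable fun y : ℝ => y ^ 2 := by fun_prop
  have hint : Integrable (fun x : Fin K → ℝ => K * ∑ k, x k ^ 2) (pi Q) :=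
    (integrable_finsetSum _ fun k _ => integrable_pi_eval k (h2 k)).const_mul _
  have hle : ∀ x : Fin K → ℝ, (∑ k, x k) ^ 2 ≤ K * ∑ k, x k ^ 2 := fun x => by
    simpa using sq_sum_le_card_mul_sum_sq (s := (Finset.univ : Finset (Fin K))) (f := x)
  have hint' : Integrable (fun x : Fin K → ℝ => (∑ k, x k) ^ 2) (pi Q) :=
    hint.mono' (by fun_prop) (Filter.Eventually.of_forall fun x => by
      rw [Real.norm_of_nonneg (sq_nonneg _)]
      exact hle x)
  refine ⟨(integrable_map_total hsq).mpr hint', ?_⟩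
  rw [integral_map_total hsq]
  refine (integral_mono hint' hint hle).trans ?_
  rw [integral_const_mul, integral_finsetSum _ fun k _ => integrable_pi_eval k (h2 k)]
  have : ∑ k, ∫ x : Fin K → ℝ, x k ^ 2 ∂(pi Q) ≤ ∑ _k : Fin K, B :=
    sum_le_sum fun k _ => (integral_pi_eval k (h2 k)).le.trans (hB k)
  calc (K : ℝ) * ∑ k, ∫ x : Fin K → ℝ, x k ^ 2 ∂(pi Q)
      ≤ K * ∑ _k : Fin K, B := mul_le_mul_of_nonneg_left this K.cast_nonneg
    _ = K ^ 2 * B := by simp; ring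

end

theorem StepLaws.mean_le {m B : ℝ} {Q Q₀ : Measure ℝ} (h : StepLaws m B Q Q₀) :
    ∫ y, y ∂Q₀ ≤ 1 + B := by
  have := h.prob₀
  calc ∫ y, y ∂Q₀ ≤ ∫ y, (1 + y ^ 2) ∂Q₀ :=
        integral_mono h.int1₀ ((integrable_const _).add h.int2₀) fun y => by
          nlinarith [sq_nonneg (y - 1), sq_nonneg y]
    _ = 1 + ∫ y, y ^ 2 ∂Q₀ := by rw [integral_add (integrable_const _) h.int2₀]; simp
    _ ≤ 1 + B := by linarith [h.second₀]

theorem StepLaws.total {K : ℕ} {m B : ℝ} {Q Q₀ : Fin K → Measure ℝ}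
    [∀ k, IsProbabilityMeasure (Q k)] [∀ k, IsProbabilityMeasure (Q₀ k)]
    (h : ∀ k, StepLaws m B (Q k) (Q₀ k)) (hK : 0 < K) (hm : 0 < m)
    (htilt : pi Q₀ = (pi Q).withDensity fun x => ofReal (exp (∑ k, x k))) :
    StepLaws (K * m) (K ^ 2 * B) ((pi Q).map fun x => ∑ k, x k)
      ((pi Q₀).map fun x => ∑ k, x k) where
  prob := isProbabilityMeasure_map measurable_total.aemeasurable
  prob₀ := isProbabilityMeasure_map measurable_total.aemeasurable
  tilt := by
    refine Measure.ext fun C hC => ?_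
    rw [map_apply measurable_total hC, htilt, withDensity_apply _ (measurable_total hC),
      withDensity_apply _ hC, setLIntegral_map hC (by fun_prop) measurable_total]
  int1 := integrable_total fun k => (h k).int1
  int2 := (total_sq (fun k => (h k).int2) fun k => (h k).second).1
  int1₀ := integrable_total fun k => (h k).int1₀
  int2₀ := (total_sq (fun k => (h k).int2₀) fun k => (h k).second₀).1
  second := (total_sq (fun k => (h k).int2) fun k => (h k).second).2
  second₀ := (total_sq (fun k => (h k).int2₀) fun k => (h k).second₀).2
  mean := by
    rw [integral_neg, integral_total fun k => (h k).int1, ← Finset.sum_neg_distrib]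
    have := Finset.card_nsmul_le_sum Finset.univ (fun k => -∫ y, y ∂(Q k)) m
      fun k _ => (integral_neg (μ := Q k) fun y => y) ▸ (h k).mean
    simpa using this
  mean₀ := by
    rw [integral_total fun k => (h k).int1₀]
    simpa using Finset.card_nsmul_le_sum Finset.univ (fun k => ∫ y, y ∂(Q₀ k)) m
      fun k _ => (h k).mean₀
  m_pos := mul_pos (by exact_mod_cast hK) hm

/-! ### The exit law as the law of the first message -/

section
variable {Ω : Type*} [mΩ : MeasurableSpace Ω] {ℱ : ℕ → MeasurableSpace Ω} {P : Measure Ω}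
  {x : ℕ → Ω → ℝ} {Q : Measure ℝ} 

/-- Nothing is sent up to time `n`. -/
def quiet (lo hi : ℝ) (x : ℕ → Ω → ℝ) (n : ℕ) : Set Ω := {ω | ∀ i < n, ω ∉ sends lo hi x i}

theorem quiet_succ (n : ℕ) : quiet lo hi x (n + 1) = quiet lo hi x n \ sends lo hi x n := by
  ext ω
  simp only [quiet, mem_ofPred_eq, Set.mem_sdiff, Order.lt_add_one_iff]
  exact ⟨fun h => ⟨fun i hi => h i hi.le, h n le_rfl⟩, fun h i hi =>
    (Nat.lt_or_eq_of_le hi).elim (h.1 i) fun he => he ▸ h.2⟩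

theorem IIDSteps.measurableSet_quiet (h : IIDSteps ℱ P x Q 0) (n : ℕ) :
    MeasurableSet[ℱ n] (quiet lo hi x n) := by
  induction n with
  | zero => simp [quiet]
  | succ n ih =>
    rw [quiet_succ]
    exact (h.mono n.le_succ _ ih).diff (h.measurableSet_sends n)

theorem IIDSteps.lintegral_quiet (h : IIDSteps ℱ P x Q 0) (n : ℕ)
    (hf : Measurable f) : ∫⁻ ω in quiet lo hi x n, f (resid lo hi x n ω) ∂P
      = (stay Q 𝕀)^[n] f 0 := by
  have := h.prob
  have := h.prob_step
  induction n generalizing f with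
  | zero => simp [quiet, resid]
  | succ n ih =>
    have h1 := h.resid_step (lo := lo) (hi := hi) n.zero_le (h.measurableSet_quiet (lo := lo) (hi
      := hi) n)
      (F := fun _ => 0) measurable_const hf
    have h0 : ∀ y, leave Q 𝕀 (fun _ => 0) y = 0 := fun y => by simp [leave]
    simp only [h0, lintegral_const, zero_mul, add_zero] at h1
    rw [quiet_succ, h1, ih (measurable_stay measurableSet_Ioo hf), Function.iterate_succ_apply]

/-- The landing point of the first exit has the exit law. -/
theorem IIDSteps.map_eq_exitLaw (h : IIDSteps ℱ P x Q 0)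
    [IsProbabilityMeasure (exitLaw Q 𝕀)] {Y : Ω → ℝ}
    (hY : ∀ n ω, ω ∈ quiet lo hi x n → ω ∈ sends lo hi x n → Y ω = resid lo hi x n ω + x n ω)
    (hY0 : ∀ ω, (∀ n, ω ∉ sends lo hi x n) → Y ω = 0) :
    Measurable Y ∧ P.map Y = exitLaw Q 𝕀 := by
  have := h.prob
  have := h.prob_step
  set E : Set ℝ → ℕ → Set Ω := fun C n =>
    quiet lo hi x n ∩ sends lo hi x n ∩ {ω | resid lo hi x n ω + x n ω ∈ C} with hE
  have hsum : ∀ n, Measurable fun ω => resid lo hi x n ω + x n ω := fun n =>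
    ((h.measurable_resid n).mono (h.le n) le_rfl).add (h.measurable n)
  have hqs : ∀ n, MeasurableSet (quiet lo hi x n ∩ sends lo hi x n) := fun n =>
    (h.le n _ (h.measurableSet_quiet n)).inter (h.le _ _ (h.measurableSet_sends n))
  have hEm : ∀ C, MeasurableSet C → ∀ n, MeasurableSet (E C n) := fun C hC n =>
    (hqs n).inter (hsum n hC)
  have hmem : ∀ C n ω, ω ∈ E C n → Y ω ∈ C := fun C n ω hω => by
    rw [hY n ω hω.1.1 hω.1.2]
    exact hω.2
  have hfirst : ∀ ω, (∃ n, ω ∈ quiet lo hi x n ∩ sends lo hi x n) ∨ ∀ n, ω ∉ sends lo hi x n := by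
    intro ω
    by_cases hω : ∃ n, ω ∈ sends lo hi x n
    · classical
      exact Or.inl ⟨Nat.find hω, fun i hi => Nat.find_min hω hi, Nat.find_spec hω⟩
    · exact Or.inr (not_exists.mp hω)
  have hmeas : Measurable Y := by
    intro C hC
    have : Y ⁻¹' C = (⋃ n, E C n) ∪ ((⋂ n, (sends lo hi x n)ᶜ) ∩ {_ω | (0 : ℝ) ∈ C}) := by
      ext ω
      simp only [Set.mem_preimage, Set.mem_union, Set.mem_iUnion, Set.mem_inter_iff,
        Set.mem_iInter, Set.mem_compl_iff, mem_ofPred_eq]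
      constructor
      · intro hω
        rcases hfirst ω with ⟨n, hn⟩ | hn
        · exact Or.inl ⟨n, hn, by rw [mem_ofPred_eq, ← hY n ω hn.1 hn.2]; exact hω⟩
        · exact Or.inr ⟨hn, by rw [← hY0 ω hn]; exact hω⟩
      · rintro (⟨n, hn⟩ | ⟨hn, h0⟩)
        · exact hmem C n ω hn
        · rw [hY0 ω hn]; exact h0
    rw [this]
    exact (MeasurableSet.iUnion (hEm C hC)).union ((MeasurableSet.iInter fun n =>
      (h.le _ _ (h.measurableSet_sends n)).compl).inter (MeasurableSet.const _))
  refine ⟨hmeas, ?_⟩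
  have := isProbabilityMeasure_map (μ := P) hmeas.aemeasurable
  refine (Measure.eq_of_le_of_isProbabilityMeasure (Measure.le_iff.mpr fun C hC => ?_)).symm
  have hdisj : Pairwise (Function.onFun Disjoint (E C)) := by
    have : ∀ i j, i < j → Disjoint (E C i) (E C j) := fun i j hij =>
      Set.disjoint_left.mpr fun ω hi hj => hj.1.1 i hij hi.1.2
    exact fun i j hij => (Nat.lt_or_gt_of_ne hij).elim (this i j) fun hji => (this j i hji).symm
  have hval : ∀ n, P (E C n) = (stay Q 𝕀)^[n] (leave Q 𝕀 (C.indicator 1)) 0 := by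
    intro n
    have hC1 : Measurable (C.indicator (1 : ℝ → ℝ≥0∞)) := measurable_one.indicator hC
    have h1 := h.resid_step (lo := lo) (hi := hi) n.zero_le (h.measurableSet_quiet (lo := lo) (hi
      := hi) n)
      (G := fun _ => 0) hC1 measurable_const
    have h0 : ∀ y, stay Q 𝕀 (fun _ => 0) y = 0 := fun y => by simp [stay]
    simp only [h0, lintegral_const, zero_mul, zero_add] at h1
    rw [← h.lintegral_quiet n (measurable_leave measurableSet_Ioo hC1), ← h1]
    have : (fun ω => C.indicator (1 : ℝ → ℝ≥0∞) (resid lo hi x n ω + x n ω))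
        = {ω | resid lo hi x n ω + x n ω ∈ C}.indicator 1 := rfl
    rw [this]
    refine ((lintegral_indicator_one (hsum n hC)).trans
      ((restrict_apply (hsum n hC)).trans ?_)).symm
    rw [Set.inter_comm]
    rfl
  have hex : exitLaw Q 𝕀 C = ∑' n, P (E C n) := by
    rw [← lintegral_indicator_one hC, lintegral_exitLaw measurableSet_Ioo
      (measurable_one.indicator hC), exitMean, pot]
    exact tsum_congr fun n => (hval n).symm
  rw [hex, ← measure_iUnion hdisj (hEm C hC), map_apply hmeas hC]
  exact measure_mono (Set.iUnion_subset fun n ω hω => hmem C n ω hω)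

end

/-! ### Communication times and messages -/

theorem sInf_natCast_le_iff {p : ℕ → Prop} :
    sInf {s : ℕ∞ | ∃ r : ℕ, s = r ∧ p r} ≤ t ↔ ∃ r ≤ t, p r := by
  constructor
  · intro h
    have hne : {s : ℕ∞ | ∃ r : ℕ, s = r ∧ p r}.Nonempty := by
      by_contra hne
      rw [Set.not_nonempty_iff_eq_empty.mp hne, sInf_empty] at h
      exact absurd h (by simp)
    obtain ⟨r, hr, hp⟩ := csInf_mem hne
    rw [hr] at h
    exact ⟨r, by exact_mod_cast h, hp⟩
  · rintro ⟨r, hr, hp⟩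
    exact le_trans (b := (r : ℕ∞)) (sInf_le ⟨r, rfl, hp⟩) (by exact_mod_cast hr)

namespace ChangeModel

variable {K : ℕ} {Ω : Type u} [mΩ : MeasurableSpace Ω] {M : ChangeModel.{u, v} K Ω}
  {S : CommScheme K} {k : Fin K}

section
local notation "xs" => fun t ω => incr M t ω k
local notation "res_" => resid (S.lo k) (S.hi k) xs
local notation "snd_" => sends (S.lo k) (S.hi k) xs

theorem commTime_succ_le_iff {n t : ℕ} {ω : Ω} : M.commTime S k (n + 1) ω ≤ t ↔
    ∃ r ≤ t, M.commTime S k n ω < r ∧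
      M.uLoc k r ω - M.uLoc k (M.commTime S k n ω).toNat ω ∉ Ioo (-S.lo k) (S.hi k) := by
  rw [commTime, sInf_natCast_le_iff]

theorem commTime_mono (ω : Ω) : Monotone fun n => M.commTime S k n ω :=
  monotone_nat_of_le_succ fun n => by
    rw [commTime]
    exact le_sInf fun s ⟨t, hs, ht, _⟩ => hs ▸ ht.le

theorem lt_commTime_succ {n t : ℕ} {ω : Ω} (h : M.commTime S k n ω = t) :
    (t : ℕ∞) < M.commTime S k (n + 1) ω := by
  rw [← not_le, commTime_succ_le_iff, h]
  rintro ⟨r, hr, hr', -⟩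
  exact absurd hr' (not_lt.mpr (by exact_mod_cast hr))

theorem numMsg_eq {n t : ℕ} {ω : Ω} (h1 : M.commTime S k n ω ≤ t)
    (h2 : (t : ℕ∞) < M.commTime S k (n + 1) ω) : M.numMsg S k t ω = n := by
  have : {n : ℕ | M.commTime S k n ω ≤ t} = Iic n := by
    ext j
    refine ⟨fun hj => ?_, fun hj => (commTime_mono ω hj).trans h1⟩
    by_contra hn
    exact absurd (h2.trans_le ((commTime_mono ω (Nat.succ_le_of_lt (not_le.mp hn))).trans hj))
      (lt_irrefl _)
  rw [numMsg, this, csSup_Iic]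

/-- The last communication before time `t` starts the excursion recorded by `resid`. -/
theorem numMsg_spec (t : ℕ) (ω : Ω) : M.commTime S k (M.numMsg S k t ω) ω ≤ t ∧
    (t : ℕ∞) < M.commTime S k (M.numMsg S k t ω + 1) ω ∧
    res_ t ω = M.uLoc k t ω - M.uLoc k (M.commTime S k (M.numMsg S k t ω) ω).toNat ω ∧
    (ω ∈ snd_ t → M.numMsg S k (t + 1) ω = M.numMsg S k t ω + 1 ∧
      M.commTime S k (M.numMsg S k t ω + 1) ω = (t + 1 : ℕ)) ∧
    (ω ∉ snd_ t → M.numMsg S k (t + 1) ω = M.numMsg S k t ω) := by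
  have step : ∀ t, M.commTime S k (M.numMsg S k t ω) ω ≤ t →
      (t : ℕ∞) < M.commTime S k (M.numMsg S k t ω + 1) ω →
      res_ t ω = M.uLoc k t ω - M.uLoc k (M.commTime S k (M.numMsg S k t ω) ω).toNat ω →
      (ω ∈ snd_ t → M.commTime S k (M.numMsg S k t ω + 1) ω = (t + 1 : ℕ)) ∧
      (ω ∉ snd_ t → ((t + 1 : ℕ) : ℕ∞) < M.commTime S k (M.numMsg S k t ω + 1) ω) := by
    intro t h1 h2 h3
    have hge : ((t + 1 : ℕ) : ℕ∞) ≤ M.commTime S k (M.numMsg S k t ω + 1) ω := by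
      push_cast
      exact Order.add_one_le_of_lt h2
    have hz : res_ t ω + incr M t ω k
        = M.uLoc k (t + 1) ω - M.uLoc k (M.commTime S k (M.numMsg S k t ω) ω).toNat ω := by
      rw [h3, incr]; ring
    constructor
    · intro hs
      have hs' : res_ t ω + incr M t ω k ∉ Ioo (-S.lo k) (S.hi k) := hs
      rw [hz] at hs'
      exact le_antisymm (commTime_succ_le_iff.mpr ⟨t + 1, le_rfl,
        h1.trans_lt (by exact_mod_cast t.lt_succ_self), hs'⟩) hge
    · intro hs
      have hs' := not_not.mp hs
      rw [hz] at hs'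
      refine lt_of_not_ge fun hle => ?_
      obtain ⟨r, hr, hr', hx⟩ := commTime_succ_le_iff.mp hle
      rcases Nat.lt_or_eq_of_le hr with hlt | rfl
      · have := commTime_succ_le_iff.mpr ⟨r, Nat.le_of_lt_succ hlt, hr', hx⟩
        exact absurd (h2.trans_le this) (lt_irrefl _)
      · exact hx hs'
  have hmain : M.commTime S k (M.numMsg S k t ω) ω ≤ t ∧
      (t : ℕ∞) < M.commTime S k (M.numMsg S k t ω + 1) ω ∧
      res_ t ω = M.uLoc k t ω - M.uLoc k (M.commTime S k (M.numMsg S k t ω) ω).toNat ω := by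
    induction t with
    | zero =>
      have h0 : M.commTime S k 0 ω = (0 : ℕ) := by simp [commTime]
      rw [numMsg_eq h0.le (lt_commTime_succ h0), h0]
      exact ⟨le_rfl, lt_commTime_succ h0, by simp [resid]⟩
    | succ t ih =>
      obtain ⟨h1, h2, h3⟩ := ih
      obtain ⟨hs, hn⟩ := step t h1 h2 h3
      by_cases hω : ω ∈ snd_ t
      · have h4 := hs hω
        rw [numMsg_eq h4.le (lt_commTime_succ h4), h4]
        exact ⟨le_rfl, lt_commTime_succ h4, by rw [resid_of_sends hω, ENat.toNat_natCast, sub_self]⟩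
      · have h1' : M.commTime S k (M.numMsg S k t ω) ω ≤ (t + 1 : ℕ) :=
          h1.trans (by exact_mod_cast t.le_succ)
        rw [numMsg_eq h1' (hn hω)]
        refine ⟨h1', hn hω, ?_⟩
        rw [resid_of_not_sends hω, h3, incr]
        ring
  obtain ⟨h1, h2, h3⟩ := hmain
  obtain ⟨hs, hn⟩ := step t h1 h2 h3
  exact ⟨h1, h2, h3, fun hω => ⟨numMsg_eq (hs hω).le (lt_commTime_succ (hs hω)), hs hω⟩,
    fun hω => numMsg_eq (h1.trans (by exact_mod_cast t.le_succ)) (hn hω)⟩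

theorem msg_eq (n : ℕ) (ω : Ω) : M.msg S k n ω
    = quantize S.d (S.hi k) (S.lo k) (S.epsUp k) (S.epsDn k) (M.ell S k n ω) := by
  have hdn : ∀ j, M.MsgDn S k n j ω ↔ HalfCell S.d (S.lo k) (S.epsDn k) (-M.ell S k n ω) j :=
    fun j => and_congr ⟨fun h => by linarith, fun h => by linarith⟩
      (or_congr Iff.rfl ⟨fun h => by linarith, fun h => by linarith⟩)
  have hup : ∀ j, M.MsgUp S k n j ω ↔ HalfCell S.d (S.hi k) (S.epsUp k) (M.ell S k n ω) j :=
    fun j => Iff.rfl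
  classical
  rw [msg, quantize]
  refine sum_congr rfl fun j _ => congrArg₂ _ ?_ ?_
  · exact if_congr (hup j) rfl rfl
  · exact if_congr (hdn j) rfl rfl

theorem ell_of_sends {ω : Ω} (hω : ω ∈ snd_ t) :
    M.ell S k (M.numMsg S k t ω + 1) ω = res_ t ω + incr M t ω k := by
  obtain ⟨-, -, h3, h4, -⟩ := numMsg_spec (M := M) (S := S) (k := k) t ω
  rw [ell, (h4 hω).2, h3, incr, Nat.add_sub_cancel, ENat.toNat_natCast]
  ring

theorem uTildeLoc_succ (t : ℕ) (ω : Ω) : M.uTildeLoc S k (t + 1) ω = M.uTildeLoc S k t ω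
    + (snd_ t).indicator (fun ω => M.msgLLR S k
      (quantize S.d (S.hi k) (S.lo k) (S.epsUp k) (S.epsDn k) (res_ t ω + incr M t ω k))) ω := by
  obtain ⟨-, -, h3, h4, h5⟩ := numMsg_spec (M := M) (S := S) (k := k) t ω
  by_cases hω : ω ∈ snd_ t
  · rw [indicator_of_mem hω, uTildeLoc, (h4 hω).1, Finset.sum_Icc_succ_top (by omega), msg_eq,
      ell_of_sends hω, uTildeLoc]
  · rw [indicator_of_notMem hω, uTildeLoc, h5 hω, uTildeLoc, add_zero]

theorem numMsg_of_quiet {n : ℕ} {ω : Ω} (hω : ω ∈ quiet (S.lo k) (S.hi k) xs n) :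
    M.numMsg S k n ω = 0 := by
  induction n with
  | zero =>
    have h0 : M.commTime S k 0 ω = (0 : ℕ) := by simp [commTime]
    exact numMsg_eq h0.le (lt_commTime_succ h0)
  | succ n ih =>
    rw [quiet_succ] at hω
    rw [(numMsg_spec n ω).2.2.2.2 hω.2, ih hω.1]

/-- The first accumulated log-likelihood ratio has the exit law. -/
theorem map_ell {P : Measure Ω} {Q : Measure ℝ} (h : IIDSteps M.sigma P xs Q 0)
    [IsProbabilityMeasure (exitLaw Q (Ioo (-S.lo k) (S.hi k)))] :
    Measurable (M.ell S k 1) ∧ P.map (M.ell S k 1) = exitLaw Q (Ioo (-S.lo k) (S.hi k)) := by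
  refine h.map_eq_exitLaw (fun n ω hq hs => ?_) fun ω hs => ?_
  · rw [← ell_of_sends hs, numMsg_of_quiet hq]
  · have htop : M.commTime S k 1 ω = ⊤ := by
      refine ENat.eq_top_iff_forall_gt.mpr fun t => ?_
      have := (numMsg_spec (M := M) (S := S) (k := k) t ω).2.1
      rwa [numMsg_of_quiet fun i _ => hs i] at this
    rw [ell, htop, Nat.sub_self]
    simp [commTime]

end

theorem cond_map_real {P : Measure Ω} [IsFiniteMeasure P] {Y : Ω → ℝ} (hY : Measurable Y)
    {A C : Set ℝ} (hA : MeasurableSet A) (hC : MeasurableSet C) :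
    (cond (P.map Y) A).real C = (cond P (Y ⁻¹' A)).real (Y ⁻¹' C) := by
  rw [measureReal_def, measureReal_def, cond_apply hA, cond_apply (hY hA),
    map_apply hY hA, map_apply hY (hA.inter hC), Set.preimage_inter]

/-! ### The sensors of a configuration -/

variable {m B a b Δ γ ν ν' : ℝ}

theorem integrable_map_uLoc (τ : ℕ∞) (k : Fin K) {f : ℝ → ℝ} (hf : Measurable f) :
    Integrable f ((M.P τ).map (M.uLoc k 1)) ↔ Integrable (fun ω => f (M.uLoc k 1 ω)) (M.P τ) :=
  integrable_map_measure hf.aestronglyMeasurable (measurable_uLoc' k 1).aemeasurable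

theorem integral_map_uLoc (τ : ℕ∞) (k : Fin K) {f : ℝ → ℝ} (hf : Measurable f) :
    ∫ y, f y ∂((M.P τ).map (M.uLoc k 1)) = ∫ ω, f (M.uLoc k 1 ω) ∂(M.P τ) :=
  integral_map (measurable_uLoc' k 1).aemeasurable hf.aestronglyMeasurable

theorem stepLaws (h : M.IsRandomWalkModel) (hb : M.MomentBounds m B) (hm : 0 < m) (k : Fin K) :
    StepLaws m B (M.pre k) (M.post k) := by
  have := M.isProb 0
  have := M.isProb ⊤
  have hsq : Measurable fun y : ℝ => y ^ 2 := by fun_prop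
  have h12 : (1 : ℝ≥0∞) ≤ 2 := by norm_num
  exact
    { prob := inferInstance
      prob₀ := inferInstance
      tilt := h.post_eq k
      int1 := (integrable_map_uLoc ⊤ k measurable_id').mpr ((hb.memLp_pre k).integrable h12)
      int2 := (integrable_map_uLoc ⊤ k hsq).mpr (hb.memLp_pre k).integrable_sq
      int1₀ := (integrable_map_uLoc 0 k measurable_id').mpr ((hb.memLp_post k).integrable h12)
      int2₀ := (integrable_map_uLoc 0 k hsq).mpr (hb.memLp_post k).integrable_sq
      second := (integral_map_uLoc ⊤ k hsq).trans_le (hb.second_pre k)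
      second₀ := (integral_map_uLoc 0 k hsq).trans_le (hb.second_post k)
      mean := (hb.kl_pre k).trans_eq (integral_map_uLoc ⊤ k measurable_neg).symm
      mean₀ := (hb.kl_post k).trans_eq (integral_map_uLoc 0 k measurable_id').symm
      m_pos := hm }

/-- The overshoot cell of sensor `k` as a function of the exit position. -/
def cell (S : CommScheme K) (k : Fin K) : ℝ → ℤ :=
  quantize S.d (S.hi k) (S.lo k) (S.epsUp k) (S.epsDn k)

/-- The log-likelihood ratio of the message of sensor `k` as a function of the exit position. -/
def exitLLR (M : ChangeModel.{u, v} K Ω) (S : CommScheme K) (k : Fin K) : ℝ → ℝ :=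
  cellLLR (exitLaw (M.pre k) (Ioo (-S.lo k) (S.hi k)))
    (exitLaw (M.post k) (Ioo (-S.lo k) (S.hi k))) (cell S k)

theorem steps_pre_local (h : M.IsRandomWalkModel) (k : Fin K) :
    IIDSteps M.sigma (M.P ⊤) (fun t ω => M.incr t ω k) (M.pre k) 0 := h.steps_pre.marginal k

theorem steps_post_local (h : M.IsRandomWalkModel) (τ : ℕ) (k : Fin K) :
    IIDSteps M.sigma (M.P τ) (fun t ω => M.incr t ω k) (M.post k) τ := (h.steps_post τ).marginal k

section Config
variable (h : M.IsConfig S m B a b Δ γ ν ν') (hm : 0 < m)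
include h hm

theorem IsConfig.laws (k : Fin K) : StepLaws m B (M.pre k) (M.post k) :=
  stepLaws h.walk h.bounds hm k

theorem IsConfig.exitPair (k : Fin K) : ExitPair (S.lo k) (S.hi k)
    (exitLaw (M.pre k) (Ioo (-S.lo k) (S.hi k)))
    (exitLaw (M.post k) (Ioo (-S.lo k) (S.hi k))) :=
  (h.laws hm k).exitPair (h.scheme.lo_pos k) (h.scheme.hi_pos k)

theorem IsConfig.map_ell_pre (k : Fin K) : Measurable (M.ell S k 1) ∧
    (M.P ⊤).map (M.ell S k 1) = exitLaw (M.pre k) (Ioo (-S.lo k) (S.hi k)) := by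
  have := (h.exitPair hm k).prob
  exact map_ell (steps_pre_local h.walk k)

theorem IsConfig.map_ell_post (k : Fin K) :
    (M.P 0).map (M.ell S k 1) = exitLaw (M.post k) (Ioo (-S.lo k) (S.hi k)) := by
  have := (h.exitPair hm k).prob₀
  exact (map_ell (steps_post_local h.walk 0 k)).2

theorem IsConfig.levels_up (k : Fin K) : Levels S.d (S.hi k) (S.epsUp k)
    (exitLaw (M.post k) (Ioo (-S.lo k) (S.hi k))) where
  d_pos := h.scheme.d_pos
  zero := h.scheme.epsUp_zero k
  pos := h.scheme.epsUp_pos k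
  level j hj hjd := by
    have := M.isProb 0
    rw [← h.map_ell_post hm k, cond_map_real (A := {z | S.hi k ≤ z})
      (C := {z | S.epsUp k j ≤ z - S.hi k}) (h.map_ell_pre hm k).1 measurableSet_Ici
      (measurableSet_le measurable_const (by fun_prop))]
    exact h.scheme.level_up k j hj hjd

theorem IsConfig.levels_dn (k : Fin K) : Levels S.d (S.lo k) (S.epsDn k)
    ((exitLaw (M.pre k) (Ioo (-S.lo k) (S.hi k))).map Neg.neg) where
  d_pos := h.scheme.d_pos
  zero := h.scheme.epsDn_zero k
  pos := h.scheme.epsDn_pos k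
  level j hj hjd := by
    have := M.isProb ⊤
    have hY := (h.map_ell_pre hm k).1
    rw [← (h.map_ell_pre hm k).2, Measure.map_map measurable_neg hY,
      cond_map_real (A := {z | S.lo k ≤ z}) (C := {z | S.epsDn k j ≤ z - S.lo k})
      (measurable_neg.comp hY) measurableSet_Ici
      (measurableSet_le measurable_const (by fun_prop)), ← h.scheme.level_dn k j hj hjd]
    have h1 : (Neg.neg ∘ M.ell S k 1) ⁻¹' {z | S.lo k ≤ z} = {ω | M.ell S k 1 ω ≤ -S.lo k} :=
      Set.ext fun ω => le_neg (a := S.lo k) (b := M.ell S k 1 ω)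
    have h2 : (Neg.neg ∘ M.ell S k 1) ⁻¹' {z | S.epsDn k j ≤ z - S.lo k}
        = {ω | M.ell S k 1 ω + S.lo k ≤ -S.epsDn k j} := by
      ext ω
      simp only [Set.mem_preimage, mem_ofPred_eq, Function.comp_apply]
      constructor <;> intro h3 <;> linarith
    rw [h1, h2]

theorem IsConfig.quantizer_cell (k : Fin K) : Quantizer (S.lo k) (S.hi k) (epsGap S k)
    (S.epsUp k (S.d - 1)) (S.epsDn k (S.d - 1))
    (exitLaw (M.pre k) (Ioo (-S.lo k) (S.hi k))) (cell S k) := by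
  have hle : ∀ j, j + 1 < S.d →
      max (S.epsUp k (j + 1) - S.epsUp k j) (S.epsDn k (j + 1) - S.epsDn k j) ≤ epsGap S k :=
    fun j hj => le_ciSup (f := fun j : Fin (S.d - 1) =>
      max (S.epsUp k (j + 1) - S.epsUp k j) (S.epsDn k (j + 1) - S.epsDn k j))
      (Set.finite_range _).bddAbove ⟨j, by omega⟩
  exact quantizer (h.exitPair hm k) (h.levels_up hm k) (h.levels_dn hm k)
    (fun j hj => (le_max_left _ _).trans (hle j hj)) fun j hj => (le_max_right _ _).trans (hle j hj)

theorem IsConfig.epsGap_nonneg (k : Fin K) : 0 ≤ epsGap S k :=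
  Real.iSup_nonneg fun j => le_max_of_le_left
    (sub_nonneg.mpr ((h.levels_up hm k).lt (Nat.lt_succ_self j) (by omega)).le)

theorem IsConfig.thetaLoc_le (k : Fin K) : M.thetaLoc S k ≤ M.theta S :=
  le_ciSup (f := M.thetaLoc S) (Set.finite_range _).bddAbove k

theorem IsConfig.theta_nonneg : 0 ≤ M.theta S :=
  Real.iSup_nonneg fun k => add_nonneg (add_nonneg (h.epsGap_nonneg hm k)
    (integral_nonneg fun _ => sq_nonneg _)) (integral_nonneg fun _ => sq_nonneg _)

theorem IsConfig.sensor (ha : 0 < a) (hΔ : 0 < Δ) (k : Fin K) :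
    Sensor m B a b Δ (lossConst m B * min (M.theta S) 1) (M.pre k) (M.post k) (S.lo k) (S.hi k)
      (exitLLR M S k) := by
  have hd : S.d - 1 < S.d := Nat.sub_lt h.scheme.d_pos one_pos
  have hsq : Measurable fun y : ℝ => y ^ 2 := by fun_prop
  refine (h.quantizer_cell hm k).sensor (h.laws hm k) ha hΔ (h.lo_mem k).1 (h.lo_mem k).2
    (h.hi_mem k).1 (h.hi_mem k).2 (h.epsGap_nonneg hm k) ((h.levels_up hm k).nonneg hd)
    ((h.levels_dn hm k).nonneg hd) ((Eq.le ?_).trans (h.thetaLoc_le hm k))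
  rw [thetaLoc, post, pre, setIntegral_map (s := {y | S.epsUp k (S.d - 1) ≤ y}) measurableSet_Ici
    hsq.aestronglyMeasurable (measurable_uLoc' k 1).aemeasurable,
    setIntegral_map (s := {y | S.epsDn k (S.d - 1) ≤ -y})
    (measurableSet_le measurable_const measurable_neg)
    hsq.aestronglyMeasurable (measurable_uLoc' k 1).aemeasurable]
  rfl

theorem IsConfig.msgLLR_cell (k : Fin K) (z : ℝ) : M.msgLLR S k (cell S k z) = exitLLR M S k z := by
  have hY := (h.map_ell_pre hm k).1
  have hc : Measurable (cell S k) := measurable_quantize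
  have hset : {ω | M.msg S k 1 ω = cell S k z} = M.ell S k 1 ⁻¹' (cell S k ⁻¹' {cell S k z}) := by
    ext ω
    rw [mem_ofPred_eq, msg_eq]
    rfl
  rw [exitLLR, cellLLR, ← (h.map_ell_pre hm k).2, ← h.map_ell_post hm k, msgLLR, hset,
    map_measureReal_apply hY (hc (measurableSet_singleton _)),
    map_measureReal_apply hY (hc (measurableSet_singleton _))]

/-- The fusion statistic is a functional of the increments. -/
theorem IsConfig.uTilde_eq_fusion (t : ℕ) (ω : Ω) :
    M.uTilde S t ω = fusion S.lo S.hi (exitLLR M S) M.incr t ω := by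
  induction t with
  | zero =>
    have h0 : ∀ k, M.numMsg S k 0 ω = 0 := fun k => numMsg_of_quiet fun i hi => absurd hi (by simp)
    simp [uTilde, uTildeLoc, h0, fusion]
  | succ t ih =>
    rw [fusion, ← ih, uTilde, uTilde, ← sum_add_distrib]
    refine sum_congr rfl fun k _ => ?_
    rw [uTildeLoc_succ]
    simp only [← h.msgLLR_cell hm k]
    rfl

theorem IsConfig.neg_le_exitLLR (ha : 0 < a) {Δ₀ : ℝ} (hΔ₀ : 0 < Δ₀) (hΔ : Δ₀ ≤ Δ) {N : ℕ}
    (hN : S.d ≤ N) (k : Fin K) (hz : z ∉ Ioo (-S.lo k) (S.hi k)) :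
    -(N * (b + overConst m B * B / Δ₀) / (1 - exp (-(a * Δ₀))) * Δ) ≤ exitLLR M S k z := by
  have ho := (mul_pos (h.laws hm k).overConst_pos (h.laws hm k).B_pos).le
  have hprob := (h.exitPair hm k).prob
  have hover : ∫⁻ z, ofReal (-z - S.lo k) ∂(exitLaw (M.pre k)
      (Ioo (-S.lo k) (S.hi k))) ≤ ofReal (overConst m B * B) := by
    rw [lintegral_exitLaw measurableSet_Ioo (by fun_prop)]
    exact (h.laws hm k).exitMean_under_le_const
      ⟨neg_lt_zero.mpr (h.scheme.lo_pos k), h.scheme.hi_pos k⟩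
  refine le_trans (neg_le_neg ?_) ((h.quantizer_cell hm k).neg_le_cellLLR (h.exitPair hm k)
    h.scheme.d_pos (fun z hz => (mass_dn_cell (h.levels_up hm k) (h.levels_dn hm k)
    (h.scheme.lo_pos k) (h.scheme.hi_pos k) hz).le) ho hover hz)
  have hexp := exp_le_exp.mpr (neg_le_neg ((mul_le_mul_of_nonneg_left hΔ ha.le).trans (h.hi_mem
    k).1))
  have hlt : exp (-(a * Δ₀)) < 1 := by
    rw [← exp_zero]
    exact exp_lt_exp.mpr (neg_lt_zero.mpr (mul_pos ha hΔ₀))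
  have hlo : S.lo k + overConst m B * B ≤ (b + overConst m B * B / Δ₀) * Δ := by
    have : overConst m B * B ≤ overConst m B * B / Δ₀ * Δ := by
      rw [div_mul_eq_mul_div, le_div_iff₀ hΔ₀]
      exact mul_le_mul_of_nonneg_left hΔ ho
    linarith [(h.lo_mem k).2]
  calc (S.d : ℝ) * (S.lo k + overConst m B * B) / (1 - exp (-S.hi k))
      ≤ N * ((b + overConst m B * B / Δ₀) * Δ) / (1 - exp (-(a * Δ₀))) := by
        have h0 := add_nonneg (h.scheme.lo_pos k).le ho
        exact div_le_div₀ (mul_nonneg N.cast_nonneg (h0.trans hlo))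
          (mul_le_mul (by exact_mod_cast hN) hlo h0 N.cast_nonneg) (by linarith) (by linarith)
    _ = _ := by ring

theorem IsConfig.total : StepLaws (K * m) (K ^ 2 * B)
    ((pi M.pre).map fun x => ∑ k, x k) ((pi M.post).map fun x => ∑ k, x k) :=
  StepLaws.total (h.laws hm) h.one_le_K hm h.walk.pi_post

theorem IsConfig.mean_le : ∫ y, y ∂((pi M.post).map fun x => ∑ k, x k) ≤ K * (1 + B) := by
  rw [integral_total fun k => (h.laws hm k).int1₀]
  refine (Finset.sum_le_card_nsmul Finset.univ (fun k => ∫ y, y ∂(M.post k)) (1 + B)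
    fun k _ => (h.laws hm k).mean_le).trans_eq ?_
  rw [card_univ, Fintype.card_fin, nsmul_eq_mul]

theorem IsConfig.spread_le : spread ((pi M.post).map fun x => ∑ k, x k) ≤ K * (B / (2 * m)) := by
  refine (h.total hm).spread₀_le.trans_eq ?_
  field_simp

end Config

end ChangeModel

/-! ### False-alarm period and worst-case delay through expected stopping times -/

section
variable {Ω : Type*} [mΩ : MeasurableSpace Ω] {ℱ : ℕ → MeasurableSpace Ω} {P : Measure Ω}

/-- If the walk stopped at `T` is integrable then so is `T`: with `ρ` the affinity of the step laws,
`exp (U t / 2) ρ⁻ᵗ` is a supermartingale, and `t log ρ⁻¹ ≤ |U t| + exp (U t / 2) ρ⁻ᵗ`. -/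
theorem IIDSteps.tsum_alive_ne_top {X U : ℕ → Ω → ℝ} {Q Q₀ : Measure ℝ} {m B : ℝ}
    (h : IIDSteps ℱ P X Q 0) (hQ : StepLaws m B Q Q₀) {T : Ω → ℕ∞}
    (hT : ∀ t, MeasurableSet[ℱ t] {ω | (t : ℕ∞) < T ω}) (hUm : ∀ t, Measurable[ℱ t] (U t))
    (hU : ∀ t ω, U (t + 1) ω = U t ω + X t ω) (hU0 : ∀ ω, U 0 ω = 0)
    (hfin : ∀ᵐ ω ∂P, T ω ≠ ⊤) (hint : Integrable (fun ω => -U (T ω).toNat ω) P) :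
    ∑' i : ℕ, P {ω | (i : ℕ∞) < T ω} ≠ ∞ := by
  have := h.prob
  have hρ := hQ.affinityBound_pos
  set c := log (affinityBound m B)⁻¹ with hc
  have hc0 : 0 < c := log_pos ((one_lt_inv₀ hρ).mpr hQ.affinityBound_lt)
  set alive : ℕ → Set Ω := fun t => {ω | (t : ℕ∞) < T ω} with halive
  set V : ℕ → Ω → ℝ≥0∞ := fun t ω => ofReal (exp (U t ω / 2 + c * t)) with hV
  have hal : ∀ t, MeasurableSet (alive t) := fun t => h.le t _ (hT t)
  have hanti : ∀ t, alive (t + 1) ⊆ alive t := fun t ω hω =>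
    lt_of_le_of_lt (by exact_mod_cast t.le_succ) (show ((t + 1 : ℕ) : ℕ∞) < T ω from hω)
  have hVm : ∀ t, Measurable (V t) := fun t => by
    have := (hUm t).mono (h.le t) le_rfl
    fun_prop
  have hhalf : ∫⁻ x, ofReal (exp (x / 2)) ∂Q ≤ ofReal (affinityBound m B) := by
    refine le_trans (Eq.le ?_) hQ.lintegral_exp_half_le
    rw [hQ.lintegral_exp_mul (by fun_prop)]
    refine lintegral_congr fun x => ?_
    rw [← ofReal_mul (exp_pos _).le, ← exp_add]
    ring_nf
  have hstep : ∀ t, 0 ≤ t → ∫⁻ ω in alive t, V (t + 1) ω ∂P + 0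
      ≤ ∫⁻ ω in alive t, V t ω ∂P + 0 := by
    intro t _
    have h1 : ∀ ω, V (t + 1) ω = ofReal (exp (U t ω / 2 + c * (t + 1)))
        * ofReal (exp (X t ω / 2)) := fun ω => by
      rw [← ofReal_mul (exp_pos _).le, ← exp_add, hV]
      simp only [hU]
      push_cast
      ring_nf
    rw [add_zero, add_zero, lintegral_congr h1, h.setLIntegral (F := fun z x =>
      ofReal (exp (z / 2 + c * (t + 1))) * ofReal (exp (x / 2)))
      t.zero_le (hT t) (hUm t) (by fun_prop)]
    refine lintegral_mono fun ω => ?_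
    rw [lintegral_const_mul _ (by fun_prop)]
    refine (mul_le_mul_right hhalf _).trans (Eq.le ?_)
    have hρc : affinityBound m B = exp (-c) := by rw [hc, log_inv, neg_neg, exp_log hρ]
    rw [← ofReal_mul (exp_pos _).le, hρc, ← exp_add, hV]
    ring_nf
  have hhalt : ∑' i, ∫⁻ ω in alive i \ alive (i + 1), V (i + 1) ω ∂P ≤ 1 := by
    refine tsum_le_of_sum_range_le fun n => ?_
    have h1 := lyapunov_le (τ := 0) (fun t _ => hal t) (fun t _ => hanti t) hstep n
    simp only [zero_add, sum_const_zero, add_zero] at h1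
    have h0 : V 0 = fun _ => 1 := by
      funext ω
      simp [hV, hU0]
    rw [h0, lintegral_const, restrict_apply MeasurableSet.univ, one_mul] at h1
    exact (le_add_self.trans h1).trans prob_le_one
  have hpt : ∀ᵐ ω ∂P, ofReal c * ∑' i, (alive i).indicator 1 ω ≤ ofReal |-U (T ω).toNat ω|
        + ∑' i, (alive i \ alive (i + 1)).indicator (V (i + 1)) ω := by
    filter_upwards [hfin] with ω hω
    obtain ⟨n, hn⟩ := ENat.ne_top_iff_exists.mp hω
    have hmem : ∀ i, ω ∈ alive i ↔ i < n := fun i => by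
      rw [halive, mem_ofPred_eq, ← hn]
      exact_mod_cast Iff.rfl
    have hsum : ∑' i, (alive i).indicator (1 : Ω → ℝ≥0∞) ω = n := by
      rw [tsum_eq_sum (s := range n) fun i hi =>
        indicator_of_notMem (by rw [hmem]; simpa using hi) _]
      rw [sum_congr rfl fun i hi => indicator_of_mem
        ((hmem i).mpr (mem_range.mp hi)) (1 : Ω → ℝ≥0∞)]
      simp
    rw [hsum, ← hn, ENat.toNat_natCast]
    cases n with
    | zero => simp
    | succ n =>
      have hw : ω ∈ alive n \ alive (n + 1) := ⟨(hmem n).mpr n.lt_succ_self, by simp [hmem]⟩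
      have h1 := ENNReal.le_tsum (f := fun i => (alive i \ alive (i + 1)).indicator (V (i + 1)) ω) n
      rw [indicator_of_mem hw] at h1
      refine le_trans ?_ (add_le_add_right h1 _)
      rw [hV, ← ofReal_add (abs_nonneg _) (exp_pos _).le,
        ← ofReal_natCast (n + 1), ← ofReal_mul hc0.le]
      refine ofReal_le_ofReal ?_
      have h2 := Real.add_one_le_exp (U (n + 1) ω / 2 + c * ((n + 1 : ℕ) : ℝ))
      have h3 := le_abs_self (-U (n + 1) ω)
      have h4 := abs_nonneg (-U (n + 1) ω)
      linarith
  have hlin := lintegral_mono_ae hpt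
  have hind : ∀ i, Measurable ((alive i).indicator (1 : Ω → ℝ≥0∞)) := fun i =>
    measurable_one.indicator (hal i)
  have hstopm : ∀ i, Measurable ((alive i \ alive (i + 1)).indicator (V (i + 1))) := fun i =>
    (hVm _).indicator ((hal i).diff (hal _))
  rw [lintegral_const_mul _ (Measurable.tsum hind), lintegral_tsum fun i => (hind i).aemeasurable,
    lintegral_add_right _ (Measurable.tsum hstopm),
    lintegral_tsum fun i => (hstopm i).aemeasurable] at hlin
  simp only [lintegral_indicator_one (hal _), lintegral_indicator ((hal _).diff (hal _))] at hlin
  have hUfin : ∫⁻ ω, ofReal |-U (T ω).toNat ω| ∂P < ∞ := by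
    have := hint.2
    simpa [HasFiniteIntegral, ← ofReal_norm] using this
  intro htop
  rw [htop, ENNReal.mul_top (by simpa using hc0)] at hlin
  exact absurd (top_le_iff.mp hlin)
    (ENNReal.add_ne_top.mpr ⟨hUfin.ne, (hhalt.trans_lt ENNReal.one_lt_top).ne⟩)

theorem condExp_le_const {𝒢 : MeasurableSpace Ω} (h𝒢 : 𝒢 ≤ mΩ) [IsProbabilityMeasure P]
    {D : Ω → ℝ} (hD : Integrable D P) {b : ℝ}
    (h : ∀ A, MeasurableSet[𝒢] A → ∫ ω in A, D ω ∂P ≤ b * P.real A) :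
    ∀ᵐ ω ∂P, (P[D | 𝒢]) ω ≤ b := by
  have hA : MeasurableSet[𝒢] {ω | b < (P[D | 𝒢]) ω} :=
    stronglyMeasurable_condExp.measurable measurableSet_Ioi
  have h1 : ∫ ω in {ω | b < (P[D | 𝒢]) ω}, ((P[D | 𝒢]) ω - b) ∂P ≤ 0 := by
    rw [integral_sub integrable_condExp.integrableOn (integrable_const b).integrableOn,
      setIntegral_condExp h𝒢 hD hA, setIntegral_const, smul_eq_mul]
    linarith [h _ hA]
  have h2 : ¬ 0 < P {ω | b < (P[D | 𝒢]) ω} := fun hpos => by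
    refine absurd h1 (not_le.mpr ?_)
    rw [setIntegral_pos_iff_support_of_nonneg_ae
      ((ae_restrict_iff' (h𝒢 _ hA)).mpr (Filter.Eventually.of_forall fun ω hω =>
        (sub_pos.mpr (show b < (P[D | 𝒢]) ω from hω)).le)) (integrable_condExp.sub
          (integrable_const b)).integrableOn]
    refine hpos.trans_le (measure_mono fun ω hω => ⟨?_, hω⟩)
    exact (sub_pos.mpr (show b < (P[D | 𝒢]) ω from hω)).ne'
  rw [ae_iff]
  simpa using h2

end

namespace ChangeModel

variable {K : ℕ} {Ω : Type u} [mΩ : MeasurableSpace Ω] {M : ChangeModel.{u, v} K Ω}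

theorem lt_hitTime_iff {y : ℕ → Ω → ℝ} {ω : Ω} : (t : ℕ∞) < hitTime y x ω ↔ ∀ r ≤ t, y r ω < x := by
  rw [← not_le, hitTime, sInf_natCast_le_iff]
  simp only [not_exists, not_and, not_le]

theorem measurableSet_lt_hitTime {y : ℕ → Ω → ℝ} (hy : ∀ t, Measurable[M.sigma t] (y t)) (x : ℝ)
    (t : ℕ) : MeasurableSet[M.sigma t] {ω | (t : ℕ∞) < hitTime y x ω} := by
  have : {ω | (t : ℕ∞) < hitTime y x ω} = ⋂ r ∈ range (t + 1), {ω | y r ω < x} := by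
    ext ω
    simp [lt_hitTime_iff]
  rw [this]
  exact Finset.measurableSet_biInter _ fun r hr =>
    sigma_mono (Nat.lt_succ_iff.mp (mem_range.mp hr)) _ (hy r measurableSet_Iio)

section
variable (h : M.IsRandomWalkModel) {m B : ℝ} (hQ : StepLaws m B ((pi M.pre).map fun x => ∑ k, x k)
    ((pi M.post).map fun x => ∑ k, x k))
  {T : Ω → ℕ∞} (hT : ∀ t, MeasurableSet[M.sigma t] {ω | (t : ℕ∞) < T ω})
include h hQ hT

/-- Wald's identity for the false-alarm period. -/
theorem falseAlarm_wald {γ : ℝ} (hγ : M.falseAlarmPeriod T = (γ : EReal)) :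
    ∑' i : ℕ, M.P ⊤ {ω | (i : ℕ∞) < T ω} ≠ ∞ ∧
    (∑' i : ℕ, M.P ⊤ {ω | (i : ℕ∞) < T ω}).toReal
      * ∫ y, -y ∂((pi M.pre).map fun x => ∑ k, x k) = γ := by
  unfold falseAlarmPeriod at hγ
  split_ifs at hγ with hcond
  · have hγ' : ∫ ω, -M.u (T ω).toNat ω ∂(M.P ⊤) = γ := by exact_mod_cast hγ
    have hs := h.steps_pre.comp measurable_total
    have hfin := hs.tsum_alive_ne_top hQ hT measurable_u u_succ u_zero hcond.1 hcond.2
    refine ⟨hfin, ?_⟩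
    have hw := (hs.wald hQ.int1 hT (MeasurableSet.univ (α := Ω)) (by simpa using hfin) u_succ).2.2
    simp only [Set.univ_inter, zero_add, restrict_univ] at hw
    have hD : ∀ ω, {ω | ((0 : ℕ) : ℕ∞) < T ω}.indicator
        (fun ω => M.u (T ω).toNat ω - M.u 0 ω) ω = M.u (T ω).toNat ω := by
      intro ω
      by_cases hω : ((0 : ℕ) : ℕ∞) < T ω
      · rw [indicator_of_mem (show ω ∈ {ω | ((0 : ℕ) : ℕ∞) < T ω} from hω), u_zero, sub_zero]
      · rw [indicator_of_notMem (show ω ∉ {ω | ((0 : ℕ) : ℕ∞) < T ω} from hω)]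
        have : T ω = 0 := by simpa using hω
        rw [this, ENat.toNat_zero, u_zero]
    simp only [hD] at hw
    rw [integral_neg, mul_neg, ← hw, ← integral_neg, hγ']
  · exact absurd hγ (EReal.top_ne_coe γ)

/-- A bound on the expected numbers of steps after every change time bounds the worst-case delay,
and the worst-case delay is itself such a bound. -/
theorem exists_worstDelay {b : ℝ} (hb : 0 ≤ b)
    (hle : ∀ (τ : ℕ) (A : Set Ω), MeasurableSet[M.sigma τ] A →
      ofReal (∫ y, y ∂((pi M.post).map fun x => ∑ k, x k))
          * ∑' i : ℕ, M.P τ (A ∩ {ω | ((τ + i : ℕ) : ℕ∞) < T ω})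
        ≤ ofReal b * M.P τ (A ∩ {ω | (τ : ℕ∞) < T ω})) :
    ∃ j : ℝ, M.worstDelay T = (j : EReal) ∧ 0 ≤ j ∧ j ≤ b ∧
      ∀ (τ : ℕ) (A : Set Ω), MeasurableSet[M.sigma τ] A →
      ofReal (∫ y, y ∂((pi M.post).map fun x => ∑ k, x k))
          * ∑' i : ℕ, M.P τ (A ∩ {ω | ((τ + i : ℕ) : ℕ∞) < T ω})
        ≤ ofReal j * M.P τ (A ∩ {ω | (τ : ℕ∞) < T ω}) := by
  set μ := ∫ y, y ∂((pi M.post).map fun x => ∑ k, x k)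
  have hμ0 : 0 < μ := hQ.m_pos.trans_le hQ.mean₀
  have hprob : ∀ τ : ℕ, IsProbabilityMeasure (M.P τ) := fun τ => M.isProb τ
  have hfin : ∀ (τ : ℕ) (A : Set Ω), MeasurableSet[M.sigma τ] A →
      ∑' i : ℕ, M.P τ (A ∩ {ω | ((τ + i : ℕ) : ℕ∞) < T ω}) ≠ ∞ := by
    intro τ A hA htop
    have h1 := hle τ A hA
    rw [htop, ENNReal.mul_top (by simpa using hμ0)] at h1
    exact absurd (top_le_iff.mp h1) (ENNReal.mul_ne_top ofReal_ne_top (measure_ne_top _ _))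
  have wald := fun (τ : ℕ) (A : Set Ω) (hA : MeasurableSet[M.sigma τ] A) =>
    ((h.steps_post τ).comp measurable_total).wald hQ.int1₀ hT hA (hfin τ A hA) u_succ
  have hint : ∀ τ : ℕ, (∀ᵐ ω ∂(M.P τ), T ω ≠ ⊤) ∧ Integrable (M.delay T τ) (M.P τ) := by
    intro τ
    have h1 := wald τ univ (@MeasurableSet.univ _ (M.sigma τ))
    exact ⟨h1.1.mono fun ω hω => hω trivial, integrableOn_univ.mp h1.2.1⟩
  have hval : ∀ (τ : ℕ) (A : Set Ω), MeasurableSet[M.sigma τ] A → ∫ ω in A, M.delay T τ ω ∂(M.P τ)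
        = (∑' i : ℕ, M.P τ (A ∩ {ω | ((τ + i : ℕ) : ℕ∞) < T ω})).toReal * μ :=
    fun τ A hA => (wald τ A hA).2.2
  have hup : ∀ τ : ℕ, ∀ᵐ ω ∂(M.P τ), ((M.P τ)[M.delay T τ | M.sigma τ]) ω ≤ b := by
    refine fun τ => condExp_le_const (sigma_le τ) (hint τ).2 fun A hA => ?_
    rw [hval τ A hA, mul_comm]
    have h1 := (hle τ A hA).trans (mul_le_mul_right (measure_mono Set.inter_subset_left) _)
    have h2 := ENNReal.toReal_mono (ENNReal.mul_ne_top ofReal_ne_top (measure_ne_top _ _)) h1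
    rwa [ENNReal.toReal_mul, ENNReal.toReal_mul, ENNReal.toReal_ofReal hμ0.le,
      ENNReal.toReal_ofReal hb] at h2
  have hlow : ∀ τ : ℕ, ∀ᵐ ω ∂(M.P τ), 0 ≤ ((M.P τ)[M.delay T τ | M.sigma τ]) ω := by
    intro τ
    have h1 := condExp_le_const (sigma_le τ) (hint τ).2.neg (b := 0) fun A hA => by
      simp only [Pi.neg_apply]
      rw [integral_neg, hval τ A hA, zero_mul, neg_nonpos]
      exact mul_nonneg toReal_nonneg hμ0.le
    filter_upwards [h1, condExp_neg (M.delay T τ) (M.sigma τ) (μ := M.P τ)] with ω h2 h3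
    rw [h3] at h2
    exact neg_nonpos.mp h2
  have hw : M.worstDelay T = ⨆ τ : ℕ,
      essSup (fun ω => (((M.P τ)[M.delay T τ | M.sigma τ] ω : ℝ) : EReal)) (M.P τ) :=
    iSup_congr fun τ => if_pos (hint τ)
  have hwb : M.worstDelay T ≤ (b : EReal) := by
    rw [hw]
    exact iSup_le fun τ => essSup_le_of_ae_le _ ((hup τ).mono fun ω hω => EReal.coe_le_coe hω)
  have hle_w : ∀ τ : ℕ, ∀ᵐ ω ∂(M.P τ),
      (((M.P τ)[M.delay T τ | M.sigma τ] ω : ℝ) : EReal) ≤ M.worstDelay T := fun τ => by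
    rw [hw]
    exact (ae_le_essSup (μ := M.P τ)).mono fun ω hω => hω.trans (le_iSup (fun τ : ℕ =>
      essSup (fun ω => (((M.P τ)[M.delay T τ | M.sigma τ] ω : ℝ) : EReal)) (M.P τ)) τ)
  have hw0 : (0 : EReal) ≤ M.worstDelay T := by
    obtain ⟨ω, h1, h2⟩ := ((hlow 0).and (hle_w 0)).exists
    exact (EReal.coe_nonneg.mpr h1).trans h2
  have hj := EReal.coe_toReal (ne_of_lt (hwb.trans_lt (EReal.coe_lt_top b))) (ne_of_gt
    (lt_of_lt_of_le EReal.bot_lt_zero hw0))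
  have hj0 := EReal.toReal_nonneg hw0
  refine ⟨(M.worstDelay T).toReal, hj.symm, hj0, EReal.coe_le_coe_iff.mp (hj.trans_le hwb),
    fun τ A hA => ?_⟩
  set A' := A ∩ {ω | (τ : ℕ∞) < T ω} with hA'
  have hA'm := MeasurableSet.inter hA (hT τ)
  have hsets : ∀ i : ℕ, A' ∩ {ω | ((τ + i : ℕ) : ℕ∞) < T ω}
      = A ∩ {ω | ((τ + i : ℕ) : ℕ∞) < T ω} := fun i => by
    rw [hA', Set.inter_assoc]
    congr 1
    exact Set.inter_eq_right.mpr fun ω hω => lt_of_le_of_lt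
      (by exact_mod_cast τ.le_add_right i) (show ((τ + i : ℕ) : ℕ∞) < T ω from hω)
  have h1 := hval τ A' hA'm
  simp only [hsets] at h1
  have h2 : ∫ ω in A', M.delay T τ ω ∂(M.P τ) ≤ (M.worstDelay T).toReal * (M.P τ).real A' := by
    rw [← setIntegral_condExp (sigma_le τ) (hint τ).2 hA'm]
    refine (setIntegral_mono_ae integrable_condExp.integrableOn
      (integrable_const (M.worstDelay T).toReal).integrableOn
      ((hle_w τ).mono fun ω hω => ?_)).trans_eq ?_
    · exact EReal.coe_le_coe_iff.mp (hω.trans_eq hj.symm)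
    · rw [setIntegral_const, smul_eq_mul, mul_comm]
  rw [h1] at h2
  calc ofReal μ * ∑' i : ℕ, M.P τ (A ∩ {ω | ((τ + i : ℕ) : ℕ∞) < T ω})
      = ofReal ((∑' i : ℕ, M.P τ (A ∩ {ω | ((τ + i : ℕ) : ℕ∞) < T ω})).toReal * μ) := by
        rw [ofReal_mul toReal_nonneg, ofReal_toReal (hfin τ A hA), mul_comm]
    _ ≤ ofReal ((M.worstDelay T).toReal * (M.P τ).real A') := ofReal_le_ofReal h2
    _ = ofReal (M.worstDelay T).toReal * M.P τ A' := by rw [ofReal_mul hj0, ofReal_measureReal]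

end

/-! ### Bounds for the two tests -/

variable {S : CommScheme K} {m B a b Δ γ ν ν' : ℝ}

theorem lt_hitTime_anti {y : ℕ → Ω → ℝ} {s t : ℕ} (hst : s ≤ t) :
    {ω | (t : ℕ∞) < hitTime y x ω} ⊆ {ω | (s : ℕ∞) < hitTime y x ω} := fun ω hω =>
  lt_of_le_of_lt (by exact_mod_cast hst) (show (t : ℕ∞) < hitTime y x ω from hω)

section
variable (h : M.IsConfig S m B a b Δ γ ν ν') (hm : 0 < m)
include h hm

theorem IsConfig.le_card_mul {c : ℝ} (hc : 0 ≤ c) : c ≤ K * c :=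
  le_mul_of_one_le_left hc (by exact_mod_cast h.one_le_K)

theorem IsConfig.period_le {T : Ω → ℕ∞} (hT : ∀ t, MeasurableSet[M.sigma t] {ω | (t : ℕ∞) < T ω})
    (hγ : M.falseAlarmPeriod T = (γ : EReal)) :
    ∑' i : ℕ, M.P ⊤ {ω | (i : ℕ∞) < T ω} ≤ ofReal (γ / m) := by
  obtain ⟨hfin, hw⟩ := falseAlarm_wald h.walk (h.total hm) hT hγ
  rw [ENNReal.le_ofReal_iff_toReal_le hfin (div_nonneg (by linarith [h.one_lt_gamma]) hm.le),
    le_div_iff₀ hm, ← hw]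
  exact mul_le_mul_of_nonneg_left ((h.le_card_mul hm hm.le).trans (h.total hm).mean) toReal_nonneg

theorem IsConfig.threshold_pos {y : ℕ → Ω → ℝ} (hy : ∀ t, Measurable[M.sigma t] (y t))
    (hy0 : ∀ ω, y 0 ω = 0) (hγ : M.falseAlarmPeriod (hitTime y x) = (γ : EReal)) : 0 < x := by
  by_contra hx
  have hw := (falseAlarm_wald h.walk (h.total hm) (measurableSet_lt_hitTime hy x) hγ).2
  have hempty : ∀ i : ℕ, {ω | (i : ℕ∞) < hitTime y x ω} = ∅ := fun i =>
    Set.eq_empty_of_forall_notMem fun ω hω => hx (by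
      have := lt_hitTime_iff.mp (show (i : ℕ∞) < hitTime y x ω from hω) 0 i.zero_le
      rwa [hy0] at this)
  simp only [hempty, measure_empty, tsum_zero, ENNReal.toReal_zero, zero_mul] at hw
  linarith [h.one_lt_gamma]

/-- No test with false-alarm period `γ` has a worst-case delay much smaller than `log γ`. -/
theorem IsConfig.log_gamma_le {T : Ω → ℕ∞}
    (hT : ∀ t, MeasurableSet[M.sigma t] {ω | (t : ℕ∞) < T ω}) (hT0 : ∀ ω, 0 < T ω)
    (hγ : M.falseAlarmPeriod T = (γ : EReal)) {j : ℝ} (hj0 : 0 ≤ j)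
    (hj : ∀ (τ : ℕ) (A : Set Ω), MeasurableSet[M.sigma τ] A →
      ofReal (∫ y, y ∂((pi M.post).map fun x => ∑ k, x k))
          * ∑' i : ℕ, M.P τ (A ∩ {ω | ((τ + i : ℕ) : ℕ∞) < T ω})
        ≤ ofReal j * M.P τ (A ∩ {ω | (τ : ℕ∞) < T ω})) :
    log γ ≤ j + K * (2 + B / m) := by
  obtain ⟨hfin, hw⟩ := falseAlarm_wald h.walk (h.total hm) hT hγ
  have hK : (1 : ℝ) ≤ K := by exact_mod_cast h.one_le_K
  have hlaws := h.total hm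
  set μ := ∫ y, y ∂((pi M.post).map fun x => ∑ k, x k)
  have h1 := (h.walk.steps_pre.comp measurable_total).log_period_le (U := M.u) (J := j) hlaws hT
    (fun t ω hω => lt_of_le_of_lt (by exact_mod_cast t.le_succ)
      (show ((t + 1 : ℕ) : ℕ∞) < T ω from hω))
    (Set.eq_univ_of_forall fun ω => by simpa using hT0 ω) hfin measurable_u u_succ hj0
    (fun t A hA => by
      have hA' : ∀ i : ℕ, MeasurableSet[M.sigma (t + i)] (A ∩ {ω | ((t + i : ℕ) : ℕ∞) < T ω}) :=
        fun i => (sigma_mono (t.le_add_right i) _ hA).inter (hT _)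
      have h2 := hj t A hA
      rw [h.walk.apply_eq t (MeasurableSet.inter hA (hT t)), ← ENNReal.tsum_mul_left] at h2
      refine le_trans (Eq.le (tsum_congr fun i => ?_)) h2
      rw [h.walk.density t (t + i) (t.le_add_right i) _ (hA' i), ← lintegral_const_mul']
      · exact lintegral_congr fun ω => ofReal_mul ((hlaws.m_pos.trans_le hlaws.mean₀).le)
      · exact ofReal_ne_top)
  rw [hw] at h1
  have hB0 : 0 < B := (h.laws hm ⟨0, h.one_le_K⟩).B_pos
  have h3 : (K : ℝ) ^ 2 * B / (2 * (K * m)) = K * (B / m) / 2 := by field_simp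
  have h4 : 0 ≤ (K : ℝ) * (B / m) := by positivity
  have h5 := Real.log_le_sub_one_of_pos (x := 2 * (1 + (K : ℝ) ^ 2 * B / (2 * (K * m))))
    (by rw [h3]; linarith)
  rw [h3] at h1 h5
  linarith

theorem IsConfig.yStat_measurable (t : ℕ) : Measurable[M.sigma t] (M.yStat t) :=
  (measurable_u t).sub (Measurable.iInf fun s : Fin t =>
    (measurable_u s).mono (sigma_mono s.2.le) le_rfl)

theorem exp_sub_le_expCusum (t s : ℕ) (hs : s ≤ t) (ω : Ω) : exp (M.u (t + 1) ω - M.u s ω)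
    ≤ expCusum (fun t ω => ∑ k, M.incr t ω k) (t + 1) ω := by
  have hX : ∀ t s, exp (M.u (t + 1) ω - M.u s ω)
      = exp (M.u t ω - M.u s ω) * exp (∑ k, M.incr t ω k) := fun t s => by
    rw [← exp_add, u_succ]
    ring_nf
  induction t with
  | zero =>
    obtain rfl : s = 0 := by omega
    rw [hX, expCusum, sub_self, exp_zero]
    exact mul_le_mul_of_nonneg_right (le_max_right _ _) (exp_pos _).le
  | succ t ih =>
    rw [hX, expCusum]
    refine mul_le_mul_of_nonneg_right ?_ (exp_pos _).le
    rcases Nat.lt_or_eq_of_le hs with hlt | rfl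
    · exact (ih (Nat.lt_succ_iff.mp hlt)).trans (le_max_left _ _)
    · rw [sub_self, exp_zero]
      exact le_max_right _ _

theorem IsConfig.exists_cusum_delay : ∃ j : ℝ, M.worstDelay (M.cusum ν) = (j : EReal) ∧
    log γ ≤ j + K * (2 + B / m) ∧ j ≤ log γ + K * (|log m| + 2 * (B / m)) := by
  have hlaws := h.total hm
  have hy := h.yStat_measurable hm
  have hy0 : ∀ ω, M.yStat 0 ω = 0 := fun ω => by simp [yStat, u_zero]
  have hν : 0 < ν := h.threshold_pos hm hy hy0 h.falseAlarm_cusum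
  have hT := measurableSet_lt_hitTime hy ν
  have hT0 : ∀ ω, 0 < hitTime M.yStat ν ω := fun ω => by
    have : ((0 : ℕ) : ℕ∞) < hitTime M.yStat ν ω := lt_hitTime_iff.mpr fun r hr => by
      obtain rfl : r = 0 := by omega
      rwa [hy0]
    simpa using this
  have hsum := h.period_le hm hT h.falseAlarm_cusum
  -- the threshold is at most `log γ + O(1)`
  have hexp := (h.walk.steps_pre.comp measurable_total).exp_le_period (x := ν) hlaws hT
    (fun t => lt_hitTime_anti t.le_succ)
    (Set.eq_univ_of_forall fun ω => by simpa using hT0 ω) (fun t ω hω hω' => by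
      have hge : ν ≤ M.yStat (t + 1) ω := by
        by_contra hlt
        refine hω' (lt_hitTime_iff.mpr fun r hr => ?_)
        rcases Nat.lt_or_eq_of_le hr with hlt' | rfl
        · exact lt_hitTime_iff.mp (show (t : ℕ∞) < hitTime M.yStat ν ω from hω) r
            (Nat.lt_succ_iff.mp hlt')
        · exact not_le.mp hlt
      obtain ⟨s, hs⟩ := exists_eq_ciInf_of_finite (f := fun s : Fin (t + 1) => M.u s ω)
      rw [yStat, ← hs] at hge
      exact (exp_le_exp.mpr hge).trans (exp_sub_le_expCusum h hm t s (Nat.lt_succ_iff.mp s.2) ω))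
    (ne_top_of_le_ne_top ofReal_ne_top hsum)
  have hγ0 : 0 < γ := by linarith [h.one_lt_gamma]
  have hν' : ν ≤ log γ - log m := by
    have h1 := (ofReal_le_ofReal_iff (by positivity)).mp (hexp.trans hsum)
    have h2 := log_le_log (exp_pos _) h1
    rwa [log_exp, Real.log_div hγ0.ne' hm.ne'] at h2
  have hsp := h.spread_le hm
  have hsp0 : 0 ≤ spread ((pi M.post).map fun x => ∑ k, x k) :=
    div_nonneg (integral_nonneg fun _ => sq_nonneg _)
      (by linarith [hlaws.m_pos.trans_le hlaws.mean₀])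
  obtain ⟨j, hj1, hj0, hjb, hj⟩ := exists_worstDelay h.walk hlaws hT
    (b := ν + 4 * spread ((pi M.post).map fun x => ∑ k, x k)) (by linarith)
    fun τ A hA => ((h.walk.steps_post τ).comp measurable_total).delay_le (U := M.u)
      hlaws.posDrift₀ (fun t ht => (sigma_mono ht _ hA).inter (hT t))
      (fun t _ => Set.inter_subset_inter_right _ (lt_hitTime_anti t.le_succ)) measurable_u u_succ
      hν.le (fun t ω ht hω => by
        rcases Nat.lt_or_eq_of_le ht with hlt | rfl
        · have h1 := lt_hitTime_iff.mp (show (t : ℕ∞) < hitTime M.yStat ν ω from hω.2) t le_rfl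
          have h2 := ciInf_le (f := fun s : Fin t => M.u s ω) (Set.finite_range _).bddBelow ⟨τ, hlt⟩
          rw [yStat] at h1
          linarith
        · rw [sub_self]
          exact hν.le)
  refine ⟨j, hj1, h.log_gamma_le hm hT hT0 h.falseAlarm_cusum hj0 hj, ?_⟩
  have h1 := h.le_card_mul hm (abs_nonneg (log m))
  have h2 := neg_abs_le (log m)
  have h3 : (K : ℝ) * (B / (2 * m)) = K * (B / m) / 2 := by field_simp
  rw [h3] at hsp
  linarith

theorem IsConfig.uTilde_measurable (ha : 0 < a) (hΔ : 0 < Δ) (t : ℕ) :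
    Measurable[M.sigma t] (M.uTilde S t) := by
  have h1 := measurable_fusion (lo := S.lo) (hi := S.hi) (steps_pre_local h.walk) sigma_mono
    (fun k => (h.sensor hm ha hΔ k).meas) t
  have h2 : M.uTilde S t = fusion S.lo S.hi (exitLLR M S) M.incr t :=
    funext fun ω => h.uTilde_eq_fusion hm t ω
  rwa [h2]

end

/-- The worst-case delay of the decentralized test: its threshold exceeds `log γ` by a relative
error of order `θ / Δ`, and so does its delay exceed the threshold. -/
theorem exists_dcusum_delay {m B a b Δ₀ : ℝ} (hm : 0 < m) (hB : 0 < B) (ha : 0 < a) (hb : 0 < b)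
    (hΔ₀ : 0 < Δ₀) (N : ℕ) : ∃ C : ℝ, 0 < C ∧
    ∀ (K : ℕ) (Ω : Type u) [MeasurableSpace Ω] (M : ChangeModel.{u, v} K Ω)
      (S : CommScheme K) (Δ γ ν ν' : ℝ),
      Δ₀ ≤ Δ → M.IsConfig S m B a b Δ γ ν ν' → (S.d ≤ N ∨ log K ≤ N * Δ) →
      ∃ j : ℝ, M.worstDelay (M.dcusum S ν') = (j : EReal) ∧ log γ ≤ j + K * (2 + B / m) ∧
        j ≤ (1 + C * min (M.theta S) 1 / Δ) * log γ + K * (C * Δ) := by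
  set D := N * (b + overConst m B * B / Δ₀) / (1 - exp (-(a * Δ₀)))
  have hover : 0 ≤ overConst m B := by unfold overConst; positivity
  have hexp : 0 < 1 - exp (-(a * Δ₀)) := by
    rw [sub_pos, ← exp_zero]
    exact exp_lt_exp.mpr (neg_lt_zero.mpr (mul_pos ha hΔ₀))
  have hD0 : 0 ≤ D := by positivity
  obtain ⟨C₁, hC₁, H₁⟩ := exists_fusion_threshold.{u} hm hB ha hb hΔ₀
  obtain ⟨C₂, hC₂, H₂⟩ := exists_network_delay.{u} (N := N) hm hB ha hb hΔ₀ hD0 N.cast_nonneg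
  refine ⟨C₁ + C₂ + C₁ * C₂ / Δ₀, by positivity, fun K Ω mΩ M S Δ γ ν ν' hΔ h hmode => ?_⟩
  have hΔp : 0 < Δ := hΔ₀.trans_le hΔ
  have hθ := h.theta_nonneg hm
  have hlaws := h.total hm
  have hut := h.uTilde_measurable hm ha hΔp
  have hfus := h.uTilde_eq_fusion hm
  have hy : ∀ t, Measurable[M.sigma t] (M.yTilde S t) := fun t =>
    (hut t).sub (Measurable.iInf fun s : Fin (t + 1) =>
      (hut s).mono (sigma_mono (Nat.lt_succ_iff.mp s.2)) le_rfl)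
  have hattain : ∀ t ω, ∃ s ≤ t, M.yTilde S t ω = M.uTilde S t ω - M.uTilde S s ω := by
    intro t ω
    obtain ⟨s, hs⟩ := exists_eq_ciInf_of_finite (f := fun s : Fin (t + 1) => M.uTilde S s ω)
    exact ⟨s, Nat.lt_succ_iff.mp s.2, by rw [yTilde, hs]⟩
  have hy0 : ∀ ω, M.yTilde S 0 ω = 0 := fun ω => by
    obtain ⟨s, hs, he⟩ := hattain 0 ω
    obtain rfl : s = 0 := by omega
    rw [he, sub_self]
  have hν : 0 < ν' := h.threshold_pos hm hy hy0 h.falseAlarm_dcusum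
  have hT := measurableSet_lt_hitTime hy ν'
  have hT0 : ∀ ω, 0 < hitTime (M.yTilde S) ν' ω := fun ω => by
    have : ((0 : ℕ) : ℕ∞) < hitTime (M.yTilde S) ν' ω := lt_hitTime_iff.mpr fun r hr => by
      obtain rfl : r = 0 := by omega
      rwa [hy0]
    simpa using this
  have hsensor := h.sensor hm ha hΔp
  have hthr := H₁ K Ω Δ (M.theta S) M.sigma (M.P ⊤) M.incr M.pre M.post S.lo S.hi (exitLLR M S) ν' γ
    (fun t => {ω | (t : ℕ∞) < hitTime (M.yTilde S) ν' ω}) h.one_le_K h.walk.steps_pre hsensor hΔ hθ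
    hν h.one_lt_gamma.le (fun t => sigma_le t _ (hT t)) (fun t ω hω => by
      have h1 : ¬ ∀ r ≤ t, M.yTilde S r ω < ν' := fun hall => hω (lt_hitTime_iff.mpr hall)
      push Not at h1
      obtain ⟨r, hr, hge⟩ := h1
      obtain ⟨s, hs, he⟩ := hattain r ω
      refine ⟨s, r, hs, hr, ?_⟩
      rwa [← hfus, ← hfus, ← he]) (h.period_le hm hT h.falseAlarm_dcusum)
  set θ' := min (M.theta S) 1 with hθ'
  obtain ⟨j, hj1, hj0, hjb, hj⟩ := exists_worstDelay h.walk hlaws hT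
    (b := (1 + C₂ * θ' / Δ) * ν' + K * (C₂ * Δ)) (by positivity) fun τ A hA => by
    refine H₂ K Ω Δ (M.theta S) M.sigma (M.P τ) M.incr M.pre M.post _ S.lo S.hi (exitLLR M S) τ ν'
      (fun t => A ∩ {ω | (t : ℕ∞) < hitTime (M.yTilde S) ν' ω}) ?_ hΔ hθ ?_ hlaws.mean₀
      (h.mean_le hm) (h.spread_le hm)
    · exact
        { sensor := hsensor
          steps := steps_post_local h.walk τ
          sum_steps := (h.walk.steps_post τ).comp measurable_total
          drift := hlaws.posDrift₀
          pos := h.one_le_K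
          nonneg := hν.le
          meas := fun t ht => (sigma_mono ht _ hA).inter (hT t)
          anti := fun t _ => Set.inter_subset_inter_right _ (lt_hitTime_anti t.le_succ)
          le := fun t ω ht hω s hs hst => by
            have h1 := lt_hitTime_iff.mp
              (show (t : ℕ∞) < hitTime (M.yTilde S) ν' ω from hω.2) t le_rfl
            have h2 := ciInf_le (f := fun s : Fin (t + 1) => M.uTilde S s ω) (Set.finite_range
              _).bddBelow ⟨s, Nat.lt_succ_iff.mpr hst⟩
            rw [yTilde] at h1
            rw [← hfus, ← hfus]
            linarith }
    · exact hmode.imp (fun hN k z hz => h.neg_le_exitLLR hm ha hΔ₀ hΔ hN k hz) id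
  refine ⟨j, hj1, h.log_gamma_le hm hT hT0 h.falseAlarm_dcusum hj0 hj, hjb.trans ?_⟩
  have hr1 : θ' / Δ ≤ 1 / Δ₀ := div_le_div₀ zero_le_one (min_le_right _ _) hΔ₀ hΔ
  -- the product of the two relative errors is again of order `θ' / Δ`
  have hprod : (1 + C₂ * θ' / Δ) * (1 + C₁ * θ' / Δ) ≤ 1 + (C₁ + C₂ + C₁ * C₂ / Δ₀) * θ' / Δ := by
    have h1 : C₁ * C₂ * ((θ' / Δ) * (θ' / Δ)) ≤ C₁ * C₂ * ((1 / Δ₀) * (θ' / Δ)) :=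
      mul_le_mul_of_nonneg_left (mul_le_mul_of_nonneg_right hr1 (by positivity)) (by positivity)
    calc (1 + C₂ * θ' / Δ) * (1 + C₁ * θ' / Δ)
        = 1 + (C₁ + C₂) * (θ' / Δ) + C₁ * C₂ * ((θ' / Δ) * (θ' / Δ)) := by ring
      _ ≤ 1 + (C₁ + C₂) * (θ' / Δ) + C₁ * C₂ * ((1 / Δ₀) * (θ' / Δ)) := by linarith
      _ = _ := by ring
  have hcoef : (1 + C₂ * θ' / Δ) * C₁ + C₂ ≤ C₁ + C₂ + C₁ * C₂ / Δ₀ := by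
    have h1 : C₁ * C₂ * (θ' / Δ) ≤ C₁ * C₂ * (1 / Δ₀) :=
      mul_le_mul_of_nonneg_left hr1 (by positivity)
    calc (1 + C₂ * θ' / Δ) * C₁ + C₂ = C₁ + C₂ + C₁ * C₂ * (θ' / Δ) := by ring
      _ ≤ C₁ + C₂ + C₁ * C₂ * (1 / Δ₀) := by linarith
      _ = _ := by ring
  have hfac : 0 ≤ 1 + C₂ * θ' / Δ := by positivity
  calc (1 + C₂ * θ' / Δ) * ν' + K * (C₂ * Δ)
      ≤ (1 + C₂ * θ' / Δ) * ((1 + C₁ * θ' / Δ) * log γ + K * (C₁ * Δ)) + K * (C₂ * Δ) := by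
        linarith [mul_le_mul_of_nonneg_left hthr hfac]
    _ = ((1 + C₂ * θ' / Δ) * (1 + C₁ * θ' / Δ)) * log γ
          + ((1 + C₂ * θ' / Δ) * C₁ + C₂) * (K * Δ) := by ring
    _ ≤ (1 + (C₁ + C₂ + C₁ * C₂ / Δ₀) * θ' / Δ) * log γ + (C₁ + C₂ + C₁ * C₂ / Δ₀) * (K * Δ) :=
        add_le_add (mul_le_mul_of_nonneg_right hprod (log_nonneg h.one_lt_gamma.le))
          (mul_le_mul_of_nonneg_right hcoef (by positivity))
    _ = _ := by ring

/-- Both worst-case delays are `log γ` up to the errors in the comparison of the tests. -/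
theorem exists_delays {m B a b Δ₀ : ℝ} (hm : 0 < m) (hB : 0 < B) (ha : 0 < a) (hb : 0 < b)
    (hΔ₀ : 0 < Δ₀) (N : ℕ) : ∃ C : ℝ, 0 < C ∧
    ∀ (K : ℕ) (Ω : Type u) [MeasurableSpace Ω] (M : ChangeModel.{u, v} K Ω)
      (S : CommScheme K) (Δ γ ν ν' : ℝ),
      Δ₀ ≤ Δ → M.IsConfig S m B a b Δ γ ν ν' → (S.d ≤ N ∨ log K ≤ N * Δ) →
      ∃ jC jD : ℝ, M.worstDelay (M.cusum ν) = (jC : EReal) ∧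
        M.worstDelay (M.dcusum S ν') = (jD : EReal) ∧ |jC - log γ| ≤ K * (C * Δ) ∧
        log γ - K * (C * Δ) ≤ jD ∧
        jD ≤ log γ + C * (min (M.theta S) 1 / Δ * log γ) + K * (C * Δ) := by
  obtain ⟨C, hC, H⟩ := exists_dcusum_delay.{u, v} hm hB ha hb hΔ₀ N
  set C' := (2 + 2 * (B / m) + |log m|) / Δ₀ with hC'
  refine ⟨C + C', by positivity, fun K Ω mΩ M S Δ γ ν ν' hΔ h hmode => ?_⟩
  have hΔp : 0 < Δ := hΔ₀.trans_le hΔ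
  have hK : (0 : ℝ) ≤ K := K.cast_nonneg
  have hBm : 0 < B / m := by positivity
  have habs := abs_nonneg (log m)
  have hcst : 2 + 2 * (B / m) + |log m| ≤ C' * Δ := by
    rw [hC', div_mul_eq_mul_div, le_div_iff₀ hΔ₀]
    exact mul_le_mul_of_nonneg_left hΔ (by positivity)
  have hCΔ : 0 < C * Δ := mul_pos hC hΔp
  have e1 : (K : ℝ) * (2 + B / m) ≤ K * ((C + C') * Δ) := mul_le_mul_of_nonneg_left (by linarith) hK
  have e2 : (K : ℝ) * (|log m| + 2 * (B / m)) ≤ K * ((C + C') * Δ) :=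
    mul_le_mul_of_nonneg_left (by linarith) hK
  have e3 : (K : ℝ) * (C * Δ) ≤ K * ((C + C') * Δ) := mul_le_mul_of_nonneg_left (by linarith) hK
  obtain ⟨jC, hC1, hC2, hC3⟩ := h.exists_cusum_delay hm
  obtain ⟨jD, hD1, hD2, hD3⟩ := H K Ω M S Δ γ ν ν' hΔ h hmode
  have hC'0 : 0 ≤ C' := by positivity
  refine ⟨jC, jD, hC1, hD1, abs_le.mpr ⟨by linarith, by linarith⟩, by linarith, ?_⟩
  have e4 : (1 + C * min (M.theta S) 1 / Δ) * log γ
      = log γ + C * (min (M.theta S) 1 / Δ * log γ) := by ring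
  rw [e4] at hD3
  have e5 : C * (min (M.theta S) 1 / Δ * log γ) ≤ (C + C') * (min (M.theta S) 1 / Δ * log γ) :=
    mul_le_mul_of_nonneg_right (by linarith) (mul_nonneg (div_nonneg (le_min (h.theta_nonneg hm)
      zero_le_one) hΔp.le) (log_nonneg h.one_lt_gamma.le))
  linarith

end ChangeModel

/-! ### The comparison of the two tests -/

theorem theorem2 (m B a b Δ₀ : ℝ) (hm : 0 < m) (hB : 0 < B) (ha : 0 < a) (hab : a ≤ b)
    (hΔ₀ : 0 < Δ₀) (N : ℕ) :
    -- the bound on the performance loss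
    (∃ c C : ℝ, 0 < c ∧ 0 < C ∧
      ∀ (K : ℕ) (Ω : Type u) [MeasurableSpace Ω] (M : ChangeModel.{u, v} K Ω)
        (S : CommScheme K) (Δ γ ν ν' : ℝ),
        Δ₀ ≤ Δ → M.IsConfig S m B a b Δ γ ν ν' →
        (S.d ≤ N ∨ Real.log K ≤ N * Δ) →
        ∃ jC jD : ℝ, M.worstDelay (M.cusum ν) = (jC : EReal) ∧
          M.worstDelay (M.dcusum S ν') = (jD : EReal) ∧
          jD - jC ≤ M.theta S / (c * Δ) * Real.log γ + K * (C * Δ)) ∧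
    -- second-order asymptotic optimality for fixed `K` and `Δ` when `θ log γ` is bounded
    (∀ (K : ℕ) (Δ R : ℝ), Δ₀ ≤ Δ → ∃ L : ℝ,
      ∀ (Ω : Type u) [MeasurableSpace Ω] (M : ChangeModel.{u, v} K Ω)
        (S : CommScheme K) (γ ν ν' : ℝ),
        M.IsConfig S m B a b Δ γ ν ν' → M.theta S * Real.log γ ≤ R →
        ∃ jC jD : ℝ, M.worstDelay (M.cusum ν) = (jC : EReal) ∧
          M.worstDelay (M.dcusum S ν') = (jD : EReal) ∧ |jD - jC| ≤ L) ∧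
    -- first-order asymptotic optimality when `K Δ = o(log γ)` and `Δ → ∞` or `θ / Δ → 0`
    (∀ ε : ℝ, 0 < ε → ∃ η : ℝ, 0 < η ∧
      ∀ (K : ℕ) (Ω : Type u) [MeasurableSpace Ω] (M : ChangeModel.{u, v} K Ω)
        (S : CommScheme K) (Δ γ ν ν' : ℝ),
        Δ₀ ≤ Δ → M.IsConfig S m B a b Δ γ ν ν' →
        (S.d ≤ N ∨ Real.log K ≤ N * Δ) →
        (1 ≤ η * Δ ∨ M.theta S ≤ η * Δ) → K * Δ ≤ η * Real.log γ →
        ∃ jC jD : ℝ, M.worstDelay (M.cusum ν) = (jC : EReal) ∧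
          M.worstDelay (M.dcusum S ν') = (jD : EReal) ∧
          0 < jC ∧ |jD / jC - 1| ≤ ε) := by
  have hb : 0 < b := ha.trans_le hab
  obtain ⟨C, hC, H⟩ := ChangeModel.exists_delays.{u, v} hm hB ha hb hΔ₀ N
  refine ⟨⟨C⁻¹, 2 * C, inv_pos.mpr hC, by positivity, fun K Ω mΩ M S Δ γ ν ν' hΔ h hmode => ?_⟩,
    fun K Δ R hΔ => ?_, fun ε hε => ?_⟩
  · obtain ⟨jC, jD, h1, h2, h3, h4, h5⟩ := H K Ω M S Δ γ ν ν' hΔ h hmode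
    refine ⟨jC, jD, h1, h2, ?_⟩
    have hΔp : 0 < Δ := hΔ₀.trans_le hΔ
    have hlog : 0 ≤ Real.log γ := Real.log_nonneg h.one_lt_gamma.le
    have e1 : C * (min (M.theta S) 1 / Δ * Real.log γ) ≤ C * (M.theta S / Δ * Real.log γ) :=
      mul_le_mul_of_nonneg_left (mul_le_mul_of_nonneg_right
        (div_le_div_of_nonneg_right (min_le_left _ _) hΔp.le) hlog) hC.le
    have e2 : M.theta S / (C⁻¹ * Δ) * Real.log γ = C * (M.theta S / Δ * Real.log γ) := by field_simp
    rw [e2]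
    linarith [(abs_le.mp h3).1]
  · -- for fixed `K` the condition `log K ≤ N Δ` holds with a suitable `N`
    obtain ⟨C', hC', H'⟩ := ChangeModel.exists_delays.{u, v} hm hB ha hb hΔ₀ ⌈Real.log K / Δ₀⌉₊
    refine ⟨C' * (R / Δ) + 2 * (K * (C' * Δ)), fun Ω mΩ M S γ ν ν' h hR => ?_⟩
    have hΔp : 0 < Δ := hΔ₀.trans_le hΔ
    have hlogK : Real.log K ≤ (⌈Real.log K / Δ₀⌉₊ : ℝ) * Δ := by
      have h1 : Real.log K ≤ (⌈Real.log K / Δ₀⌉₊ : ℝ) * Δ₀ := (div_le_iff₀ hΔ₀).mp (Nat.le_ceil _)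
      exact h1.trans (mul_le_mul_of_nonneg_left hΔ (Nat.cast_nonneg _))
    obtain ⟨jC, jD, h1, h2, h3, h4, h5⟩ := H' K Ω M S Δ γ ν ν' hΔ h (Or.inr hlogK)
    refine ⟨jC, jD, h1, h2, ?_⟩
    have hlog : 0 ≤ Real.log γ := Real.log_nonneg h.one_lt_gamma.le
    have hR0 : 0 ≤ R := (mul_nonneg (h.theta_nonneg hm) hlog).trans hR
    have e1 : C' * (min (M.theta S) 1 / Δ * Real.log γ) ≤ C' * (R / Δ) := by
      refine mul_le_mul_of_nonneg_left ?_ hC'.le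
      rw [div_mul_eq_mul_div]
      exact div_le_div_of_nonneg_right
        ((mul_le_mul_of_nonneg_right (min_le_left _ _) hlog).trans hR) hΔp.le
    have e2 : 0 ≤ C' * (R / Δ) := by positivity
    obtain ⟨h6, h7⟩ := abs_le.mp h3
    exact abs_le.mpr ⟨by linarith, by linarith⟩
  · -- with `K Δ` and `θ' log γ / Δ` at most `η log γ`, all errors are at most `3 C η log γ`
    set δ := min ε 1
    have hδ0 : 0 < δ := lt_min hε one_pos
    refine ⟨δ / (6 * C), by positivity, fun K Ω mΩ M S Δ γ ν ν' hΔ h hmode hη hK => ?_⟩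
    obtain ⟨jC, jD, h1, h2, h3, h4, h5⟩ := H K Ω M S Δ γ ν ν' hΔ h hmode
    have hΔp : 0 < Δ := hΔ₀.trans_le hΔ
    have hlog : 0 < Real.log γ := Real.log_pos h.one_lt_gamma
    have hθ : min (M.theta S) 1 / Δ ≤ δ / (6 * C) := by
      rw [div_le_iff₀ hΔp]
      exact hη.elim (fun h6 => (min_le_right _ _).trans h6) fun h6 => (min_le_left _ _).trans h6
    have e1 : C * (min (M.theta S) 1 / Δ * Real.log γ) ≤ δ / 6 * Real.log γ := by
      have := mul_le_mul_of_nonneg_left (mul_le_mul_of_nonneg_right hθ hlog.le) hC.le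
      refine this.trans_eq ?_
      field_simp
    have e2 : (K : ℝ) * (C * Δ) ≤ δ / 6 * Real.log γ := by
      calc (K : ℝ) * (C * Δ) = C * (K * Δ) := by ring
        _ ≤ C * (δ / (6 * C) * Real.log γ) := mul_le_mul_of_nonneg_left hK hC.le
        _ = _ := by field_simp
    have hδ1 : δ * Real.log γ ≤ Real.log γ := mul_le_of_le_one_left hlog.le (min_le_right _ _)
    obtain ⟨h6, h7⟩ := abs_le.mp h3
    have hjC : Real.log γ / 2 ≤ jC := by linarith
    have hjC0 : 0 < jC := by linarith
    refine ⟨jC, jD, h1, h2, hjC0, ?_⟩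
    rw [div_sub_one hjC0.ne', abs_div, abs_of_pos hjC0, div_le_iff₀ hjC0]
    have e3 : |jD - jC| ≤ δ / 2 * Real.log γ := abs_le.mpr ⟨by linarith, by linarith⟩
    have e4 : δ * (Real.log γ / 2) ≤ ε * jC := mul_le_mul (min_le_left _ _) hjC (by linarith) hε.le
    linarith
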